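/- **Setting.** Let $\Xi=[-1,1]$ and let $H:\mathbb R\to\mathbb R$ be smooth and even, with $H(0)=1$, $H(\pm1)=0$, $H<1$ on $\Xi\setminus\{0\}$, $H>0$ on $(-1,1)$, $H''(0)<0$ and $H''(1)>0$. Put $\kappa=\pi/\sqrt{|H''(0)|H''(1)}$ and $\mathrm S=[-\kappa,\kappa]$. For $\varepsilon>0$ put $g_\varepsilon=Z_\varepsilon^{-1}e^{-H/\varepsilon}$ with $Z_\varepsilon=\int_{-1}^1e^{-H/\varepsilon}\,d\xi$, $\gamma_\varepsilon=g_\varepsilon\mathscr L^1|_{\Xi}$, $\tau_\varepsilon=\frac1{2\kappa}\int_{-1}^1\frac{d\xi}{g_\varepsilon(\xi)}$, and let $\hat s_\varepsilon:\Xi\to\mathrm S$, $\hat s_\varepsilon(\xi)=\int_0^\xi\frac{d\eta}{\tau_\varepsilon g_\varepsilon(\eta)}$, with inverse $\hat\xi_\varepsilon$. Let $\mathscr M(\cdot)$ denote finite nonnegative Borel measures with weak-* convergence (duality with continuous functions). For $\rho\in\mathscr M(\Xi)$, $\rho=u\gamma_\varepsilon$, let $\mathcal E_\varepsilon(\rho)=\int_\Xi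 u\log u\,d\gamma_\varepsilon-\rho(\Xi)\log\rho(\Xi)$, and $\mathcal E_\varepsilon(\rho)=+\infty$ if $\rho\not\ll\gamma_\varepsilon$. Fix $T>0$. For $\rho=u\gamma_\varepsilon\in C([0,T];\mathscr M(\Xi))$ and a Borel velocity field $v$ with $\int_0^T\!\int_\Xi|v|\,d\rho_t\,dt<\infty$ and $\partial_t\rho+\partial_\xi(\rho v)=0$ in $\mathscr D'((0,T)\times\mathbb R)$ (such a $v$ is unique $\rho_t\,dt$-a.e.), let $$\mathcal J_\varepsilon(\rho)=\int_0^T\Big(\frac1{2\tau_\varepsilon}\int_\Xi v^2\,d\rho_t+2\tau_\varepsilon\int_\Xi|\partial_\xi\sqrt u|^2\,d\gamma_\varepsilon\Big)dt$$ ($+\infty$ if there is no such $v$ or if $\sqrt u$ has no weak derivative $\partial_\xi\sqrt u$). Put $\hat u_\varepsilon=u_\varepsilon\circ\hat\xi_\varepsilon$, $\hat v_\varepsilon=\dfrac{v_\varepsilon\circ\hat\xi_\varepsilon}{\tau_\varepsilon\, g_\varepsilon\circ\hat\xi_\varepsilon}$, $\hat g_\varepsilon=\tau_\varepsilon\, g_\varepsilon^2\circ\hat\xi_\varepsilon$,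 $\hat w_\varepsilon=\hat u_\varepsilon\hat v_\varepsilon\hat g_\varepsilon$ and $\hat\rho_\varepsilon=(\hat s_\varepsilon)_\#\rho_\varepsilon$. **Theorem (Compactness, the general case).** Let $\varepsilon$ run through a sequence of positive numbers tending to $0$, and let $\rho_\varepsilon=u_\varepsilon\gamma_\varepsilon\in C([0,T];\mathscr M(\Xi))$ satisfy, for constants $m,C>0$ independent of $\varepsilon$, $$\rho_\varepsilon(t,\Xi)=m\ \text{ for all }t\in[0,T],\qquad \mathcal E_\varepsilon(\rho_\varepsilon(0))\le C,\qquad \mathcal J_\varepsilon(\rho_\varepsilon)\le C.$$ Then there are a subsequence (not relabeled) and a limit $\rho_0=\frac12u_0^-\delta_{-1}+\frac12u_0^+\delta_1\in C([0,T];\mathscr M(\Xi))$ such that: 1. $\rho_\varepsilon(t)\rightharpoonup^*\rho_0(t)$ in $\mathscr M(\Xi)$ for every $t\in[0,T]$; 2. the spatial traces $u_\varepsilon(\cdot,\pm1)$ (boundary values of the continuous representative of $u_\varepsilon(t,\cdot)$, which exists for a.e. $t$) are well-defined and converge strongly to $u_0^\pm$ in $L^1(0,T)$; 3. for all $0<\delta<1$,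 $u_\varepsilon\to u_0^-$ in $L^1(0,T;L^\infty(-1,-\delta))$ and $u_\varepsilon\to u_0^+$ in $L^1(0,T;L^\infty(\delta,1))$. Moreover $\hat u_\varepsilon\in L^1(0,T;W^{1,1}(-\kappa,\kappa))$, $\hat w_\varepsilon\in L^1((0,T)\times\mathrm S)$, and there exist $\hat u_0\in L^1(0,T;W^{1,1}(-\kappa,\kappa))$, $\hat w_0\in L^1((0,T)\times\mathrm S)$, a measure $\lambda^\perp\in\mathscr M([0,T])$ singular with respect to Lebesgue measure and, with $\Lambda^\perp=\lambda^\perp\otimes\mathscr L^1|_{\mathrm S}$, a function $\hat m_0\in L^\infty_{\Lambda^\perp}([0,T]\times\mathrm S)$ with $\partial_s\hat m_0\in L^2_{\Lambda^\perp}([0,T]\times\mathrm S)$, such that along the same subsequence: 4. $\hat u_\varepsilon\rightharpoonup^*\hat u_0+\hat m_0\Lambda^\perp$, $\partial_s\hat u_\varepsilon\rightharpoonup^*\partial_s\hat u_0+\partial_s\hat m_0\Lambda^\perp$ and $\hat w_\varepsilon\rightharpoonup^*\hat w_0$ in duality with $C([0,T]\times\mathrm S)$; 5. the traces of $\hat u_0(t,\cdot)$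 at $s=\pm\kappa$ equal $u_0^\pm(t)$ for a.e. $t\in(0,T)$, and the traces of $\hat m_0(t,\cdot)$ at $s=\pm\kappa$ vanish for $\lambda^\perp$-a.e. $t\in[0,T]$; 6. $\hat\rho_\varepsilon(t)\rightharpoonup^*\hat\rho_0(t)=\frac12\big(u_0^-(t)\delta_{-\kappa}+u_0^+(t)\delta_\kappa\big)$ in $\mathscr M(\mathrm S)$ for every $t\in[0,T]$; 7. $u_0^+$ is absolutely continuous on $[0,T]$; for a.e. $t\in(0,T)$ the function $\hat w_0(t,\cdot)$ is a.e. constant in $\mathrm S$, equal to $\frac12\dot u_0^+(t)$; and $(\hat\rho_0,\hat w_0\mathscr L^2|_{(0,T)\times\mathrm S})$ satisfies $\partial_t\hat\rho_0+\partial_s(\hat w_0\mathscr L^2|_{(0,T)\times\mathrm S})=0$ in $\mathscr D'((0,T)\times\mathbb R)$. -/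

import Mathlib

open MeasureTheory Set Filter Topology
open scoped NNReal ENNReal ContDiff

noncomputable section

namespace Kramers

/-- The double-well potential, considered on `Ξ = [-1, 1]`: smooth and even, with strict maximum
`H 0 = 1`, minimum value `0` attained exactly at the wells `±1`, and nondegenerate second
derivatives at `0` and `1` (so that the rate constant `k` is positive). -/
structure IsDoubleWell (H : ℝ → ℝ) : Prop where
  smooth : ContDiff ℝ ∞ H
  even : ∀ x, H (-x) = H x
  at_zero : H 0 = 1
  at_one : H 1 = 0
  lt_one : ∀ x ∈ Icc (-1 : ℝ) 1, x ≠ 0 → H x < 1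
  pos : ∀ x ∈ Ioo (-1 : ℝ) 1, 0 < H x
  deriv2_zero : deriv (deriv H) 0 < 0
  deriv2_one : 0 < deriv (deriv H) 1

/-- The rate constant `k = π⁻¹ √(|H''(0)| H''(1))`. -/
def rate (H : ℝ → ℝ) : ℝ :=
  1 / Real.pi * √(|deriv (deriv H) 0| * deriv (deriv H) 1)

/-- `κ = 1 / k`. -/
def kappa (H : ℝ → ℝ) : ℝ := 1 / rate H

/-- The normalization constant `Z_ε`. -/
def partitionZ (H : ℝ → ℝ) (ε : ℝ) : ℝ := ∫ x in (-1 : ℝ)..1, Real.exp (-H x / ε)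

/-- The Lebesgue density `g_ε` of `γ_ε`. -/
def gDens (H : ℝ → ℝ) (ε x : ℝ) : ℝ := (partitionZ H ε)⁻¹ * Real.exp (-H x / ε)

/-- The invariant measure `γ_ε`. Measures on `Ξ = [-1, 1]` are extended by zero to `ℝ`. -/
def gibbs (H : ℝ → ℝ) (ε : ℝ) : Measure ℝ :=
  (volume.restrict (Icc (-1 : ℝ) 1)).withDensity (fun x => ENNReal.ofReal (gDens H ε x))

/-- The time scale `τ_ε`. -/
def tau (H : ℝ → ℝ) (ε : ℝ) : ℝ :=
  1 / (2 * kappa H) * ∫ x in (-1 : ℝ)..1, 1 / gDens H ε x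

/-- The change of variables `ŝ_ε`, mapping `[-1, 1]` onto `[-κ, κ]`. -/
def sHat (H : ℝ → ℝ) (ε ξ : ℝ) : ℝ := ∫ η in (0 : ℝ)..ξ, 1 / (tau H ε * gDens H ε η)

/-- The inverse `ξ̂_ε : [-κ, κ] → [-1, 1]` of `ŝ_ε`. -/
def xiHat (H : ℝ → ℝ) (ε : ℝ) : ℝ → ℝ := Function.invFunOn (sHat H ε) (Icc (-1) 1)

/-- The Lebesgue density `ĝ_ε` of `(ŝ_ε)_# γ_ε`. -/
def gHat (H : ℝ → ℝ) (ε s : ℝ) : ℝ := tau H ε * gDens H ε (xiHat H ε s) ^ 2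

/-- `û_ε = u_ε ∘ ξ̂_ε`. -/
def uHat (H : ℝ → ℝ) (ε : ℝ) (u : ℝ → ℝ → ℝ≥0) (t s : ℝ) : ℝ := u t (xiHat H ε s)

/-- `v̂_ε = (v_ε ∘ ξ̂_ε) / (τ_ε g_ε ∘ ξ̂_ε)`. -/
def vHat (H : ℝ → ℝ) (ε : ℝ) (v : ℝ → ℝ → ℝ) (t s : ℝ) : ℝ :=
  v t (xiHat H ε s) / (tau H ε * gDens H ε (xiHat H ε s))

/-- `ŵ_ε = û_ε v̂_ε ĝ_ε`. -/
def wHat (H : ℝ → ℝ) (ε : ℝ) (u : ℝ → ℝ → ℝ≥0) (v : ℝ → ℝ → ℝ) (t s : ℝ) : ℝ :=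
  uHat H ε u t s * vHat H ε v t s * gHat H ε s

/-- The density `dρ/dγ_ε`. -/
def dens (H : ℝ → ℝ) (ε : ℝ) (ρ : FiniteMeasure ℝ) (x : ℝ) : ℝ :=
  ((ρ : Measure ℝ).rnDeriv (gibbs H ε) x).toReal

open scoped Classical in
/-- The free energy `E_ε(ρ) = ∫ u log u dγ_ε - ρ(Ξ) log ρ(Ξ)`, `u = dρ/dγ_ε`, with value `+∞` if
`ρ` is not absolutely continuous. Since `u log u` is bounded below, the integral is `+∞` exactly
when `u log u` is not integrable. -/
def freeEnergy (H : ℝ → ℝ) (ε : ℝ) (ρ : FiniteMeasure ℝ) : EReal :=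
  if (ρ : Measure ℝ) ≪ gibbs H ε ∧
      Integrable (fun x => dens H ε ρ x * Real.log (dens H ε ρ x)) (gibbs H ε) then
    (((∫ x, dens H ε ρ x * Real.log (dens H ε ρ x) ∂(gibbs H ε))
      - (ρ.mass : ℝ) * Real.log (ρ.mass : ℝ) : ℝ) : EReal)
  else ⊤

/-- `f ∈ W^{1,1}(a,b)` with weak derivative `f'`. -/
def HasWeakDeriv (a b : ℝ) (f f' : ℝ → ℝ) : Prop :=
  IntegrableOn f (Ioo a b) ∧ IntegrableOn f' (Ioo a b) ∧
    ∀ φ : ℝ → ℝ, ContDiff ℝ ∞ φ → HasCompactSupport φ → tsupport φ ⊆ Ioo a b →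
      ∫ x in Ioo a b, f x * deriv φ x = -∫ x in Ioo a b, f' x * φ x

/-- `f` has a continuous representative on `[a,b]`, with boundary values `y` at `a` and `z` at `b`;
these are the traces of `f`. -/
def HasTraces (a b : ℝ) (f : ℝ → ℝ) (y z : ℝ) : Prop :=
  ∃ g : ℝ → ℝ, ContinuousOn g (Icc a b) ∧ f =ᵐ[volume.restrict (Icc a b)] g ∧ g a = y ∧ g b = z

/-- The couple `(ρ, ν)` with `ν(dt dx) = f(t,x) μ_t(dx) dt` belongs to the class CE on `(0,T)`:
`ρ` is weakly-* continuous on `[0,T]`, `ν` is a finite signed measure, and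
`∂_t ρ + ∂_x ν = 0` in the sense of distributions on `(0,T) × ℝ`. -/
def ContinuityEquation (T : ℝ) (ρ : ℝ → FiniteMeasure ℝ) (μ : ℝ → Measure ℝ)
    (f : ℝ → ℝ → ℝ) : Prop :=
  ContinuousOn ρ (Icc 0 T) ∧ Measurable (Function.uncurry f) ∧
    (∫⁻ t in Ioo 0 T, ∫⁻ x, ‖f t x‖ₑ ∂(μ t)) < ⊤ ∧
    ∀ φ : ℝ → ℝ → ℝ, ContDiff ℝ ∞ (Function.uncurry φ) →
      HasCompactSupport (Function.uncurry φ) →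
      tsupport (Function.uncurry φ) ⊆ Ioo 0 T ×ˢ univ →
      ∫ t in Ioo 0 T, ((∫ x, deriv (fun r => φ r x) t ∂(ρ t : Measure ℝ))
        + ∫ x, f t x * deriv (φ t) x ∂(μ t)) = 0

/-- The kinetic part `∫₀ᵀ ∫_Ξ v² / (2 τ_ε) dρ_t dt` of the dissipation. -/
def kineticPart (H : ℝ → ℝ) (ε T : ℝ) (ρ : ℝ → FiniteMeasure ℝ) (v : ℝ → ℝ → ℝ) : ℝ≥0∞ :=
  ∫⁻ t in Ioo 0 T, ∫⁻ x, ENNReal.ofReal (v t x ^ 2 / (2 * tau H ε)) ∂(ρ t : Measure ℝ)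

/-- The Fisher part `∫₀ᵀ 2 τ_ε ∫_Ξ |∂_ξ √u|² dγ_ε dt` of the dissipation, `u = dρ/dγ_ε`. The weak
derivative `q = ∂_ξ √u` is unique up to null sets, so the infimum is the value of the integral if
`q` exists, and `+∞` otherwise. -/
def fisherPart (H : ℝ → ℝ) (ε T : ℝ) (ρ : ℝ → FiniteMeasure ℝ) : ℝ≥0∞ :=
  ⨅ (q : ℝ → ℝ → ℝ) (_ : Measurable (Function.uncurry q))
    (_ : ∀ᵐ t ∂(volume.restrict (Ioo 0 T)),
      HasWeakDeriv (-1) 1 (fun x => √(dens H ε (ρ t) x)) (q t)),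
    ∫⁻ t in Ioo 0 T, ∫⁻ x, ENNReal.ofReal (2 * tau H ε * q t x ^ 2) ∂(gibbs H ε)

/-- The dissipation `J_ε(ρ; 0, T)` of a curve `ρ` with `(ρ, ρ v) ∈ CE`; the velocity `v` is
determined `ρ_t(dx) dt`-a.e. by `ρ`. -/
def dissipation (H : ℝ → ℝ) (ε T : ℝ) (ρ : ℝ → FiniteMeasure ℝ) (v : ℝ → ℝ → ℝ) : ℝ≥0∞ :=
  kineticPart H ε T ρ v + fisherPart H ε T ρ

/-- The Dirac measure `δ_x`. -/
def diracFM (x : ℝ) : FiniteMeasure ℝ := ⟨Measure.dirac x, inferInstance⟩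

/-- The measure `½ a δ_{-x} + ½ b δ_x`. -/
def twoPoint (x : ℝ) (a b : ℝ≥0) : FiniteMeasure ℝ :=
  (a / 2) • diracFM (-x) + (b / 2) • diracFM x

/-- The Lebesgue measure on `S = [-κ, κ]`. -/
def lebS (H : ℝ → ℝ) : Measure ℝ := volume.restrict (Icc (-kappa H) (kappa H))

/-- The Lebesgue measure on `(0,T) × S`. -/
def lebTS (H : ℝ → ℝ) (T : ℝ) : Measure (ℝ × ℝ) := (volume.restrict (Ioo 0 T)).prod (lebS H)

/-- `f ∈ L¹(0,T; W^{1,1}(-κ,κ))` with weak derivative `∂_s f = f'`. -/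
def MemL1W11 (H : ℝ → ℝ) (T : ℝ) (f f' : ℝ → ℝ → ℝ) : Prop :=
  Integrable (Function.uncurry f) (lebTS H T) ∧ Integrable (Function.uncurry f') (lebTS H T) ∧
    ∀ᵐ t ∂(volume.restrict (Ioo 0 T)), HasWeakDeriv (-kappa H) (kappa H) (f t) (f' t)

/-- Weak-* convergence `f_n ⇀* f₀ + m Λ` of measures on `[0,T] × S`, with `Λ = lam ⊗ Lebesgue`, in
duality with `C([0,T] × S)` (functions are identified with their Lebesgue densities, and every
continuous function on the compact set `[0,T] × S` is the restriction of one on `ℝ²`). -/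
def WeakStarTendsto (H : ℝ → ℝ) (T : ℝ) (f : ℕ → ℝ → ℝ → ℝ) (f₀ : ℝ → ℝ → ℝ)
    (lam : FiniteMeasure ℝ) (m : ℝ → ℝ → ℝ) : Prop :=
  ∀ φ : ℝ × ℝ → ℝ, Continuous φ →
    Tendsto (fun n => ∫ z, φ z * f n z.1 z.2 ∂(lebTS H T)) atTop
      (𝓝 ((∫ z, φ z * f₀ z.1 z.2 ∂(lebTS H T))
        + ∫ z, φ z * m z.1 z.2 ∂((lam : Measure ℝ).prod (lebS H))))

end Kramers

end

noncomputable section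

namespace Kramers

/-! ### Absolutely continuous functions of one variable -/

/-! In the variable s = ŝ_ε(ξ) the dissipation loses its dependence on ε. With û = r², ∂ₛ r = Q and
ŵ = r B, the Fisher part is 2 ∫∫ Q² ds dt and the kinetic part is ½ ∫∫ B² ds dt. Only the reference
measure still depends on ε: it is a centred probability measure γ on [-K, K], K = κ, which by
Laplace's method concentrates at ±K. `Curve` and `CurveSeq` isolate this situation,
`Admissible.exists_curve` shows that the given curves fit into it, and the analysis takes place
there.

Put E(t) = ∫ Q(t, s)² ds. Since ∫ r² dγ ≤ m and r is Hölder-½ in s with constant √E, both sup r² and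
the Hölder-½ constant of r² are at most a constant times 1 + E(t). But E is bounded only in L¹(0,T),
so it may concentrate in time; this is the origin of the singular measure and the main difficulty.
Three ideas deal with it.

Entropy. Take a convex F of superlinear growth with x F''(x) ≤ 1. Testing the continuity equation
with F'(r²), mollified in time, produces at most ∫ (Q² + B²) ds in absolute value. Some time has
bounded entropy, so the bound spreads to all times in both directions. Hence P(t) is at most M γ up
to an error of order 1 / F'(M), at every t (`Curve.integral_P_le`). No mass survives between the
wells, and P_n(t) is asymptotically described by the single number f_n(t) = ∫ (K + s)/(2K) dP_n(t).

Logarithmic cut-off. The plain continuity equation bounds the total variation of f_n, which would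
allow jumps in the limit. By the first idea the affine weight may be replaced by any ψ with the same
values at ±K. Take ψ' proportional to 1/(K - s + η). Since r(s)² ≤ 2 r(K)² + 2 E (K - s), the energy
meets only the factor ∫ ψ'² (K - s) ds, which is at most 1/log((2K + η)/η), whereas r(K)² is at most
2m + o(1)(1 + E). This gives asymptotic absolute continuity (`CurveSeq.eventually_sum_massP_le`),
hence convergence at every time along a subsequence to an absolutely continuous f. Then u₀⁺ = 2f and
u₀⁻ = 2(m - f). The traces converge in L¹(0,T) because r(±K)² is close to twice the mass at that
end, the uniform convergence away from 0 follows from the Hölder bound, and the flux limit is f'(t),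
since space-time averages of the flux are increments of ∫ ψ dP_n.

Densities and moments. The measures r² dt ds and ∂ₛ(r²) dt ds are dominated by (1 + E_n) dt ⊗ ds. If
α is a limit of the energy measures, the limits have densities p (bounded) and q (square integrable)
with respect to α ⊗ ds. Decompose α = d dt + λ^⊥; then û₀ = p d, and m̂₀ = p on the singular part.
Integration by parts against a(t) s^k passes to the limit, and strong convergence of the traces
makes the boundary term absolutely continuous in t. By the Weierstrass theorem these moment
identities encode the weak derivatives and the traces, which are u₀^± for û₀ and 0 for m̂₀
(`CurveSeq.exists_limit`). -/

/-- A Lipschitz function of an absolutely continuous function is absolutely continuous. -/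
theorem absolutelyContinuousOnInterval_comp {F g : ℝ → ℝ} {a b : ℝ} {M : ℝ≥0} {s : Set ℝ}
    (hF : LipschitzOnWith M F s) (hg : AbsolutelyContinuousOnInterval g a b)
    (hs : ∀ x ∈ uIcc a b, g x ∈ s) :
    AbsolutelyContinuousOnInterval (fun x => F (g x)) a b := by
  rw [absolutelyContinuousOnInterval_iff] at hg ⊢
  intro ε hε
  -- The added 1 covers a vanishing Lipschitz constant.
  obtain ⟨δ, hδ, h⟩ := hg (ε / (M + 1)) (by positivity)
  refine ⟨δ, hδ, fun E hE hlen => ?_⟩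
  have h1 := h E hE hlen
  calc ∑ i ∈ Finset.range E.1, dist (F (g (E.2 i).1)) (F (g (E.2 i).2))
      ≤ ∑ i ∈ Finset.range E.1, (M + 1) * dist (g (E.2 i).1) (g (E.2 i).2) := by
        refine Finset.sum_le_sum fun i hi => ?_
        have h2 := hF.dist_le_mul _ (hs _ (hE.1 i hi).1) _ (hs _ (hE.1 i hi).2)
        have := dist_nonneg (x := g (E.2 i).1) (y := g (E.2 i).2)
        linarith
    _ = (M + 1) * ∑ i ∈ Finset.range E.1, dist (g (E.2 i).1) (g (E.2 i).2) := by
        rw [Finset.mul_sum]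
    _ < (M + 1) * (ε / (M + 1)) := by gcongr
    _ = ε := by field_simp

theorem absolutelyContinuousOnInterval_primitive {a b : ℝ} (c : ℝ) {y : ℝ → ℝ}
    (hy : IntervalIntegrable y volume a b) :
    AbsolutelyContinuousOnInterval (fun x => c + ∫ z in a..x, y z) a b := by
  have h1 := hy.absolutelyContinuousOnInterval_intervalIntegral (c := a) (by simp)
  have h2 : AbsolutelyContinuousOnInterval (fun _ : ℝ => c) a b :=
    (contDiff_const (n := 1)).contDiffOn.absolutelyContinuousOnInterval
  exact h2.fun_add h1

theorem ae_hasDerivAt_primitive {a b : ℝ} (c : ℝ) {y : ℝ → ℝ}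
    (hy : IntervalIntegrable y volume a b) :
    ∀ᵐ x, x ∈ uIcc a b → HasDerivAt (fun x => c + ∫ z in a..x, y z) (y x) x := by
  filter_upwards [hy.ae_hasDerivAt_integral] with x hx hxm
  exact (hx hxm a (by simp)).const_add c

/-- Chain rule for primitives of integrable functions. -/
theorem comp_primitive {a b : ℝ} (c : ℝ) {y : ℝ → ℝ}
    (hy : IntervalIntegrable y volume a b) {F : ℝ → ℝ} (hF : ContDiff ℝ 1 F) {s : ℝ}
    (hs : s ∈ uIcc a b) :
    F (c + ∫ z in a..s, y z) =
      F c + ∫ x in a..s, deriv F (c + ∫ z in a..x, y z) * y x := by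
  have hsub : uIcc a s ⊆ uIcc a b := uIcc_subset_uIcc_left hs
  have hy' : IntervalIntegrable y volume a s := hy.mono_set hsub
  have hac := absolutelyContinuousOnInterval_primitive c hy'
  set g : ℝ → ℝ := fun x => c + ∫ z in a..x, y z with hg
  -- A C¹ function is Lipschitz only on bounded convex sets, so the compact range of the primitive
  -- is first enclosed in a ball.
  have himg : IsCompact (g '' uIcc a s) := isCompact_uIcc.image_of_continuousOn hac.continuousOn
  obtain ⟨R, hR⟩ := himg.isBounded.subset_closedBall 0
  obtain ⟨M, hM⟩ := hF.contDiffOn.exists_lipschitzOnWith one_ne_zero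
    (convex_closedBall (0 : ℝ) R) (isCompact_closedBall 0 R)
  have hFg := absolutelyContinuousOnInterval_comp hM hac
    (fun x hx => hR (mem_image_of_mem g hx))
  have h := hFg.integral_deriv_eq_sub
  have hga : g a = c := by simp [hg]
  rw [hga] at h
  have h2 : ∫ x in a..s, deriv (fun x => F (g x)) x = ∫ x in a..s, deriv F (g x) * y x := by
    refine intervalIntegral.integral_congr_ae ?_
    filter_upwards [ae_hasDerivAt_primitive c hy'] with x hx hxm
    have hx' := hx (uIoc_subset_uIcc hxm)
    have hFd : HasDerivAt F (deriv F (g x)) (g x) :=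
      (hF.differentiable one_ne_zero _).hasDerivAt
    exact (hFd.comp x hx').deriv
  rw [h2] at h
  change F (g s) = _
  linarith

/-- Integration by parts with boundary terms. It serves twice: with test functions for weak
derivatives, and with monomials for the moment identities that detect traces. -/
theorem integral_deriv_mul_primitive {a b : ℝ} (c : ℝ) {y φ : ℝ → ℝ}
    (hy : IntervalIntegrable y volume a b) (hφ : ContDiff ℝ 1 φ) :
    ∫ x in a..b, (deriv φ x * (c + ∫ z in a..x, y z) + φ x * y x) =
      φ b * (c + ∫ z in a..b, y z) - φ a * c := by
  have hac := absolutelyContinuousOnInterval_primitive c hy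
  have hφac : AbsolutelyContinuousOnInterval φ a b :=
    hφ.contDiffOn.absolutelyContinuousOnInterval
  have h := hφac.integral_deriv_mul_eq_sub hac
  simp only [intervalIntegral.integral_same, add_zero] at h
  rw [← h]
  refine intervalIntegral.integral_congr_ae ?_
  filter_upwards [ae_hasDerivAt_primitive c hy] with x hx hxm
  rw [(hx (uIoc_subset_uIcc hxm)).deriv]

/-- An integrable function on an interval with a weak derivative is almost everywhere equal to a
primitive of the weak derivative. -/
theorem HasWeakDeriv.ae_eq_primitive {a b : ℝ} (hab : a < b) {f f' : ℝ → ℝ}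
    (h : HasWeakDeriv a b f f') :
    ∃ c, ∀ᵐ x ∂(volume.restrict (Ioo a b)), f x = c + ∫ y in a..x, f' y := by
  obtain ⟨hf, hf', h⟩ := h
  have hf'i : IntervalIntegrable f' volume a b := by
    rwa [intervalIntegrable_iff_integrableOn_Ioo_of_le hab.le]
  set k : ℝ → ℝ := fun x => f x - ∫ y in a..x, f' y with hk
  have hprim : IntegrableOn (fun x => ∫ y in a..x, f' y) (Ioo a b) := by
    have := (absolutelyContinuousOnInterval_primitive 0 hf'i).continuousOn
    simp only [zero_add] at this
    rw [uIcc_of_le hab.le] at this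
    exact (this.integrableOn_compact isCompact_Icc).mono_set Ioo_subset_Icc_self
  have hkint : IntegrableOn k (Ioo a b) := hf.sub hprim
  -- `k` has vanishing weak derivative
  have hk0 : ∀ φ : ℝ → ℝ, ContDiff ℝ ∞ φ → HasCompactSupport φ → tsupport φ ⊆ Ioo a b →
      ∫ x in Ioo a b, k x * deriv φ x = 0 := by
    intro φ hφ hφc hφs
    have hφa : φ a = 0 := image_eq_zero_of_notMem_tsupport fun hx => by
      have := (hφs hx).1; exact lt_irrefl _ this
    have hφb : φ b = 0 := image_eq_zero_of_notMem_tsupport fun hx => by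
      have := (hφs hx).2; exact lt_irrefl _ this
    have hφ1 : ContDiff ℝ 1 φ := hφ.of_le (by exact_mod_cast le_top)
    have hd : Continuous (deriv φ) := hφ1.continuous_deriv le_rfl
    have hib := integral_deriv_mul_primitive 0 hf'i hφ1
    simp only [zero_add, hφa, hφb, zero_mul, sub_zero] at hib
    rw [intervalIntegral.integral_of_le hab.le, integral_Ioc_eq_integral_Ioo] at hib
    obtain ⟨B, hB⟩ := hφc.exists_bound_of_continuous hφ.continuous
    obtain ⟨B', hB'⟩ := hφc.deriv.exists_bound_of_continuous hd
    have i1 : IntegrableOn (fun x => deriv φ x * ∫ z in a..x, f' z) (Ioo a b) :=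
      hprim.bdd_mul hd.aestronglyMeasurable (Eventually.of_forall hB')
    have i2 : IntegrableOn (fun x => φ x * f' x) (Ioo a b) :=
      hf'.bdd_mul hφ.continuous.aestronglyMeasurable (Eventually.of_forall hB)
    have i3 : IntegrableOn (fun x => deriv φ x * f x) (Ioo a b) :=
      hf.bdd_mul hd.aestronglyMeasurable (Eventually.of_forall hB')
    rw [integral_add i1 i2] at hib
    have h1 := h φ hφ hφc hφs
    have e1 : ∫ x in Ioo a b, k x * deriv φ x
        = (∫ x in Ioo a b, deriv φ x * f x) - ∫ x in Ioo a b, deriv φ x * ∫ z in a..x, f' z := by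
      rw [← integral_sub i3 i1]
      congr 1; ext x; simp only [hk]; ring
    have e2 : ∫ x in Ioo a b, deriv φ x * f x = ∫ x in Ioo a b, f x * deriv φ x := by
      congr 1; ext x; ring
    have e3 : ∫ x in Ioo a b, φ x * f' x = ∫ x in Ioo a b, f' x * φ x := by
      congr 1; ext x; ring
    rw [e1, e2, h1]
    linarith
  -- A test function g becomes the derivative of a test function after subtracting (∫ g) θ, because
  -- the difference has zero mean. Hence ∫ g k = (∫ g)(∫ k θ), which identifies the constant.
  obtain ⟨θ, hθ, hθc, hθs, hθ1⟩ : ∃ θ : ℝ → ℝ, ContDiff ℝ ∞ θ ∧ HasCompactSupport θ ∧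
      tsupport θ ⊆ Ioo a b ∧ ∫ x, θ x = 1 := by
    let B : ContDiffBump ((a + b) / 2 : ℝ) :=
      ⟨(b - a) / 8, (b - a) / 4, by linarith, by linarith⟩
    refine ⟨B.normed volume, B.contDiff_normed, B.hasCompactSupport_normed, ?_,
      B.integral_normed⟩
    rw [B.tsupport_normed_eq]
    intro x hx
    rw [Metric.mem_closedBall, Real.dist_eq, abs_le] at hx
    change -((b - a) / 4) ≤ _ ∧ _ ≤ (b - a) / 4 at hx
    constructor <;> linarith [hx.1, hx.2]
  refine ⟨∫ x in Ioo a b, k x * θ x, ?_⟩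
  set c := ∫ x in Ioo a b, k x * θ x with hc
  have key : ∀ᵐ x, x ∈ Ioo a b → k x - c = 0 := by
    refine isOpen_Ioo.ae_eq_zero_of_integral_contDiff_smul_eq_zero
      ((hkint.sub (integrableOn_const (by simp))).locallyIntegrableOn) ?_
    intro g hg hgc hgs
    have hsupp : ∀ q : ℝ → ℝ, tsupport q ⊆ Ioo a b → ∀ F : ℝ → ℝ,
        ∫ x, q x * F x = ∫ x in Ioo a b, q x * F x := by
      intro q hq F
      rw [setIntegral_eq_integral_of_forall_compl_eq_zero]
      intro x hx
      rw [image_eq_zero_of_notMem_tsupport (fun h => hx (hq h)), zero_mul]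
    set G := ∫ x, g x with hG
    set q : ℝ → ℝ := fun x => g x - G * θ x with hq
    have hqd : ContDiff ℝ ∞ q := hg.sub (contDiff_const.mul hθ)
    have hqs : tsupport q ⊆ tsupport g ∪ tsupport θ := by
      refine closure_minimal (fun x hx => ?_)
        ((isClosed_tsupport g).union (isClosed_tsupport θ))
      by_contra hcon
      rw [mem_union, not_or] at hcon
      apply hx
      simp [hq, image_eq_zero_of_notMem_tsupport hcon.1, image_eq_zero_of_notMem_tsupport hcon.2]
    have hqc : Continuous q := hqd.continuous
    set φ : ℝ → ℝ := fun x => ∫ y in a..x, q y with hφ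
    have hφd : ∀ x, HasDerivAt φ (q x) x := fun x =>
      intervalIntegral.integral_hasDerivAt_right (hqc.intervalIntegrable _ _)
        (hqc.stronglyMeasurableAtFilter _ _) hqc.continuousAt
    have hφderiv : deriv φ = q := funext fun x => (hφd x).deriv
    have hφs : ContDiff ℝ ∞ φ := by
      rw [contDiff_infty_iff_deriv]
      exact ⟨fun x => (hφd x).differentiableAt, hφderiv ▸ hqd⟩
    have hK : IsCompact (tsupport g ∪ tsupport θ) := hgc.isCompact.union hθc.isCompact
    have hKs : tsupport g ∪ tsupport θ ⊆ Ioo a b := union_subset hgs hθs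
    -- the support of `φ` lies in a compact subinterval
    obtain ⟨a', b', ha', hb', hKab⟩ : ∃ a' b', a < a' ∧ b' < b ∧
        tsupport g ∪ tsupport θ ⊆ Icc a' b' := by
      have hne : (tsupport g ∪ tsupport θ).Nonempty := by
        by_contra hemp
        rw [not_nonempty_iff_eq_empty] at hemp
        have : θ = 0 := by
          rw [← tsupport_eq_empty_iff]
          exact subset_empty_iff.1 (hemp ▸ subset_union_right)
        simp [this] at hθ1
      obtain ⟨x, hx, hxl⟩ := hK.exists_isLeast hne
      obtain ⟨z, hz, hzl⟩ := hK.exists_isGreatest hne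
      exact ⟨x, z, (hKs hx).1, (hKs hz).2, fun w hw => ⟨hxl hw, hzl hw⟩⟩
    have hq0 : ∀ x, x ∉ Icc a' b' → q x = 0 := fun x hx =>
      image_eq_zero_of_notMem_tsupport fun h' => hx (hKab (hqs h'))
    have hqint : ∫ x, q x = 0 := by
      rw [hq, integral_sub (hg.continuous.integrable_of_hasCompactSupport hgc)
        ((hθ.continuous.integrable_of_hasCompactSupport hθc).const_mul _),
        integral_const_mul, hθ1]
      simp [hG]
    have hφz : ∀ x, x ∉ Icc a' b' → φ x = 0 := by
      intro x hx
      rw [mem_Icc, not_and_or, not_le, not_le] at hx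
      rcases hx with hx | hx
      · refine intervalIntegral.integral_zero_ae (Eventually.of_forall fun y hy => hq0 y ?_)
        intro hy'
        have := (mem_uIoc.1 hy)
        rcases this with h1 | h1 <;> linarith [hy'.1, h1.1, h1.2]
      · have h1 : φ x = ∫ y in Ioc a x, q y := by
          by_cases hax : a ≤ x
          · exact intervalIntegral.integral_of_le hax
          · exfalso
            obtain ⟨w, hw⟩ : (tsupport θ).Nonempty := by
              by_contra hemp
              rw [not_nonempty_iff_eq_empty, tsupport_eq_empty_iff] at hemp
              simp [hemp] at hθ1
            have := hKab (Or.inr hw)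
            linarith [this.1, this.2]
        rw [h1, setIntegral_eq_integral_of_forall_compl_eq_zero, hqint]
        intro y hy
        apply hq0
        intro hy'
        exact hy ⟨by linarith [hy'.1], by linarith [hy'.2]⟩
    have hφts : tsupport φ ⊆ Icc a' b' := closure_minimal (fun x hx => by
      by_contra hcon; exact hx (hφz x hcon)) isClosed_Icc
    have hφcs : HasCompactSupport φ := HasCompactSupport.of_support_subset_isCompact
      (isCompact_Icc (a := a') (b := b')) ((subset_tsupport φ).trans hφts)
    have h0 := hk0 φ hφs hφcs (hφts.trans fun x hx => ⟨by linarith [hx.1], by linarith [hx.2]⟩)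
    rw [hφderiv] at h0
    obtain ⟨Bg, hBg⟩ := hgc.exists_bound_of_continuous hg.continuous
    obtain ⟨Bθ, hBθ⟩ := hθc.exists_bound_of_continuous hθ.continuous
    have i1 : IntegrableOn (fun x => g x * k x) (Ioo a b) :=
      hkint.bdd_mul hg.continuous.aestronglyMeasurable (Eventually.of_forall hBg)
    have i2 : IntegrableOn (fun x => k x * θ x) (Ioo a b) := by
      have := hkint.bdd_mul hθ.continuous.aestronglyMeasurable (Eventually.of_forall hBθ)
      simpa only [IntegrableOn, mul_comm] using this
    have e : (fun x => k x * q x) = fun x => g x * k x - G * (k x * θ x) := by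
      ext x; simp only [hq]; ring
    rw [e, integral_sub i1 (i2.const_mul _), integral_const_mul] at h0
    simp only [smul_eq_mul]
    rw [hsupp g hgs]
    have e2 : (fun x => g x * (k x - c)) = fun x => g x * k x - g x * c := by
      ext x; ring
    rw [e2, integral_sub i1 ((hg.continuous.integrable_of_hasCompactSupport hgc).integrableOn.mul_const _),
      integral_mul_const]
    have : ∫ x in Ioo a b, g x = G := by
      have := hsupp g hgs (fun _ => 1)
      simp only [mul_one] at this
      exact this.symm
    rw [this, hc]
    linarith
  rw [ae_restrict_iff' measurableSet_Ioo]
  filter_upwards [key] with x hx hxm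
  have := hx hxm
  simp only [hk] at this
  linarith

/-- A primitive of an integrable function has that function as weak derivative. -/
theorem hasWeakDeriv_of_ae_eq_primitive {a b : ℝ} (hab : a < b) {c : ℝ} {f f' : ℝ → ℝ}
    (hf' : IntegrableOn f' (Ioo a b))
    (h : ∀ᵐ x ∂(volume.restrict (Ioo a b)), f x = c + ∫ y in a..x, f' y) :
    HasWeakDeriv a b f f' := by
  have hf'i : IntervalIntegrable f' volume a b := by
    rwa [intervalIntegrable_iff_integrableOn_Ioo_of_le hab.le]
  have hcont := (absolutelyContinuousOnInterval_primitive c hf'i).continuousOn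
  rw [uIcc_of_le hab.le] at hcont
  have hprim : IntegrableOn (fun x => c + ∫ y in a..x, f' y) (Ioo a b) :=
    (hcont.integrableOn_compact isCompact_Icc).mono_set Ioo_subset_Icc_self
  refine ⟨hprim.congr (h.mono fun x hx => hx.symm), hf', fun φ hφ hφc hφs => ?_⟩
  have hφa : φ a = 0 := image_eq_zero_of_notMem_tsupport fun hx => by
    have := (hφs hx).1; exact lt_irrefl _ this
  have hφb : φ b = 0 := image_eq_zero_of_notMem_tsupport fun hx => by
    have := (hφs hx).2; exact lt_irrefl _ this
  have hφ1 : ContDiff ℝ 1 φ := hφ.of_le (by exact_mod_cast le_top)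
  have hd : Continuous (deriv φ) := hφ1.continuous_deriv le_rfl
  have hib := integral_deriv_mul_primitive c hf'i hφ1
  simp only [hφa, hφb, zero_mul, sub_zero] at hib
  rw [intervalIntegral.integral_of_le hab.le, integral_Ioc_eq_integral_Ioo] at hib
  obtain ⟨B, hB⟩ := hφc.exists_bound_of_continuous hφ.continuous
  obtain ⟨B', hB'⟩ := hφc.deriv.exists_bound_of_continuous hd
  have i1 : IntegrableOn (fun x => deriv φ x * (c + ∫ z in a..x, f' z)) (Ioo a b) :=
    hprim.bdd_mul hd.aestronglyMeasurable (Eventually.of_forall hB')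
  have i2 : IntegrableOn (fun x => φ x * f' x) (Ioo a b) :=
    hf'.bdd_mul hφ.continuous.aestronglyMeasurable (Eventually.of_forall hB)
  rw [integral_add i1 i2] at hib
  have e1 : ∫ x in Ioo a b, f x * deriv φ x
      = ∫ x in Ioo a b, deriv φ x * (c + ∫ z in a..x, f' z) := by
    refine integral_congr_ae (h.mono fun x hx => ?_)
    simp only [hx]; ring
  have e3 : ∫ x in Ioo a b, f' x * φ x = ∫ x in Ioo a b, φ x * f' x := by
    congr 1; ext x; ring
  rw [e1, e3]
  linarith

theorem hasTraces_of_ae_eq_primitive {a b : ℝ} (hab : a < b) {c : ℝ} {f f' : ℝ → ℝ}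
    (hf' : IntegrableOn f' (Ioo a b))
    (h : ∀ᵐ x ∂(volume.restrict (Ioo a b)), f x = c + ∫ y in a..x, f' y) :
    HasTraces a b f c (c + ∫ y in a..b, f' y) := by
  have hf'i : IntervalIntegrable f' volume a b := by
    rwa [intervalIntegrable_iff_integrableOn_Ioo_of_le hab.le]
  have hcont := (absolutelyContinuousOnInterval_primitive c hf'i).continuousOn
  rw [uIcc_of_le hab.le] at hcont
  refine ⟨_, hcont, ?_, by simp, rfl⟩
  rwa [Filter.EventuallyEq, ← restrict_Ioo_eq_restrict_Icc]

/-! ### Curves in the transformed variable -/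

/-- The Cauchy-Schwarz inequality for real integrals. -/
theorem sq_integral_mul_le {α : Type*} [MeasurableSpace α] {μ : Measure α} {f g : α → ℝ}
    (hf : Integrable (fun x => f x ^ 2) μ) (hg : Integrable (fun x => g x ^ 2) μ)
    (hfg : Integrable (fun x => f x * g x) μ) :
    (∫ x, f x * g x ∂μ) ^ 2 ≤ (∫ x, f x ^ 2 ∂μ) * ∫ x, g x ^ 2 ∂μ := by
  -- The quadratic c ↦ ∫ (c f + g)² is nonnegative, so its discriminant is not positive.
  have h : ∀ c : ℝ, 0 ≤ (∫ x, f x ^ 2 ∂μ) * (c * c) + (2 * ∫ x, f x * g x ∂μ) * c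
      + ∫ x, g x ^ 2 ∂μ := by
    intro c
    have h0 : 0 ≤ ∫ x, (c * f x + g x) ^ 2 ∂μ := integral_nonneg fun x => sq_nonneg _
    have e : (fun x => (c * f x + g x) ^ 2) =
        fun x => ((c * c) * f x ^ 2 + (2 * c) * (f x * g x)) + g x ^ 2 := by
      ext x; ring
    have i1 : Integrable (fun x => (c * c) * f x ^ 2 + (2 * c) * (f x * g x)) μ :=
      (hf.const_mul _).add (hfg.const_mul _)
    rw [e, integral_add i1 hg,
      integral_add (hf.const_mul _) (hfg.const_mul _), integral_const_mul,
      integral_const_mul] at h0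
    linarith
  have := discrim_le_zero h
  rw [discrim] at this
  nlinarith

/-- The Lebesgue measure on `[-K, K]`. -/
abbrev leb (K : ℝ) : Measure ℝ := volume.restrict (Icc (-K) K)

/-- The Lebesgue measure on `(0, T)`. -/
abbrev lebT (T : ℝ) : Measure ℝ := volume.restrict (Ioo 0 T)

/-- The Lebesgue measure on `(0, T) × [-K, K]`. -/
abbrev lebProd (T K : ℝ) : Measure (ℝ × ℝ) := (lebT T).prod (leb K)

/-- A curve `P` of measures on `[-K, K]` with density `r ^ 2` with respect to `γ`, with
`∂ₛ r = Q`, whose flux has Lebesgue density `r B`; `Q` and `B` are square integrable. -/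
structure Curve (K T m C : ℝ) (γ : Measure ℝ) (P : ℝ → FiniteMeasure ℝ)
    (r Q B : ℝ → ℝ → ℝ) : Prop where
  K_pos : 0 < K
  T_pos : 0 < T
  m_nonneg : 0 ≤ m
  C_nonneg : 0 ≤ C
  prob : IsProbabilityMeasure γ
  γ_supp : ∀ᵐ s ∂γ, s ∈ Icc (-K) K
  r_meas : Measurable (Function.uncurry r)
  Q_meas : Measurable (Function.uncurry Q)
  B_meas : Measurable (Function.uncurry B)
  r_nonneg : ∀ t s, 0 ≤ r t s
  Q_memLp : ∀ t, MemLp (Q t) 2 (leb K)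
  ftc : ∀ t, ∀ s ∈ Icc (-K) K, r t s = r t (-K) + ∫ x in (-K)..s, Q t x
  mass_le : ∀ t, ∫ s, r t s ^ 2 ∂γ ≤ m
  P_supp : ∀ t ∈ Icc 0 T, ∀ᵐ s ∂(P t : Measure ℝ), s ∈ Icc (-K) K
  P_mass : ∀ t ∈ Icc 0 T, ((P t).mass : ℝ) = m
  P_cont : ∀ φ : ℝ → ℝ, Continuous φ →
    ContinuousOn (fun t => ∫ s, φ s ∂(P t : Measure ℝ)) (Icc 0 T)
  P_eq : ∀ᵐ t ∂(lebT T), ∀ φ : ℝ → ℝ, Continuous φ →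
    ∫ s, φ s ∂(P t : Measure ℝ) = ∫ s, φ s * r t s ^ 2 ∂γ
  Q_int : Integrable (fun z : ℝ × ℝ => Q z.1 z.2 ^ 2) (lebProd T K)
  B_int : Integrable (fun z : ℝ × ℝ => B z.1 z.2 ^ 2) (lebProd T K)
  Q_le : ∫ z, Q z.1 z.2 ^ 2 ∂(lebProd T K) ≤ C
  B_le : ∫ z, B z.1 z.2 ^ 2 ∂(lebProd T K) ≤ C
  ce : ∀ ζ ψ : ℝ → ℝ, ContDiff ℝ ∞ ζ → HasCompactSupport ζ → tsupport ζ ⊆ Ioo 0 T →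
    ContDiff ℝ ∞ ψ →
    ∫ t in Ioo 0 T, (deriv ζ t * ∫ s, ψ s ∂(P t : Measure ℝ)
      + ζ t * ∫ s, deriv ψ s * (r t s * B t s) ∂(leb K)) = 0

/-- The energy `∫ Q(t, s)² ds` at time `t`. -/
def energy (K : ℝ) (Q : ℝ → ℝ → ℝ) (t : ℝ) : ℝ := ∫ s, Q t s ^ 2 ∂(leb K)

theorem energy_nonneg (K : ℝ) (Q : ℝ → ℝ → ℝ) (t : ℝ) : 0 ≤ energy K Q t :=
  integral_nonneg fun _ => sq_nonneg _

namespace Curve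

variable {K T m C : ℝ} {γ : Measure ℝ} {P : ℝ → FiniteMeasure ℝ} {r Q B : ℝ → ℝ → ℝ}

theorem Q_sq_integrable (h : Curve K T m C γ P r Q B) (t : ℝ) :
    Integrable (fun s => Q t s ^ 2) (leb K) := (h.Q_memLp t).integrable_sq

theorem Q_integrable (h : Curve K T m C γ P r Q B) (t : ℝ) : Integrable (Q t) (leb K) :=
  (h.Q_memLp t).integrable one_le_two

theorem neg_le (h : Curve K T m C γ P r Q B) : -K ≤ K := by linarith [h.K_pos]

theorem Q_intervalIntegrable (h : Curve K T m C γ P r Q B) (t : ℝ) :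
    IntervalIntegrable (Q t) volume (-K) K := by
  rw [intervalIntegrable_iff_integrableOn_Icc_of_le h.neg_le]
  exact h.Q_integrable t

theorem r_continuousOn (h : Curve K T m C γ P r Q B) (t : ℝ) :
    ContinuousOn (r t) (Icc (-K) K) := by
  have := (absolutelyContinuousOnInterval_primitive (r t (-K)) (h.Q_intervalIntegrable t)).continuousOn
  rw [uIcc_of_le h.neg_le] at this
  exact this.congr fun s hs => h.ftc t s hs

theorem integrable_of_continuousOn (h : Curve K T m C γ P r Q B) {f : ℝ → ℝ}
    (hf : ContinuousOn f (Icc (-K) K)) : Integrable f γ := by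
  have := h.prob
  have h1 : γ.restrict (Icc (-K) K) = γ := Measure.restrict_eq_self_of_ae_mem h.γ_supp
  rw [← h1]
  exact hf.integrableOn_compact isCompact_Icc

/-- Cauchy-Schwarz for 1 · Q on the interval between the two points: r is Hölder-½ in space with
constant √E(t). -/
theorem sq_sub_le (h : Curve K T m C γ P r Q B) (t : ℝ) {s s' : ℝ} (hs : s ∈ Icc (-K) K)
    (hs' : s' ∈ Icc (-K) K) : (r t s - r t s') ^ 2 ≤ |s - s'| * energy K Q t := by
  wlog hle : s' ≤ s generalizing s s'
  · have := this hs' hs (le_of_not_ge hle)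
    rw [abs_sub_comm] at this
    nlinarith
  have hsub : Ioc s' s ⊆ Icc (-K) K := fun x hx => ⟨hs'.1.trans hx.1.le, hx.2.trans hs.2⟩
  have e : r t s - r t s' = ∫ x in Ioc s' s, 1 * Q t x := by
    rw [h.ftc t s hs, h.ftc t s' hs', ← intervalIntegral.integral_of_le hle]
    simp only [one_mul]
    rw [add_sub_add_left_eq_sub]
    refine intervalIntegral.integral_interval_sub_left ?_ ?_
    · refine (h.Q_intervalIntegrable t).mono_set ?_
      rw [uIcc_of_le hs.1, uIcc_of_le h.neg_le]
      exact Icc_subset_Icc_right hs.2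
    · refine (h.Q_intervalIntegrable t).mono_set ?_
      rw [uIcc_of_le hs'.1, uIcc_of_le h.neg_le]
      exact Icc_subset_Icc_right hs'.2
  have hQ : IntegrableOn (Q t) (Ioc s' s) := IntegrableOn.mono_set (h.Q_integrable t) hsub
  have hQ2 : IntegrableOn (fun x => Q t x ^ 2) (Ioc s' s) :=
    IntegrableOn.mono_set (h.Q_sq_integrable t) hsub
  have cs := sq_integral_mul_le (μ := volume.restrict (Ioc s' s)) (f := fun _ => (1 : ℝ))
    (g := Q t) (by simp) hQ2 (by simpa only [one_mul] using! hQ)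
  rw [← e] at cs
  refine cs.trans ?_
  have e1 : ∫ x in Ioc s' s, (1 : ℝ) ^ 2 = |s - s'| := by
    simp [abs_of_nonneg (sub_nonneg.2 hle), hle]
  rw [e1]
  gcongr
  exact setIntegral_mono_set (h.Q_sq_integrable t) (Eventually.of_forall fun x => sq_nonneg _)
    (Eventually.of_forall hsub)

/-- Since γ is a probability measure, r² does not exceed its mean, hence m, at some point of [-K,
K]. The Hölder bound over a distance at most 2K carries this to every s. In time the bound is only
integrable, which is what allows concentration. -/
theorem sq_le (h : Curve K T m C γ P r Q B) (t : ℝ) {s : ℝ} (hs : s ∈ Icc (-K) K) :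
    r t s ^ 2 ≤ (2 * m + 4 * K) * (1 + energy K Q t) := by
  have := h.prob
  obtain ⟨s₀, hs₀, hle⟩ := exists_notMem_null_le_integral
    (h.integrable_of_continuousOn ((h.r_continuousOn t).pow 2)) (ae_iff.1 h.γ_supp)
  have hs₀' : s₀ ∈ Icc (-K) K := by simpa using hs₀
  have h1 := h.sq_sub_le t hs hs₀'
  have hm : r t s₀ ^ 2 ≤ m := hle.trans (h.mass_le t)
  have hA := energy_nonneg K Q t
  have hd : |s - s₀| ≤ 2 * K := by
    rw [abs_le]; constructor <;> linarith [hs.1, hs.2, hs₀'.1, hs₀'.2]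
  have h2 : |s - s₀| * energy K Q t ≤ 2 * K * energy K Q t := by gcongr
  have hKp := h.K_pos
  have hmp := h.m_nonneg
  have h3 : r t s ^ 2 ≤ 2 * r t s₀ ^ 2 + 2 * (r t s - r t s₀) ^ 2 := by
    nlinarith [sq_nonneg (r t s - 2 * r t s₀)]
  nlinarith [mul_nonneg hmp hA]

/-- The constant in the bound of `r²`. -/
theorem const_nonneg (h : Curve K T m C γ P r Q B) : 0 ≤ 2 * m + 4 * K := by
  linarith [h.m_nonneg, h.K_pos]

/-- Factor the difference of squares: the difference and the sum each cost one square root of 1 + E,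
so the total is linear in 1 + E and integrable in time. -/
theorem abs_sq_sub_sq_le (h : Curve K T m C γ P r Q B) (t : ℝ) {s s' : ℝ}
    (hs : s ∈ Icc (-K) K) (hs' : s' ∈ Icc (-K) K) :
    |r t s ^ 2 - r t s' ^ 2| ≤
      2 * √(2 * m + 4 * K) * √|s - s'| * (1 + energy K Q t) := by
  have hA := energy_nonneg K Q t
  have h1 : |r t s - r t s'| ≤ √|s - s'| * √(1 + energy K Q t) := by
    rw [← Real.sqrt_mul (abs_nonneg _), ← Real.sqrt_sq_eq_abs]
    refine Real.sqrt_le_sqrt ((h.sq_sub_le t hs hs').trans ?_)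
    gcongr; linarith
  have h2 : ∀ x ∈ Icc (-K) K, r t x ≤ √(2 * m + 4 * K) * √(1 + energy K Q t) := by
    intro x hx
    rw [← Real.sqrt_mul h.const_nonneg]
    exact Real.le_sqrt_of_sq_le (h.sq_le t hx)
  have h3 : |r t s ^ 2 - r t s' ^ 2| = |r t s - r t s'| * (r t s + r t s') := by
    rw [sq_sub_sq, abs_mul, abs_of_nonneg (add_nonneg (h.r_nonneg t s) (h.r_nonneg t s'))]
    ring
  have h4 := h2 s hs
  have h5 := h2 s' hs'
  have h6 : √(1 + energy K Q t) * √(1 + energy K Q t) = 1 + energy K Q t :=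
    Real.mul_self_sqrt (by linarith)
  rw [h3]
  calc |r t s - r t s'| * (r t s + r t s')
      ≤ (√|s - s'| * √(1 + energy K Q t)) *
          (2 * (√(2 * m + 4 * K) * √(1 + energy K Q t))) := by
        refine mul_le_mul h1 (by linarith) (add_nonneg (h.r_nonneg t s) (h.r_nonneg t s'))
          (by positivity)
    _ = 2 * √(2 * m + 4 * K) * √|s - s'| * (√(1 + energy K Q t) * √(1 + energy K Q t)) := by
        ring
    _ = _ := by rw [h6]

theorem energy_integrable (h : Curve K T m C γ P r Q B) :
    Integrable (energy K Q) (lebT T) := h.Q_int.integral_prod_left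

theorem energyB_integrable (h : Curve K T m C γ P r Q B) :
    Integrable (energy K B) (lebT T) := h.B_int.integral_prod_left

theorem integral_energy_le (h : Curve K T m C γ P r Q B) :
    ∫ t, energy K Q t ∂(lebT T) ≤ C := by
  have := h.Q_le
  rwa [integral_prod _ h.Q_int] at this

theorem integral_energyB_le (h : Curve K T m C γ P r Q B) :
    ∫ t, energy K B t ∂(lebT T) ≤ C := by
  have := h.B_le
  rwa [integral_prod _ h.B_int] at this

theorem integral_one_add_energy_le (h : Curve K T m C γ P r Q B) :
    ∫ t, (1 + energy K Q t) ∂(lebT T) ≤ T + C := by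
  rw [integral_add (integrable_const _) h.energy_integrable]
  have := h.integral_energy_le
  simp only [integral_const, smul_eq_mul, mul_one]
  rw [measureReal_restrict_apply_univ, Real.volume_real_Ioo_of_le h.T_pos.le]
  linarith

theorem r_sq_integrable (h : Curve K T m C γ P r Q B) :
    Integrable (fun z : ℝ × ℝ => r z.1 z.2 ^ 2) (lebProd T K) := by
  have hd : Integrable (fun z : ℝ × ℝ => (2 * m + 4 * K) * (1 + energy K Q z.1)) (lebProd T K) :=
    Integrable.comp_fst (((integrable_const _).add h.energy_integrable).const_mul _) _
  refine hd.mono' (h.r_meas.pow_const 2).aestronglyMeasurable ?_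
  have hsupp : ∀ᵐ z : ℝ × ℝ ∂(lebProd T K), z.2 ∈ Icc (-K) K :=
    Measure.quasiMeasurePreserving_snd.ae (ae_restrict_mem measurableSet_Icc)
  filter_upwards [hsupp] with z hz
  rw [Real.norm_of_nonneg (sq_nonneg _)]
  exact h.sq_le z.1 hz

theorem rQ_integrable (h : Curve K T m C γ P r Q B) :
    Integrable (fun z : ℝ × ℝ => r z.1 z.2 * Q z.1 z.2) (lebProd T K) := by
  refine (h.r_sq_integrable.add h.Q_int).mono' (h.r_meas.mul h.Q_meas).aestronglyMeasurable
    (Eventually.of_forall fun z => ?_)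
  simp only [Real.norm_eq_abs, Pi.add_apply]
  rw [abs_le]
  constructor <;> nlinarith [sq_nonneg (r z.1 z.2 + Q z.1 z.2), sq_nonneg (r z.1 z.2 - Q z.1 z.2)]

theorem rB_integrable (h : Curve K T m C γ P r Q B) :
    Integrable (fun z : ℝ × ℝ => r z.1 z.2 * B z.1 z.2) (lebProd T K) := by
  refine (h.r_sq_integrable.add h.B_int).mono' (h.r_meas.mul h.B_meas).aestronglyMeasurable
    (Eventually.of_forall fun z => ?_)
  simp only [Real.norm_eq_abs, Pi.add_apply]
  rw [abs_le]
  constructor <;> nlinarith [sq_nonneg (r z.1 z.2 + B z.1 z.2), sq_nonneg (r z.1 z.2 - B z.1 z.2)]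

/-- The derivative of `r²`. -/
theorem r_sq_ftc (h : Curve K T m C γ P r Q B) (t : ℝ) {s : ℝ} (hs : s ∈ Icc (-K) K) :
    r t s ^ 2 = r t (-K) ^ 2 + ∫ x in (-K)..s, 2 * (r t x * Q t x) := by
  have h1 := comp_primitive (r t (-K)) (h.Q_intervalIntegrable t) (F := fun x => x ^ 2)
    (contDiff_id.pow 2) (s := s) (by rwa [uIcc_of_le h.neg_le])
  rw [← h.ftc t s hs] at h1
  rw [h1]
  congr 1
  refine intervalIntegral.integral_congr fun x hx => ?_
  rw [uIcc_of_le hs.1] at hx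
  rw [← h.ftc t x ⟨hx.1, hx.2.trans hs.2⟩]
  simp
  ring

theorem rQ_slice_integrable (h : Curve K T m C γ P r Q B) (t : ℝ) :
    Integrable (fun s => r t s * Q t s) (leb K) :=
  IntegrableOn.continuousOn_mul (h.r_continuousOn t) (h.Q_integrable t) isCompact_Icc

/-- The weight `(K + s) / (2 K)`, the affine function with values `0` at `-K` and `1` at `K`. -/
def weight (K s : ℝ) : ℝ := (K + s) / (2 * K)

/-- The boundary error `∫ (K + s) / (2 K) √(K - s) dγ`. -/
def bdErr (K : ℝ) (γ : Measure ℝ) : ℝ := √((∫ s, (K ^ 2 - s ^ 2) ∂γ) / (2 * K))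

theorem weight_continuous (K : ℝ) : Continuous (weight K) := by
  unfold weight; fun_prop

theorem weight_mem (h : Curve K T m C γ P r Q B) {s : ℝ} (hs : s ∈ Icc (-K) K) :
    weight K s ∈ Icc (0 : ℝ) 1 := by
  have := h.K_pos
  unfold weight
  constructor
  · exact div_nonneg (by linarith [hs.1]) (by linarith)
  · rw [div_le_one (by linarith)]; linarith [hs.2]

/-- By Cauchy-Schwarz against 1 it suffices to integrate the square. With w = `weight K`, 0 ≤ w ≤ 1
gives w² (K - s) ≤ w (K - s) = (K² - s²)/(2K), whose γ-mean is small once γ concentrates at ±K. Thus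
`bdErr` is an upper bound for both boundary integrals. -/
theorem integral_weight_mul_sqrt_le (h : Curve K T m C γ P r Q B) :
    ∫ s, weight K s * √(K - s) ∂γ ≤ bdErr K γ ∧
      ∫ s, (1 - weight K s) * √(K + s) ∂γ ≤ bdErr K γ := by
  have := h.prob
  have hK := h.K_pos
  have key : ∀ w : ℝ → ℝ, Continuous w →
      (∀ s ∈ Icc (-K) K, w s ^ 2 ≤ (K ^ 2 - s ^ 2) / (2 * K)) → ∫ s, w s ∂γ ≤ bdErr K γ := by
    intro w hw hle
    refine Real.le_sqrt_of_sq_le ?_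
    have i0 : Integrable w γ := h.integrable_of_continuousOn hw.continuousOn
    have i1 : Integrable (fun s => w s ^ 2) γ :=
      h.integrable_of_continuousOn (hw.pow 2).continuousOn
    have cs := sq_integral_mul_le (μ := γ) (f := fun _ => (1 : ℝ)) (g := w) (by simp)
      i1 (by simpa using i0)
    simp only [one_mul, one_pow, integral_const, probReal_univ, smul_eq_mul,
      mul_one] at cs
    refine cs.trans ?_
    rw [← integral_div]
    have i2 : Integrable (fun s => (K ^ 2 - s ^ 2) / (2 * K)) γ :=
      h.integrable_of_continuousOn (by fun_prop)
    refine integral_mono_ae i1 i2 ?_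
    filter_upwards [h.γ_supp] with s hs using hle s hs
  constructor
  · refine key _ (by unfold weight; fun_prop) fun s hs => ?_
    have hw := h.weight_mem hs
    rw [mul_pow, Real.sq_sqrt (by linarith [hs.2])]
    have e : (K ^ 2 - s ^ 2) / (2 * K) = weight K s * (K - s) := by
      unfold weight; field_simp; ring
    rw [e]
    have : 0 ≤ K - s := by linarith [hs.2]
    have := hw.1
    have := hw.2
    gcongr
    nlinarith
  · refine key _ (by unfold weight; fun_prop) fun s hs => ?_
    have hw := h.weight_mem hs
    rw [mul_pow, Real.sq_sqrt (by linarith [hs.1])]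
    have e : (K ^ 2 - s ^ 2) / (2 * K) = (1 - weight K s) * (K + s) := by
      unfold weight; field_simp; ring
    rw [e]
    have : 0 ≤ K + s := by linarith [hs.1]
    have := hw.1
    have := hw.2
    gcongr
    nlinarith

/-- A centred γ assigns weight ½ to each end; this is the source of the factors ½ in the limit
measures. -/
theorem integral_weight (h : Curve K T m C γ P r Q B) (hsym : ∫ s, s ∂γ = 0) :
    ∫ s, weight K s ∂γ = 1 / 2 := by
  have := h.prob
  have hK := h.K_pos
  have i1 : Integrable (fun s : ℝ => s) γ := h.integrable_of_continuousOn continuousOn_id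
  unfold weight
  rw [integral_div, integral_add (integrable_const _) i1, hsym]
  simp
  field_simp

/-- The boundary values of `r²` are close to the mass in the corresponding half. -/
theorem trace_le (h : Curve K T m C γ P r Q B) (hsym : ∫ s, s ∂γ = 0) (t : ℝ) :
    |r t K ^ 2 / 2 - ∫ s, weight K s * r t s ^ 2 ∂γ| ≤
        2 * √(2 * m + 4 * K) * bdErr K γ * (1 + energy K Q t) ∧
      |r t (-K) ^ 2 / 2 - ∫ s, (1 - weight K s) * r t s ^ 2 ∂γ| ≤
        2 * √(2 * m + 4 * K) * bdErr K γ * (1 + energy K Q t) := by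
  have := h.prob
  have hK := h.K_pos
  have hA := energy_nonneg K Q t
  have hw := weight_continuous K
  have hr := h.r_continuousOn t
  have key : ∀ (w : ℝ → ℝ) (s₁ : ℝ), Continuous w → s₁ ∈ Icc (-K) K →
      (∀ s ∈ Icc (-K) K, 0 ≤ w s) → ∫ s, w s ∂γ = 1 / 2 →
      ∫ s, w s * √|s₁ - s| ∂γ ≤ bdErr K γ →
      |r t s₁ ^ 2 / 2 - ∫ s, w s * r t s ^ 2 ∂γ| ≤
        2 * √(2 * m + 4 * K) * bdErr K γ * (1 + energy K Q t) := by
    intro w s₁ hwc hs₁ hw0 hw1 hwe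
    -- Because w has γ-integral ½, the error is a weighted average of r(s₁)² - r(s)², to which the
    -- Hölder bound for r² applies.
    have e : r t s₁ ^ 2 / 2 - ∫ s, w s * r t s ^ 2 ∂γ
        = ∫ s, w s * (r t s₁ ^ 2 - r t s ^ 2) ∂γ := by
      have e' : (fun s => w s * (r t s₁ ^ 2 - r t s ^ 2)) =
          fun s => w s * r t s₁ ^ 2 - w s * r t s ^ 2 := by ext s; ring
      rw [e', integral_sub, integral_mul_const, hw1]
      · ring
      · exact h.integrable_of_continuousOn (by fun_prop)
      · exact h.integrable_of_continuousOn (hwc.continuousOn.mul (hr.pow 2))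
    rw [e]
    calc |∫ s, w s * (r t s₁ ^ 2 - r t s ^ 2) ∂γ|
        ≤ ∫ s, |w s * (r t s₁ ^ 2 - r t s ^ 2)| ∂γ := abs_integral_le_integral_abs
      _ ≤ ∫ s, (2 * √(2 * m + 4 * K) * (1 + energy K Q t)) * (w s * √|s₁ - s|) ∂γ := by
          refine integral_mono_ae ?_ ?_ ?_
          · exact (h.integrable_of_continuousOn
              (hwc.continuousOn.mul (continuousOn_const.sub (hr.pow 2)))).abs
          · exact h.integrable_of_continuousOn (by fun_prop)
          · filter_upwards [h.γ_supp] with s hs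
            rw [abs_mul, abs_of_nonneg (hw0 s hs)]
            have h1 := h.abs_sq_sub_sq_le t hs₁ hs
            have h0 := hw0 s hs
            calc w s * |r t s₁ ^ 2 - r t s ^ 2|
                ≤ w s * (2 * √(2 * m + 4 * K) * √|s₁ - s| * (1 + energy K Q t)) := by gcongr
              _ = _ := by ring
      _ = (2 * √(2 * m + 4 * K) * (1 + energy K Q t)) * ∫ s, w s * √|s₁ - s| ∂γ := by
          rw [integral_const_mul]
      _ ≤ (2 * √(2 * m + 4 * K) * (1 + energy K Q t)) * bdErr K γ := by gcongr
      _ = _ := by ring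
  have hKm : K ∈ Icc (-K) K := ⟨h.neg_le, le_rfl⟩
  have hKm' : -K ∈ Icc (-K) K := ⟨le_rfl, h.neg_le⟩
  obtain ⟨e1, e2⟩ := h.integral_weight_mul_sqrt_le
  constructor
  · refine key (weight K) K hw hKm (fun s hs => (h.weight_mem hs).1) (h.integral_weight hsym) ?_
    refine (le_of_eq (integral_congr_ae ?_)).trans e1
    filter_upwards [h.γ_supp] with s hs
    rw [abs_of_nonneg (by linarith [hs.2])]
  · refine key (fun s => 1 - weight K s) (-K) (by fun_prop) hKm'
      (fun s hs => by linarith [(h.weight_mem hs).2]) ?_ ?_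
    · rw [integral_sub (integrable_const _) (h.integrable_of_continuousOn hw.continuousOn),
        h.integral_weight hsym]
      simp; norm_num
    · refine (le_of_eq (integral_congr_ae ?_)).trans e2
      filter_upwards [h.γ_supp] with s hs
      rw [abs_of_nonpos (by linarith [hs.1])]
      congr 2; ring

end Curve

namespace Curve

variable {K T m C : ℝ} {γ : Measure ℝ} {P : ℝ → FiniteMeasure ℝ} {r Q B : ℝ → ℝ → ℝ}

/-! ### The continuity equation for general test functions -/

theorem r_sq_integrable_prod (h : Curve K T m C γ P r Q B) :
    Integrable (fun z : ℝ × ℝ => r z.1 z.2 ^ 2) ((lebT T).prod γ) := by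
  have := h.prob
  have hd : Integrable (fun z : ℝ × ℝ => (2 * m + 4 * K) * (1 + energy K Q z.1))
      ((lebT T).prod γ) :=
    Integrable.comp_fst (((integrable_const _).add h.energy_integrable).const_mul _) _
  refine hd.mono' (h.r_meas.pow_const 2).aestronglyMeasurable ?_
  have hsupp : ∀ᵐ z : ℝ × ℝ ∂((lebT T).prod γ), z.2 ∈ Icc (-K) K :=
    Measure.quasiMeasurePreserving_snd.ae h.γ_supp
  filter_upwards [hsupp] with z hz
  rw [Real.norm_of_nonneg (sq_nonneg _)]
  exact h.sq_le z.1 hz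

theorem bdd_mul_r_sq_integrable_prod (h : Curve K T m C γ P r Q B) {a ψ : ℝ → ℝ}
    (ha : Continuous a) (hac : HasCompactSupport a) (hψ : ContinuousOn ψ (Icc (-K) K))
    (hψm : Measurable ψ) :
    Integrable (fun z : ℝ × ℝ => a z.1 * (ψ z.2 * r z.1 z.2 ^ 2)) ((lebT T).prod γ) := by
  have := h.prob
  obtain ⟨M, hM⟩ := hac.exists_bound_of_continuous ha
  obtain ⟨M', hM'⟩ := isCompact_Icc.exists_bound_of_continuousOn hψ
  have hsupp : ∀ᵐ z : ℝ × ℝ ∂((lebT T).prod γ), z.2 ∈ Icc (-K) K :=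
    Measure.quasiMeasurePreserving_snd.ae h.γ_supp
  have := h.r_sq_integrable_prod.bdd_mul (c := M') (f := fun z => ψ z.2)
    (hψm.comp measurable_snd).aestronglyMeasurable
    (hsupp.mono fun z hz => hM' _ hz)
  exact this.bdd_mul (c := M) (f := fun z => a z.1)
    (ha.measurable.comp measurable_fst).aestronglyMeasurable (Eventually.of_forall fun z => hM _)

theorem bdd_mul_rB_integrable (h : Curve K T m C γ P r Q B) {a g : ℝ → ℝ}
    (ha : Continuous a) (hac : HasCompactSupport a) (hg : Continuous g) :
    Integrable (fun z : ℝ × ℝ => a z.1 * (g z.2 * (r z.1 z.2 * B z.1 z.2))) (lebProd T K) := by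
  obtain ⟨M, hM⟩ := hac.exists_bound_of_continuous ha
  obtain ⟨M', hM'⟩ := (isCompact_Icc (a := -K) (b := K)).exists_bound_of_continuousOn hg.continuousOn
  have hsupp : ∀ᵐ z : ℝ × ℝ ∂(lebProd T K), z.2 ∈ Icc (-K) K :=
    Measure.quasiMeasurePreserving_snd.ae (ae_restrict_mem measurableSet_Icc)
  have := h.rB_integrable.bdd_mul (c := M') (f := fun z => g z.2)
    (hg.measurable.comp measurable_snd).aestronglyMeasurable
    (hsupp.mono fun z hz => hM' _ hz)
  exact this.bdd_mul (c := M) (f := fun z => a z.1)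
    (ha.measurable.comp measurable_fst).aestronglyMeasurable (Eventually.of_forall fun z => hM _)

/-- The time average of `r²` with weight `a`. -/
def avg (T : ℝ) (a : ℝ → ℝ) (f : ℝ → ℝ → ℝ) (s : ℝ) : ℝ := ∫ t, a t * f t s ∂(lebT T)

theorem integral_mul_integral_P (h : Curve K T m C γ P r Q B) {a ψ : ℝ → ℝ}
    (ha : Continuous a) (hac : HasCompactSupport a) (hψ : Continuous ψ) :
    ∫ t, a t * ∫ s, ψ s ∂(P t : Measure ℝ) ∂(lebT T) =
      ∫ s, ψ s * avg T a (fun t s => r t s ^ 2) s ∂γ := by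
  have := h.prob
  have hi := h.bdd_mul_r_sq_integrable_prod ha hac hψ.continuousOn hψ.measurable
  have e1 : ∫ t, a t * ∫ s, ψ s ∂(P t : Measure ℝ) ∂(lebT T) =
      ∫ t, ∫ s, a t * (ψ s * r t s ^ 2) ∂γ ∂(lebT T) := by
    refine integral_congr_ae ?_
    filter_upwards [h.P_eq] with t ht
    rw [ht ψ hψ, integral_const_mul]
  rw [e1, integral_integral_swap hi]
  congr 1
  ext s
  rw [avg, ← integral_const_mul]
  congr 1
  ext t
  ring

theorem integral_mul_flux (h : Curve K T m C γ P r Q B) {a g : ℝ → ℝ}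
    (ha : Continuous a) (hac : HasCompactSupport a) (hg : Continuous g) :
    ∫ t, a t * ∫ s, g s * (r t s * B t s) ∂(leb K) ∂(lebT T) =
      ∫ s, g s * avg T a (fun t s => r t s * B t s) s ∂(leb K) := by
  have hi := h.bdd_mul_rB_integrable ha hac hg
  have e1 : ∫ t, a t * ∫ s, g s * (r t s * B t s) ∂(leb K) ∂(lebT T) =
      ∫ t, ∫ s, a t * (g s * (r t s * B t s)) ∂(leb K) ∂(lebT T) := by
    congr 1; ext t; rw [integral_const_mul]
  rw [e1, integral_integral_swap hi]
  congr 1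
  ext s
  rw [avg, ← integral_const_mul]
  congr 1
  ext t
  ring

theorem integrable_mul_integral_P (h : Curve K T m C γ P r Q B) {a ψ : ℝ → ℝ}
    (ha : Continuous a) (hac : HasCompactSupport a) (hψ : Continuous ψ) :
    Integrable (fun t => a t * ∫ s, ψ s ∂(P t : Measure ℝ)) (lebT T) := by
  have hi : IntegrableOn (fun t => ∫ s, ψ s ∂(P t : Measure ℝ)) (Icc 0 T) :=
    (h.P_cont ψ hψ).integrableOn_compact isCompact_Icc
  obtain ⟨M, hM⟩ := hac.exists_bound_of_continuous ha
  exact (hi.mono_set Ioo_subset_Icc_self).bdd_mul ha.aestronglyMeasurable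
    (Eventually.of_forall hM)

theorem integrable_mul_flux (h : Curve K T m C γ P r Q B) {a g : ℝ → ℝ}
    (ha : Continuous a) (hac : HasCompactSupport a) (hg : Continuous g) :
    Integrable (fun t => a t * ∫ s, g s * (r t s * B t s) ∂(leb K)) (lebT T) := by
  have := (h.bdd_mul_rB_integrable ha hac hg).integral_prod_left
  simpa only [integral_const_mul] using this

theorem avg_integrable (h : Curve K T m C γ P r Q B) {a : ℝ → ℝ}
    (ha : Continuous a) (hac : HasCompactSupport a) :
    Integrable (avg T a (fun t s => r t s ^ 2)) γ := by
  have := h.prob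
  have := (h.bdd_mul_r_sq_integrable_prod ha hac (continuousOn_const (c := (1 : ℝ)))
    measurable_const).integral_prod_right
  simpa only [one_mul] using! this

theorem avg_flux_integrable (h : Curve K T m C γ P r Q B) {a : ℝ → ℝ}
    (ha : Continuous a) (hac : HasCompactSupport a) :
    Integrable (avg T a (fun t s => r t s * B t s)) (leb K) := by
  have := (h.bdd_mul_rB_integrable ha hac (continuous_const (y := (1 : ℝ)))).integral_prod_right
  simpa only [one_mul] using! this

theorem ce_smooth (h : Curve K T m C γ P r Q B) {ζ ψ : ℝ → ℝ} (hζ : ContDiff ℝ ∞ ζ)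
    (hζc : HasCompactSupport ζ) (hζs : tsupport ζ ⊆ Ioo 0 T) (hψ : ContDiff ℝ ∞ ψ) :
    ∫ s, ψ s * avg T (deriv ζ) (fun t s => r t s ^ 2) s ∂γ
      + ∫ s, deriv ψ s * avg T ζ (fun t s => r t s * B t s) s ∂(leb K) = 0 := by
  have hζ1 : Continuous (deriv ζ) := hζ.continuous_deriv (by exact_mod_cast le_top)
  have hψ1 : Continuous (deriv ψ) := hψ.continuous_deriv (by exact_mod_cast le_top)
  rw [← h.integral_mul_integral_P hζ1 hζc.deriv hψ.continuous,
    ← h.integral_mul_flux hζ.continuous hζc hψ1,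
    ← integral_add (h.integrable_mul_integral_P hζ1 hζc.deriv hψ.continuous)
      (h.integrable_mul_flux hζ.continuous hζc hψ1)]
  exact h.ce ζ ψ hζ hζc hζs hψ

theorem contDiff_primitive {g : ℝ → ℝ} (hg : ContDiff ℝ ∞ g) (a : ℝ) :
    ContDiff ℝ ∞ (fun x => ∫ y in a..x, g y) ∧ deriv (fun x => ∫ y in a..x, g y) = g := by
  have hgc := hg.continuous
  have hd : ∀ x, HasDerivAt (fun x => ∫ y in a..x, g y) (g x) x := fun x =>
    intervalIntegral.integral_hasDerivAt_right (hgc.intervalIntegrable _ _)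
      (hgc.stronglyMeasurableAtFilter _ _) hgc.continuousAt
  have hderiv : deriv (fun x => ∫ y in a..x, g y) = g := funext fun x => (hd x).deriv
  refine ⟨?_, hderiv⟩
  rw [contDiff_infty_iff_deriv]
  exact ⟨fun x => (hd x).differentiableAt, by rw [hderiv]; exact hg⟩

/-- Integration by parts against a measure. -/
theorem integral_primitive_mul (h : Curve K T m C γ P r Q B) {g b : ℝ → ℝ}
    (hg : Integrable g (leb K)) (hb : Integrable b γ) :
    ∫ s, (∫ x in (-K)..s, g x) * b s ∂γ = ∫ x, g x * (∫ s in Ioi x, b s ∂γ) ∂(leb K) ∧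
      Integrable (fun x => g x * (∫ s in Ioi x, b s ∂γ)) (leb K) := by
  have := h.prob
  have hi : Integrable (fun z : ℝ × ℝ => g z.1 * (Ioi z.1).indicator b z.2) ((leb K).prod γ) := by
    have h1 : Integrable (fun z : ℝ × ℝ => g z.1 * b z.2) ((leb K).prod γ) := hg.mul_prod hb
    have hms : MeasurableSet {z : ℝ × ℝ | z.1 < z.2} := measurableSet_lt measurable_fst measurable_snd
    refine (h1.indicator hms).congr (Eventually.of_forall fun z => ?_)
    by_cases hz : z.1 < z.2
    · simp [indicator, hz]
    · simp [indicator, hz]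
  have e : ∀ x, g x * (∫ s in Ioi x, b s ∂γ) = ∫ s, g x * (Ioi x).indicator b s ∂γ := by
    intro x
    rw [integral_const_mul, integral_indicator measurableSet_Ioi]
  refine ⟨?_, ?_⟩
  · simp_rw [e]
    rw [integral_integral_swap hi]
    refine integral_congr_ae ?_
    filter_upwards [h.γ_supp] with s hs
    have e2 : ∀ x, g x * (Ioi x).indicator b s = (Iio s).indicator g x * b s := by
      intro x
      by_cases hx : x < s <;> simp [indicator, hx]
    simp_rw [e2]
    rw [integral_mul_const]
    congr 1
    rw [intervalIntegral.integral_of_le hs.1, integral_Ioc_eq_integral_Ioo,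
      ← integral_Ico_eq_integral_Ioo, setIntegral_indicator measurableSet_Iio]
    congr 2
    ext x
    simp only [mem_Ico, mem_inter_iff, mem_Icc, mem_Iio]
    exact ⟨fun hx => ⟨⟨hx.1, hx.2.le.trans hs.2⟩, hx.2⟩, fun hx => ⟨hx.1.1, hx.2⟩⟩
  · simp_rw [e]
    exact hi.integral_prod_left

/-- The continuity equation, averaged in time, for absolutely continuous test functions. -/
theorem ce_integrable (h : Curve K T m C γ P r Q B) {ζ g : ℝ → ℝ} (hζ : ContDiff ℝ ∞ ζ)
    (hζc : HasCompactSupport ζ) (hζs : tsupport ζ ⊆ Ioo 0 T) (hg : Integrable g (leb K)) (c : ℝ) :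
    ∫ s, (c + ∫ x in (-K)..s, g x) * avg T (deriv ζ) (fun t s => r t s ^ 2) s ∂γ
      + ∫ s, g s * avg T ζ (fun t s => r t s * B t s) s ∂(leb K) = 0 := by
  have := h.prob
  have hζ1 : Continuous (deriv ζ) := hζ.continuous_deriv (by exact_mod_cast le_top)
  set b := avg T (deriv ζ) (fun t s => r t s ^ 2) with hbdef
  set z := avg T ζ (fun t s => r t s * B t s) with hzdef
  have hb : Integrable b γ := h.avg_integrable hζ1 hζc.deriv
  have hz : Integrable z (leb K) := h.avg_flux_integrable hζ.continuous hζc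
  have hΓ : Integrable (fun x => ∫ s in Ioi x, b s ∂γ) (leb K) := by
    have := (h.integral_primitive_mul (g := fun _ => (1 : ℝ)) (integrable_const _) hb).2
    simpa only [one_mul] using this
  -- Testing with primitives of smooth functions and exchanging integrals shows that the averaged
  -- flux z is minus the γ-tail of b. In this strong form the identity can be multiplied by any
  -- integrable g.
  have key : ∀ᵐ x ∂(leb K), (∫ s in Ioi x, b s ∂γ) + z x = 0 := by
    refine ae_eq_zero_of_integral_contDiff_smul_eq_zero (hΓ.add hz).locallyIntegrable ?_
    intro q hq hqc
    obtain ⟨h1, h2⟩ := contDiff_primitive hq (-K)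
    have h3 := h.ce_smooth hζ hζc hζs h1
    rw [h2] at h3
    obtain ⟨M, hM⟩ := hqc.exists_bound_of_continuous hq.continuous
    have i0 : Integrable q (leb K) := (hq.continuous.integrable_of_hasCompactSupport hqc).integrableOn
    obtain ⟨h4, h5⟩ := h.integral_primitive_mul i0 hb
    rw [← hbdef, ← hzdef, h4] at h3
    rw [← h3, ← integral_add h5
      (hz.bdd_mul hq.continuous.aestronglyMeasurable (Eventually.of_forall hM))]
    congr 1; ext x; simp only [smul_eq_mul]; ring
  have hc : ∫ s, b s ∂γ = 0 := by
    have h3 := h.ce_smooth hζ hζc hζs (contDiff_const (c := (1 : ℝ)))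
    simpa using h3
  obtain ⟨h4, h5⟩ := h.integral_primitive_mul hg hb
  have hprim : Integrable (fun s => (∫ x in (-K)..s, g x) * b s) γ := by
    have hgi : IntervalIntegrable g volume (-K) K := by
      rw [intervalIntegrable_iff_integrableOn_Icc_of_le h.neg_le]
      exact hg
    have hcont := (absolutelyContinuousOnInterval_primitive 0 hgi).continuousOn
    rw [uIcc_of_le h.neg_le] at hcont
    simp only [zero_add] at hcont
    have e : γ = γ.restrict (Icc (-K) K) := (Measure.restrict_eq_self_of_ae_mem h.γ_supp).symm
    rw [e] at hb ⊢
    exact IntegrableOn.continuousOn_mul hcont hb isCompact_Icc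
  have e1 : (fun s => (c + ∫ x in (-K)..s, g x) * b s) =
      fun s => c * b s + (∫ x in (-K)..s, g x) * b s := by ext s; ring
  rw [e1, integral_add (hb.const_mul _) hprim, integral_const_mul, hc, h4, mul_zero, zero_add]
  have e2 : ∫ x, g x * z x ∂(leb K) = ∫ x, -(g x * (∫ s in Ioi x, b s ∂γ)) ∂(leb K) := by
    refine integral_congr_ae ?_
    filter_upwards [key] with x hx
    have : z x = -(∫ s in Ioi x, b s ∂γ) := by linarith
    rw [this]; ring
  rw [e2, integral_neg, add_neg_cancel]

/-- The integral of a test function `c + ∫ g` along the curve is absolutely continuous. -/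
theorem integral_P_sub (h : Curve K T m C γ P r Q B) {g : ℝ → ℝ} (hg : Continuous g)
    {t₁ t₂ : ℝ} (h₁ : t₁ ∈ Icc 0 T) (h₂ : t₂ ∈ Icc 0 T) :
    (∫ s, (∫ x in (-K)..s, g x) ∂(P t₂ : Measure ℝ)) - ∫ s, (∫ x in (-K)..s, g x) ∂(P t₁ : Measure ℝ)
      = ∫ t in t₁..t₂, ∫ s, g s * (r t s * B t s) ∂(leb K) := by
  set ψ : ℝ → ℝ := fun s => ∫ x in (-K)..s, g x with hψdef
  have hψ : Continuous ψ := intervalIntegral.continuous_primitive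
    (fun _ _ => hg.intervalIntegrable _ _) _
  set N : ℝ → ℝ := fun t => ∫ s, ψ s ∂(P t : Measure ℝ)
  set M : ℝ → ℝ := fun t => ∫ s, g s * (r t s * B t s) ∂(leb K)
  have hN : ContinuousOn N (Icc 0 T) := h.P_cont ψ hψ
  have hMint : IntegrableOn M (Ioo 0 T) := by
    obtain ⟨M', hM'⟩ := (isCompact_Icc (a := -K) (b := K)).exists_bound_of_continuousOn
      hg.continuousOn
    have hsupp : ∀ᵐ z : ℝ × ℝ ∂(lebProd T K), z.2 ∈ Icc (-K) K :=
      Measure.quasiMeasurePreserving_snd.ae (ae_restrict_mem measurableSet_Icc)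
    exact (h.rB_integrable.bdd_mul (c := M') (f := fun z => g z.2)
      (hg.measurable.comp measurable_snd).aestronglyMeasurable
      (hsupp.mono fun z hz => hM' _ hz)).integral_prod_left
  have hNint : IntegrableOn N (Ioo 0 T) :=
    (hN.integrableOn_compact isCompact_Icc).mono_set Ioo_subset_Icc_self
  have hgi : Integrable g (leb K) := hg.continuousOn.integrableOn_compact isCompact_Icc
  have hweak : HasWeakDeriv 0 T N M := by
    refine ⟨hNint, hMint, fun ζ hζ hζc hζs => ?_⟩
    have hζ1 : Continuous (deriv ζ) := hζ.continuous_deriv (by exact_mod_cast le_top)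
    have h1 := h.ce_integrable hζ hζc hζs hgi 0
    simp only [zero_add] at h1
    have h2 := h.integral_mul_integral_P hζ1 hζc.deriv hψ
    have h3 := h.integral_mul_flux hζ.continuous hζc hg
    rw [← h2, ← h3] at h1
    have e1 : ∫ t in Ioo 0 T, N t * deriv ζ t = ∫ t in Ioo 0 T, deriv ζ t * N t := by
      congr 1; ext t; ring
    have e2 : ∫ t in Ioo 0 T, M t * ζ t = ∫ t in Ioo 0 T, ζ t * M t := by
      congr 1; ext t; ring
    rw [e1, e2]
    linarith
  obtain ⟨c, hc⟩ := hweak.ae_eq_primitive h.T_pos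
  have hMi : IntervalIntegrable M volume 0 T := by
    rwa [intervalIntegrable_iff_integrableOn_Ioo_of_le h.T_pos.le]
  have hcont := (absolutelyContinuousOnInterval_primitive c hMi).continuousOn
  rw [uIcc_of_le h.T_pos.le] at hcont
  rw [restrict_Ioo_eq_restrict_Icc] at hc
  -- Weak continuity of P upgrades the almost everywhere identity to every t in [0, T], endpoints
  -- included.
  have heq := Measure.eqOn_Icc_of_ae_eq volume h.T_pos.ne hc hN hcont
  have hsub : ∀ t ∈ Icc 0 T, IntervalIntegrable M volume 0 t := fun t ht =>
    hMi.mono_set (by rw [uIcc_of_le ht.1, uIcc_of_le h.T_pos.le]; exact Icc_subset_Icc_right ht.2)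
  change N t₂ - N t₁ = _
  rw [heq h₁, heq h₂, add_sub_add_left_eq_sub]
  exact intervalIntegral.integral_interval_sub_left (hsub _ h₂) (hsub _ h₁)

end Curve

/-! ### An entropy function -/

/-- The derivative of the entropy function. -/
def logF (x : ℝ) : ℝ := Real.log (1 + x ^ 2) / 2

/-- A convex function of superlinear growth with `x * entF'' x ≤ 1`. -/
def entF (x : ℝ) : ℝ := x * logF x - x + Real.arctan x

theorem hasDerivAt_logF (x : ℝ) : HasDerivAt logF (x / (1 + x ^ 2)) x := by
  have h1 : HasDerivAt (fun x : ℝ => 1 + x ^ 2) (2 * x) x := by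
    simpa using (hasDerivAt_pow 2 x).const_add 1
  have h2 := (h1.log (by positivity)).div_const 2
  have e : x / (1 + x ^ 2) = 2 * x / (1 + x ^ 2) / 2 := by field_simp
  rw [e]
  exact h2

theorem contDiff_logF : ContDiff ℝ 1 logF := by
  unfold logF
  refine (ContDiff.log (by fun_prop) fun x => by positivity).div_const 2

theorem hasDerivAt_entF (x : ℝ) : HasDerivAt entF (logF x) x := by
  have h := (((hasDerivAt_id x).mul (hasDerivAt_logF x)).sub (hasDerivAt_id x)).add
    (Real.hasDerivAt_arctan x)
  have e : logF x = 1 * logF x + id x * (x / (1 + x ^ 2)) - 1 + 1 / (1 + x ^ 2) := by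
    have : (1 + x ^ 2) ≠ 0 := by positivity
    simp only [id]
    field_simp
    ring
  rw [e]
  exact h

theorem logF_nonneg (x : ℝ) : 0 ≤ logF x := by
  unfold logF
  have : 0 ≤ Real.log (1 + x ^ 2) := Real.log_nonneg (by nlinarith [sq_nonneg x])
  linarith

theorem logF_pos {x : ℝ} (hx : 0 < x) : 0 < logF x := by
  unfold logF
  have : 0 < Real.log (1 + x ^ 2) := Real.log_pos (by nlinarith [sq_pos_of_pos hx])
  linarith

theorem logF_mono {x y : ℝ} (hx : 0 ≤ x) (hxy : x ≤ y) : logF x ≤ logF y := by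
  unfold logF
  have : Real.log (1 + x ^ 2) ≤ Real.log (1 + y ^ 2) :=
    Real.log_le_log (by positivity) (by nlinarith)
  linarith

theorem logF_le (x : ℝ) : logF x ≤ x ^ 2 := by
  unfold logF
  have := Real.log_le_sub_one_of_pos (x := 1 + x ^ 2) (by positivity)
  nlinarith [sq_nonneg x]

theorem tendsto_logF : Tendsto logF atTop atTop := by
  unfold logF
  refine Tendsto.atTop_div_const (by norm_num) (Real.tendsto_log_atTop.comp ?_)
  exact tendsto_atTop_add_const_left _ _ (tendsto_pow_atTop two_ne_zero)

theorem entF_monotone : Monotone entF :=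
  monotone_of_deriv_nonneg (fun x => (hasDerivAt_entF x).differentiableAt) fun x => by
    rw [(hasDerivAt_entF x).deriv]; exact logF_nonneg x

theorem entF_continuous : Continuous entF :=
  continuous_iff_continuousAt.2 fun x => (hasDerivAt_entF x).continuousAt

theorem entF_nonneg {x : ℝ} (hx : 0 ≤ x) : 0 ≤ entF x := by
  have := entF_monotone hx
  simpa [entF] using this

/-- Beyond M the slope of `entF` is at least `logF M`, so the excess x - M costs at least `logF M *
(x - M)`. This turns an entropy bound into uniform integrability. -/
theorem le_add_entF_div {M x : ℝ} (hM : 0 < M) (hx : 0 ≤ x) : x ≤ M + entF x / logF M := by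
  have hF := logF_pos hM
  rcases le_total x M with hle | hle
  · have := div_nonneg (entF_nonneg hx) hF.le
    linarith
  · have hmono : MonotoneOn (fun y => entF y - logF M * y) (Ici M) := by
      refine monotoneOn_of_deriv_nonneg (convex_Ici M) ?_ ?_ ?_
      · exact (entF_continuous.sub (by fun_prop)).continuousOn
      · intro y _
        exact ((hasDerivAt_entF y).sub ((hasDerivAt_id y).const_mul _)).differentiableAt.differentiableWithinAt
      · intro y hy
        rw [interior_Ici] at hy
        have hd : HasDerivAt (fun y => entF y - logF M * y) (logF y - logF M * 1) y :=
          (hasDerivAt_entF y).sub ((hasDerivAt_id y).const_mul _)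
        rw [hd.deriv]
        have := logF_mono hM.le (le_of_lt hy)
        linarith
    have h1 := hmono (self_mem_Ici) hle hle
    simp only at h1
    have h2 := entF_nonneg hM.le
    have h3 : logF M * (x - M) ≤ entF x := by nlinarith
    have h4 : x - M ≤ entF x / logF M := by
      rw [le_div_iff₀ hF]; linarith
    linarith

/-! ### Entropy production along a curve. -/

namespace Curve

variable {K T m C : ℝ} {γ : Measure ℝ} {P : ℝ → FiniteMeasure ℝ} {r Q B : ℝ → ℝ → ℝ}

theorem avg_measurable (T : ℝ) {a : ℝ → ℝ} {f : ℝ → ℝ → ℝ} (ha : Measurable a)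
    (hf : Measurable (Function.uncurry f)) : Measurable (avg T a f) := by
  have h1 : Measurable (fun z : ℝ × ℝ => a z.1 * f z.1 z.2) :=
    (ha.comp measurable_fst).mul hf
  exact (h1.stronglyMeasurable.integral_prod_left).measurable

theorem r_sq_slice_integrable (h : Curve K T m C γ P r Q B) {s : ℝ} (hs : s ∈ Icc (-K) K) :
    Integrable (fun t => r t s ^ 2) (lebT T) := by
  refine (((integrable_const 1).add h.energy_integrable).const_mul (2 * m + 4 * K)).mono'
    ((h.r_meas.comp (measurable_id.prodMk measurable_const)).pow_const 2).aestronglyMeasurable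
    (Eventually.of_forall fun t => ?_)
  rw [Real.norm_of_nonneg (sq_nonneg _)]
  exact h.sq_le t hs

/-- The averages of `r²` are primitives of the averages of `2 r Q`. -/
theorem avg_ftc (h : Curve K T m C γ P r Q B) {ζ : ℝ → ℝ} (hζ : Continuous ζ)
    (hζc : HasCompactSupport ζ) {s : ℝ} (hs : s ∈ Icc (-K) K) :
    avg T ζ (fun t s => r t s ^ 2) s = avg T ζ (fun t s => r t s ^ 2) (-K)
      + ∫ x in (-K)..s, 2 * avg T ζ (fun t s => r t s * Q t s) x := by
  obtain ⟨M, hM⟩ := hζc.exists_bound_of_continuous hζ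
  have hKm : -K ∈ Icc (-K) K := ⟨le_rfl, h.neg_le⟩
  have i0 : Integrable (fun t => ζ t * r t (-K) ^ 2) (lebT T) :=
    (h.r_sq_slice_integrable hKm).bdd_mul hζ.aestronglyMeasurable (Eventually.of_forall hM)
  have i1 : Integrable (fun t => ζ t * r t s ^ 2) (lebT T) :=
    (h.r_sq_slice_integrable hs).bdd_mul hζ.aestronglyMeasurable (Eventually.of_forall hM)
  have hi : Integrable (fun z : ℝ × ℝ => ζ z.1 *
      (Iic s).indicator (fun x => 2 * (r z.1 x * Q z.1 x)) z.2) (lebProd T K) := by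
    have h1 := (h.rQ_integrable.const_mul 2).indicator
      (measurable_snd (measurableSet_Iic (a := s)))
    refine (h1.bdd_mul (c := M) (f := fun z => ζ z.1)
      (hζ.measurable.comp measurable_fst).aestronglyMeasurable
      (Eventually.of_forall fun z => hM _)).congr (Eventually.of_forall fun z => ?_)
    by_cases hz : z.2 ≤ s <;> simp [indicator, hz]
  have e0 : ∀ (f : ℝ → ℝ), ∫ x in (-K)..s, f x = ∫ x, (Iic s).indicator f x ∂(leb K) := by
    intro f
    rw [intervalIntegral.integral_of_le hs.1, setIntegral_indicator measurableSet_Iic,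
      ← integral_Icc_eq_integral_Ioc]
    congr 2
    ext x
    simp only [mem_inter_iff, mem_Icc, mem_Iic]
    exact ⟨fun hx => ⟨⟨hx.1, hx.2.trans hs.2⟩, hx.2⟩, fun hx => ⟨hx.1.1, hx.2⟩⟩
  have e1 : avg T ζ (fun t s => r t s ^ 2) s - avg T ζ (fun t s => r t s ^ 2) (-K) =
      ∫ t, ∫ x, ζ t * (Iic s).indicator (fun x => 2 * (r t x * Q t x)) x ∂(leb K) ∂(lebT T) := by
    rw [avg, avg, ← integral_sub i1 i0]
    congr 1
    ext t
    rw [integral_const_mul, ← e0, h.r_sq_ftc t hs]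
    ring
  rw [integral_integral_swap hi] at e1
  rw [e0]
  rw [← sub_eq_iff_eq_add', e1]
  congr 1
  ext x
  by_cases hx : x ≤ s
  · simp only [indicator, mem_Iic, hx, if_true, avg]
    rw [← integral_const_mul]
    congr 1; ext t; ring
  · simp [indicator, hx]

theorem avg_rQ_integrable (h : Curve K T m C γ P r Q B) {ζ : ℝ → ℝ} (hζ : Continuous ζ)
    (hζc : HasCompactSupport ζ) :
    Integrable (avg T ζ (fun t s => r t s * Q t s)) (leb K) := by
  obtain ⟨M, hM⟩ := hζc.exists_bound_of_continuous hζ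
  exact (h.rQ_integrable.bdd_mul (c := M) (f := fun z => ζ z.1)
    (hζ.measurable.comp measurable_fst).aestronglyMeasurable
    (Eventually.of_forall fun z => hM _)).integral_prod_right

/-- Averages of products are controlled by averages of squares. -/
theorem sq_avg_mul_le {ζ : ℝ → ℝ} (hζ0 : ∀ t, 0 ≤ ζ t) {f g : ℝ → ℝ → ℝ} {s : ℝ}
    (hf : Integrable (fun t => ζ t * f t s ^ 2) (lebT T))
    (hg : Integrable (fun t => ζ t * g t s ^ 2) (lebT T))
    (hfg : Integrable (fun t => ζ t * (f t s * g t s)) (lebT T)) :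
    avg T ζ (fun t s => f t s * g t s) s ^ 2 ≤
      avg T ζ (fun t s => f t s ^ 2) s * avg T ζ (fun t s => g t s ^ 2) s := by
  have e1 : ∀ x y t : ℝ, ζ t * (x * y) = (√(ζ t) * x) * (√(ζ t) * y) := fun x y t => by
    have := Real.mul_self_sqrt (hζ0 t)
    calc ζ t * (x * y) = (√(ζ t) * √(ζ t)) * (x * y) := by rw [this]
      _ = _ := by ring
  have e2 : ∀ x t : ℝ, ζ t * x ^ 2 = (√(ζ t) * x) ^ 2 := fun x t => by
    rw [mul_pow, Real.sq_sqrt (hζ0 t)]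
  simp only [avg]
  simp only [e1, e2] at hf hg hfg ⊢
  exact sq_integral_mul_le hf hg hfg

/-- The dissipation controls the production of entropy. -/
theorem abs_entropy_production_le (h : Curve K T m C γ P r Q B) {ζ : ℝ → ℝ}
    (hζ : ContDiff ℝ ∞ ζ) (hζc : HasCompactSupport ζ) (hζs : tsupport ζ ⊆ Ioo 0 T)
    (hζ0 : ∀ t, 0 ≤ ζ t) :
    |∫ s, logF (avg T ζ (fun t s => r t s ^ 2) s)
        * avg T (deriv ζ) (fun t s => r t s ^ 2) s ∂γ| ≤
      ∫ t, ζ t * (energy K Q t + energy K B t) ∂(lebT T) := by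
  have := h.prob
  obtain ⟨M, hM⟩ := hζc.exists_bound_of_continuous hζ.continuous
  set b := avg T ζ (fun t s => r t s ^ 2) with hb
  set y := fun x => 2 * avg T ζ (fun t s => r t s * Q t s) x with hy
  set z := avg T ζ (fun t s => r t s * B t s) with hz
  have hyi : Integrable y (leb K) := (h.avg_rQ_integrable hζ.continuous hζc).const_mul 2
  have hyI : IntervalIntegrable y volume (-K) K := by
    rw [intervalIntegrable_iff_integrableOn_Icc_of_le h.neg_le]
    exact hyi
  have hbftc : ∀ s ∈ Icc (-K) K, b s = b (-K) + ∫ x in (-K)..s, y x := fun s hs =>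
    h.avg_ftc hζ.continuous hζc hs
  -- The test function `logF ∘ b` is only absolutely continuous in s, with integrable derivative g
  -- by the chain rule. This is why the continuity equation was extended beyond smooth test
  -- functions.
  set g : ℝ → ℝ := fun x => deriv logF (b (-K) + ∫ x in (-K)..x, y x) * y x with hg
  have hcont := (absolutelyContinuousOnInterval_primitive (b (-K)) hyI).continuousOn
  rw [uIcc_of_le h.neg_le] at hcont
  have hgi : Integrable g (leb K) :=
    IntegrableOn.continuousOn_mul ((contDiff_logF.continuous_deriv le_rfl).comp_continuousOn hcont)
      hyi isCompact_Icc
  have h1 := h.ce_integrable hζ hζc hζs hgi (logF (b (-K)))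
  have e1 : ∫ s, (logF (b (-K)) + ∫ x in (-K)..s, g x)
        * avg T (deriv ζ) (fun t s => r t s ^ 2) s ∂γ =
      ∫ s, logF (b s) * avg T (deriv ζ) (fun t s => r t s ^ 2) s ∂γ := by
    refine integral_congr_ae ?_
    filter_upwards [h.γ_supp] with s hs
    rw [hbftc s hs, comp_primitive (b (-K)) hyI contDiff_logF (by rwa [uIcc_of_le h.neg_le])]
  rw [e1] at h1
  rw [eq_neg_of_add_eq_zero_left h1, abs_neg]
  have hQi : Integrable (fun z : ℝ × ℝ => ζ z.1 * Q z.1 z.2 ^ 2) (lebProd T K) :=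
    h.Q_int.bdd_mul (c := M) (f := fun z => ζ z.1)
      (hζ.continuous.measurable.comp measurable_fst).aestronglyMeasurable
      (Eventually.of_forall fun z => hM _)
  have hBi : Integrable (fun z : ℝ × ℝ => ζ z.1 * B z.1 z.2 ^ 2) (lebProd T K) :=
    h.B_int.bdd_mul (c := M) (f := fun z => ζ z.1)
      (hζ.continuous.measurable.comp measurable_fst).aestronglyMeasurable
      (Eventually.of_forall fun z => hM _)
  have hrQi : Integrable (fun z : ℝ × ℝ => ζ z.1 * (r z.1 z.2 * Q z.1 z.2)) (lebProd T K) :=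
    h.rQ_integrable.bdd_mul (c := M) (f := fun z => ζ z.1)
      (hζ.continuous.measurable.comp measurable_fst).aestronglyMeasurable
      (Eventually.of_forall fun z => hM _)
  have hrBi : Integrable (fun z : ℝ × ℝ => ζ z.1 * (r z.1 z.2 * B z.1 z.2)) (lebProd T K) :=
    h.rB_integrable.bdd_mul (c := M) (f := fun z => ζ z.1)
      (hζ.continuous.measurable.comp measurable_fst).aestronglyMeasurable
      (Eventually.of_forall fun z => hM _)
  set q := avg T ζ (fun t s => Q t s ^ 2) with hq
  set β := avg T ζ (fun t s => B t s ^ 2) with hβ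
  have hqi : Integrable q (leb K) := hQi.integral_prod_right
  have hβi : Integrable β (leb K) := hBi.integral_prod_right
  have hpt : ∀ᵐ s ∂(leb K), |g s * z s| ≤ q s + β s := by
    filter_upwards [hQi.prod_left_ae, hBi.prod_left_ae, hrQi.prod_left_ae, hrBi.prod_left_ae,
      ae_restrict_mem measurableSet_Icc] with s s1 s2 s3 s4 hs
    have ir : Integrable (fun t => ζ t * r t s ^ 2) (lebT T) :=
      (h.r_sq_slice_integrable hs).bdd_mul hζ.continuous.aestronglyMeasurable
        (Eventually.of_forall hM)
    have c1 := sq_avg_mul_le hζ0 (f := r) (g := Q) ir s1 s3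
    have c2 := sq_avg_mul_le hζ0 (f := r) (g := B) ir s2 s4
    have hb0 : 0 ≤ b s := integral_nonneg fun t => mul_nonneg (hζ0 t) (sq_nonneg _)
    have hq0 : 0 ≤ q s := integral_nonneg fun t => mul_nonneg (hζ0 t) (sq_nonneg _)
    have hβ0 : 0 ≤ β s := integral_nonneg fun t => mul_nonneg (hζ0 t) (sq_nonneg _)
    have hgs : g s = b s / (1 + b s ^ 2) * y s := by
      simp only [hg]
      rw [← hbftc s hs, (hasDerivAt_logF _).deriv]
    -- Two applications of Cauchy-Schwarz in time give (y z)² ≤ 4 b² q β ≤ (b (q + β))². The factor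
    -- b is then absorbed by x F''(x) = x²/(1 + x²) ≤ 1, the property for which the entropy was
    -- chosen.
    have hyz : |y s * z s| ≤ (q s + β s) * b s := by
      refine abs_le_of_sq_le_sq ?_ (by positivity)
      have e : (y s * z s) ^ 2 =
          4 * (avg T ζ (fun t s => r t s * Q t s) s ^ 2 * avg T ζ (fun t s => r t s * B t s) s ^ 2) := by
        simp only [hy, hz]; ring
      rw [e]
      have c3 := mul_le_mul c1 c2 (sq_nonneg _) (mul_nonneg hb0 hq0)
      calc _ ≤ 4 * (b s * q s * (b s * β s)) := by linarith [c3]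
        _ ≤ ((q s + β s) * b s) ^ 2 := by
          have := mul_nonneg (sq_nonneg (b s)) (sq_nonneg (q s - β s))
          nlinarith
    have hF1 : b s / (1 + b s ^ 2) * b s ≤ 1 := by
      rw [div_mul_eq_mul_div, div_le_one (by positivity)]; nlinarith
    have hF0 : 0 ≤ b s / (1 + b s ^ 2) := by positivity
    rw [hgs, mul_assoc, abs_mul, abs_of_nonneg hF0]
    calc b s / (1 + b s ^ 2) * |y s * z s| ≤ b s / (1 + b s ^ 2) * ((q s + β s) * b s) := by
          gcongr
      _ = (b s / (1 + b s ^ 2) * b s) * (q s + β s) := by ring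
      _ ≤ 1 * (q s + β s) := by gcongr
      _ = _ := one_mul _
  calc |∫ s, g s * z s ∂(leb K)| ≤ ∫ s, |g s * z s| ∂(leb K) := abs_integral_le_integral_abs
    _ ≤ ∫ s, (q s + β s) ∂(leb K) :=
        integral_mono_of_nonneg (Eventually.of_forall fun s => abs_nonneg _) (hqi.add hβi) hpt
    _ = ∫ t, ζ t * (energy K Q t + energy K B t) ∂(lebT T) := by
        rw [integral_add hqi hβi, hq, hβ]
        simp only [avg]
        rw [← integral_integral_swap (f := fun t s => ζ t * Q t s ^ 2) hQi,
          ← integral_integral_swap (f := fun t s => ζ t * B t s ^ 2) hBi,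
          ← integral_add hQi.integral_prod_left hBi.integral_prod_left]
        congr 1
        ext t
        simp only [integral_const_mul, energy]
        ring

end Curve

/-! ### Mollification in time and the entropy estimate -/

/-- A smooth mollification kernel supported in `[-h, h]`. -/
structure IsKernel (η : ℝ → ℝ) (h : ℝ) : Prop where
  smooth : ContDiff ℝ ∞ η
  compact : HasCompactSupport η
  nonneg : ∀ x, 0 ≤ η x
  integral_eq : ∫ x, η x = 1
  zero : ∀ x, h < |x| → η x = 0

theorem exists_isKernel {h : ℝ} (hh : 0 < h) : ∃ η, IsKernel η h := by
  let B : ContDiffBump (0 : ℝ) := ⟨h / 2, h, by linarith, by linarith⟩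
  refine ⟨B.normed volume, B.contDiff_normed, B.hasCompactSupport_normed,
    fun x => B.nonneg_normed x, B.integral_normed, fun x hx => ?_⟩
  refine image_eq_zero_of_notMem_tsupport fun hmem => ?_
  rw [B.tsupport_normed_eq, Metric.mem_closedBall, Real.dist_eq, sub_zero] at hmem
  exact absurd hmem (not_le.2 hx)

namespace IsKernel

variable {η : ℝ → ℝ} {h T : ℝ}

theorem continuous_deriv (hη : IsKernel η h) : Continuous (deriv η) :=
  hη.smooth.continuous_deriv (by exact_mod_cast le_top)

theorem exists_bound (hη : IsKernel η h) :
    ∃ M, 0 ≤ M ∧ (∀ x, |η x| ≤ M) ∧ ∀ x, |deriv η x| ≤ M := by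
  obtain ⟨M, hM⟩ := hη.compact.exists_bound_of_continuous hη.smooth.continuous
  obtain ⟨M', hM'⟩ := hη.compact.deriv.exists_bound_of_continuous hη.continuous_deriv
  exact ⟨max M M', ((norm_nonneg _).trans (hM 0)).trans (le_max_left _ _),
    fun x => (hM x).trans (le_max_left _ _), fun x => (hM' x).trans (le_max_right _ _)⟩

theorem contDiff_shift (hη : IsKernel η h) (t : ℝ) : ContDiff ℝ ∞ (fun τ => η (t - τ)) :=
  hη.smooth.comp (contDiff_const.sub contDiff_id)

theorem compact_shift (hη : IsKernel η h) (t : ℝ) : HasCompactSupport (fun τ => η (t - τ)) :=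
  hη.compact.comp_homeomorph (Homeomorph.subLeft t)

theorem tsupport_shift (hη : IsKernel η h) {t : ℝ} (h1 : h < t) (h2 : t < T - h) :
    tsupport (fun τ => η (t - τ)) ⊆ Ioo 0 T := by
  have : tsupport (fun τ => η (t - τ)) ⊆ Icc (t - h) (t + h) := by
    refine closure_minimal (fun τ hτ => ?_) isClosed_Icc
    by_contra hcon
    refine hτ (hη.zero _ ?_)
    rw [mem_Icc, not_and_or, not_le, not_le] at hcon
    rw [lt_abs]
    rcases hcon with hc | hc
    · left; linarith
    · right; linarith
  exact this.trans fun τ hτ => ⟨by linarith [hτ.1], by linarith [hτ.2]⟩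

theorem integrable_shift_mul (hη : IsKernel η h) {a : ℝ → ℝ} (ha : Integrable a (lebT T)) (t : ℝ) :
    Integrable (fun τ => η (t - τ) * a τ) (lebT T) := by
  obtain ⟨M, -, hM, -⟩ := hη.exists_bound
  exact ha.bdd_mul (hη.contDiff_shift t).continuous.aestronglyMeasurable
    (Eventually.of_forall fun τ => hM _)

theorem hasDerivAt_mollify (hη : IsKernel η h) {a : ℝ → ℝ} (ha : Integrable a (lebT T)) (t : ℝ) :
    HasDerivAt (fun t => ∫ τ, η (t - τ) * a τ ∂(lebT T))
      (∫ τ, deriv η (t - τ) * a τ ∂(lebT T)) t := by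
  obtain ⟨M, hM0, -, hM⟩ := hη.exists_bound
  have hcd : Continuous (fun τ => deriv η (t - τ)) :=
    hη.continuous_deriv.comp (continuous_const.sub continuous_id)
  refine (hasDerivAt_integral_of_dominated_loc_of_deriv_le (s := univ)
    (F := fun t τ => η (t - τ) * a τ) (F' := fun t τ => deriv η (t - τ) * a τ)
    (bound := fun τ => M * |a τ|) univ_mem
    (Eventually.of_forall fun x => (hη.integrable_shift_mul ha x).aestronglyMeasurable)
    (hη.integrable_shift_mul ha t)
    (hcd.aestronglyMeasurable.mul ha.aestronglyMeasurable) ?_ (ha.abs.const_mul M) ?_).2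
  · refine Eventually.of_forall fun τ x _ => ?_
    rw [norm_mul]
    exact mul_le_mul_of_nonneg_right (hM _) (norm_nonneg _)
  · refine Eventually.of_forall fun τ x _ => ?_
    have h1 : HasDerivAt η (deriv η (x - τ)) (x - τ) :=
      (hη.smooth.differentiable (by simp) _).hasDerivAt
    have h2 : HasDerivAt (fun x => η (x - τ)) (deriv η (x - τ)) x := h1.comp_sub_const x τ
    exact h2.mul_const _

theorem continuous_mollify (hη : IsKernel η h) {a : ℝ → ℝ} (ha : Integrable a (lebT T)) :
    Continuous (fun t => ∫ τ, η (t - τ) * a τ ∂(lebT T)) :=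
  continuous_iff_continuousAt.2 fun t => (hη.hasDerivAt_mollify ha t).continuousAt

/-- After exchanging the integrals, each τ contributes at most a(τ) times the unit mass of the
kernel. The bound does not see the width of the kernel. -/
theorem integral_mollify_le (hη : IsKernel η h) {a : ℝ → ℝ} (ha : Integrable a (lebT T))
    (ha0 : ∀ τ, 0 ≤ a τ) {t₁ t₂ : ℝ} (h12 : t₁ ≤ t₂) :
    ∫ t in t₁..t₂, ∫ τ, η (t - τ) * a τ ∂(lebT T) ≤ ∫ τ, a τ ∂(lebT T) := by
  obtain ⟨M, hM0, hM, -⟩ := hη.exists_bound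
  have hi : Integrable (fun z : ℝ × ℝ => η (z.1 - z.2) * a z.2)
      ((volume.restrict (Ioc t₁ t₂)).prod (lebT T)) := by
    have h1 : Integrable (fun z : ℝ × ℝ => a z.2) ((volume.restrict (Ioc t₁ t₂)).prod (lebT T)) :=
      ha.comp_snd _
    refine h1.bdd_mul (c := M) (f := fun z : ℝ × ℝ => η (z.1 - z.2)) ?_
      (Eventually.of_forall fun z => hM _)
    exact (hη.smooth.continuous.comp (continuous_fst.sub continuous_snd)).aestronglyMeasurable
  rw [intervalIntegral.integral_of_le h12, integral_integral_swap hi]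
  refine integral_mono hi.integral_prod_right ha fun τ => ?_
  simp only
  rw [integral_mul_const]
  have h1 : ∫ t in Ioc t₁ t₂, η (t - τ) ≤ 1 := by
    rw [← hη.integral_eq, ← integral_sub_right_eq_self η τ]
    refine setIntegral_le_integral ?_ (Eventually.of_forall fun t => hη.nonneg _)
    exact (hη.smooth.continuous.integrable_of_hasCompactSupport hη.compact).comp_sub_right τ
  calc _ ≤ 1 * a τ := mul_le_mul_of_nonneg_right h1 (ha0 τ)
    _ = a τ := one_mul _

theorem integral_shift (hη : IsKernel η h) {t : ℝ} (h1 : h < t) (h2 : t < T - h) :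
    ∫ τ, η (t - τ) ∂(lebT T) = 1 := by
  rw [setIntegral_eq_integral_of_forall_compl_eq_zero, integral_sub_left_eq_self η volume t,
    hη.integral_eq]
  intro τ hτ
  exact image_eq_zero_of_notMem_tsupport (f := fun τ => η (t - τ))
    fun hc => hτ (hη.tsupport_shift h1 h2 hc)

end IsKernel

/-- The entropy bound. -/
def entConst (K T m C : ℝ) : ℝ := entF ((2 * m + 4 * K) * (1 + 2 * (C + 1) / T)) + 2 * C

namespace Curve

variable {K T m C : ℝ} {γ : Measure ℝ} {P : ℝ → FiniteMeasure ℝ} {r Q B : ℝ → ℝ → ℝ}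
  {η : ℝ → ℝ} {δ : ℝ}

theorem abs_avg_le (h : Curve K T m C γ P r Q B) {a : ℝ → ℝ} {M : ℝ} (hM : ∀ t, |a t| ≤ M)
    {s : ℝ} (hs : s ∈ Icc (-K) K) :
    |avg T a (fun t s => r t s ^ 2) s| ≤ M * ((2 * m + 4 * K) * (T + C)) := by
  have hM0 : 0 ≤ M := (abs_nonneg _).trans (hM 0)
  have hi : Integrable (fun t => M * ((2 * m + 4 * K) * (1 + energy K Q t))) (lebT T) :=
    (((integrable_const 1).add h.energy_integrable).const_mul (2 * m + 4 * K)).const_mul M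
  calc |avg T a (fun t s => r t s ^ 2) s|
      ≤ ∫ t, |a t * r t s ^ 2| ∂(lebT T) := abs_integral_le_integral_abs
    _ ≤ ∫ t, M * ((2 * m + 4 * K) * (1 + energy K Q t)) ∂(lebT T) := by
        refine integral_mono_of_nonneg (Eventually.of_forall fun s => abs_nonneg _) hi
          (Eventually.of_forall fun t => ?_)
        simp only
        rw [abs_mul, abs_of_nonneg (sq_nonneg (r t s))]
        exact mul_le_mul (hM t) (h.sq_le t hs) (sq_nonneg _) hM0
    _ = M * ((2 * m + 4 * K) * ∫ t, (1 + energy K Q t) ∂(lebT T)) := by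
        rw [integral_const_mul, integral_const_mul]
    _ ≤ _ := by
        have := h.integral_one_add_energy_le
        have := h.const_nonneg
        gcongr

/-- The entropy of the curve mollified in time. -/
def ent (T : ℝ) (γ : Measure ℝ) (r : ℝ → ℝ → ℝ) (η : ℝ → ℝ) (t : ℝ) : ℝ :=
  ∫ s, entF (avg T (fun τ => η (t - τ)) (fun t s => r t s ^ 2) s) ∂γ

theorem avg_shift_measurable (h : Curve K T m C γ P r Q B) {a : ℝ → ℝ} (ha : Continuous a)
    (t : ℝ) : Measurable (avg T (fun τ => a (t - τ)) (fun t s => r t s ^ 2)) :=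
  avg_measurable T (ha.comp (continuous_const.sub continuous_id)).measurable
    (h.r_meas.pow_const 2)

theorem integrable_entF (h : Curve K T m C γ P r Q B) (hη : IsKernel η δ) (t : ℝ) :
    Integrable (fun s => entF (avg T (fun τ => η (t - τ)) (fun t s => r t s ^ 2) s)) γ := by
  have := h.prob
  obtain ⟨M, hM0, hM, -⟩ := hη.exists_bound
  set R := M * ((2 * m + 4 * K) * (T + C))
  obtain ⟨M', hM'⟩ := (isCompact_Icc (a := -R) (b := R)).exists_bound_of_continuousOn
    entF_continuous.continuousOn
  refine (integrable_const M').mono'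
    (entF_continuous.measurable.comp
      (h.avg_shift_measurable hη.smooth.continuous t)).aestronglyMeasurable ?_
  filter_upwards [h.γ_supp] with s hs
  exact hM' _ (abs_le.1 (h.abs_avg_le (fun τ => hM _) hs))

theorem hasDerivAt_ent (h : Curve K T m C γ P r Q B) (hη : IsKernel η δ) (t : ℝ) :
    HasDerivAt (ent T γ r η)
      (∫ s, logF (avg T (fun τ => η (t - τ)) (fun t s => r t s ^ 2) s)
        * avg T (fun τ => deriv η (t - τ)) (fun t s => r t s ^ 2) s ∂γ) t := by
  have := h.prob
  obtain ⟨M, hM0, hM, hMd⟩ := hη.exists_bound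
  set R := M * ((2 * m + 4 * K) * (T + C)) with hR
  have hm1 := fun t => h.avg_shift_measurable hη.smooth.continuous t
  have hm2 := fun t => h.avg_shift_measurable hη.continuous_deriv t
  refine (hasDerivAt_integral_of_dominated_loc_of_deriv_le (s := univ)
    (F := fun t s => entF (avg T (fun τ => η (t - τ)) (fun t s => r t s ^ 2) s))
    (F' := fun t s => logF (avg T (fun τ => η (t - τ)) (fun t s => r t s ^ 2) s)
        * avg T (fun τ => deriv η (t - τ)) (fun t s => r t s ^ 2) s)
    (bound := fun _ => R ^ 2 * R) univ_mem
    (Eventually.of_forall fun x => (h.integrable_entF hη x).aestronglyMeasurable)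
    (h.integrable_entF hη t)
    ((contDiff_logF.continuous.measurable.comp (hm1 t)).mul (hm2 t)).aestronglyMeasurable
    ?_ (integrable_const _) ?_).2
  · filter_upwards [h.γ_supp] with s hs x _
    have h1 := h.abs_avg_le (a := fun τ => η (x - τ)) (fun τ => hM _) hs
    have h2 := h.abs_avg_le (a := fun τ => deriv η (x - τ)) (fun τ => hMd _) hs
    rw [norm_mul, Real.norm_of_nonneg (logF_nonneg _)]
    refine mul_le_mul ((logF_le _).trans ?_) h2 (norm_nonneg _) (sq_nonneg _)
    exact sq_le_sq' (abs_le.1 h1).1 (abs_le.1 h1).2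
  · filter_upwards [h.γ_supp] with s hs x _
    exact (hasDerivAt_entF _).comp x (hη.hasDerivAt_mollify (h.r_sq_slice_integrable hs) x)

/-- The entropy production estimate with ζ = η(t - ·), whose derivative in τ is minus the one in t.
The support of ζ must lie in (0, T), hence the distance δ from the endpoints. -/
theorem abs_deriv_ent_le (h : Curve K T m C γ P r Q B) (hη : IsKernel η δ) {t : ℝ}
    (h1 : δ < t) (h2 : t < T - δ) :
    |deriv (ent T γ r η) t| ≤ ∫ τ, η (t - τ) * (energy K Q τ + energy K B τ) ∂(lebT T) := by
  have h3 := h.abs_entropy_production_le (hη.contDiff_shift t) (hη.compact_shift t)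
    (hη.tsupport_shift h1 h2) (fun τ => hη.nonneg _)
  rw [(h.hasDerivAt_ent hη t).deriv]
  refine le_of_eq_of_le ?_ h3
  have hd : deriv (fun τ => η (t - τ)) = fun τ => -deriv η (t - τ) :=
    funext fun τ => deriv_comp_const_sub ..
  rw [hd, ← abs_neg, ← integral_neg]
  congr 2
  ext s
  have : avg T (fun τ => -deriv η (t - τ)) (fun t s => r t s ^ 2) s
      = -avg T (fun τ => deriv η (t - τ)) (fun t s => r t s ^ 2) s := by
    simp only [avg, neg_mul, integral_neg]
  rw [this]; ring

/-- The entropy changes at most at the rate of the mollified dissipation, whose total integral is at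
most 2C for every kernel. The dissipation bounds the production from both sides, so t may lie before
or after t₀. -/
theorem ent_sub_le (h : Curve K T m C γ P r Q B) (hη : IsKernel η δ) {t t₀ : ℝ}
    (h1 : t ∈ Ioo δ (T - δ)) (h2 : t₀ ∈ Ioo δ (T - δ)) :
    ent T γ r η t - ent T γ r η t₀ ≤ 2 * C := by
  set a : ℝ → ℝ := fun τ => energy K Q τ + energy K B τ with ha
  have hai : Integrable a (lebT T) := h.energy_integrable.add h.energyB_integrable
  have ha0 : ∀ τ, 0 ≤ a τ := fun τ => add_nonneg (energy_nonneg _ _ _) (energy_nonneg _ _ _)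
  have haC : ∫ τ, a τ ∂(lebT T) ≤ 2 * C := by
    rw [ha, integral_add h.energy_integrable h.energyB_integrable]
    linarith [h.integral_energy_le, h.integral_energyB_le]
  set D : ℝ → ℝ := fun t => ∫ τ, η (t - τ) * a τ ∂(lebT T) with hD
  have hDc : Continuous D := hη.continuous_mollify hai
  have hDd : ∀ x, HasDerivAt (fun x => ∫ y in t₀..x, D y) (D x) x := fun x =>
    intervalIntegral.integral_hasDerivAt_right (hDc.intervalIntegrable _ _)
      (hDc.stronglyMeasurableAtFilter _ _) hDc.continuousAt
  have hE : ∀ x, HasDerivAt (ent T γ r η) (deriv (ent T γ r η) x) x := fun x =>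
    (h.hasDerivAt_ent hη x).differentiableAt.hasDerivAt
  have hbd : ∀ x ∈ Ioo δ (T - δ), |deriv (ent T γ r η) x| ≤ D x := fun x hx =>
    h.abs_deriv_ent_le hη hx.1 hx.2
  rcases le_total t₀ t with hle | hle
  · have hmono : MonotoneOn (fun x => (∫ y in t₀..x, D y) - ent T γ r η x) (Ioo δ (T - δ)) := by
      refine monotoneOn_of_deriv_nonneg (convex_Ioo _ _)
        (fun x _ => ((hDd x).sub (hE x)).continuousAt.continuousWithinAt)
        (fun x _ => ((hDd x).sub (hE x)).differentiableAt.differentiableWithinAt) fun x hx => ?_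
      rw [interior_Ioo] at hx
      have := ((hDd x).sub (hE x)).deriv
      rw [show (fun x => (∫ y in t₀..x, D y) - ent T γ r η x) =
        ((fun x => ∫ y in t₀..x, D y) - ent T γ r η) from rfl, this]
      linarith [(abs_le.1 (hbd x hx)).2]
    have h3 := hmono h2 h1 hle
    simp only [intervalIntegral.integral_same] at h3
    have h4 := hη.integral_mollify_le hai ha0 hle
    linarith
  · have hmono : MonotoneOn (fun x => (∫ y in t₀..x, D y) + ent T γ r η x) (Ioo δ (T - δ)) := by
      refine monotoneOn_of_deriv_nonneg (convex_Ioo _ _)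
        (fun x _ => ((hDd x).add (hE x)).continuousAt.continuousWithinAt)
        (fun x _ => ((hDd x).add (hE x)).differentiableAt.differentiableWithinAt) fun x hx => ?_
      rw [interior_Ioo] at hx
      have := ((hDd x).add (hE x)).deriv
      rw [show (fun x => (∫ y in t₀..x, D y) + ent T γ r η x) =
        ((fun x => ∫ y in t₀..x, D y) + ent T γ r η) from rfl, this]
      linarith [(abs_le.1 (hbd x hx)).1]
    have h3 := hmono h1 h2 hle
    simp only [intervalIntegral.integral_same] at h3
    have h4 := hη.integral_mollify_le hai ha0 hle
    rw [intervalIntegral.integral_symm] at h4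
    linarith

/-- The interval (δ, T - δ) has length at least T/2 and the mollified energy has integral at most C
< C + 1, so somewhere it is at most 2(C + 1)/T. At that time the pointwise bound for r² makes the
mollified density, and hence its entropy, bounded. -/
theorem exists_ent_le (h : Curve K T m C γ P r Q B) (hη : IsKernel η δ) (hδ : 0 < δ)
    (hδT : 4 * δ ≤ T) : ∃ t₀ ∈ Ioo δ (T - δ),
      ent T γ r η t₀ ≤ entF ((2 * m + 4 * K) * (1 + 2 * (C + 1) / T)) := by
  have := h.prob
  have hT := h.T_pos
  have hA0 : ∀ τ, 0 ≤ energy K Q τ := energy_nonneg _ _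
  obtain ⟨t₀, ht₀, hle⟩ : ∃ t₀ ∈ Ioo δ (T - δ),
      ∫ τ, η (t₀ - τ) * energy K Q τ ∂(lebT T) ≤ 2 * (C + 1) / T := by
    by_contra! hcon
    have h1 := hη.integral_mollify_le h.energy_integrable hA0 (t₁ := δ) (t₂ := T - δ) (by linarith)
    have h2 := h.integral_energy_le
    have h3 : ∫ t in δ..(T - δ), 2 * (C + 1) / T ≤
        ∫ t in δ..(T - δ), ∫ τ, η (t - τ) * energy K Q τ ∂(lebT T) := by
      refine intervalIntegral.integral_mono_on_of_le_Ioo (by linarith) (by simp)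
        ((hη.continuous_mollify h.energy_integrable).intervalIntegrable _ _) fun t ht => ?_
      exact (hcon t ht).le
    rw [intervalIntegral.integral_const, smul_eq_mul] at h3
    have h4 : C + 1 ≤ (T - δ - δ) * (2 * (C + 1) / T) := by
      rw [mul_div_assoc', le_div_iff₀ hT]
      have := h.C_nonneg
      nlinarith
    linarith
  refine ⟨t₀, ht₀, ?_⟩
  have hpt : ∀ᵐ s ∂γ, entF (avg T (fun τ => η (t₀ - τ)) (fun t s => r t s ^ 2) s) ≤
      entF ((2 * m + 4 * K) * (1 + 2 * (C + 1) / T)) := by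
    filter_upwards [h.γ_supp] with s hs
    refine entF_monotone ?_
    have hc := h.const_nonneg
    have i1 : Integrable (fun τ => η (t₀ - τ) * ((2 * m + 4 * K) * (1 + energy K Q τ))) (lebT T) :=
      hη.integrable_shift_mul (((integrable_const 1).add h.energy_integrable).const_mul _) t₀
    calc avg T (fun τ => η (t₀ - τ)) (fun t s => r t s ^ 2) s
        ≤ ∫ τ, η (t₀ - τ) * ((2 * m + 4 * K) * (1 + energy K Q τ)) ∂(lebT T) := by
          refine integral_mono (hη.integrable_shift_mul (h.r_sq_slice_integrable hs) t₀) i1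
            fun τ => ?_
          exact mul_le_mul_of_nonneg_left (h.sq_le τ hs) (hη.nonneg _)
      _ = (2 * m + 4 * K) * ((∫ τ, η (t₀ - τ) * 1 ∂(lebT T))
            + ∫ τ, η (t₀ - τ) * energy K Q τ ∂(lebT T)) := by
          rw [← integral_add (hη.integrable_shift_mul (integrable_const 1) t₀)
            (hη.integrable_shift_mul h.energy_integrable t₀), ← integral_const_mul]
          congr 1; ext τ; ring
      _ ≤ _ := by
          simp only [mul_one]
          rw [hη.integral_shift ht₀.1 ht₀.2]
          gcongr
  calc ent T γ r η t₀ ≤ ∫ s, entF ((2 * m + 4 * K) * (1 + 2 * (C + 1) / T)) ∂γ :=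
        integral_mono_ae (h.integrable_entF hη t₀) (integrable_const _) hpt
    _ = _ := by simp

theorem ent_le (h : Curve K T m C γ P r Q B) (hη : IsKernel η δ) (hδ : 0 < δ)
    (hδT : 4 * δ ≤ T) {t : ℝ} (ht : t ∈ Ioo δ (T - δ)) : ent T γ r η t ≤ entConst K T m C := by
  obtain ⟨t₀, ht₀, hle⟩ := h.exists_ent_le hη hδ hδT
  have := h.ent_sub_le hη ht ht₀
  unfold entConst
  linarith

theorem integral_mul_avg_le (h : Curve K T m C γ P r Q B) (hη : IsKernel η δ) (hδ : 0 < δ)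
    (hδT : 4 * δ ≤ T) {t : ℝ} (ht : t ∈ Ioo δ (T - δ)) {φ : ℝ → ℝ} (hφ : Continuous φ)
    (hφ01 : ∀ s ∈ Icc (-K) K, φ s ∈ Icc (0 : ℝ) 1) {M : ℝ} (hM : 0 < M) :
    ∫ s, φ s * avg T (fun τ => η (t - τ)) (fun t s => r t s ^ 2) s ∂γ ≤
      M * ∫ s, φ s ∂γ + entConst K T m C / logF M := by
  have := h.prob
  have hF := logF_pos hM
  have hφi : Integrable φ γ := h.integrable_of_continuousOn hφ.continuousOn
  have hbi : Integrable (avg T (fun τ => η (t - τ)) (fun t s => r t s ^ 2)) γ :=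
    h.avg_integrable (hη.contDiff_shift t).continuous (hη.compact_shift t)
  have hei := h.integrable_entF hη t
  have hle : ∫ s, φ s * avg T (fun τ => η (t - τ)) (fun t s => r t s ^ 2) s ∂γ ≤
      ∫ s, (M * φ s + entF (avg T (fun τ => η (t - τ)) (fun t s => r t s ^ 2) s) / logF M) ∂γ := by
    refine integral_mono_of_nonneg ?_ ((hφi.const_mul M).add (hei.div_const _)) ?_
    · filter_upwards [h.γ_supp] with s hs
      exact mul_nonneg (hφ01 s hs).1
        (integral_nonneg fun τ => mul_nonneg (hη.nonneg _) (sq_nonneg _))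
    · filter_upwards [h.γ_supp] with s hs
      have hb0 : 0 ≤ avg T (fun τ => η (t - τ)) (fun t s => r t s ^ 2) s :=
        integral_nonneg fun τ => mul_nonneg (hη.nonneg _) (sq_nonneg _)
      have h1 := le_add_entF_div hM hb0
      have h2 : 0 ≤ entF (avg T (fun τ => η (t - τ)) (fun t s => r t s ^ 2) s) / logF M :=
        div_nonneg (entF_nonneg hb0) hF.le
      obtain ⟨p0, p1⟩ := hφ01 s hs
      nlinarith
  refine hle.trans ?_
  rw [integral_add (hφi.const_mul M) (hei.div_const _), integral_const_mul, integral_div]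
  have := h.ent_le hη hδ hδT ht
  gcongr
  exact this

/-- At every time, the curve charges sets of small `γ`-measure only a little. -/
theorem integral_P_le (h : Curve K T m C γ P r Q B) {φ : ℝ → ℝ} (hφ : Continuous φ)
    (hφ01 : ∀ s ∈ Icc (-K) K, φ s ∈ Icc (0 : ℝ) 1) {M : ℝ} (hM : 0 < M) {t : ℝ}
    (ht : t ∈ Icc 0 T) :
    ∫ s, φ s ∂(P t : Measure ℝ) ≤ M * ∫ s, φ s ∂γ + entConst K T m C / logF M := by
  have hT := h.T_pos
  set N : ℝ → ℝ := fun t => ∫ s, φ s ∂(P t : Measure ℝ) with hN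
  have hNc : ContinuousOn N (Icc 0 T) := h.P_cont φ hφ
  have key : ∀ t ∈ Ioo 0 T, N t ≤ M * ∫ s, φ s ∂γ + entConst K T m C / logF M := by
    intro t ht
    refine le_of_forall_pos_le_add fun e he => ?_
    have hca : ContinuousAt N t := hNc.continuousAt (Icc_mem_nhds ht.1 ht.2)
    obtain ⟨d, hd, hdN⟩ := Metric.continuousAt_iff.1 hca e he
    -- The kernel width is below d, so that N varies by less than e on the window; below t and T -
    -- t, so that the window stays inside (0, T); and at most T/4, as the entropy bound requires.
    set δ := min (d / 2) (min (t / 2) (min ((T - t) / 2) (T / 4))) with hδdef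
    have hδ : 0 < δ := by
      have := ht.1
      have := ht.2
      simp only [hδdef, lt_min_iff]
      refine ⟨by linarith, by linarith, by linarith, by linarith⟩
    have hδ1 : δ ≤ d / 2 := min_le_left _ _
    have hδ2 : δ ≤ t / 2 := (min_le_right _ _).trans (min_le_left _ _)
    have hδ3 : δ ≤ (T - t) / 2 :=
      (min_le_right _ _).trans ((min_le_right _ _).trans (min_le_left _ _))
    have hδ4 : δ ≤ T / 4 :=
      (min_le_right _ _).trans ((min_le_right _ _).trans (min_le_right _ _))
    obtain ⟨η, hη⟩ := exists_isKernel hδ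
    have htm : t ∈ Ioo δ (T - δ) := ⟨by linarith [ht.1], by linarith [ht.2]⟩
    have h1 := h.integral_mul_avg_le hη hδ (by linarith) htm hφ hφ01 hM
    rw [← h.integral_mul_integral_P (hη.contDiff_shift t).continuous (hη.compact_shift t) hφ] at h1
    have hNi : Integrable N (lebT T) :=
      (hNc.integrableOn_compact isCompact_Icc).mono_set Ioo_subset_Icc_self
    have h2 : N t - e ≤ ∫ τ, η (t - τ) * N τ ∂(lebT T) := by
      have e1 : N t - e = ∫ τ, η (t - τ) * (N t - e) ∂(lebT T) := by
        rw [integral_mul_const, hη.integral_shift htm.1 htm.2, one_mul]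
      rw [e1]
      refine integral_mono (hη.integrable_shift_mul (integrable_const _) t)
        (hη.integrable_shift_mul hNi t) fun τ => ?_
      by_cases hτ : δ < |t - τ|
      · simp [hη.zero _ hτ]
      · refine mul_le_mul_of_nonneg_left ?_ (hη.nonneg _)
        have := hdN (x := τ) (by rw [Real.dist_eq, abs_sub_comm]; linarith)
        rw [Real.dist_eq, abs_lt] at this
        linarith [this.1]
    linarith
  -- The endpoints are reached by continuity of N.
  have hcl : closure (Ioo 0 T) = Icc 0 T := closure_Ioo hT.ne
  have := hNc
  rw [← hcl] at this ht
  exact le_on_closure (fun x hx => key x hx) this continuousOn_const ht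

end Curve

namespace Curve

variable {K T m C : ℝ} {γ : Measure ℝ} {P : ℝ → FiniteMeasure ℝ} {r Q B : ℝ → ℝ → ℝ}

/-! ### Logarithmic cut-off functions -/

/-- The normalization constant of the logarithmic cut-off. -/
def logL (K η : ℝ) : ℝ := Real.log ((2 * K + η) / η)

/-- The derivative of a logarithmic cut-off function near `K`. -/
def cutoff (K η s : ℝ) : ℝ := 1 / (logL K η * (max (K - s) 0 + η))

theorem logL_pos {K η : ℝ} (hK : 0 < K) (hη : 0 < η) : 0 < logL K η := by
  refine Real.log_pos ?_
  rw [lt_div_iff₀ hη]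
  linarith

theorem cutoff_continuous {K η : ℝ} (hK : 0 < K) (hη : 0 < η) : Continuous (cutoff K η) := by
  have hL := logL_pos hK hη
  unfold cutoff
  refine continuous_const.div (by fun_prop) fun s => ?_
  have : 0 ≤ max (K - s) 0 := le_max_right _ _
  positivity

theorem cutoff_eq {K η s : ℝ} (hs : s ≤ K) : cutoff K η s = (logL K η)⁻¹ * (K - s + η)⁻¹ := by
  rw [cutoff, max_eq_left (by linarith), one_div, mul_inv]

theorem integral_cutoff_aux {K η : ℝ} (hK : 0 < K) (hη : 0 < η) :
    ∫ s in (-K)..K, (K - s + η)⁻¹ = logL K η := by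
  have hd : ∀ s ∈ uIcc (-K) K, HasDerivAt (fun s => -Real.log (K - s + η)) ((K - s + η)⁻¹) s := by
    intro s hs
    rw [uIcc_of_le (by linarith)] at hs
    have h1 : HasDerivAt (fun s : ℝ => K - s + η) (-1) s :=
      ((hasDerivAt_id s).const_sub K).add_const η
    have h2 := (h1.log (by linarith [hs.2])).neg
    have e : (K - s + η)⁻¹ = -(-1 / (K - s + η)) := by rw [neg_div, neg_neg, one_div]
    rw [e]
    exact h2
  have hc : ContinuousOn (fun s => (K - s + η)⁻¹) (uIcc (-K) K) := by
    refine ContinuousOn.inv₀ (by fun_prop) fun s hs => ?_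
    rw [uIcc_of_le (by linarith)] at hs
    linarith [hs.2]
  rw [intervalIntegral.integral_eq_sub_of_hasDerivAt hd hc.intervalIntegrable, logL,
    Real.log_div (by linarith) (by linarith)]
  ring_nf

theorem integral_cutoff_sq_aux {K η : ℝ} (hK : 0 < K) (hη : 0 < η) :
    ∫ s in (-K)..K, (K - s + η)⁻¹ ^ 2 ≤ η⁻¹ := by
  have hd : ∀ s ∈ uIcc (-K) K, HasDerivAt (fun s => (K - s + η)⁻¹) ((K - s + η)⁻¹ ^ 2) s := by
    intro s hs
    rw [uIcc_of_le (by linarith)] at hs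
    have h1 : HasDerivAt (fun s : ℝ => K - s + η) (-1) s :=
      ((hasDerivAt_id s).const_sub K).add_const η
    have h2 := h1.inv (by linarith [hs.2])
    have e : (K - s + η)⁻¹ ^ 2 = - -1 / (K - s + η) ^ 2 := by rw [neg_neg, one_div, inv_pow]
    rw [e]
    exact h2
  have hc : ContinuousOn (fun s => (K - s + η)⁻¹ ^ 2) (uIcc (-K) K) := by
    refine ContinuousOn.pow (ContinuousOn.inv₀ (by fun_prop) fun s hs => ?_) 2
    rw [uIcc_of_le (by linarith)] at hs
    linarith [hs.2]
  rw [intervalIntegral.integral_eq_sub_of_hasDerivAt hd hc.intervalIntegrable]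
  have : 0 ≤ (K - -K + η)⁻¹ := inv_nonneg.2 (by linarith)
  simp only [sub_self, zero_add]
  linarith

theorem integral_cutoff {K η : ℝ} (hK : 0 < K) (hη : 0 < η) :
    ∫ s in (-K)..K, cutoff K η s = 1 := by
  have hL := logL_pos hK hη
  have : ∫ s in (-K)..K, cutoff K η s = ∫ s in (-K)..K, (logL K η)⁻¹ * (K - s + η)⁻¹ := by
    refine intervalIntegral.integral_congr fun s hs => ?_
    rw [uIcc_of_le (by linarith)] at hs
    exact cutoff_eq hs.2
  rw [this, intervalIntegral.integral_const_mul, integral_cutoff_aux hK hη,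
    inv_mul_cancel₀ hL.ne']

/-- For fixed η this is a finite constant. It blows up as η → 0, but it will only multiply terms
that are small for another reason: the total length of the time intervals and `bdErr`. -/
theorem integral_cutoff_sq_le {K η : ℝ} (hK : 0 < K) (hη : 0 < η) :
    ∫ s, cutoff K η s ^ 2 ∂(leb K) ≤ 1 / (logL K η ^ 2 * η) := by
  have hL := logL_pos hK hη
  rw [integral_Icc_eq_integral_Ioc, ← intervalIntegral.integral_of_le (by linarith)]
  have : ∫ s in (-K)..K, cutoff K η s ^ 2 =
      ∫ s in (-K)..K, (logL K η)⁻¹ ^ 2 * (K - s + η)⁻¹ ^ 2 := by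
    refine intervalIntegral.integral_congr fun s hs => ?_
    rw [uIcc_of_le (by linarith)] at hs
    simp only [cutoff_eq hs.2]
    ring
  rw [this, intervalIntegral.integral_const_mul]
  calc _ ≤ (logL K η)⁻¹ ^ 2 * η⁻¹ := by
        gcongr
        exact integral_cutoff_sq_aux hK hη
    _ = _ := by field_simp

/-- The reason for the logarithmic profile. Since (K - s)/(K - s + η) ≤ 1, the integrand is at most
the cut-off, which has unit integral, divided by the normalization. The result tends to 0 with η. -/
theorem integral_cutoff_sq_mul_le {K η : ℝ} (hK : 0 < K) (hη : 0 < η) :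
    ∫ s, cutoff K η s ^ 2 * (K - s) ∂(leb K) ≤ 1 / logL K η := by
  have hL := logL_pos hK hη
  rw [integral_Icc_eq_integral_Ioc, ← intervalIntegral.integral_of_le (by linarith)]
  have hcc := cutoff_continuous hK hη
  have : ∫ s in (-K)..K, cutoff K η s ^ 2 * (K - s) ≤
      ∫ s in (-K)..K, (logL K η)⁻¹ * cutoff K η s := by
    refine intervalIntegral.integral_mono_on (by linarith)
      (Continuous.intervalIntegrable (by fun_prop) _ _)
      (Continuous.intervalIntegrable (by fun_prop) _ _) fun s hs => ?_
    have hp : 0 < K - s + η := by linarith [hs.2]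
    simp only [cutoff_eq hs.2]
    have e : ((logL K η)⁻¹ * (K - s + η)⁻¹) ^ 2 * (K - s) =
        (logL K η)⁻¹ * ((logL K η)⁻¹ * (K - s + η)⁻¹) * ((K - s) / (K - s + η)) := by
      field_simp
    rw [e]
    refine mul_le_of_le_one_right (by positivity) ?_
    rw [div_le_one hp]; linarith
  refine this.trans ?_
  rw [intervalIntegral.integral_const_mul, integral_cutoff hK hη]
  simp

theorem r_sq_slice_integrable_leb (h : Curve K T m C γ P r Q B) (t : ℝ) :
    Integrable (fun s => r t s ^ 2) (leb K) :=
  ((h.r_continuousOn t).pow 2).integrableOn_compact isCompact_Icc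

/-- At the endpoint the general bound for r² improves: the mass m appears without the energy, and
the energy carries the vanishing factor `bdErr`. -/
theorem trace_sq_le (h : Curve K T m C γ P r Q B) (hsym : ∫ s, s ∂γ = 0) (t : ℝ) :
    r t K ^ 2 ≤ 2 * m + 4 * √(2 * m + 4 * K) * bdErr K γ * (1 + energy K Q t) := by
  have := h.prob
  have h1 := (abs_le.1 (h.trace_le hsym t).1).2
  have hr := h.r_continuousOn t
  have h2 : ∫ s, weight K s * r t s ^ 2 ∂γ ≤ ∫ s, r t s ^ 2 ∂γ := by
    refine integral_mono_ae
      (h.integrable_of_continuousOn ((weight_continuous K).continuousOn.mul (hr.pow 2)))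
      (h.integrable_of_continuousOn (hr.pow 2)) ?_
    filter_upwards [h.γ_supp] with s hs
    have := h.weight_mem hs
    nlinarith [sq_nonneg (r t s), this.1, this.2]
  have h3 := h.mass_le t
  linarith

/-- Young's inequality with parameter θ, then r(s)² ≤ 2 r(K)² + 2 E (K - s). The energy of Q is
multiplied only by `bdErr` or by the inverse logarithm, and what remains besides the θ-term is
constant in time. -/
theorem abs_flux_cutoff_le (h : Curve K T m C γ P r Q B) (hsym : ∫ s, s ∂γ = 0) {θ η : ℝ}
    (hθ : 0 < θ) (hη : 0 < η) : ∀ᵐ t ∂(lebT T),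
      |∫ s, cutoff K η s * (r t s * B t s) ∂(leb K)| ≤ θ / 2 * energy K B t
        + 1 / (2 * θ) * (2 * (2 * m + 4 * √(2 * m + 4 * K) * bdErr K γ * (1 + energy K Q t))
            * (1 / (logL K η ^ 2 * η)) + 2 * energy K Q t * (1 / logL K η)) := by
  have hK := h.K_pos
  have hL := logL_pos hK hη
  have hcc := cutoff_continuous hK hη
  filter_upwards [h.B_int.prod_right_ae] with t hB
  have hr := h.r_continuousOn t
  have hA := energy_nonneg K Q t
  have i1 : Integrable (fun s => cutoff K η s ^ 2 * r t s ^ 2) (leb K) :=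
    ((hcc.pow 2).continuousOn.mul (hr.pow 2)).integrableOn_compact isCompact_Icc
  have i2 : Integrable (fun s => cutoff K η s ^ 2) (leb K) :=
    (hcc.pow 2).continuousOn.integrableOn_compact isCompact_Icc
  have i3 : Integrable (fun s => cutoff K η s ^ 2 * (K - s)) (leb K) :=
    ((hcc.pow 2).mul (by fun_prop : Continuous fun s => K - s)).continuousOn.integrableOn_compact
      isCompact_Icc
  have step1 : |∫ s, cutoff K η s * (r t s * B t s) ∂(leb K)| ≤
      θ / 2 * energy K B t + 1 / (2 * θ) * ∫ s, cutoff K η s ^ 2 * r t s ^ 2 ∂(leb K) := by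
    rw [energy, ← integral_const_mul, ← integral_const_mul,
      ← integral_add (hB.const_mul _) (i1.const_mul _)]
    refine abs_integral_le_integral_abs.trans (integral_mono_of_nonneg
      (Eventually.of_forall fun s => abs_nonneg _)
      ((hB.const_mul _).add (i1.const_mul _)) (Eventually.of_forall fun s => ?_))
    simp only
    set x := cutoff K η s * r t s with hx
    have e1 : cutoff K η s * (r t s * B t s) = x * B t s := by rw [hx]; ring
    have e2 : cutoff K η s ^ 2 * r t s ^ 2 = x ^ 2 := by rw [hx]; ring
    rw [e1, e2]
    have key : ∀ y : ℝ, x * y ≤ θ / 2 * y ^ 2 + 1 / (2 * θ) * x ^ 2 := by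
      intro y
      have : θ / 2 * y ^ 2 + 1 / (2 * θ) * x ^ 2 - x * y = (θ * y - x) ^ 2 / (2 * θ) := by
        field_simp; ring
      have h0 : 0 ≤ (θ * y - x) ^ 2 / (2 * θ) := by positivity
      linarith
    rw [abs_le]
    constructor
    · have := key (-B t s)
      have e : (-B t s) ^ 2 = B t s ^ 2 := by ring
      rw [e] at this
      linarith
    · exact key _
  have step2 : ∫ s, cutoff K η s ^ 2 * r t s ^ 2 ∂(leb K) ≤
      2 * r t K ^ 2 * (1 / (logL K η ^ 2 * η)) + 2 * energy K Q t * (1 / logL K η) := by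
    have hle : ∫ s, cutoff K η s ^ 2 * r t s ^ 2 ∂(leb K) ≤
        ∫ s, (2 * r t K ^ 2 * cutoff K η s ^ 2
          + 2 * energy K Q t * (cutoff K η s ^ 2 * (K - s))) ∂(leb K) := by
      refine integral_mono_ae i1 ((i2.const_mul _).add (i3.const_mul _)) ?_
      filter_upwards [ae_restrict_mem measurableSet_Icc] with s hs
      have h1 := h.sq_sub_le t hs (⟨h.neg_le, le_rfl⟩ : K ∈ Icc (-K) K)
      rw [abs_of_nonpos (by linarith [hs.2])] at h1
      have h2 : r t s ^ 2 ≤ 2 * r t K ^ 2 + 2 * energy K Q t * (K - s) := by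
        nlinarith [sq_nonneg (r t s - 2 * r t K)]
      have h3 := mul_le_mul_of_nonneg_left h2 (sq_nonneg (cutoff K η s))
      linarith
    refine hle.trans ?_
    rw [integral_add (i2.const_mul _) (i3.const_mul _), integral_const_mul, integral_const_mul]
    have := integral_cutoff_sq_le hK hη
    have := integral_cutoff_sq_mul_le hK hη
    gcongr
  refine step1.trans ?_
  gcongr
  refine step2.trans ?_
  have := h.trace_sq_le hsym t
  gcongr

/-- The variation of the mass near `K` along a family of disjoint time intervals. -/
theorem sum_cutoff_le (h : Curve K T m C γ P r Q B) (hsym : ∫ s, s ∂γ = 0) {θ η : ℝ}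
    (hθ : 0 < θ) (hη : 0 < η) {E : ℕ × (ℕ → ℝ × ℝ)}
    (hE : E ∈ AbsolutelyContinuousOnInterval.disjWithin 0 T) :
    ∑ i ∈ Finset.range E.1, |(∫ s, (∫ x in (-K)..s, cutoff K η x) ∂(P (E.2 i).1 : Measure ℝ))
        - ∫ s, (∫ x in (-K)..s, cutoff K η x) ∂(P (E.2 i).2 : Measure ℝ)| ≤
      θ / 2 * C + 1 / (2 * θ) * (2 * (2 * m * ∑ i ∈ Finset.range E.1, dist (E.2 i).1 (E.2 i).2
        + 4 * √(2 * m + 4 * K) * bdErr K γ * (T + C)) * (1 / (logL K η ^ 2 * η))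
          + 2 * C * (1 / logL K η)) := by
  have hK := h.K_pos
  have hL := logL_pos hK hη
  have hcc := cutoff_continuous hK hη
  have hT := h.T_pos
  set M : ℝ → ℝ := fun t => ∫ s, cutoff K η s * (r t s * B t s) ∂(leb K) with hMdef
  have hae := h.abs_flux_cutoff_le hsym hθ hη
  set c₁ := 4 * √(2 * m + 4 * K) * bdErr K γ with hc₁
  have hc₁0 : 0 ≤ c₁ := by
    have : 0 ≤ bdErr K γ := Real.sqrt_nonneg _
    positivity
  set G : ℝ → ℝ := fun t => θ / 2 * energy K B t
        + 1 / (2 * θ) * (2 * (2 * m + c₁ * (1 + energy K Q t))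
            * (1 / (logL K η ^ 2 * η)) + 2 * energy K Q t * (1 / logL K η)) with hG
  -- On the union of the intervals the energies are only known to be at most C, however short U is.
  -- Their coefficients are the small ones, whereas the part constant in time integrates to a
  -- multiple of the length of U.
  set U : Set ℝ := ⋃ i ∈ Finset.range E.1, uIoc (E.2 i).1 (E.2 i).2 with hU
  have hUsub : U ⊆ Ioc 0 T := by
    have := AbsolutelyContinuousOnInterval.biUnion_uIoc_subset_of_mem_disjWithin (n := E.1)
      (I := E.2) hE
    rwa [uIoc_of_le hT.le] at this
  have hUm : MeasurableSet U := Finset.measurableSet_biUnion _ fun i _ => measurableSet_uIoc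
  have hrest : lebT T = volume.restrict (Ioc 0 T) := by
    rw [lebT, restrict_Ioo_eq_restrict_Ioc]
  have hQi : IntegrableOn (energy K Q) (Ioc 0 T) := by
    have := h.energy_integrable; rwa [hrest] at this
  have hBi : IntegrableOn (energy K B) (Ioc 0 T) := by
    have := h.energyB_integrable; rwa [hrest] at this
  have hQC : ∫ t in Ioc 0 T, energy K Q t ≤ C := by
    have := h.integral_energy_le; rwa [hrest] at this
  have hBC : ∫ t in Ioc 0 T, energy K B t ≤ C := by
    have := h.integral_energyB_le; rwa [hrest] at this
  have hQU : ∫ t in U, energy K Q t ≤ C :=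
    (setIntegral_mono_set hQi (Eventually.of_forall fun t => energy_nonneg _ _ _)
      (Eventually.of_forall hUsub)).trans hQC
  have hBU : ∫ t in U, energy K B t ≤ C :=
    (setIntegral_mono_set hBi (Eventually.of_forall fun t => energy_nonneg _ _ _)
      (Eventually.of_forall hUsub)).trans hBC
  have iQ : IntegrableOn (energy K Q) U := hQi.mono_set hUsub
  have iB : IntegrableOn (energy K B) U := hBi.mono_set hUsub
  have hUfin : volume U ≠ ⊤ :=
    ((measure_mono hUsub).trans_lt (by simp)).ne
  have ic : ∀ c : ℝ, IntegrableOn (fun _ : ℝ => c) U := fun c => integrableOn_const hUfin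
  have hUvol : volume.real U = ∑ i ∈ Finset.range E.1, dist (E.2 i).1 (E.2 i).2 := by
    rw [hU, measureReal_biUnion_finset hE.2 (fun i _ => measurableSet_uIoc)
      (fun i _ => by simp [uIoc])]
    refine Finset.sum_congr rfl fun i _ => ?_
    rw [uIoc, Real.volume_real_Ioc_of_le (min_le_max), max_sub_min_eq_abs', Real.dist_eq]
  have hUT : volume.real U ≤ T := by
    have := measureReal_mono hUsub (μ := volume) (by simp)
    rwa [Real.volume_real_Ioc_of_le hT.le, sub_zero] at this
  have e0 : G = fun t => (θ / 2 * energy K B t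
      + (1 / (2 * θ) * (2 * c₁ * (1 / (logL K η ^ 2 * η)) + 2 * (1 / logL K η))) * energy K Q t)
      + 1 / (2 * θ) * (2 * (2 * m + c₁) * (1 / (logL K η ^ 2 * η))) := by
    ext t; simp only [hG]; ring
  have iBQ : IntegrableOn (fun t => θ / 2 * energy K B t
      + (1 / (2 * θ) * (2 * c₁ * (1 / (logL K η ^ 2 * η)) + 2 * (1 / logL K η))) * energy K Q t) U :=
    (iB.const_mul _).add (iQ.const_mul _)
  have iG : IntegrableOn G U := by
    rw [e0]
    exact iBQ.add (ic _)
  have hsum : ∑ i ∈ Finset.range E.1, |(∫ s, (∫ x in (-K)..s, cutoff K η x) ∂(P (E.2 i).1 : Measure ℝ))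
        - ∫ s, (∫ x in (-K)..s, cutoff K η x) ∂(P (E.2 i).2 : Measure ℝ)| ≤ ∫ t in U, G t := by
    rw [hU, integral_biUnion_finset _ (fun i _ => measurableSet_uIoc) hE.2
      (fun i hi => iG.mono_set (subset_biUnion_of_mem (u := fun i => uIoc (E.2 i).1 (E.2 i).2) hi))]
    refine Finset.sum_le_sum fun i hi => ?_
    have m1 := (hE.1 i hi).1
    have m2 := (hE.1 i hi).2
    rw [uIcc_of_le hT.le] at m1 m2
    rw [h.integral_P_sub hcc m2 m1]
    have hsubi : uIoc (E.2 i).1 (E.2 i).2 ⊆ U :=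
      subset_biUnion_of_mem (u := fun i => uIoc (E.2 i).1 (E.2 i).2) hi
    have := intervalIntegral.norm_integral_le_integral_norm_uIoc (f := M) (μ := volume)
      (a := (E.2 i).2) (b := (E.2 i).1)
    rw [uIoc_comm] at this
    refine this.trans ?_
    refine integral_mono_of_nonneg (Eventually.of_forall fun t => norm_nonneg _)
      (iG.mono_set hsubi) ?_
    have hae' : ∀ᵐ t ∂(volume.restrict (Ioc 0 T)), |M t| ≤ G t := by
      rw [← hrest]; exact hae
    exact ae_restrict_of_ae_restrict_of_subset (hsubi.trans hUsub) hae'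
  refine hsum.trans ?_
  rw [e0, integral_add iBQ (ic _),
    integral_add (iB.const_mul _) (iQ.const_mul _), integral_const_mul, integral_const_mul,
    setIntegral_const, smul_eq_mul]
  have hc₂ : 0 ≤ 1 / (2 * θ) * (2 * c₁ * (1 / (logL K η ^ 2 * η)) + 2 * (1 / logL K η)) := by
    positivity
  have b1 : θ / 2 * ∫ t in U, energy K B t ≤ θ / 2 * C := by gcongr
  have b2 := mul_le_mul_of_nonneg_left hQU hc₂
  have b3 : volume.real U * (1 / (2 * θ) * (2 * c₁ * (1 / (logL K η ^ 2 * η)))) ≤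
      T * (1 / (2 * θ) * (2 * c₁ * (1 / (logL K η ^ 2 * η)))) := by gcongr
  rw [← hUvol]
  set v := volume.real U
  have e : θ / 2 * C + 1 / (2 * θ) * (2 * (2 * m * v + c₁ * (T + C)) * (1 / (logL K η ^ 2 * η))
      + 2 * C * (1 / logL K η)) = θ / 2 * C
      + (1 / (2 * θ) * (2 * c₁ * (1 / (logL K η ^ 2 * η)) + 2 * (1 / logL K η))) * C
      + v * (1 / (2 * θ) * (2 * (2 * m) * (1 / (logL K η ^ 2 * η))))
      + T * (1 / (2 * θ) * (2 * c₁ * (1 / (logL K η ^ 2 * η)))) := by ring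
  rw [e]
  have e' : v * (1 / (2 * θ) * (2 * (2 * m + c₁) * (1 / (logL K η ^ 2 * η)))) =
      v * (1 / (2 * θ) * (2 * (2 * m) * (1 / (logL K η ^ 2 * η))))
      + v * (1 / (2 * θ) * (2 * c₁ * (1 / (logL K η ^ 2 * η)))) := by ring
  rw [e']
  linarith

end Curve

open Curve

/-! ### Sequences of curves with concentrating reference measures -/

theorem Curve.integrable_P {K T m C : ℝ} {γ : Measure ℝ} {P : ℝ → FiniteMeasure ℝ}
    {r Q B : ℝ → ℝ → ℝ} (h : Curve K T m C γ P r Q B) {t : ℝ} (ht : t ∈ Icc 0 T) {f : ℝ → ℝ}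
    (hf : ContinuousOn f (Icc (-K) K)) : Integrable f (P t : Measure ℝ) := by
  have h1 : (P t : Measure ℝ).restrict (Icc (-K) K) = P t :=
    Measure.restrict_eq_self_of_ae_mem (h.P_supp t ht)
  rw [← h1]
  exact hf.integrableOn_compact isCompact_Icc

theorem Curve.P_real_univ {K T m C : ℝ} {γ : Measure ℝ} {P : ℝ → FiniteMeasure ℝ}
    {r Q B : ℝ → ℝ → ℝ} (h : Curve K T m C γ P r Q B) {t : ℝ} (ht : t ∈ Icc 0 T) :
    (P t : Measure ℝ).real univ = m := h.P_mass t ht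

/-- A sequence of curves whose reference measures are centered and concentrate at `±K`. -/
structure CurveSeq (K T m C : ℝ) (γ : ℕ → Measure ℝ) (P : ℕ → ℝ → FiniteMeasure ℝ)
    (r Q B : ℕ → ℝ → ℝ → ℝ) : Prop where
  curve : ∀ n, Curve K T m C (γ n) (P n) (r n) (Q n) (B n)
  sym : ∀ n, ∫ s, s ∂(γ n) = 0
  conc : Tendsto (fun n => ∫ s, (K ^ 2 - s ^ 2) ∂(γ n)) atTop (𝓝 0)

/-- Near ±K continuity makes φ small; at distance at least d from both ends (K - s)(K + s) ≥ d K, so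
a multiple of K² - s² dominates. It reduces all test functions vanishing at ±K to K² - s². -/
theorem exists_abs_le_add_mul {K : ℝ} (hK : 0 < K) {φ : ℝ → ℝ} (hφ : Continuous φ)
    (h1 : φ K = 0) (h2 : φ (-K) = 0) {θ : ℝ} (hθ : 0 < θ) :
    ∃ c, 0 ≤ c ∧ ∀ s ∈ Icc (-K) K, |φ s| ≤ θ + c * (K ^ 2 - s ^ 2) := by
  obtain ⟨d₁, hd₁, H1⟩ := Metric.continuousAt_iff.1 (hφ.continuousAt (x := K)) θ hθ
  obtain ⟨d₂, hd₂, H2⟩ := Metric.continuousAt_iff.1 (hφ.continuousAt (x := -K)) θ hθ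
  obtain ⟨M, hM⟩ := (isCompact_Icc (a := -K) (b := K)).exists_bound_of_continuousOn hφ.continuousOn
  have hM0 : 0 ≤ M := (norm_nonneg _).trans (hM K ⟨by linarith, le_rfl⟩)
  set d := min K (min d₁ d₂) with hd
  have hd0 : 0 < d := lt_min hK (lt_min hd₁ hd₂)
  have hdK : d ≤ K := min_le_left _ _
  have hdd₁ : d ≤ d₁ := (min_le_right _ _).trans (min_le_left _ _)
  have hdd₂ : d ≤ d₂ := (min_le_right _ _).trans (min_le_right _ _)
  refine ⟨M / (d * K), by positivity, fun s hs => ?_⟩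
  have hnn : 0 ≤ K ^ 2 - s ^ 2 := by nlinarith [hs.1, hs.2]
  have hc0 : 0 ≤ M / (d * K) * (K ^ 2 - s ^ 2) := by positivity
  by_cases c1 : K - s < d
  · have := H1 (x := s) (by rw [Real.dist_eq, abs_lt]; constructor <;> linarith [hs.2])
    rw [h1, Real.dist_eq, sub_zero] at this
    linarith
  by_cases c2 : s + K < d
  · have := H2 (x := s) (by rw [Real.dist_eq, abs_lt]; constructor <;> linarith [hs.1])
    rw [h2, Real.dist_eq, sub_zero] at this
    linarith
  push Not at c1 c2
  have h3 : d * K ≤ K ^ 2 - s ^ 2 := by nlinarith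
  have h4 : M ≤ M / (d * K) * (K ^ 2 - s ^ 2) := by
    calc M = M / (d * K) * (d * K) := by field_simp
      _ ≤ _ := by gcongr
  have := hM s hs
  rw [Real.norm_eq_abs] at this
  linarith

/-- Pointwise bounded sequences on a countable type have pointwise convergent subsequences. -/
theorem exists_subseq_tendsto_of_countable {ι : Type*} [Countable ι] {x : ℕ → ι → ℝ} {c : ι → ℝ}
    (hx : ∀ n i, |x n i| ≤ c i) :
    ∃ σ : ℕ → ℕ, StrictMono σ ∧ ∃ y : ι → ℝ, ∀ i, Tendsto (fun n => x (σ n) i) atTop (𝓝 (y i)) := by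
  have hc : IsCompact (Set.pi univ fun i => Icc (-c i) (c i)) :=
    isCompact_univ_pi fun i => isCompact_Icc
  obtain ⟨y, -, σ, hσ, hy⟩ := hc.tendsto_subseq (x := x) fun n i _ => abs_le.1 (hx n i)
  exact ⟨σ, hσ, y, fun i => (tendsto_pi_nhds.1 hy) i⟩

/-- Asymptotically equicontinuous, pointwise bounded functions on a separable space have a
subsequence that converges pointwise. -/
theorem exists_subseq_tendsto_of_equicontinuous {X : Type*} [TopologicalSpace X]
    [TopologicalSpace.SeparableSpace X] {F : ℕ → X → ℝ} {c : X → ℝ} (hb : ∀ n x, |F n x| ≤ c x)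
    (heq : ∀ x, ∀ e > 0, ∀ᶠ x' in 𝓝 x, ∀ᶠ n in atTop, |F n x - F n x'| ≤ e) :
    ∃ σ : ℕ → ℕ, StrictMono σ ∧ ∃ f : X → ℝ, ∀ x,
      Tendsto (fun n => F (σ n) x) atTop (𝓝 (f x)) := by
  obtain ⟨D, hDc, hDd⟩ := TopologicalSpace.exists_countable_dense X
  have := hDc.to_subtype
  obtain ⟨σ, hσ, y, hy⟩ := exists_subseq_tendsto_of_countable
    (x := fun n (d : D) => F n d) (c := fun d => c d) fun n d => hb n d
  refine ⟨σ, hσ, ?_⟩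
  have hC : ∀ x, CauchySeq (fun n => F (σ n) x) := by
    intro x
    rw [Metric.cauchySeq_iff']
    intro e he
    obtain ⟨d, hdD, hd⟩ := (hDd.inter_nhds_nonempty (heq x (e / 8) (by linarith)))
    have h1 := hσ.tendsto_atTop.eventually hd
    have h2 := (hy ⟨d, hdD⟩).cauchySeq
    rw [Metric.cauchySeq_iff'] at h2
    obtain ⟨n₁, hn₁⟩ := eventually_atTop.1 h1
    obtain ⟨n₂, hn₂⟩ := h2 (e / 8) (by linarith)
    refine ⟨max n₁ n₂, fun n hn => ?_⟩
    have a1 := hn₁ n ((le_max_left _ _).trans hn)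
    have a2 := hn₁ (max n₁ n₂) (le_max_left _ _)
    have a3 := hn₂ n ((le_max_right _ _).trans hn)
    have a4 := hn₂ (max n₁ n₂) (le_max_right _ _)
    rw [Real.dist_eq] at a3 a4 ⊢
    simp only at a3 a4
    rw [abs_lt] at a3 a4 ⊢
    rw [abs_le] at a1 a2
    constructor <;> linarith [a1.1, a1.2, a2.1, a2.2, a3.1, a3.2, a4.1, a4.2]
  choose f hf using fun x => cauchySeq_tendsto_of_complete (hC x)
  exact ⟨f, hf⟩

theorem tendsto_logL {K : ℝ} (hK : 0 < K) : Tendsto (logL K) (𝓝[>] 0) atTop := by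
  unfold logL
  refine Real.tendsto_log_atTop.comp ?_
  have h1 : Tendsto (fun η : ℝ => 1 + 2 * K * η⁻¹) (𝓝[>] 0) atTop :=
    tendsto_atTop_add_const_left _ _ (tendsto_inv_nhdsGT_zero.const_mul_atTop (by linarith))
  refine h1.congr' ?_
  filter_upwards [self_mem_nhdsWithin] with η hη
  have : η ≠ 0 := ne_of_gt hη
  field_simp
  ring

/-! ### Compactness of the endpoint masses. -/

namespace CurveSeq

variable {K T m C : ℝ} {γ : ℕ → Measure ℝ} {P : ℕ → ℝ → FiniteMeasure ℝ} {r Q B : ℕ → ℝ → ℝ → ℝ}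

theorem K_pos (h : CurveSeq K T m C γ P r Q B) : 0 < K := (h.curve 0).K_pos
theorem T_pos (h : CurveSeq K T m C γ P r Q B) : 0 < T := (h.curve 0).T_pos
theorem m_nonneg (h : CurveSeq K T m C γ P r Q B) : 0 ≤ m := (h.curve 0).m_nonneg
theorem C_nonneg (h : CurveSeq K T m C γ P r Q B) : 0 ≤ C := (h.curve 0).C_nonneg

theorem comp (h : CurveSeq K T m C γ P r Q B) {σ : ℕ → ℕ} (hσ : StrictMono σ) :
    CurveSeq K T m C (fun n => γ (σ n)) (fun n => P (σ n)) (fun n => r (σ n)) (fun n => Q (σ n))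
      (fun n => B (σ n)) :=
  ⟨fun _ => h.curve _, fun _ => h.sym _, h.conc.comp hσ.tendsto_atTop⟩

theorem tendsto_bdErr (h : CurveSeq K T m C γ P r Q B) :
    Tendsto (fun n => bdErr K (γ n)) atTop (𝓝 0) := by
  have h1 := (h.conc.div_const (2 * K)).sqrt
  simpa [bdErr] using h1

/-- Choose M first, to make the entropy error small, and then n. The bound is uniform in t, and the
test functions may vary with n, as happens when functions of ξ are transported to s. -/
theorem eventually_integral_P_le (h : CurveSeq K T m C γ P r Q B) {φ : ℕ → ℝ → ℝ}
    (hφ : ∀ n, Continuous (φ n)) (hφ01 : ∀ n, ∀ s ∈ Icc (-K) K, φ n s ∈ Icc (0 : ℝ) 1)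
    (hlim : Tendsto (fun n => ∫ s, φ n s ∂(γ n)) atTop (𝓝 0)) {e : ℝ} (he : 0 < e) :
    ∀ᶠ n in atTop, ∀ t ∈ Icc 0 T, ∫ s, φ n s ∂(P n t : Measure ℝ) ≤ e := by
  have h1 : Tendsto (fun M => entConst K T m C / logF M) atTop (𝓝 0) :=
    tendsto_const_nhds.div_atTop tendsto_logF
  obtain ⟨M, hM, hM0⟩ := ((h1.eventually (gt_mem_nhds (half_pos he))).and
    (eventually_gt_atTop 0)).exists
  have h2 := (hlim.const_mul M)
  rw [mul_zero] at h2
  filter_upwards [h2.eventually (gt_mem_nhds (half_pos he))] with n hn t ht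
  have := (h.curve n).integral_P_le (hφ n) (hφ01 n) hM0 ht
  linarith

/-- |φ| is at most a small constant plus a multiple of K² - s². The constant is paid by the mass m,
and K² - s² has vanishing γ_n-mean, hence vanishing P_n(t)-mean uniformly in t. -/
theorem eventually_integral_abs_le (h : CurveSeq K T m C γ P r Q B) {φ : ℝ → ℝ}
    (hφ : Continuous φ) (h1 : φ K = 0) (h2 : φ (-K) = 0) {e : ℝ} (he : 0 < e) :
    ∀ᶠ n in atTop, ∀ t ∈ Icc 0 T, ∫ s, |φ s| ∂(P n t : Measure ℝ) ≤ e := by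
  have hK := h.K_pos
  have hm := h.m_nonneg
  obtain ⟨c, hc0, hc⟩ := exists_abs_le_add_mul hK hφ h1 h2 (θ := e / (2 * (m + 1))) (by positivity)
  have hlim : Tendsto (fun n => ∫ s, (K ^ 2 - s ^ 2) / K ^ 2 ∂(γ n)) atTop (𝓝 0) := by
    simp_rw [integral_div]
    simpa using h.conc.div_const (K ^ 2)
  have hev := h.eventually_integral_P_le (φ := fun _ s => (K ^ 2 - s ^ 2) / K ^ 2)
    (fun _ => by fun_prop) (fun _ s hs => ?_) hlim (e := e / (2 * (c * K ^ 2 + 1))) (by positivity)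
  · filter_upwards [hev] with n hn t ht
    have i1 : Integrable (fun s => (K ^ 2 - s ^ 2) / K ^ 2) (P n t : Measure ℝ) :=
      (h.curve n).integrable_P ht (by fun_prop)
    have hle : ∫ s, |φ s| ∂(P n t : Measure ℝ) ≤
        ∫ s, (e / (2 * (m + 1)) + (c * K ^ 2) * ((K ^ 2 - s ^ 2) / K ^ 2)) ∂(P n t : Measure ℝ) := by
      refine integral_mono_ae ((h.curve n).integrable_P ht hφ.abs.continuousOn)
        ((integrable_const _).add (i1.const_mul _)) ?_
      filter_upwards [(h.curve n).P_supp t ht] with s hs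
      have e1 : (c * K ^ 2) * ((K ^ 2 - s ^ 2) / K ^ 2) = c * (K ^ 2 - s ^ 2) := by field_simp
      rw [e1]
      exact hc s hs
    refine hle.trans ?_
    rw [integral_add (integrable_const _) (i1.const_mul _), integral_const_mul, integral_const,
      (h.curve n).P_real_univ ht, smul_eq_mul]
    have b1 : m * (e / (2 * (m + 1))) ≤ e / 2 := by
      rw [mul_div_assoc', div_le_div_iff₀ (by positivity) (by positivity)]
      nlinarith
    have b2 : c * K ^ 2 * ∫ s, (K ^ 2 - s ^ 2) / K ^ 2 ∂(P n t : Measure ℝ) ≤ e / 2 := by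
      calc _ ≤ c * K ^ 2 * (e / (2 * (c * K ^ 2 + 1))) := by
            gcongr
            exact hn t ht
        _ ≤ e / 2 := by
            rw [mul_div_assoc', div_le_div_iff₀ (by positivity) (by positivity)]
            nlinarith
    linarith
  · constructor
    · exact div_nonneg (by nlinarith [hs.1, hs.2]) (by positivity)
    · rw [div_le_one (by positivity)]; nlinarith [sq_nonneg s]

/-- The mass near `K`. -/
def massP (K : ℝ) (P : ℝ → FiniteMeasure ℝ) (t : ℝ) : ℝ := ∫ s, weight K s ∂(P t : Measure ℝ)

theorem massP_mem (h : CurveSeq K T m C γ P r Q B) (n : ℕ) {t : ℝ} (ht : t ∈ Icc 0 T) :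
    massP K (P n) t ∈ Icc 0 m := by
  have hc := h.curve n
  constructor
  · refine integral_nonneg_of_ae ?_
    filter_upwards [hc.P_supp t ht] with s hs using (hc.weight_mem hs).1
  · calc massP K (P n) t ≤ ∫ s, 1 ∂(P n t : Measure ℝ) := by
          refine integral_mono_ae (hc.integrable_P ht (weight_continuous K).continuousOn)
            (integrable_const _) ?_
          filter_upwards [hc.P_supp t ht] with s hs using (hc.weight_mem hs).2
      _ = m := by simp [hc.P_real_univ ht]

theorem weight_right (h : CurveSeq K T m C γ P r Q B) : weight K K = 1 := by
  have := h.K_pos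
  unfold weight; field_simp; ring

theorem weight_left (K : ℝ) : weight K (-K) = 0 := by
  unfold weight; simp

/-- Asymptotic absolute continuity of the mass near `K`. -/
theorem eventually_sum_massP_le (h : CurveSeq K T m C γ P r Q B) {e : ℝ} (he : 0 < e) :
    ∃ δ > 0, ∀ E ∈ AbsolutelyContinuousOnInterval.disjWithin 0 T,
      ∑ i ∈ Finset.range E.1, dist (E.2 i).1 (E.2 i).2 < δ →
      ∀ᶠ n in atTop,
        ∑ i ∈ Finset.range E.1, |massP K (P n) (E.2 i).1 - massP K (P n) (E.2 i).2| ≤ e := by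
  have hK := h.K_pos
  have hT := h.T_pos
  have hm := h.m_nonneg
  have hC := h.C_nonneg
  -- Order of choices: θ bounds the kinetic contribution by e/4, then η bounds the energy term by
  -- e/4, then δ bounds the length term by e/8. Only afterwards is n taken large, for `bdErr` and
  -- for the change of test function, e/8 each.
  set θ := e / (2 * (C + 1)) with hθdef
  have hθ : 0 < θ := by positivity
  -- choice of the cut-off
  obtain ⟨η, hη, hηL⟩ : ∃ η > 0, 1 / (2 * θ) * (2 * C * (1 / logL K η)) ≤ e / 4 := by
    have h1 : Tendsto (fun η => 1 / (2 * θ) * (2 * C * (1 / logL K η))) (𝓝[>] 0) (𝓝 0) := by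
      have := (tendsto_const_nhds (x := (1 : ℝ))).div_atTop (tendsto_logL hK)
      simpa using (this.const_mul (2 * C)).const_mul (1 / (2 * θ))
    obtain ⟨η, h2, h3⟩ := ((h1.eventually (gt_mem_nhds (by linarith : (0 : ℝ) < e / 4))).and
      self_mem_nhdsWithin).exists
    exact ⟨η, h3, h2.le⟩
  have hL := logL_pos hK hη
  set a := 1 / (2 * θ) * (2 * (1 / (logL K η ^ 2 * η))) with ha
  have ha0 : 0 < a := by positivity
  refine ⟨e / (8 * (a * (2 * m) + 1)), by positivity, fun E hE hlen => ?_⟩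
  set ψ : ℝ → ℝ := fun s => ∫ x in (-K)..s, cutoff K η x with hψ
  have hcc := cutoff_continuous hK hη
  have hψc : Continuous ψ := intervalIntegral.continuous_primitive
    (fun _ _ => hcc.intervalIntegrable _ _) _
  -- The affine weight and the cut-off primitive ψ agree at ±K, so exchanging them is asymptotically
  -- free. The tolerance is divided by the number of intervals, which is legitimate because the
  -- family E is fixed before n.
  have htail := h.eventually_integral_abs_le (φ := fun s => weight K s - ψ s)
    ((weight_continuous K).sub hψc) (by simp [h.weight_right, hψ, integral_cutoff hK hη])
    (by simp [weight_left, hψ]) (e := e / (16 * (E.1 + 1))) (by positivity)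
  have hbd : Tendsto (fun n => a * (4 * √(2 * m + 4 * K) * bdErr K (γ n) * (T + C))) atTop (𝓝 0) := by
    simpa using ((h.tendsto_bdErr.const_mul (4 * √(2 * m + 4 * K))).mul_const (T + C)).const_mul a
  filter_upwards [htail, hbd.eventually (gt_mem_nhds (by linarith : (0 : ℝ) < e / 8))]
    with n hn hnb
  have hc := h.curve n
  have h1 := hc.sum_cutoff_le (h.sym n) hθ hη hE
  have hpt : ∀ i ∈ Finset.range E.1, |massP K (P n) (E.2 i).1 - massP K (P n) (E.2 i).2| ≤
      |(∫ s, ψ s ∂(P n (E.2 i).1 : Measure ℝ)) - ∫ s, ψ s ∂(P n (E.2 i).2 : Measure ℝ)|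
        + 2 * (e / (16 * (E.1 + 1))) := by
    intro i hi
    have m1 := (hE.1 i hi).1
    have m2 := (hE.1 i hi).2
    rw [uIcc_of_le hT.le] at m1 m2
    have key : ∀ t ∈ Icc 0 T, |massP K (P n) t - ∫ s, ψ s ∂(P n t : Measure ℝ)| ≤
        e / (16 * (E.1 + 1)) := by
      intro t ht
      rw [massP, ← integral_sub (hc.integrable_P ht (weight_continuous K).continuousOn)
        (hc.integrable_P ht hψc.continuousOn)]
      exact abs_integral_le_integral_abs.trans (hn t ht)
    have k1 := abs_le.1 (key _ m1)
    have k2 := abs_le.1 (key _ m2)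
    have k3 := abs_le.1 (le_refl |(∫ s, ψ s ∂(P n (E.2 i).1 : Measure ℝ))
      - ∫ s, ψ s ∂(P n (E.2 i).2 : Measure ℝ)|)
    rw [abs_le]
    constructor <;> linarith [k1.1, k1.2, k2.1, k2.2, k3.1, k3.2]
  calc _ ≤ ∑ i ∈ Finset.range E.1,
        (|(∫ s, ψ s ∂(P n (E.2 i).1 : Measure ℝ)) - ∫ s, ψ s ∂(P n (E.2 i).2 : Measure ℝ)|
        + 2 * (e / (16 * (E.1 + 1)))) := Finset.sum_le_sum hpt
    _ ≤ e := by
      rw [Finset.sum_add_distrib, Finset.sum_const, Finset.card_range, nsmul_eq_mul]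
      have b1 : (E.1 : ℝ) * (2 * (e / (16 * (E.1 + 1)))) ≤ e / 8 := by
        have : (E.1 : ℝ) * (2 * (e / (16 * (E.1 + 1)))) = (E.1 : ℝ) / (E.1 + 1) * (e / 8) := by
          field_simp; ring
        rw [this]
        refine mul_le_of_le_one_left (by positivity) ?_
        rw [div_le_one (by positivity)]
        linarith
      have b2 : θ / 2 * C ≤ e / 4 := by
        rw [hθdef, div_div, div_mul_eq_mul_div, div_le_div_iff₀ (by positivity) (by positivity)]
        nlinarith
      have b3 : a * (2 * m * ∑ i ∈ Finset.range E.1, dist (E.2 i).1 (E.2 i).2) ≤ e / 8 := by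
        have : a * (2 * m * ∑ i ∈ Finset.range E.1, dist (E.2 i).1 (E.2 i).2) ≤
            a * (2 * m * (e / (8 * (a * (2 * m) + 1)))) := by gcongr
        refine this.trans ?_
        have e1 : a * (2 * m * (e / (8 * (a * (2 * m) + 1)))) =
            (a * (2 * m)) / (a * (2 * m) + 1) * (e / 8) := by field_simp
        rw [e1]
        refine mul_le_of_le_one_left (by positivity) ?_
        rw [div_le_one (by positivity)]
        linarith
      have e2 : 1 / (2 * θ) * (2 * (2 * m * ∑ i ∈ Finset.range E.1, dist (E.2 i).1 (E.2 i).2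
        + 4 * √(2 * m + 4 * K) * bdErr K (γ n) * (T + C)) * (1 / (logL K η ^ 2 * η))
          + 2 * C * (1 / logL K η)) =
          a * (2 * m * ∑ i ∈ Finset.range E.1, dist (E.2 i).1 (E.2 i).2)
          + a * (4 * √(2 * m + 4 * K) * bdErr K (γ n) * (T + C))
          + 1 / (2 * θ) * (2 * C * (1 / logL K η)) := by
        rw [ha]; ring
      rw [e2] at h1
      linarith

/-- Convergence of the mass near `K` along a subsequence, at every time. -/
theorem exists_subseq_massP (h : CurveSeq K T m C γ P r Q B) :
    ∃ σ : ℕ → ℕ, StrictMono σ ∧ ∃ f : ℝ → ℝ, ∀ t ∈ Icc 0 T,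
      Tendsto (fun n => massP K (P (σ n)) t) atTop (𝓝 (f t)) := by
  have hT := h.T_pos
  have hb : ∀ (n : ℕ) (t : Icc (0 : ℝ) T), |massP K (P n) t| ≤ m := by
    intro n t
    have := h.massP_mem n t.2
    rw [abs_of_nonneg this.1]
    exact this.2
  have heq : ∀ t : Icc (0 : ℝ) T, ∀ e > 0, ∀ᶠ t' : Icc (0 : ℝ) T in 𝓝 t, ∀ᶠ n in atTop,
      |massP K (P n) t - massP K (P n) t'| ≤ e := by
    intro t e he
    obtain ⟨δ, hδ, H⟩ := h.eventually_sum_massP_le he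
    filter_upwards [Metric.ball_mem_nhds t hδ] with t' ht'
    have h1 := H (1, fun _ => ((t : ℝ), (t' : ℝ))) ?_ ?_
    · filter_upwards [h1] with n hn
      simpa using hn
    · refine ⟨fun i _ => ?_, ?_⟩
      · rw [uIcc_of_le hT.le]
        exact ⟨t.2, t'.2⟩
      · simp
    · simp only [Finset.range_one, Finset.sum_singleton]
      rw [dist_comm]
      exact ht'
  obtain ⟨σ, hσ, f, hf⟩ := exists_subseq_tendsto_of_equicontinuous hb heq
  refine ⟨σ, hσ, fun t => f (projIcc 0 T hT.le t), fun t ht => ?_⟩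
  have := hf ⟨t, ht⟩
  simp only
  rwa [projIcc_of_mem hT.le ht]

/-- Each family of intervals is finite and fixed as n → ∞, so the asymptotic estimate passes to the
pointwise limit with the same δ. -/
theorem absolutelyContinuous_of_tendsto (h : CurveSeq K T m C γ P r Q B) {f : ℝ → ℝ}
    (hf : ∀ t ∈ Icc 0 T, Tendsto (fun n => massP K (P n) t) atTop (𝓝 (f t))) :
    AbsolutelyContinuousOnInterval f 0 T := by
  have hT := h.T_pos
  rw [absolutelyContinuousOnInterval_iff]
  intro e he
  obtain ⟨δ, hδ, H⟩ := h.eventually_sum_massP_le (half_pos he)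
  refine ⟨δ, hδ, fun E hE hlen => ?_⟩
  have hlim : Tendsto (fun n => ∑ i ∈ Finset.range E.1,
      |massP K (P n) (E.2 i).1 - massP K (P n) (E.2 i).2|) atTop
      (𝓝 (∑ i ∈ Finset.range E.1, |f (E.2 i).1 - f (E.2 i).2|)) := by
    refine tendsto_finsetSum _ fun i hi => ?_
    have m1 := (hE.1 i hi).1
    have m2 := (hE.1 i hi).2
    rw [uIcc_of_le hT.le] at m1 m2
    exact ((hf _ m1).sub (hf _ m2)).abs
  have := le_of_tendsto hlim (H E hE hlen)
  simp only [Real.dist_eq]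
  linarith

end CurveSeq

/-! ### Limits of the measures, the traces and the fluxes. -/

open Curve

/-- Weak convergence of functions on `(0, T) × [-K, K]` follows from uniform integrability bounds
and convergence of the time-space averages against functions of space. -/
theorem tendsto_integral_of_tendsto_step {K T V : ℝ} (hT : 0 < T) {W : ℕ → ℝ × ℝ → ℝ}
    {W₀ : ℝ × ℝ → ℝ} (hW : ∀ n, Integrable (W n) (lebProd T K))
    (hWV : ∀ n, ∫ z, |W n z| ∂(lebProd T K) ≤ V)
    (hW₀ : Integrable W₀ (lebProd T K))
    (hlim : ∀ g : ℝ → ℝ, Continuous g → ∀ t₁ ∈ Icc 0 T, ∀ t₂ ∈ Icc 0 T, t₁ ≤ t₂ →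
      Tendsto (fun n => ∫ t in t₁..t₂, ∫ s, g s * W n (t, s) ∂(leb K)) atTop
        (𝓝 (∫ t in t₁..t₂, ∫ s, g s * W₀ (t, s) ∂(leb K))))
    {φ : ℝ × ℝ → ℝ} (hφ : Continuous φ) :
    Tendsto (fun n => ∫ z, φ z * W n z ∂(lebProd T K)) atTop
      (𝓝 (∫ z, φ z * W₀ z ∂(lebProd T K))) := by
  set V' := max V (∫ z, |W₀ z| ∂(lebProd T K)) with hV'
  have hcpt : IsCompact (Icc (0 : ℝ) T ×ˢ Icc (-K) K) := isCompact_Icc.prod isCompact_Icc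
  have huc := hcpt.uniformContinuousOn_of_continuous hφ.continuousOn
  have hsupp : ∀ᵐ z : ℝ × ℝ ∂(lebProd T K), z ∈ Icc (0 : ℝ) T ×ˢ Icc (-K) K := by
    have h1 : ∀ᵐ z : ℝ × ℝ ∂(lebProd T K), z.2 ∈ Icc (-K) K :=
      Measure.quasiMeasurePreserving_snd.ae (ae_restrict_mem measurableSet_Icc)
    have h2 : ∀ᵐ z : ℝ × ℝ ∂(lebProd T K), z.1 ∈ Ioo 0 T :=
      Measure.quasiMeasurePreserving_fst.ae (ae_restrict_mem measurableSet_Ioo)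
    filter_upwards [h1, h2] with z a b using ⟨⟨b.1.le, b.2.le⟩, a⟩
  have hmul : ∀ (f : ℝ × ℝ → ℝ), Continuous f → ∀ w : ℝ × ℝ → ℝ, Integrable w (lebProd T K) →
      Integrable (fun z => f z * w z) (lebProd T K) := by
    intro f hf w hw
    obtain ⟨M, hM⟩ := hcpt.exists_bound_of_continuousOn hf.continuousOn
    exact hw.bdd_mul hf.aestronglyMeasurable (hsupp.mono fun z hz => hM z hz)
  have hII : ∀ w : ℝ → ℝ, Integrable w (lebT T) → IntervalIntegrable w volume 0 T := by
    intro w hw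
    rwa [intervalIntegrable_iff_integrableOn_Ioo_of_le hT.le]
  -- approximation of `φ` by functions that are piecewise constant in time
  have key : ∀ e > 0, ∃ (N : ℕ) (p : ℕ → ℝ), (∀ k ≤ N, p k ∈ Icc 0 T) ∧ Monotone p ∧
      ∀ w : ℝ × ℝ → ℝ, Integrable w (lebProd T K) → ∫ z, |w z| ∂(lebProd T K) ≤ V' →
      |(∫ z, φ z * w z ∂(lebProd T K)) -
        ∑ k ∈ Finset.range N, ∫ t in (p k)..(p (k + 1)), ∫ s, φ (p k, s) * w (t, s) ∂(leb K)|
        ≤ e * V' := by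
    intro e he
    obtain ⟨δ, hδ, hδφ⟩ := Metric.uniformContinuousOn_iff.1 huc e he
    obtain ⟨N, hN⟩ := exists_nat_gt (T / δ)
    have hN0 : 0 < (N : ℝ) := (by positivity : 0 ≤ T / δ).trans_lt hN
    set p : ℕ → ℝ := fun k => k * (T / N) with hp
    have hpm : Monotone p := fun a b hab => by
      simp only [hp]
      have : (a : ℝ) ≤ b := by exact_mod_cast hab
      gcongr
    have hpN : p N = T := by simp only [hp]; field_simp
    have hp0 : p 0 = 0 := by simp [hp]
    have hpmem : ∀ k ≤ N, p k ∈ Icc 0 T := fun k hk =>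
      ⟨hp0 ▸ hpm (Nat.zero_le k), hpN ▸ hpm hk⟩
    have hstep : T / N < δ := by rw [div_lt_iff₀ hN0]; rwa [div_lt_iff₀ hδ, mul_comm] at hN
    refine ⟨N, p, hpmem, hpm, fun w hw hwV => ?_⟩
    have iφw := hmul φ hφ w hw
    have hsubI : ∀ k < N, ∀ f : ℝ → ℝ, Integrable f (lebT T) →
        IntervalIntegrable f volume (p k) (p (k + 1)) := by
      intro k hk f hf
      refine (hII f hf).mono_set ?_
      rw [uIcc_of_le (hpm (Nat.le_succ k)), uIcc_of_le hT.le]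
      exact Icc_subset_Icc (hpmem k hk.le).1 (hpmem (k + 1) hk).2
    have e1 : ∀ f : ℝ → ℝ, Integrable f (lebT T) → ∫ t, f t ∂(lebT T) =
        ∑ k ∈ Finset.range N, ∫ t in (p k)..(p (k + 1)), f t := by
      intro f hf
      rw [intervalIntegral.sum_integral_adjacent_intervals (fun k hk => hsubI k hk f hf), hp0, hpN,
        intervalIntegral.integral_of_le hT.le, integral_Ioc_eq_integral_Ioo]
    have iF : Integrable (fun t => ∫ s, φ (t, s) * w (t, s) ∂(leb K)) (lebT T) :=
      iφw.integral_prod_left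
    have iA : Integrable (fun t => ∫ s, |w (t, s)| ∂(leb K)) (lebT T) := hw.abs.integral_prod_left
    rw [integral_prod _ iφw, e1 _ iF, ← Finset.sum_sub_distrib]
    have hk : ∀ k ∈ Finset.range N,
        |(∫ t in (p k)..(p (k + 1)), ∫ s, φ (t, s) * w (t, s) ∂(leb K)) -
          ∫ t in (p k)..(p (k + 1)), ∫ s, φ (p k, s) * w (t, s) ∂(leb K)| ≤
        ∫ t in (p k)..(p (k + 1)), e * ∫ s, |w (t, s)| ∂(leb K) := by
      intro k hk
      rw [Finset.mem_range] at hk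
      have ig : Integrable (fun z : ℝ × ℝ => φ (p k, z.2) * w z) (lebProd T K) :=
        hmul (fun z => φ (p k, z.2)) (by fun_prop) w hw
      have iG : Integrable (fun t => ∫ s, φ (p k, s) * w (t, s) ∂(leb K)) (lebT T) :=
        ig.integral_prod_left
      rw [← intervalIntegral.integral_sub (hsubI k hk _ iF) (hsubI k hk _ iG)]
      have hle := hpm (Nat.le_succ k)
      rw [← Real.norm_eq_abs]
      refine intervalIntegral.norm_integral_le_of_norm_le hle ?_
        ((hsubI k hk _ iA).const_mul e)
      have hsl : ∀ᵐ t ∂(lebT T), Integrable (fun s => φ (t, s) * w (t, s)) (leb K) ∧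
          Integrable (fun s => φ (p k, s) * w (t, s)) (leb K) ∧
          Integrable (fun s => |w (t, s)|) (leb K) := by
        filter_upwards [iφw.prod_right_ae, ig.prod_right_ae, hw.abs.prod_right_ae] with t a b c
        exact ⟨a, b, c⟩
      rw [lebT, restrict_Ioo_eq_restrict_Ioc, ae_restrict_iff' measurableSet_Ioc] at hsl
      filter_upwards [hsl] with t ht htm
      have htT : t ∈ Ioc 0 T :=
        ⟨(hpmem k hk.le).1.trans_lt htm.1, htm.2.trans (hpmem (k + 1) hk).2⟩
      obtain ⟨a, b, c⟩ := ht htT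
      rw [← integral_sub a b, ← integral_const_mul]
      refine norm_integral_le_of_norm_le (c.const_mul e) ?_
      filter_upwards [ae_restrict_mem measurableSet_Icc] with s hs
      rw [← sub_mul, norm_mul]
      refine mul_le_mul_of_nonneg_right ?_ (norm_nonneg _)
      have := hδφ (t, s) ⟨⟨htT.1.le, htT.2⟩, hs⟩ (p k, s) ⟨hpmem k hk.le, hs⟩ ?_
      · rw [Real.dist_eq] at this
        exact this.le
      · rw [Prod.dist_eq, dist_self, max_eq_left dist_nonneg, Real.dist_eq,
          abs_of_nonneg (by linarith [htm.1])]
        have : p (k + 1) = p k + T / N := by simp only [hp]; push_cast; ring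
        linarith [htm.2]
    calc _ ≤ ∑ k ∈ Finset.range N, |(∫ t in (p k)..(p (k + 1)), ∫ s, φ (t, s) * w (t, s) ∂(leb K)) -
          ∫ t in (p k)..(p (k + 1)), ∫ s, φ (p k, s) * w (t, s) ∂(leb K)| :=
          Finset.abs_sum_le_sum_abs _ _
      _ ≤ ∑ k ∈ Finset.range N, ∫ t in (p k)..(p (k + 1)), e * ∫ s, |w (t, s)| ∂(leb K) :=
          Finset.sum_le_sum hk
      _ = e * ∫ z, |w z| ∂(lebProd T K) := by
          rw [← e1 _ (iA.const_mul e), integral_const_mul, integral_prod _ hw.abs]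
      _ ≤ e * V' := by gcongr
  rw [Metric.tendsto_atTop]
  intro e he
  have hV0 : 0 ≤ V' := (integral_nonneg fun z => abs_nonneg (W₀ z)).trans (le_max_right _ _)
  obtain ⟨N, p, hp, hpm, H⟩ := key (e / (4 * (V' + 1))) (by positivity)
  have hsum : Tendsto (fun n => ∑ k ∈ Finset.range N,
      ∫ t in (p k)..(p (k + 1)), ∫ s, φ (p k, s) * W n (t, s) ∂(leb K)) atTop
      (𝓝 (∑ k ∈ Finset.range N,
        ∫ t in (p k)..(p (k + 1)), ∫ s, φ (p k, s) * W₀ (t, s) ∂(leb K))) := by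
    refine tendsto_finsetSum _ fun k hk => ?_
    rw [Finset.mem_range] at hk
    exact hlim (fun s => φ (p k, s)) (by fun_prop) _ (hp k hk.le) _ (hp (k + 1) hk)
      (hpm (Nat.le_succ k))
  obtain ⟨n₀, hn₀⟩ := Metric.tendsto_atTop.1 hsum (e / 4) (by linarith)
  refine ⟨n₀, fun n hn => ?_⟩
  have h1 := hn₀ n hn
  have h2 := H (W n) (hW n) ((hWV n).trans (le_max_left _ _))
  have h3 := H W₀ hW₀ (le_max_right _ _)
  have h4 : e / (4 * (V' + 1)) * V' ≤ e / 4 := by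
    rw [div_mul_eq_mul_div, div_le_div_iff₀ (by positivity) (by positivity)]
    nlinarith
  rw [Real.dist_eq] at h1 ⊢
  rw [abs_lt] at h1 ⊢
  rw [abs_le] at h2 h3
  constructor <;> linarith [h1.1, h1.2, h2.1, h2.2, h3.1, h3.2]

theorem Curve.integral_r_sq_le {K T m C : ℝ} {γ : Measure ℝ} {P : ℝ → FiniteMeasure ℝ}
    {r Q B : ℝ → ℝ → ℝ} (h : Curve K T m C γ P r Q B) :
    ∫ z, r z.1 z.2 ^ 2 ∂(lebProd T K) ≤ 2 * K * ((2 * m + 4 * K) * (T + C)) := by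
  have hK := h.K_pos
  rw [integral_prod _ h.r_sq_integrable]
  have hle : ∀ t, ∫ s, r t s ^ 2 ∂(leb K) ≤ 2 * K * ((2 * m + 4 * K) * (1 + energy K Q t)) := by
    intro t
    calc ∫ s, r t s ^ 2 ∂(leb K) ≤ ∫ s, (2 * m + 4 * K) * (1 + energy K Q t) ∂(leb K) := by
          refine integral_mono_ae (h.r_sq_slice_integrable_leb t) (integrable_const _) ?_
          filter_upwards [ae_restrict_mem measurableSet_Icc] with s hs using h.sq_le t hs
      _ = _ := by
          rw [setIntegral_const, Real.volume_real_Icc_of_le h.neg_le, smul_eq_mul]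
          ring
  calc _ ≤ ∫ t, 2 * K * ((2 * m + 4 * K) * (1 + energy K Q t)) ∂(lebT T) :=
        integral_mono h.r_sq_integrable.integral_prod_left
          ((((integrable_const 1).add h.energy_integrable).const_mul _).const_mul _) hle
    _ = 2 * K * ((2 * m + 4 * K) * ∫ t, (1 + energy K Q t) ∂(lebT T)) := by
        rw [integral_const_mul, integral_const_mul]
    _ ≤ _ := by
        have := h.integral_one_add_energy_le
        have := h.const_nonneg
        gcongr

theorem Curve.integral_abs_mul_le {K T m C : ℝ} {γ : Measure ℝ} {P : ℝ → FiniteMeasure ℝ}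
    {r Q B : ℝ → ℝ → ℝ} (h : Curve K T m C γ P r Q B) {D : ℝ → ℝ → ℝ}
    (hD : Integrable (fun z : ℝ × ℝ => D z.1 z.2 ^ 2) (lebProd T K))
    (hDC : ∫ z, D z.1 z.2 ^ 2 ∂(lebProd T K) ≤ C) :
    ∫ z, |r z.1 z.2 * D z.1 z.2| ∂(lebProd T K) ≤ 2 * K * ((2 * m + 4 * K) * (T + C)) + C := by
  have hle : ∫ z, |r z.1 z.2 * D z.1 z.2| ∂(lebProd T K) ≤
      ∫ z, (r z.1 z.2 ^ 2 + D z.1 z.2 ^ 2) ∂(lebProd T K) := by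
    refine integral_mono_of_nonneg (Eventually.of_forall fun z => abs_nonneg _)
      (h.r_sq_integrable.add hD) (Eventually.of_forall fun z => ?_)
    simp only
    rw [abs_le]
    constructor <;>
      nlinarith [sq_nonneg (r z.1 z.2 + D z.1 z.2), sq_nonneg (r z.1 z.2 - D z.1 z.2)]
  rw [integral_add h.r_sq_integrable hD] at hle
  linarith [h.integral_r_sq_le]

namespace CurveSeq

variable {K T m C : ℝ} {γ : ℕ → Measure ℝ} {P : ℕ → ℝ → FiniteMeasure ℝ} {r Q B : ℕ → ℝ → ℝ → ℝ}
  {f : ℝ → ℝ}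

theorem limit_mem (h : CurveSeq K T m C γ P r Q B)
    (hf : ∀ t ∈ Icc 0 T, Tendsto (fun n => massP K (P n) t) atTop (𝓝 (f t)))
    {t : ℝ} (ht : t ∈ Icc 0 T) : f t ∈ Icc 0 m :=
  isClosed_Icc.mem_of_tendsto (hf t ht) (Eventually.of_forall fun n => h.massP_mem n ht)

theorem limit_continuousOn (h : CurveSeq K T m C γ P r Q B)
    (hf : ∀ t ∈ Icc 0 T, Tendsto (fun n => massP K (P n) t) atTop (𝓝 (f t))) :
    ContinuousOn f (Icc 0 T) := by
  have := (h.absolutelyContinuous_of_tendsto hf).continuousOn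
  rwa [uIcc_of_le h.T_pos.le] at this

/-- Pointwise in time convergence of the measures. -/
theorem tendsto_integral_P (h : CurveSeq K T m C γ P r Q B)
    (hf : ∀ t ∈ Icc 0 T, Tendsto (fun n => massP K (P n) t) atTop (𝓝 (f t)))
    {φ : ℝ → ℝ} (hφ : Continuous φ) {t : ℝ} (ht : t ∈ Icc 0 T) :
    Tendsto (fun n => ∫ s, φ s ∂(P n t : Measure ℝ)) atTop
      (𝓝 (φ K * f t + φ (-K) * (m - f t))) := by
  have hw := weight_continuous K
  -- Subtracting the affine interpolation of φ(±K) leaves a function vanishing at ±K, which no limit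
  -- mass can see. The affine part is expressed through the mass at K and the total mass m.
  set ψ : ℝ → ℝ := fun s => φ s - (φ K * weight K s + φ (-K) * (1 - weight K s)) with hψ
  have hψc : Continuous ψ := by fun_prop
  have h1 : Tendsto (fun n => ∫ s, ψ s ∂(P n t : Measure ℝ)) atTop (𝓝 0) := by
    rw [Metric.tendsto_atTop]
    intro e he
    obtain ⟨n₀, hn₀⟩ := eventually_atTop.1 (h.eventually_integral_abs_le hψc
      (by simp [hψ, h.weight_right]) (by simp [hψ, weight_left]) (half_pos he))
    refine ⟨n₀, fun n hn => ?_⟩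
    rw [Real.dist_eq, sub_zero]
    have := abs_integral_le_integral_abs.trans (hn₀ n hn t ht)
    linarith
  have h2 : Tendsto (fun n => φ K * massP K (P n) t + φ (-K) * (m - massP K (P n) t)) atTop
      (𝓝 (φ K * f t + φ (-K) * (m - f t))) :=
    ((hf t ht).const_mul _).add (((hf t ht).const_sub m).const_mul _)
  have h3 := h1.add h2
  rw [zero_add] at h3
  refine h3.congr fun n => ?_
  have hc := h.curve n
  have i1 : Integrable φ (P n t : Measure ℝ) := hc.integrable_P ht hφ.continuousOn
  have i2 : Integrable (weight K) (P n t : Measure ℝ) := hc.integrable_P ht hw.continuousOn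
  have e : ψ = fun s => (φ s - (φ K - φ (-K)) * weight K s) - φ (-K) := by
    ext s; simp only [hψ]; ring
  have i3 : Integrable (fun s => φ s - (φ K - φ (-K)) * weight K s) (P n t : Measure ℝ) :=
    i1.sub (i2.const_mul _)
  rw [e, integral_sub i3 (integrable_const _), integral_sub i1 (i2.const_mul _),
    integral_const_mul, integral_const, hc.P_real_univ ht, smul_eq_mul, massP]
  ring

/-- Convergence of the boundary values. -/
theorem tendsto_trace (h : CurveSeq K T m C γ P r Q B)
    (hf : ∀ t ∈ Icc 0 T, Tendsto (fun n => massP K (P n) t) atTop (𝓝 (f t))) :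
    Tendsto (fun n => ∫ t, |r n t K ^ 2 - 2 * f t| ∂(lebT T)) atTop (𝓝 0) ∧
      Tendsto (fun n => ∫ t, |r n t (-K) ^ 2 - 2 * (m - f t)| ∂(lebT T)) atTop (𝓝 0) := by
  have hT := h.T_pos
  have hfc := h.limit_continuousOn hf
  have hfi : Integrable f (lebT T) :=
    (hfc.integrableOn_compact isCompact_Icc).mono_set Ioo_subset_Icc_self
  have hMi : ∀ n, Integrable (massP K (P n)) (lebT T) := fun n =>
    (((h.curve n).P_cont _ (weight_continuous K)).integrableOn_compact isCompact_Icc).mono_set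
      Ioo_subset_Icc_self
  have hdiff : Tendsto (fun n => ∫ t, |massP K (P n) t - f t| ∂(lebT T)) atTop (𝓝 0) := by
    have := tendsto_integral_of_dominated_convergence (μ := lebT T)
      (F := fun n t => |massP K (P n) t - f t|) (f := fun _ => (0 : ℝ)) (fun _ => 2 * m)
      (fun n => ((hMi n).sub hfi).abs.aestronglyMeasurable) (integrable_const _) ?_ ?_
    · simpa using this
    · intro n
      filter_upwards [ae_restrict_mem measurableSet_Ioo] with t ht
      have h1 := h.massP_mem n (Ioo_subset_Icc_self ht)
      have h2 := h.limit_mem hf (Ioo_subset_Icc_self ht)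
      rw [Real.norm_eq_abs, abs_abs, abs_le]
      constructor <;> linarith [h1.1, h1.2, h2.1, h2.2]
    · filter_upwards [ae_restrict_mem measurableSet_Ioo] with t ht
      have := ((hf t (Ioo_subset_Icc_self ht)).sub_const (f t)).abs
      simpa using this
  have hbd : Tendsto (fun n => 2 * (2 * √(2 * m + 4 * K) * bdErr K (γ n) * (T + C))
      + 2 * ∫ t, |massP K (P n) t - f t| ∂(lebT T)) atTop (𝓝 0) := by
    have h1 := ((h.tendsto_bdErr.const_mul (2 * √(2 * m + 4 * K))).mul_const (T + C)).const_mul 2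
    simpa using h1.add (hdiff.const_mul 2)
  -- Common to both ends: R/2 - F is the trace error, of size `bdErr` times 1 + E, and F - f₁ is the
  -- convergence error of the mass. Both vanish in L¹(0,T).
  have gen : ∀ (R F : ℕ → ℝ → ℝ), (∀ n, ∀ᵐ t ∂(lebT T), |R n t / 2 - F n t| ≤
        2 * √(2 * m + 4 * K) * bdErr K (γ n) * (1 + energy K (Q n) t)) →
      ∀ f₁ : ℝ → ℝ, (∀ n t, |F n t - f₁ t| = |massP K (P n) t - f t|) →
      Tendsto (fun n => ∫ t, |R n t - 2 * f₁ t| ∂(lebT T)) atTop (𝓝 0) := by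
    intro R F hR f₁ hF
    refine squeeze_zero (fun n => integral_nonneg fun t => abs_nonneg _) (fun n => ?_) hbd
    have hc := h.curve n
    set c := 2 * √(2 * m + 4 * K) * bdErr K (γ n) with hcdef
    have hc0 : 0 ≤ c := by
      have : 0 ≤ bdErr K (γ n) := Real.sqrt_nonneg _
      positivity
    have iA : Integrable (fun t => 1 + energy K (Q n) t) (lebT T) :=
      (integrable_const 1).add hc.energy_integrable
    have iM : Integrable (fun t => |massP K (P n) t - f t|) (lebT T) := ((hMi n).sub hfi).abs
    calc ∫ t, |R n t - 2 * f₁ t| ∂(lebT T)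
        ≤ ∫ t, (2 * (c * (1 + energy K (Q n) t)) + 2 * |massP K (P n) t - f t|) ∂(lebT T) := by
          refine integral_mono_of_nonneg (Eventually.of_forall fun t => abs_nonneg _)
            (((iA.const_mul c).const_mul 2).add (iM.const_mul 2)) ?_
          filter_upwards [hR n] with t ht
          rw [← hF n t]
          have e : R n t - 2 * f₁ t = 2 * (R n t / 2 - F n t) + 2 * (F n t - f₁ t) := by ring
          rw [e]
          refine (abs_add_le _ _).trans ?_
          rw [abs_mul, abs_mul, abs_two]
          linarith
      _ = 2 * (c * ∫ t, (1 + energy K (Q n) t) ∂(lebT T))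
          + 2 * ∫ t, |massP K (P n) t - f t| ∂(lebT T) := by
          rw [integral_add ((iA.const_mul c).const_mul 2) (iM.const_mul 2), integral_const_mul,
            integral_const_mul, integral_const_mul]
      _ ≤ _ := by
          have := hc.integral_one_add_energy_le
          gcongr
  constructor
  · refine gen (fun n t => r n t K ^ 2) (fun n => massP K (P n)) (fun n => ?_) f (fun n t => rfl)
    have hc := h.curve n
    filter_upwards [hc.P_eq] with t ht
    have := (hc.trace_le (h.sym n) t).1
    rwa [← ht _ (weight_continuous K)] at this
  · refine gen (fun n t => r n t (-K) ^ 2) (fun n t => m - massP K (P n) t) (fun n => ?_)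
      (fun t => m - f t) (fun n t => ?_)
    · have hc := h.curve n
      filter_upwards [hc.P_eq, ae_restrict_mem measurableSet_Ioo] with t ht htm
      have ht' := Ioo_subset_Icc_self htm
      have := (hc.trace_le (h.sym n) t).2
      have hw := weight_continuous K
      rw [← ht (fun s => 1 - weight K s) (by fun_prop), integral_sub (integrable_const _)
        (hc.integrable_P ht' hw.continuousOn), integral_const, hc.P_real_univ ht', smul_eq_mul,
        mul_one] at this
      exact this
    · rw [show m - massP K (P n) t - (m - f t) = -(massP K (P n) t - f t) by ring, abs_neg]

/-- Weak convergence of the fluxes. -/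
theorem tendsto_flux (h : CurveSeq K T m C γ P r Q B)
    (hf : ∀ t ∈ Icc 0 T, Tendsto (fun n => massP K (P n) t) atTop (𝓝 (f t)))
    {φ : ℝ × ℝ → ℝ} (hφ : Continuous φ) :
    Tendsto (fun n => ∫ z, φ z * (r n z.1 z.2 * B n z.1 z.2) ∂(lebProd T K)) atTop
      (𝓝 (∫ z, φ z * deriv f z.1 ∂(lebProd T K))) := by
  have hT := h.T_pos
  have hK := h.K_pos
  have hac := h.absolutelyContinuous_of_tendsto hf
  have hdi : Integrable (deriv f) (lebT T) := by
    have := hac.intervalIntegrable_deriv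
    rwa [intervalIntegrable_iff_integrableOn_Ioo_of_le hT.le] at this
  refine tendsto_integral_of_tendsto_step hT
    (W := fun n z => r n z.1 z.2 * B n z.1 z.2) (W₀ := fun z => deriv f z.1)
    (V := 2 * K * ((2 * m + 4 * K) * (T + C)) + C)
    (fun n => (h.curve n).rB_integrable)
    (fun n => (h.curve n).integral_abs_mul_le (h.curve n).B_int (h.curve n).B_le)
    (hdi.comp_fst _) ?_ hφ
  intro g hg t₁ ht₁ t₂ ht₂ hle
  -- By the continuity equation the average of the flux against g over [t₁, t₂] is the increment of
  -- ∫ ψ dP_n, so it converges to ψ(K)(f(t₂) - f(t₁)). Absolute continuity of f rewrites this as an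
  -- integral of f' and excludes a singular flux.
  set ψ : ℝ → ℝ := fun s => ∫ x in (-K)..s, g x with hψ
  have hψc : Continuous ψ := intervalIntegral.continuous_primitive
    (fun _ _ => hg.intervalIntegrable _ _) _
  have h1 := (h.tendsto_integral_P hf hψc ht₂).sub (h.tendsto_integral_P hf hψc ht₁)
  have e1 : ∫ t in t₁..t₂, ∫ s, g s * deriv f t ∂(leb K) =
      ψ K * f t₂ + ψ (-K) * (m - f t₂) - (ψ K * f t₁ + ψ (-K) * (m - f t₁)) := by
    have hψ0 : ψ (-K) = 0 := by simp [hψ]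
    have hac' : AbsolutelyContinuousOnInterval f t₁ t₂ := hac.mono (by
      rw [uIcc_of_le hle, uIcc_of_le hT.le]; exact Icc_subset_Icc ht₁.1 ht₂.2)
    have e2 : ∀ t, ∫ s, g s * deriv f t ∂(leb K) = ψ K * deriv f t := by
      intro t
      rw [integral_mul_const, integral_Icc_eq_integral_Ioc,
        ← intervalIntegral.integral_of_le (by linarith)]
    simp_rw [e2]
    rw [intervalIntegral.integral_const_mul, hac'.integral_deriv_eq_sub, hψ0]
    ring
  simp only
  rw [e1]
  refine h1.congr fun n => ?_
  exact (h.curve n).integral_P_sub hg ht₁ ht₂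

end CurveSeq

/-! ### Representation of limit functionals by densities, and functions determined by their moments.
-/

open scoped BoundedContinuousFunction

/-- A linear functional on bounded continuous functions that is dominated by an `L²` norm is given
by an `L²` density; if it is moreover dominated by the `L¹` norm, the density is bounded. -/
theorem exists_memLp_two_of_abs_le {X : Type*} [TopologicalSpace X] [NormalSpace X]
    [MeasurableSpace X] [BorelSpace X] [SecondCountableTopologyEither X ℝ] (ν : Measure X)
    [IsFiniteMeasure ν] [ν.WeaklyRegular] (L : (X →ᵇ ℝ) →ₗ[ℝ] ℝ) {c : ℝ}
    (hL : ∀ φ, |L φ| ≤ c * √(∫ x, φ x ^ 2 ∂ν)) :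
    ∃ q : X → ℝ, Measurable q ∧ MemLp q 2 ν ∧ (∀ φ : X →ᵇ ℝ, L φ = ∫ x, φ x * q x ∂ν) ∧
      ∀ b : ℝ, (∀ φ, |L φ| ≤ b * ∫ x, |φ x| ∂ν) → ∀ᵐ x ∂ν, |q x| ≤ b := by
  set e := BoundedContinuousFunction.toLp (E := ℝ) 2 ν ℝ
  have hd : DenseRange e := BoundedContinuousFunction.toLp_denseRange ℝ ν ℝ (by norm_num)
  have hee : ∀ φ, e φ =ᵐ[ν] φ := fun φ => BoundedContinuousFunction.coeFn_toLp 2 ν ℝ φ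
  have hnorm : ∀ φ, ‖e φ‖ = √(∫ x, φ x ^ 2 ∂ν) := by
    intro φ
    rw [@norm_eq_sqrt_real_inner, L2.inner_def]
    congr 1
    refine integral_congr_ae ((hee φ).mono fun x hx => ?_)
    simp [hx, sq]
  have hbd : ∃ C, ∀ φ, ‖L φ‖ ≤ C * ‖e φ‖ := ⟨c, fun φ => by rw [hnorm]; exact hL φ⟩
  -- Continuous functions are dense in L², so L extends to a bounded functional there; the density q
  -- is its Riesz representative.
  set L' := L.extendOfNorm e.toLinearMap
  have hL' : ∀ φ, L' (e φ) = L φ := fun φ => LinearMap.extendOfNorm_eq (e := e.toLinearMap)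
    hd hbd φ
  set q := (InnerProductSpace.toDual ℝ (Lp ℝ 2 ν)).symm L'
  have hq : ∀ g, L' g = ∫ x, g x * q x ∂ν := by
    intro g
    rw [← InnerProductSpace.toDual_symm_apply, L2.inner_def]
    rfl
  have hqm : MemLp q 2 ν := Lp.memLp q
  refine ⟨q, (Lp.stronglyMeasurable q).measurable, hqm, fun φ => ?_, fun b hb => ?_⟩
  · rw [← hL', hq]
    exact integral_congr_ae ((hee φ).mono fun x hx => by simp only [hx])
  -- extension of the `L¹` bound to all of `L²`
  have habs : ∀ g : Lp ℝ 2 ν, ∫ x, |g x| ∂ν = inner ℝ (Lp.const 2 ν (1 : ℝ)) |g| := by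
    intro g
    rw [L2.inner_def]
    refine integral_congr_ae ?_
    filter_upwards [Lp.coeFn_abs g, Lp.coeFn_const 2 ν (1 : ℝ)] with x h1 h2
    rw [h2, h1]
    simp
  have hext : ∀ g : Lp ℝ 2 ν, |L' g| ≤ b * ∫ x, |g x| ∂ν := by
    intro g
    refine hd.induction_on (p := fun g => |L' g| ≤ b * ∫ x, |g x| ∂ν) g ?_ fun φ => ?_
    · simp_rw [habs]
      refine isClosed_le (by fun_prop) (continuous_const.mul
        (continuous_const.inner ?_))
      exact continuous_id.sup continuous_neg
    · have e1 : ∫ x, |e φ x| ∂ν = ∫ x, |φ x| ∂ν :=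
        integral_congr_ae ((hee φ).mono fun x hx => by simp only [hx])
      rw [hL', e1]
      exact hb φ
  have hqi : Integrable q ν := hqm.integrable one_le_two
  -- Indicators of measurable sets bound the averages of q on every set by b, which bounds q itself
  -- almost everywhere.
  have hset : ∀ s, MeasurableSet s → |∫ x in s, q x ∂ν| ≤ b * ν.real s := by
    intro s hs
    have h1 := hext (indicatorConstLp 2 hs (measure_ne_top ν s) (1 : ℝ))
    have hi := indicatorConstLp_coeFn (p := 2) (hs := hs) (hμs := measure_ne_top ν s) (c := (1 : ℝ))
    have e1 : L' (indicatorConstLp 2 hs (measure_ne_top ν s) (1 : ℝ)) = ∫ x in s, q x ∂ν := by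
      rw [hq, ← integral_indicator hs]
      refine integral_congr_ae (hi.mono fun x hx => ?_)
      simp only [hx]
      by_cases h : x ∈ s <;> simp [h]
    have e2 : ∫ x, |indicatorConstLp 2 hs (measure_ne_top ν s) (1 : ℝ) x| ∂ν = ν.real s := by
      rw [← integral_indicator_one hs]
      refine integral_congr_ae (hi.mono fun x hx => ?_)
      simp only [hx]
      by_cases h : x ∈ s <;> simp [h]
    rwa [e1, e2] at h1
  have hle : q ≤ᵐ[ν] fun _ => b := ae_le_of_forall_setIntegral_le hqi (integrable_const b)
    fun s hs _ => by
      rw [setIntegral_const, smul_eq_mul, mul_comm]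
      exact (le_abs_self _).trans (hset s hs)
  have hge : (fun _ => -b) ≤ᵐ[ν] q := ae_le_of_forall_setIntegral_le (integrable_const _) hqi
    fun s hs _ => by
      rw [setIntegral_const, smul_eq_mul, mul_comm, neg_mul]
      exact (abs_le.1 (hset s hs)).1
  filter_upwards [hle, hge] with x h1 h2 using abs_le.2 ⟨h2, h1⟩

/-- Two densities with the same integrals against test functions have the same integral over
every measurable set. -/
theorem setIntegral_eq_of_forall_contDiff {α β : Measure ℝ} [IsFiniteMeasure α] [IsFiniteMeasure β]
    {G R : ℝ → ℝ} (hG : Integrable G α) (hR : Integrable R β)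
    (h : ∀ a : ℝ → ℝ, ContDiff ℝ ∞ a → HasCompactSupport a →
      ∫ t, a t * G t ∂α = ∫ t, a t * R t ∂β) {s : Set ℝ} (hs : MeasurableSet s) :
    ∫ t in s, G t ∂α = ∫ t in s, R t ∂β := by
  -- Both sides become densities with respect to the common measure α + β, where smooth test
  -- functions separate integrable functions.
  have h1 : α ≪ α + β := Measure.AbsolutelyContinuous.rfl.add_right β
  have h2 : β ≪ α + β := by
    rw [add_comm]; exact Measure.AbsolutelyContinuous.rfl.add_right α
  have i1 : ∀ {f : ℝ → ℝ}, Integrable f α →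
      Integrable (fun t => (α.rnDeriv (α + β) t).toReal * f t) (α + β) := fun hf =>
    (integrable_rnDeriv_smul_iff h1).2 hf
  have i2 : ∀ {f : ℝ → ℝ}, Integrable f β →
      Integrable (fun t => (β.rnDeriv (α + β) t).toReal * f t) (α + β) := fun hf =>
    (integrable_rnDeriv_smul_iff h2).2 hf
  have hz : ∀ᵐ t ∂(α + β), (α.rnDeriv (α + β) t).toReal * G t -
      (β.rnDeriv (α + β) t).toReal * R t = 0 := by
    refine ae_eq_zero_of_integral_contDiff_smul_eq_zero
      ((i1 hG).sub (i2 hR)).locallyIntegrable fun a ha hac => ?_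
    obtain ⟨M, hM⟩ := hac.exists_bound_of_continuous ha.continuous
    have j1 : Integrable (fun t => a t * G t) α :=
      hG.bdd_mul ha.continuous.aestronglyMeasurable (Eventually.of_forall hM)
    have j2 : Integrable (fun t => a t * R t) β :=
      hR.bdd_mul ha.continuous.aestronglyMeasurable (Eventually.of_forall hM)
    have e : (fun t => a t • ((α.rnDeriv (α + β) t).toReal * G t -
        (β.rnDeriv (α + β) t).toReal * R t)) = fun t =>
        (α.rnDeriv (α + β) t).toReal * (a t * G t) - (β.rnDeriv (α + β) t).toReal * (a t * R t) := by
      ext t; simp only [smul_eq_mul]; ring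
    rw [e, integral_sub (i1 j1) (i2 j2), integral_toReal_rnDeriv_mul h1,
      integral_toReal_rnDeriv_mul h2, h a ha hac, sub_self]
  have e1 := setIntegral_rnDeriv_smul (f := G) h1 hs
  have e2 := setIntegral_rnDeriv_smul (f := R) h2 hs
  rw [← e1, ← e2]
  refine integral_congr_ae (ae_restrict_of_ae (hz.mono fun t ht => ?_))
  simp only [smul_eq_mul]
  linarith

/-- An integrable function on `[-K, K]` with vanishing moments vanishes. -/
theorem ae_eq_zero_of_moments {K : ℝ} {f : ℝ → ℝ} (hf : Integrable f (leb K))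
    (h : ∀ k : ℕ, ∫ s, s ^ k * f s ∂(leb K) = 0) : ∀ᵐ s ∂(leb K), f s = 0 := by
  refine ae_eq_zero_of_integral_contDiff_smul_eq_zero hf.locallyIntegrable fun g hg _ => ?_
  have hpi : ∀ g : ℝ → ℝ, Continuous g → Integrable (fun s => g s * f s) (leb K) := by
    intro g hg
    obtain ⟨M, hM⟩ := (isCompact_Icc (a := -K) (b := K)).exists_bound_of_continuousOn hg.continuousOn
    exact hf.bdd_mul hg.aestronglyMeasurable ((ae_restrict_mem measurableSet_Icc).mono hM)
  have hp : ∀ p : Polynomial ℝ, ∫ s, p.eval s * f s ∂(leb K) = 0 := by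
    intro p
    simp_rw [Polynomial.eval_eq_sum_range, Finset.sum_mul]
    rw [integral_finsetSum]
    · refine Finset.sum_eq_zero fun k _ => ?_
      simp_rw [mul_assoc]
      rw [integral_const_mul, h, mul_zero]
    · intro k _
      exact hpi (fun s => p.coeff k * s ^ k) (by fun_prop)
  refine abs_eq_zero.1 (le_antisymm (le_of_forall_pos_le_add fun e he => ?_) (abs_nonneg _))
  -- Weierstrass approximation; the 1 in the denominator covers a vanishing norm of f.
  obtain ⟨p, hpe⟩ := exists_polynomial_near_of_continuousOn (-K) K g hg.continuous.continuousOn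
    (e / (1 + ∫ s, |f s| ∂(leb K))) (by positivity)
  have hN : 0 ≤ ∫ s, |f s| ∂(leb K) := integral_nonneg fun s => abs_nonneg _
  have e1 : ∫ s, g s • f s ∂(leb K) = ∫ s, (g s - p.eval s) * f s ∂(leb K) := by
    simp_rw [sub_mul, smul_eq_mul]
    rw [integral_sub (hpi g hg.continuous) (hpi _ p.continuous), hp, sub_zero]
  rw [e1, zero_add, ← Real.norm_eq_abs]
  calc _ ≤ ∫ s, e / (1 + ∫ s, |f s| ∂(leb K)) * |f s| ∂(leb K) := by
        refine norm_integral_le_of_norm_le (hf.abs.const_mul _) ?_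
        filter_upwards [ae_restrict_mem measurableSet_Icc] with s hs
        rw [norm_mul, Real.norm_eq_abs, Real.norm_eq_abs, abs_sub_comm]
        exact mul_le_mul_of_nonneg_right (hpe s hs).le (abs_nonneg _)
    _ = e / (1 + ∫ s, |f s| ∂(leb K)) * ∫ s, |f s| ∂(leb K) := integral_const_mul _ _
    _ ≤ e := by
        rw [div_mul_eq_mul_div, div_le_iff₀ (by positivity)]
        nlinarith

/-- A weak derivative and traces are characterised by the moments. -/
theorem hasWeakDeriv_and_hasTraces_of_moments {K : ℝ} (hK : 0 < K) {f q : ℝ → ℝ} {y z : ℝ}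
    (hf : Integrable f (leb K)) (hq : Integrable q (leb K))
    (h : ∀ k : ℕ, ∫ s, (s ^ k * q s + k * s ^ (k - 1) * f s) ∂(leb K) = K ^ k * z - (-K) ^ k * y) :
    HasWeakDeriv (-K) K f q ∧ HasTraces (-K) K f y z := by
  have hKK : -K < K := by linarith
  have hqi : IntervalIntegrable q volume (-K) K := by
    rw [intervalIntegrable_iff_integrableOn_Icc_of_le hKK.le]; exact hq
  have hmul : ∀ {w : ℝ → ℝ}, Integrable w (leb K) → ∀ g : ℝ → ℝ, Continuous g →
      Integrable (fun s => g s * w s) (leb K) := by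
    intro w hw g hg
    obtain ⟨M, hM⟩ := (isCompact_Icc (a := -K) (b := K)).exists_bound_of_continuousOn hg.continuousOn
    exact hw.bdd_mul hg.aestronglyMeasurable ((ae_restrict_mem measurableSet_Icc).mono hM)
  set p : ℝ → ℝ := fun x => y + ∫ u in (-K)..x, q u with hp
  have hpc : ContinuousOn p (Icc (-K) K) := by
    have := intervalIntegral.continuousOn_primitive_interval' hqi left_mem_uIcc
    rw [uIcc_of_le hKK.le] at this
    exact continuousOn_const.add this
  have hpi : Integrable p (leb K) := hpc.integrableOn_Icc
  -- Compare f with the primitive p of q starting from y. For k = 0 the left side vanishes, so z =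
  -- p(K); for k + 1 the identity then says that the k-th moment of f - p is zero. The truncated
  -- exponent at k = 0 is harmless because of the factor k.
  have key : ∀ k : ℕ, ∫ s, (k * s ^ (k - 1)) * (f s - p s) ∂(leb K) = K ^ k * (z - p K) := by
    intro k
    have h1 := integral_deriv_mul_primitive y hqi (φ := fun s => s ^ k) (by fun_prop)
    have e1 : ∀ x : ℝ, deriv (fun s : ℝ => s ^ k) x = k * x ^ (k - 1) := fun x => by simp
    simp only [e1] at h1
    rw [intervalIntegral.integral_of_le hKK.le, ← integral_Icc_eq_integral_Ioc] at h1
    have h2 := h k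
    have c1 : Continuous fun s : ℝ => (k : ℝ) * s ^ (k - 1) := by fun_prop
    have c2 : Continuous fun s : ℝ => s ^ k := by fun_prop
    rw [integral_add (hmul hq _ c2) (hmul hf _ c1)] at h2
    have h3 : ∫ s, (k * s ^ (k - 1) * p s + s ^ k * q s) ∂(leb K) = K ^ k * p K - (-K) ^ k * y := h1
    rw [integral_add (hmul hpi _ c1) (hmul hq _ c2)] at h3
    simp_rw [mul_sub]
    rw [integral_sub (hmul hf _ c1) (hmul hpi _ c1)]
    linarith
  have hz : z = p K := by
    have := key 0
    simp at this
    linarith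
  have hae : ∀ᵐ s ∂(leb K), f s - p s = 0 := by
    refine ae_eq_zero_of_moments (hf.sub hpi) fun k => ?_
    have := key (k + 1)
    rw [hz, sub_self, mul_zero] at this
    simp_rw [mul_assoc] at this
    rw [integral_const_mul] at this
    have hk : ((k + 1 : ℕ) : ℝ) ≠ 0 := by positivity
    simpa [hk] using (mul_eq_zero.1 this).resolve_left hk
  have hae' : ∀ᵐ x ∂(volume.restrict (Ioo (-K) K)), f x = y + ∫ u in (-K)..x, q u :=
    ae_restrict_of_ae_restrict_of_subset Ioo_subset_Icc_self
      (hae.mono fun s hs => by simpa [hp, sub_eq_zero] using hs)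
  have hq' : IntegrableOn q (Ioo (-K) K) := IntegrableOn.mono_set hq Ioo_subset_Icc_self
  have t := hasTraces_of_ae_eq_primitive hKK hq' hae'
  rw [hz]
  exact ⟨hasWeakDeriv_of_ae_eq_primitive hKK hq' hae', t⟩

/-! ### Weak-* limits of r² and its derivative, controlled by the energy measures. -/

open Curve
open scoped BoundedContinuousFunction

theorem ae_mem_lebProd (T K : ℝ) :
    ∀ᵐ z : ℝ × ℝ ∂(lebProd T K), z ∈ Icc (0 : ℝ) T ×ˢ Icc (-K) K := by
  have h1 : ∀ᵐ z : ℝ × ℝ ∂(lebProd T K), z.2 ∈ Icc (-K) K :=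
    Measure.quasiMeasurePreserving_snd.ae (ae_restrict_mem measurableSet_Icc)
  have h2 : ∀ᵐ z : ℝ × ℝ ∂(lebProd T K), z.1 ∈ Ioo 0 T :=
    Measure.quasiMeasurePreserving_fst.ae (ae_restrict_mem measurableSet_Ioo)
  filter_upwards [h1, h2] with z a b using ⟨⟨b.1.le, b.2.le⟩, a⟩

theorem integrable_mul_lebProd {T K : ℝ} {φ W : ℝ × ℝ → ℝ} (hφ : Continuous φ)
    (hW : Integrable W (lebProd T K)) : Integrable (fun z => φ z * W z) (lebProd T K) := by
  obtain ⟨M, hM⟩ := (isCompact_Icc.prod isCompact_Icc).exists_bound_of_continuousOn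
    (s := Icc (0 : ℝ) T ×ˢ Icc (-K) K) hφ.continuousOn
  exact hW.bdd_mul hφ.aestronglyMeasurable ((ae_mem_lebProd T K).mono hM)

/-- Weak-* sequential compactness of a bounded sequence of densities. -/
theorem exists_subseq_tendsto_integral {T K V : ℝ} {W : ℕ → ℝ × ℝ → ℝ}
    (hW : ∀ n, Integrable (W n) (lebProd T K)) (hV : ∀ n, ∫ z, |W n z| ∂(lebProd T K) ≤ V) :
    ∃ σ : ℕ → ℕ, StrictMono σ ∧ ∃ L : C(ℝ × ℝ, ℝ) → ℝ, ∀ φ : C(ℝ × ℝ, ℝ),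
      Tendsto (fun n => ∫ z, φ z * W (σ n) z ∂(lebProd T K)) atTop (𝓝 (L φ)) := by
  have hV0 : 0 ≤ V := (integral_nonneg fun z => abs_nonneg _).trans (hV 0)
  have hc : IsCompact (Icc (0 : ℝ) T ×ˢ Icc (-K) K) := isCompact_Icc.prod isCompact_Icc
  have hle : ∀ (φ : ℝ × ℝ → ℝ) (M : ℝ), 0 ≤ M → (∀ z ∈ Icc (0 : ℝ) T ×ˢ Icc (-K) K, |φ z| ≤ M) →
      ∀ n, |∫ z, φ z * W n z ∂(lebProd T K)| ≤ M * V := by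
    intro φ M hM hφ n
    calc |∫ z, φ z * W n z ∂(lebProd T K)| ≤ ∫ z, M * |W n z| ∂(lebProd T K) := by
          rw [← Real.norm_eq_abs]
          refine norm_integral_le_of_norm_le ((hW n).abs.const_mul M) ?_
          filter_upwards [ae_mem_lebProd T K] with z hz
          rw [norm_mul, Real.norm_eq_abs, Real.norm_eq_abs]
          exact mul_le_mul_of_nonneg_right (hφ z hz) (abs_nonneg _)
      _ = M * ∫ z, |W n z| ∂(lebProd T K) := integral_const_mul _ _
      _ ≤ M * V := mul_le_mul_of_nonneg_left (hV n) hM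
  have hbd : ∀ φ : C(ℝ × ℝ, ℝ), ∃ M, 0 ≤ M ∧
      ∀ z ∈ Icc (0 : ℝ) T ×ˢ Icc (-K) K, |φ z| ≤ M := by
    intro φ
    obtain ⟨M, hM⟩ := hc.exists_bound_of_continuousOn φ.continuous.continuousOn
    exact ⟨|M|, abs_nonneg _, fun z hz => (hM z hz).trans (le_abs_self M)⟩
  choose M hM0 hM using hbd
  -- C(ℝ², ℝ) with the compact-open topology is separable, and the functionals are equicontinuous
  -- there: all densities live on the same compact rectangle and have masses bounded by V.
  refine exists_subseq_tendsto_of_equicontinuous (X := C(ℝ × ℝ, ℝ))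
    (F := fun n φ => ∫ z, φ z * W n z ∂(lebProd T K)) (c := fun φ => M φ * V)
    (fun n φ => hle φ (M φ) (hM0 φ) (hM φ) n) fun φ e he => ?_
  have hu := ContinuousMap.tendsto_iff_forall_isCompact_tendstoUniformlyOn.1
    (tendsto_id (x := 𝓝 φ)) _ hc
  rw [Metric.tendstoUniformlyOn_iff] at hu
  filter_upwards [hu (e / (V + 1)) (by positivity)] with φ' hφ'
  refine Eventually.of_forall fun n => ?_
  have e1 : (∫ z, φ z * W n z ∂(lebProd T K)) - ∫ z, φ' z * W n z ∂(lebProd T K) =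
      ∫ z, (φ z - φ' z) * W n z ∂(lebProd T K) := by
    simp_rw [sub_mul]
    rw [integral_sub (integrable_mul_lebProd φ.continuous (hW n))
      (integrable_mul_lebProd φ'.continuous (hW n))]
  rw [e1]
  refine (hle _ (e / (V + 1)) (by positivity) (fun z hz => ?_) n).trans ?_
  · have := hφ' z hz
    rw [Real.dist_eq] at this
    exact this.le
  · rw [div_mul_eq_mul_div, div_le_iff₀ (by positivity)]
    nlinarith

namespace Curve

variable {K T m C : ℝ} {γ : Measure ℝ} {P : ℝ → FiniteMeasure ℝ} {r Q B : ℝ → ℝ → ℝ}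

theorem integrable_mul_one_add_energy (h : Curve K T m C γ P r Q B) {ψ : ℝ → ℝ}
    (hψ : Continuous ψ) : Integrable (fun t => ψ t * (1 + energy K Q t)) (lebT T) := by
  obtain ⟨M, hM⟩ := (isCompact_Icc (a := (0 : ℝ)) (b := T)).exists_bound_of_continuousOn
    hψ.continuousOn
  exact ((integrable_const 1).add h.energy_integrable).bdd_mul hψ.aestronglyMeasurable
    ((ae_restrict_mem measurableSet_Ioo).mono fun t ht => hM t (Ioo_subset_Icc_self ht))

theorem continuous_integral_leb {φ : ℝ × ℝ → ℝ} (hφ : Continuous φ) (K : ℝ) :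
    Continuous fun t => ∫ s, φ (t, s) ∂(leb K) :=
  continuous_parametric_integral_of_continuous (f := fun t s => φ (t, s)) (by exact hφ)
    isCompact_Icc

/-- The measures `r² dt ds` are controlled by the energy measure. -/
theorem abs_integral_mul_sq_le (h : Curve K T m C γ P r Q B) {φ : ℝ × ℝ → ℝ}
    (hφ : Continuous φ) :
    |∫ z, φ z * r z.1 z.2 ^ 2 ∂(lebProd T K)| ≤
      (2 * m + 4 * K) * ∫ t, (∫ s, |φ (t, s)| ∂(leb K)) * (1 + energy K Q t) ∂(lebT T) := by
  have hc := continuous_integral_leb hφ.abs K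
  have hi := integrable_mul_lebProd hφ h.r_sq_integrable
  rw [integral_prod _ hi, ← integral_const_mul, ← Real.norm_eq_abs]
  refine norm_integral_le_of_norm_le ((h.integrable_mul_one_add_energy hc).const_mul _)
    (Eventually.of_forall fun t => ?_)
  have hφt : Integrable (fun s => |φ (t, s)|) (leb K) :=
    (Continuous.continuousOn (by fun_prop)).integrableOn_Icc
  calc ‖∫ s, φ (t, s) * r t s ^ 2 ∂(leb K)‖
      ≤ ∫ s, |φ (t, s)| * ((2 * m + 4 * K) * (1 + energy K Q t)) ∂(leb K) := by
        refine norm_integral_le_of_norm_le (hφt.mul_const _) ?_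
        filter_upwards [ae_restrict_mem measurableSet_Icc] with s hs
        rw [norm_mul, Real.norm_eq_abs, Real.norm_of_nonneg (sq_nonneg _)]
        exact mul_le_mul_of_nonneg_left (h.sq_le t hs) (abs_nonneg _)
    _ = _ := by rw [integral_mul_const]; ring

/-- The measures `∂ₛ(r²) dt ds` are controlled by the energy measure. -/
theorem abs_integral_mul_deriv_le (h : Curve K T m C γ P r Q B) {φ : ℝ × ℝ → ℝ}
    (hφ : Continuous φ) :
    |∫ z, φ z * (2 * (r z.1 z.2 * Q z.1 z.2)) ∂(lebProd T K)| ≤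
      2 * √(2 * m + 4 * K) *
        ∫ t, √(∫ s, φ (t, s) ^ 2 ∂(leb K)) * (1 + energy K Q t) ∂(lebT T) := by
  have hc := (continuous_integral_leb (hφ.pow 2) K).sqrt
  have hi := integrable_mul_lebProd hφ (h.rQ_integrable.const_mul 2)
  rw [integral_prod _ hi, ← integral_const_mul, ← Real.norm_eq_abs]
  refine norm_integral_le_of_norm_le ((h.integrable_mul_one_add_energy hc).const_mul _)
    (Eventually.of_forall fun t => ?_)
  have hA := energy_nonneg K Q t
  have h0 := h.const_nonneg
  obtain ⟨M, hM⟩ := (isCompact_Icc (a := -K) (b := K)).exists_bound_of_continuousOn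
    (f := fun s => φ (t, s)) (Continuous.continuousOn (by fun_prop))
  have hφr : ContinuousOn (fun s => φ (t, s) * r t s) (Icc (-K) K) :=
    (Continuous.continuousOn (by fun_prop)).mul (h.r_continuousOn t)
  have hφt : Integrable (fun s => φ (t, s) ^ 2) (leb K) :=
    (Continuous.continuousOn (by fun_prop)).integrableOn_Icc
  have hφrQ : Integrable (fun s => φ (t, s) * r t s * Q t s) (leb K) := by
    have := (h.rQ_slice_integrable t).bdd_mul (c := M) (f := fun s => φ (t, s))
      (Continuous.aestronglyMeasurable (by fun_prop)) ((ae_restrict_mem measurableSet_Icc).mono hM)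
    exact this.congr (Eventually.of_forall fun s => by simp only; ring)
  -- One square root of the energy comes from the bound of r, the other from Q. What remains of φ is
  -- its L²-norm in s, integrated against the energy measure; this gives the limit derivative an L²
  -- density.
  have hcs := sq_integral_mul_le (μ := leb K) (f := fun s => φ (t, s) * r t s) (g := Q t)
    (hφr.pow 2).integrableOn_Icc (h.Q_sq_integrable t) hφrQ
  have hle : ∫ s, (φ (t, s) * r t s) ^ 2 ∂(leb K) ≤
      ((2 * m + 4 * K) * (1 + energy K Q t)) * ∫ s, φ (t, s) ^ 2 ∂(leb K) := by
    rw [← integral_const_mul]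
    refine integral_mono_ae (hφr.pow 2).integrableOn_Icc (hφt.const_mul _) ?_
    filter_upwards [ae_restrict_mem measurableSet_Icc] with s hs
    have := h.sq_le t hs
    simp only [mul_pow]
    nlinarith [sq_nonneg (φ (t, s))]
  have e1 : ∫ s, φ (t, s) * (2 * (r t s * Q t s)) ∂(leb K) =
      2 * ∫ s, φ (t, s) * r t s * Q t s ∂(leb K) := by
    rw [← integral_const_mul]
    congr 1; ext s; ring
  set I := ∫ s, φ (t, s) ^ 2 ∂(leb K)
  have hI : 0 ≤ I := integral_nonneg fun s => sq_nonneg _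
  change |∫ s, φ (t, s) * (2 * (r t s * Q t s)) ∂(leb K)| ≤
    2 * √(2 * m + 4 * K) * (√I * (1 + energy K Q t))
  rw [e1, abs_mul, abs_two, mul_assoc]
  refine mul_le_mul_of_nonneg_left ?_ zero_le_two
  refine abs_le_of_sq_le_sq ?_ (by positivity)
  rw [mul_pow, mul_pow, Real.sq_sqrt h0, Real.sq_sqrt hI]
  refine hcs.trans ?_
  have hE : ∫ s, Q t s ^ 2 ∂(leb K) = energy K Q t := rfl
  rw [hE]
  calc _ ≤ ((2 * m + 4 * K) * (1 + energy K Q t) * I) * (1 + energy K Q t) := by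
        refine mul_le_mul hle (by linarith) hA (by positivity)
    _ = _ := by ring

end Curve

open Curve
open scoped BoundedContinuousFunction

namespace Curve

variable {K T m C : ℝ} {γ : Measure ℝ} {P : ℝ → FiniteMeasure ℝ} {r Q B : ℝ → ℝ → ℝ}

theorem measurable_energy (h : Curve K T m C γ P r Q B) : Measurable (energy K Q) := by
  have : StronglyMeasurable (Function.uncurry fun t s => Q t s ^ 2) :=
    (h.Q_meas.pow_const 2).stronglyMeasurable
  exact this.integral_prod_right.measurable

/-- The energy measure `(1 + ∫ Q² ds) dt`. -/
def energyMeasure (h : Curve K T m C γ P r Q B) : FiniteMeasure ℝ :=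
  ⟨(lebT T).withDensity fun t => ENNReal.ofReal (1 + energy K Q t),
    isFiniteMeasure_withDensity_ofReal ((integrable_const 1).add h.energy_integrable).2⟩

theorem integral_energyMeasure (h : Curve K T m C γ P r Q B) (ψ : ℝ → ℝ) :
    ∫ t, ψ t ∂(h.energyMeasure : Measure ℝ) = ∫ t, ψ t * (1 + energy K Q t) ∂(lebT T) := by
  have hm : Measurable fun t => ENNReal.ofReal (1 + energy K Q t) :=
    (measurable_const.add h.measurable_energy).ennreal_ofReal
  change ∫ t, ψ t ∂((lebT T).withDensity fun t => ENNReal.ofReal (1 + energy K Q t)) = _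
  rw [integral_withDensity_eq_integral_toReal_smul hm
    (Eventually.of_forall fun t => ENNReal.ofReal_lt_top)]
  congr 1
  ext t
  rw [ENNReal.toReal_ofReal (by linarith [energy_nonneg K Q t]), smul_eq_mul, mul_comm]

theorem mass_energyMeasure_le (h : Curve K T m C γ P r Q B) :
    h.energyMeasure.mass ≤ (T + C).toNNReal := by
  have h1 := h.integral_energyMeasure fun _ => 1
  simp only [one_mul, integral_const, smul_eq_mul, mul_one] at h1
  rw [← NNReal.coe_le_coe]
  have h2 : ((h.energyMeasure.mass : ℝ≥0) : ℝ) = (h.energyMeasure : Measure ℝ).real univ := rfl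
  rw [h2, h1]
  exact h.integral_one_add_energy_le.trans (Real.le_coe_toNNReal _)

theorem energyMeasure_compl (h : Curve K T m C γ P r Q B) : h.energyMeasure (Icc 0 T)ᶜ = 0 := by
  have h1 : ((lebT T).withDensity fun t => ENNReal.ofReal (1 + energy K Q t)) (Icc 0 T)ᶜ = 0 := by
    refine withDensity_absolutelyContinuous _ _ ?_
    rw [Measure.restrict_apply measurableSet_Icc.compl]
    have : (Icc 0 T)ᶜ ∩ Ioo 0 T = ∅ := by
      rw [← disjoint_iff_inter_eq_empty, disjoint_compl_left_iff_subset]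
      exact Ioo_subset_Icc_self
    rw [this, measure_empty]
  have h2 := FiniteMeasure.null_iff_toMeasure_null h.energyMeasure (Icc 0 T)ᶜ
  exact h2.2 h1

end Curve

namespace CurveSeq

variable {K T m C : ℝ} {γ : ℕ → Measure ℝ} {P : ℕ → ℝ → FiniteMeasure ℝ} {r Q B : ℕ → ℝ → ℝ → ℝ}
  {f : ℝ → ℝ}

/-- Limit points of the energy measures. -/
theorem exists_tendsto_energy (h : CurveSeq K T m C γ P r Q B) :
    ∃ α : FiniteMeasure ℝ, (α : Measure ℝ) (Icc 0 T)ᶜ = 0 ∧ ∀ ψ : ℝ → ℝ, Continuous ψ →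
      Tendsto (fun n => ∫ t, ψ t * (1 + energy K (Q n) t) ∂(lebT T)) (hyperfilter ℕ)
        (𝓝 (∫ t, ψ t ∂(α : Measure ℝ))) := by
  have hT := h.T_pos
  have hc := isCompact_setOfPred_finiteMeasure_le_of_isCompact (T + C).toNNReal
    (isCompact_Icc (a := (0 : ℝ)) (b := T))
  set μ : ℕ → FiniteMeasure ℝ := fun n => (h.curve n).energyMeasure
  -- Measures of bounded mass on [0, T] form a compact set, so the energy measures converge along
  -- any ultrafilter without extracting a further subsequence.
  obtain ⟨α, hα, hle⟩ := hc.ultrafilter_le_nhds ((hyperfilter ℕ).map μ) (by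
    rw [le_principal_iff]
    exact Eventually.of_forall (f := (hyperfilter ℕ : Filter ℕ)) fun n =>
      ⟨(h.curve n).mass_energyMeasure_le, (h.curve n).energyMeasure_compl⟩)
  have hα0 : (α : Measure ℝ) (Icc 0 T)ᶜ = 0 :=
    (FiniteMeasure.null_iff_toMeasure_null α _).1 hα.2
  refine ⟨α, hα0, fun ψ hψ => ?_⟩
  have ht : Tendsto μ (hyperfilter ℕ) (𝓝 α) := hle
  rw [FiniteMeasure.tendsto_iff_forall_integral_tendsto] at ht
  -- Weak convergence is tested with bounded functions; composing with the projection onto [0, T]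
  -- makes ψ bounded without changing it where the measures live.
  set ψ' : ℝ → ℝ := fun t => ψ (projIcc 0 T hT.le t) with hψ'
  have hψc : Continuous ψ' := hψ.comp (continuous_subtype_val.comp continuous_projIcc)
  obtain ⟨M, hM⟩ := (isCompact_Icc (a := (0 : ℝ)) (b := T)).exists_bound_of_continuousOn
    hψ.continuousOn
  have heq : ∀ t ∈ Icc 0 T, ψ' t = ψ t := fun t ht => by
    simp only [hψ', projIcc_of_mem hT.le ht]
  have := ht (BoundedContinuousFunction.ofNormedAddCommGroup ψ' hψc M fun t => hM _ (projIcc 0 T hT.le t).2)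
  have e1 : ∀ n, ∫ t, ψ' t ∂(μ n : Measure ℝ) = ∫ t, ψ t * (1 + energy K (Q n) t) ∂(lebT T) := by
    intro n
    rw [(h.curve n).integral_energyMeasure]
    refine integral_congr_ae ?_
    filter_upwards [ae_restrict_mem measurableSet_Ioo] with t ht
    rw [heq t (Ioo_subset_Icc_self ht)]
  have e2 : ∫ t, ψ' t ∂(α : Measure ℝ) = ∫ t, ψ t ∂(α : Measure ℝ) := by
    refine integral_congr_ae ?_
    have : ∀ᵐ t ∂(α : Measure ℝ), t ∈ Icc 0 T := by
      rw [ae_iff]; exact hα0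
    exact this.mono heq
  rw [← e2]
  refine this.congr fun n => ?_
  exact e1 n

/-- The weak-* limits of `r²` and `∂ₛ(r²)` have densities with respect to the limit of the energy
measures. -/
theorem exists_limit_density (h : CurveSeq K T m C γ P r Q B) :
    ∃ σ : ℕ → ℕ, StrictMono σ ∧ ∃ α : FiniteMeasure ℝ, (α : Measure ℝ) (Icc 0 T)ᶜ = 0 ∧
      ∃ p q : ℝ × ℝ → ℝ, Measurable p ∧ Measurable q ∧
        (∀ᵐ z ∂((α : Measure ℝ).prod (leb K)), |p z| ≤ 2 * m + 4 * K) ∧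
        MemLp q 2 ((α : Measure ℝ).prod (leb K)) ∧
        (∀ φ : ℝ × ℝ → ℝ, Continuous φ →
          Tendsto (fun n => ∫ z, φ z * r (σ n) z.1 z.2 ^ 2 ∂(lebProd T K)) atTop
            (𝓝 (∫ z, φ z * p z ∂((α : Measure ℝ).prod (leb K))))) ∧
        ∀ φ : ℝ × ℝ → ℝ, Continuous φ →
          Tendsto (fun n => ∫ z, φ z * (2 * (r (σ n) z.1 z.2 * Q (σ n) z.1 z.2)) ∂(lebProd T K))
            atTop (𝓝 (∫ z, φ z * q z ∂((α : Measure ℝ).prod (leb K)))) := by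
  have hT := h.T_pos
  have hK := h.K_pos
  have hKK : -K ≤ K := by linarith
  have hc0 := (h.curve 0).const_nonneg
  obtain ⟨σ₁, hσ₁, L₁, hL₁⟩ := exists_subseq_tendsto_integral
    (fun n => (h.curve n).r_sq_integrable)
    (fun n => by
      simp only [abs_of_nonneg (sq_nonneg (r n _ _))]
      exact (h.curve n).integral_r_sq_le)
  have h₁ := h.comp hσ₁
  obtain ⟨σ₂, hσ₂, L₂, hL₂⟩ := exists_subseq_tendsto_integral
    (fun n => (h₁.curve n).rQ_integrable.const_mul 2)
    (V := 2 * (2 * K * ((2 * m + 4 * K) * (T + C)) + C))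
    (fun n => by
      simp only [abs_mul, abs_two]
      rw [integral_const_mul]
      have := (h₁.curve n).integral_abs_mul_le (h₁.curve n).Q_int (h₁.curve n).Q_le
      simp only [abs_mul] at this
      linarith)
  have h₂ := h₁.comp hσ₂
  -- The functionals L₁ and L₂ are already limits of full sequences. Hence α only needs to be a
  -- limit along an ultrafilter finer than `atTop` for the bounds to pass to them.
  obtain ⟨α, hα, hαt⟩ := h₂.exists_tendsto_energy
  set ν : Measure (ℝ × ℝ) := (α : Measure ℝ).prod (leb K) with hν
  have hL₁' : ∀ φ : C(ℝ × ℝ, ℝ), Tendsto (fun n => ∫ z, φ z * r (σ₁ (σ₂ n)) z.1 z.2 ^ 2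
      ∂(lebProd T K)) atTop (𝓝 (L₁ φ)) := fun φ => (hL₁ φ).comp hσ₂.tendsto_atTop
  have hmem : ∀ᵐ z ∂ν, z ∈ Icc (0 : ℝ) T ×ˢ Icc (-K) K := by
    have h1 : ∀ᵐ z : ℝ × ℝ ∂ν, z.2 ∈ Icc (-K) K :=
      Measure.quasiMeasurePreserving_snd.ae (ae_restrict_mem measurableSet_Icc)
    have h2 : ∀ᵐ z : ℝ × ℝ ∂ν, z.1 ∈ Icc 0 T :=
      Measure.quasiMeasurePreserving_fst.ae (by rw [ae_iff]; exact hα)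
    filter_upwards [h1, h2] with z a b using ⟨b, a⟩
  have hiν : ∀ g : ℝ × ℝ → ℝ, Continuous g → Integrable g ν := by
    intro g hg
    obtain ⟨M, hM⟩ := (isCompact_Icc.prod isCompact_Icc).exists_bound_of_continuousOn
      (s := Icc (0 : ℝ) T ×ˢ Icc (-K) K) hg.continuousOn
    exact Integrable.of_bound hg.aestronglyMeasurable M (hmem.mono hM)
  have b1 : ∀ φ : C(ℝ × ℝ, ℝ), |L₁ φ| ≤ (2 * m + 4 * K) * ∫ z, |φ z| ∂ν := by
    intro φ
    rw [integral_prod _ (hiν _ φ.continuous.abs)]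
    refine le_of_tendsto_of_tendsto ((hL₁' φ).mono_left Nat.hyperfilter_le_atTop).abs
      ((hαt _ (continuous_integral_leb φ.continuous.abs K)).const_mul _)
      (Eventually.of_forall fun n => (h₂.curve n).abs_integral_mul_sq_le φ.continuous)
  -- Cauchy-Schwarz in time for the finite measure α replaces the L¹(α; L²(ds)) norm by the L² norm
  -- on the product.
  have hcs : ∀ φ : C(ℝ × ℝ, ℝ), ∫ t, √(∫ s, φ (t, s) ^ 2 ∂(leb K)) ∂(α : Measure ℝ) ≤
      √((α : Measure ℝ).real univ) * √(∫ z, φ z ^ 2 ∂ν) := by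
    intro φ
    have hi2 : Integrable (fun z => φ z ^ 2) ν := hiν _ (φ.continuous.pow 2)
    have hI : ∀ t, 0 ≤ ∫ s, φ (t, s) ^ 2 ∂(leb K) := fun t => integral_nonneg fun s => sq_nonneg _
    have hsq : ∀ t, √(∫ s, φ (t, s) ^ 2 ∂(leb K)) ^ 2 = ∫ s, φ (t, s) ^ 2 ∂(leb K) :=
      fun t => Real.sq_sqrt (hI t)
    have hi3 : Integrable (fun t => √(∫ s, φ (t, s) ^ 2 ∂(leb K)) ^ 2) (α : Measure ℝ) := by
      simp_rw [hsq]
      exact hi2.integral_prod_left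
    have hi4 : Integrable (fun t => (1 : ℝ) * √(∫ s, φ (t, s) ^ 2 ∂(leb K))) (α : Measure ℝ) := by
      simp_rw [one_mul]
      have hc := (continuous_integral_leb (φ.continuous.pow 2) K).sqrt
      refine (hi3.add (integrable_const 1)).mono' hc.aestronglyMeasurable
        (Eventually.of_forall fun t => ?_)
      rw [Real.norm_of_nonneg (Real.sqrt_nonneg _)]
      simp only [Pi.add_apply]
      nlinarith [sq_nonneg (√(∫ s, φ (t, s) ^ 2 ∂(leb K)) - 1), Real.sqrt_nonneg (∫ s, φ (t, s) ^ 2 ∂(leb K))]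
    have := sq_integral_mul_le (μ := (α : Measure ℝ)) (f := fun _ => 1)
      (g := fun t => √(∫ s, φ (t, s) ^ 2 ∂(leb K))) (integrable_const _) hi3 hi4
    simp_rw [hsq, one_mul, one_pow] at this
    rw [integral_const, smul_eq_mul, mul_one, ← integral_prod _ hi2] at this
    rw [← Real.sqrt_mul measureReal_nonneg]
    exact Real.le_sqrt_of_sq_le this
  have b2 : ∀ φ : C(ℝ × ℝ, ℝ), |L₂ φ| ≤
      2 * √(2 * m + 4 * K) * √((α : Measure ℝ).real univ) * √(∫ z, φ z ^ 2 ∂ν) := by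
    intro φ
    refine (le_of_tendsto_of_tendsto ((hL₂ φ).mono_left Nat.hyperfilter_le_atTop).abs
      ((hαt _ (continuous_integral_leb (φ.continuous.pow 2) K).sqrt).const_mul _)
      (Eventually.of_forall fun n =>
        (h₂.curve n).abs_integral_mul_deriv_le φ.continuous)).trans ?_
    rw [mul_assoc (2 * √(2 * m + 4 * K))]
    exact mul_le_mul_of_nonneg_left (hcs φ) (by positivity)
  -- The sharper L¹ bound for L₁ is weakened to an L² bound so that the Riesz representation
  -- applies; the L¹ bound is used afterwards to see that p is bounded.
  have b3 : ∀ φ : C(ℝ × ℝ, ℝ), |L₁ φ| ≤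
      (2 * m + 4 * K) * √(ν.real univ) * √(∫ z, φ z ^ 2 ∂ν) := by
    intro φ
    refine (b1 φ).trans ?_
    rw [mul_assoc]
    refine mul_le_mul_of_nonneg_left ?_ hc0
    have hi4 : Integrable (fun z => (1 : ℝ) * |φ z|) ν := by
      simp_rw [one_mul]; exact hiν _ φ.continuous.abs
    have := sq_integral_mul_le (μ := ν) (f := fun _ => 1) (g := fun z => |φ z|)
      (integrable_const _) (hiν _ (φ.continuous.abs.pow 2)) hi4
    simp_rw [sq_abs, one_mul, one_pow] at this
    rw [integral_const, smul_eq_mul, mul_one] at this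
    rw [← Real.sqrt_mul measureReal_nonneg]
    exact Real.le_sqrt_of_sq_le this
  -- linearity of the limits
  have hlin : ∀ (W : ℕ → ℝ × ℝ → ℝ) (_ : ∀ n, Integrable (W n) (lebProd T K))
      (L : C(ℝ × ℝ, ℝ) → ℝ) (_ : ∀ φ : C(ℝ × ℝ, ℝ),
        Tendsto (fun n => ∫ z, φ z * W n z ∂(lebProd T K)) atTop (𝓝 (L φ))),
      ∃ L' : (ℝ × ℝ →ᵇ ℝ) →ₗ[ℝ] ℝ, ∀ φ, L' φ = L φ.toContinuousMap := by
    intro W hW L hL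
    refine ⟨⟨⟨fun φ => L φ.toContinuousMap, fun φ ψ => ?_⟩, fun c φ => ?_⟩, fun φ => rfl⟩
    · refine tendsto_nhds_unique (hL _) (((hL _).add (hL _)).congr fun n => ?_)
      rw [← integral_add (integrable_mul_lebProd φ.toContinuousMap.continuous (hW n))
        (integrable_mul_lebProd ψ.toContinuousMap.continuous (hW n))]
      refine integral_congr_ae (Eventually.of_forall fun z => ?_)
      exact (add_mul _ _ _).symm
    · refine tendsto_nhds_unique (hL _) (((hL _).const_mul c).congr fun n => ?_)
      rw [← integral_const_mul]
      refine integral_congr_ae (Eventually.of_forall fun z => ?_)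
      exact (mul_assoc _ _ _).symm
  obtain ⟨Λ₁, hΛ₁⟩ := hlin _ (fun n => (h₂.curve n).r_sq_integrable) L₁ hL₁'
  obtain ⟨Λ₂, hΛ₂⟩ := hlin _ (fun n => (h₂.curve n).rQ_integrable.const_mul 2) L₂ hL₂
  obtain ⟨p, hpm, hp2, hp, hpb⟩ := exists_memLp_two_of_abs_le ν Λ₁
    (fun φ => by rw [hΛ₁]; exact b3 _)
  obtain ⟨q, hqm, hq2, hq, -⟩ := exists_memLp_two_of_abs_le ν Λ₂
    (fun φ => by rw [hΛ₂]; exact b2 _)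
  -- truncation of a continuous function outside of `[0, T] × [-K, K]`
  have htr : ∀ φ : ℝ × ℝ → ℝ, Continuous φ → ∃ φ' : ℝ × ℝ →ᵇ ℝ,
      ∀ z ∈ Icc (0 : ℝ) T ×ˢ Icc (-K) K, φ' z = φ z := by
    intro φ hφ
    obtain ⟨M, hM⟩ := (isCompact_Icc.prod isCompact_Icc).exists_bound_of_continuousOn
      (s := Icc (0 : ℝ) T ×ˢ Icc (-K) K) hφ.continuousOn
    have hc : Continuous fun z : ℝ × ℝ =>
        φ ((projIcc 0 T hT.le z.1 : ℝ), (projIcc (-K) K hKK z.2 : ℝ)) :=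
      hφ.comp (((continuous_subtype_val.comp continuous_projIcc).comp continuous_fst).prodMk
        ((continuous_subtype_val.comp continuous_projIcc).comp continuous_snd))
    refine ⟨BoundedContinuousFunction.ofNormedAddCommGroup _ hc M fun z =>
      hM _ ⟨(projIcc 0 T hT.le z.1).2, (projIcc (-K) K hKK z.2).2⟩, fun z hz => ?_⟩
    simp only [BoundedContinuousFunction.coe_ofNormedAddCommGroup]
    rw [projIcc_of_mem hT.le hz.1, projIcc_of_mem hKK hz.2]
  refine ⟨σ₁ ∘ σ₂, hσ₁.comp hσ₂, α, hα, p, q, hpm, hqm,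
    hpb _ fun φ => by rw [hΛ₁]; exact b1 _, hq2, fun φ hφ => ?_, fun φ hφ => ?_⟩
  · obtain ⟨φ', hφ'⟩ := htr φ hφ
    have e1 : ∫ z, φ z * p z ∂ν = L₁ φ'.toContinuousMap := by
      rw [← hΛ₁, hp]
      exact integral_congr_ae (hmem.mono fun z hz => by simp only [hφ' z hz])
    rw [e1]
    refine (hL₁' _).congr fun n => ?_
    refine integral_congr_ae ((ae_mem_lebProd T K).mono fun z hz => ?_)
    have := hφ' z hz
    change φ' z * _ = _
    rw [this]
    rfl
  · obtain ⟨φ', hφ'⟩ := htr φ hφ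
    have e1 : ∫ z, φ z * q z ∂ν = L₂ φ'.toContinuousMap := by
      rw [← hΛ₂, hq]
      exact integral_congr_ae (hmem.mono fun z hz => by simp only [hφ' z hz])
    rw [e1]
    refine (hL₂ _).congr fun n => ?_
    refine integral_congr_ae ((ae_mem_lebProd T K).mono fun z hz => ?_)
    have := hφ' z hz
    change φ' z * _ = _
    rw [this]
    rfl

end CurveSeq

/-! ### Decomposition of the limit into a Lebesgue part and a part singular in time. -/

open Curve

namespace Curve

variable {K T m C : ℝ} {γ : Measure ℝ} {P : ℝ → FiniteMeasure ℝ} {r Q B : ℝ → ℝ → ℝ}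

/-- Integration by parts against `a(t) s ^ k`. -/
theorem integral_moment (h : Curve K T m C γ P r Q B) {a : ℝ → ℝ} (ha : Continuous a) (k : ℕ) :
    (∫ z, (a z.1 * z.2 ^ k) * (2 * (r z.1 z.2 * Q z.1 z.2)) ∂(lebProd T K)) +
      ∫ z, (a z.1 * (k * z.2 ^ (k - 1))) * r z.1 z.2 ^ 2 ∂(lebProd T K) =
    ∫ t, a t * (K ^ k * r t K ^ 2 - (-K) ^ k * r t (-K) ^ 2) ∂(lebT T) := by
  have hK := h.neg_le
  have i1 := integrable_mul_lebProd (T := T) (K := K)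
    (φ := fun z => a z.1 * z.2 ^ k) (by fun_prop) (h.rQ_integrable.const_mul 2)
  have i2 := integrable_mul_lebProd (T := T) (K := K)
    (φ := fun z => a z.1 * (k * z.2 ^ (k - 1))) (by fun_prop) h.r_sq_integrable
  rw [← integral_add i1 i2]
  refine (integral_prod _ (i1.add i2)).trans (integral_congr_ae (Eventually.of_forall fun t => ?_))
  simp only
  have hy : IntervalIntegrable (fun x => 2 * (r t x * Q t x)) volume (-K) K := by
    rw [intervalIntegrable_iff_integrableOn_Icc_of_le hK]
    exact (h.rQ_slice_integrable t).const_mul 2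
  have h1 := integral_deriv_mul_primitive (r t (-K) ^ 2) hy (φ := fun s => s ^ k) (by fun_prop)
  rw [← h.r_sq_ftc t (right_mem_Icc.2 hK), intervalIntegral.integral_of_le hK,
    ← integral_Icc_eq_integral_Ioc] at h1
  rw [← h1, ← integral_const_mul]
  refine setIntegral_congr_fun measurableSet_Icc fun s hs => ?_
  simp only [Pi.add_apply]
  rw [← h.r_sq_ftc t hs]
  simp
  ring

theorem trace_integrable (h : Curve K T m C γ P r Q B) {s : ℝ} (hs : s ∈ Icc (-K) K) :
    Integrable (fun t => r t s ^ 2) (lebT T) := by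
  have hm : Measurable fun t => r t s := h.r_meas.comp (measurable_id.prodMk measurable_const)
  refine Integrable.mono' (((integrable_const 1).add h.energy_integrable).const_mul
    (2 * m + 4 * K)) (hm.pow_const 2).aestronglyMeasurable (Eventually.of_forall fun t => ?_)
  rw [Real.norm_of_nonneg (sq_nonneg _)]
  exact h.sq_le t hs

end Curve

theorem tendsto_integral_mul_of_tendsto_abs {T : ℝ} {a : ℝ → ℝ} (ha : Continuous a)
    {g : ℕ → ℝ → ℝ} {g₀ : ℝ → ℝ} (hg : ∀ n, Integrable (g n) (lebT T)) (hg₀ : Integrable g₀ (lebT T))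
    (hlim : Tendsto (fun n => ∫ t, |g n t - g₀ t| ∂(lebT T)) atTop (𝓝 0)) :
    Tendsto (fun n => ∫ t, a t * g n t ∂(lebT T)) atTop (𝓝 (∫ t, a t * g₀ t ∂(lebT T))) := by
  obtain ⟨M, hM⟩ := (isCompact_Icc (a := (0 : ℝ)) (b := T)).exists_bound_of_continuousOn
    ha.continuousOn
  have hb : ∀ᵐ t ∂(lebT T), ‖a t‖ ≤ M :=
    (ae_restrict_mem measurableSet_Ioo).mono fun t ht => hM t (Ioo_subset_Icc_self ht)
  have hi : ∀ w : ℝ → ℝ, Integrable w (lebT T) → Integrable (fun t => a t * w t) (lebT T) :=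
    fun w hw => hw.bdd_mul ha.aestronglyMeasurable hb
  rw [tendsto_iff_dist_tendsto_zero]
  refine squeeze_zero (fun _ => dist_nonneg) (fun n => ?_) (by simpa using hlim.const_mul M)
  rw [Real.dist_eq, ← integral_sub (hi _ (hg n)) (hi _ hg₀), ← integral_const_mul,
    ← Real.norm_eq_abs]
  refine norm_integral_le_of_norm_le (((hg n).sub hg₀).abs.const_mul M) ?_
  filter_upwards [hb] with t ht
  rw [← mul_sub, norm_mul]
  exact mul_le_mul_of_nonneg_right ht (norm_nonneg _)

namespace CurveSeq

variable {K T m C : ℝ} {γ : ℕ → Measure ℝ} {P : ℕ → ℝ → FiniteMeasure ℝ} {r Q B : ℕ → ℝ → ℝ → ℝ}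
  {f : ℝ → ℝ}

theorem limit_integrable (h : CurveSeq K T m C γ P r Q B)
    (hf : ∀ t ∈ Icc 0 T, Tendsto (fun n => massP K (P n) t) atTop (𝓝 (f t))) :
    Integrable f (lebT T) :=
  ((h.limit_continuousOn hf).integrableOn_compact isCompact_Icc).mono_set Ioo_subset_Icc_self

/-- The weak-* limits of `r²` and `∂ₛ(r²)`: the Lebesgue part is a function in
`L¹(0, T; W^{1,1})` with the limit traces, the singular part has vanishing traces. -/
theorem exists_limit (h : CurveSeq K T m C γ P r Q B)
    (hf : ∀ t ∈ Icc 0 T, Tendsto (fun n => massP K (P n) t) atTop (𝓝 (f t))) :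
    ∃ σ : ℕ → ℕ, StrictMono σ ∧ ∃ (lam : FiniteMeasure ℝ) (u₀ du₀ m₀ dm₀ : ℝ → ℝ → ℝ),
      Integrable (Function.uncurry u₀) (lebProd T K) ∧
      Integrable (Function.uncurry du₀) (lebProd T K) ∧
      (∀ᵐ t ∂(lebT T), HasWeakDeriv (-K) K (u₀ t) (du₀ t)) ∧
      (lam : Measure ℝ) (Icc 0 T)ᶜ = 0 ∧ (lam : Measure ℝ) ⟂ₘ volume ∧
      MemLp (Function.uncurry m₀) ∞ ((lam : Measure ℝ).prod (leb K)) ∧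
      MemLp (Function.uncurry dm₀) 2 ((lam : Measure ℝ).prod (leb K)) ∧
      (∀ᵐ t ∂(lam : Measure ℝ), HasWeakDeriv (-K) K (m₀ t) (dm₀ t)) ∧
      (∀ φ : ℝ × ℝ → ℝ, Continuous φ →
        Tendsto (fun n => ∫ z, φ z * r (σ n) z.1 z.2 ^ 2 ∂(lebProd T K)) atTop
          (𝓝 ((∫ z, φ z * u₀ z.1 z.2 ∂(lebProd T K)) +
            ∫ z, φ z * m₀ z.1 z.2 ∂((lam : Measure ℝ).prod (leb K))))) ∧
      (∀ φ : ℝ × ℝ → ℝ, Continuous φ →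
        Tendsto (fun n => ∫ z, φ z * (2 * (r (σ n) z.1 z.2 * Q (σ n) z.1 z.2)) ∂(lebProd T K))
          atTop (𝓝 ((∫ z, φ z * du₀ z.1 z.2 ∂(lebProd T K)) +
            ∫ z, φ z * dm₀ z.1 z.2 ∂((lam : Measure ℝ).prod (leb K))))) ∧
      (∀ᵐ t ∂(lebT T), HasTraces (-K) K (u₀ t) (2 * (m - f t)) (2 * f t)) ∧
      ∀ᵐ t ∂(lam : Measure ℝ), HasTraces (-K) K (m₀ t) 0 0 := by
  have hT := h.T_pos
  have hK := h.K_pos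
  have hKK : -K ≤ K := by linarith
  obtain ⟨σ, hσ, α, hα, p, q, hpm, hqm, hpb, hq2, hp, hq⟩ := h.exists_limit_density
  have hσh := h.comp hσ
  have hfσ : ∀ t ∈ Icc 0 T, Tendsto (fun n => massP K (P (σ n)) t) atTop (𝓝 (f t)) :=
    fun t ht => (hf t ht).comp hσ.tendsto_atTop
  have hfi := h.limit_integrable hf
  set ν : Measure (ℝ × ℝ) := (α : Measure ℝ).prod (leb K) with hν
  have hmem : ∀ᵐ z ∂ν, z ∈ Icc (0 : ℝ) T ×ˢ Icc (-K) K := by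
    have h1 : ∀ᵐ z : ℝ × ℝ ∂ν, z.2 ∈ Icc (-K) K :=
      Measure.quasiMeasurePreserving_snd.ae (ae_restrict_mem measurableSet_Icc)
    have h2 : ∀ᵐ z : ℝ × ℝ ∂ν, z.1 ∈ Icc 0 T :=
      Measure.quasiMeasurePreserving_fst.ae (by rw [ae_iff]; exact hα)
    filter_upwards [h1, h2] with z a b using ⟨b, a⟩
  have hpi : Integrable p ν := Integrable.of_bound hpm.aestronglyMeasurable _ hpb
  have hqi : Integrable q ν := hq2.integrable one_le_two
  have hmul : ∀ {w : ℝ × ℝ → ℝ}, Integrable w ν → ∀ φ : ℝ × ℝ → ℝ, Continuous φ →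
      Integrable (fun z => φ z * w z) ν := by
    intro w hw φ hφ
    obtain ⟨M, hM⟩ := (isCompact_Icc.prod isCompact_Icc).exists_bound_of_continuousOn
      (s := Icc (0 : ℝ) T ×ˢ Icc (-K) K) hφ.continuousOn
    exact hw.bdd_mul hφ.aestronglyMeasurable (hmem.mono hM)
  -- the Lebesgue decomposition of the energy measure
  set ℓ := (α : Measure ℝ).singularPart (lebT T) with hℓ
  set d := (α : Measure ℝ).rnDeriv (lebT T) with hd
  have hdm : Measurable d := Measure.measurable_rnDeriv _ _
  have hdt : ∀ᵐ t ∂(lebT T), d t < ⊤ := Measure.rnDeriv_lt_top _ _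
  have hdec : (α : Measure ℝ) = ℓ + (lebT T).withDensity d :=
    Measure.haveLebesgueDecomposition_add _ _
  have hfin : IsFiniteMeasure ((lebT T).withDensity d) :=
    ⟨(Measure.withDensity_rnDeriv_le (α : Measure ℝ) (lebT T) univ).trans_lt
      (measure_lt_top _ _)⟩
  have hℓα : ℓ ≤ (α : Measure ℝ) := Measure.singularPart_le _ _
  have hνdec : ν = ℓ.prod (leb K) + (lebProd T K).withDensity (fun z => d z.1) := by
    rw [hν, hdec, Measure.add_prod, prod_withDensity_left hdm]
  have hdm' : Measurable fun z : ℝ × ℝ => d z.1 := hdm.comp measurable_fst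
  have hdt' : ∀ᵐ z : ℝ × ℝ ∂(lebProd T K), d z.1 < ⊤ :=
    Measure.quasiMeasurePreserving_fst.ae hdt
  have hi1 : ∀ {w : ℝ × ℝ → ℝ}, Integrable w ν →
      Integrable (fun z => w z * (d z.1).toReal) (lebProd T K) := by
    intro w hw
    rw [hνdec] at hw
    have := (integrable_withDensity_iff_integrable_smul' hdm' hdt').1 hw.right_of_add_measure
    exact this.congr (Eventually.of_forall fun z => by simp only [smul_eq_mul]; ring)
  have hi2 : ∀ {w : ℝ × ℝ → ℝ}, Integrable w ν → Integrable w (ℓ.prod (leb K)) := by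
    intro w hw
    rw [hνdec] at hw
    exact hw.left_of_add_measure
  have hsplit : ∀ {w : ℝ × ℝ → ℝ}, Integrable w ν → ∫ z, w z ∂ν =
      (∫ z, w z * (d z.1).toReal ∂(lebProd T K)) + ∫ z, w z ∂(ℓ.prod (leb K)) := by
    intro w hw
    have hw' := hw
    rw [hνdec] at hw'
    rw [hνdec, integral_add_measure hw'.left_of_add_measure hw'.right_of_add_measure,
      integral_withDensity_eq_integral_toReal_smul hdm' hdt', add_comm]
    congr 2
    ext z
    rw [smul_eq_mul, mul_comm]
  have hνℓ : ℓ.prod (leb K) ≤ ν := by rw [hνdec]; exact Measure.le_add_right le_rfl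
  -- the moments
  set G : ℕ → ℝ → ℝ := fun k t => ∫ s, (s ^ k * q (t, s) + k * s ^ (k - 1) * p (t, s)) ∂(leb K)
    with hG
  set R : ℕ → ℝ → ℝ := fun k t => K ^ k * (2 * f t) - (-K) ^ k * (2 * (m - f t)) with hR
  have hGint : ∀ k : ℕ, Integrable (fun z : ℝ × ℝ => z.2 ^ k * q z + k * z.2 ^ (k - 1) * p z) ν :=
    fun k => (hmul hqi (fun z => z.2 ^ k) (by fun_prop)).add
      (hmul hpi (fun z => k * z.2 ^ (k - 1)) (by fun_prop))
  have hGi : ∀ k, Integrable (G k) (α : Measure ℝ) := fun k => (hGint k).integral_prod_left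
  have hfi' : Integrable (fun t => 2 * (m - f t)) (lebT T) :=
    ((integrable_const m).sub hfi).const_mul 2
  have hRi : ∀ k, Integrable (R k) (lebT T) := fun k =>
    ((hfi.const_mul 2).const_mul _).sub (hfi'.const_mul _)
  -- Integration by parts against a(t) s^k passes to the limit: the interior terms converge
  -- weakly-*, the boundary terms because the traces converge strongly in L¹(0,T). Hence the right
  -- side has a Lebesgue density in t, whatever the singular part of α.
  have hmoment : ∀ (k : ℕ) (a : ℝ → ℝ), Continuous a →
      ∫ t, a t * G k t ∂(α : Measure ℝ) = ∫ t, a t * R k t ∂(lebT T) := by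
    intro k a ha
    have l1 := hq (fun z => a z.1 * z.2 ^ k) (by fun_prop)
    have l2 := hp (fun z => a z.1 * (k * z.2 ^ (k - 1))) (by fun_prop)
    have l3 := l1.add l2
    obtain ⟨tr1, tr2⟩ := hσh.tendsto_trace hfσ
    have j1 : ∀ n, Integrable (fun t => r (σ n) t K ^ 2) (lebT T) := fun n =>
      (hσh.curve n).trace_integrable (right_mem_Icc.2 hKK)
    have j2 : ∀ n, Integrable (fun t => r (σ n) t (-K) ^ 2) (lebT T) := fun n =>
      (hσh.curve n).trace_integrable (left_mem_Icc.2 hKK)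
    have t1 := tendsto_integral_mul_of_tendsto_abs
      (show Continuous fun t => a t * K ^ k by fun_prop) j1 (hfi.const_mul 2) tr1
    have t2 := tendsto_integral_mul_of_tendsto_abs
      (show Continuous fun t => a t * (-K) ^ k by fun_prop) j2
      hfi' tr2
    have hbm : ∀ (c : ℝ) {w : ℝ → ℝ}, Integrable w (lebT T) →
        Integrable (fun t => a t * c * w t) (lebT T) := by
      intro c w hw
      obtain ⟨M, hM⟩ := (isCompact_Icc (a := (0 : ℝ)) (b := T)).exists_bound_of_continuousOn
        (f := fun t => a t * c) (Continuous.continuousOn (by fun_prop))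
      exact hw.bdd_mul (Continuous.aestronglyMeasurable (by fun_prop))
        ((ae_restrict_mem measurableSet_Ioo).mono fun t ht => hM t (Ioo_subset_Icc_self ht))
    have e1 : (∫ z, (a z.1 * z.2 ^ k) * q z ∂ν) +
        ∫ z, (a z.1 * (k * z.2 ^ (k - 1))) * p z ∂ν = ∫ t, a t * G k t ∂(α : Measure ℝ) := by
      have m1 := hmul hqi (fun z => a z.1 * z.2 ^ k) (by fun_prop)
      have m2 := hmul hpi (fun z => a z.1 * (k * z.2 ^ (k - 1))) (by fun_prop)
      rw [← integral_add m1 m2]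
      refine (integral_prod _ (m1.add m2)).trans
        (integral_congr_ae (Eventually.of_forall fun t => ?_))
      simp only
      rw [hG, ← integral_const_mul]
      congr 1
      ext s
      simp only [Pi.add_apply]
      ring
    have e2 : ∫ t, a t * R k t ∂(lebT T) = (∫ t, a t * K ^ k * (2 * f t) ∂(lebT T)) -
        ∫ t, a t * (-K) ^ k * (2 * (m - f t)) ∂(lebT T) := by
      rw [← integral_sub (hbm _ (hfi.const_mul 2))
        (hbm _ hfi')]
      congr 1
      ext t
      simp only [hR]
      ring
    rw [← e1, e2]
    refine tendsto_nhds_unique l3 ((t1.sub t2).congr fun n => ?_)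
    rw [(hσh.curve n).integral_moment ha k, ← integral_sub (hbm _ (j1 n)) (hbm _ (j2 n))]
    congr 1
    ext t
    ring
  have hset : ∀ k s, MeasurableSet s → ∫ t in s, G k t ∂(α : Measure ℝ) = ∫ t in s, R k t ∂(lebT T) :=
    fun k s hs => setIntegral_eq_of_forall_contDiff (hGi k) (hRi k)
      (fun a ha _ => hmoment k a ha.continuous) hs
  -- N carries the Lebesgue measure and its complement carries ℓ, so restricting to N or to its
  -- complement separates the two parts of α.
  obtain ⟨N, hN, hℓN, hlN⟩ := (Measure.mutuallySingular_singularPart (α : Measure ℝ) (lebT T))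
  have hαN : ∀ s, MeasurableSet s → ∀ w : ℝ → ℝ, Integrable w (α : Measure ℝ) →
      ∫ t in s ∩ Nᶜ, w t ∂(α : Measure ℝ) = ∫ t in s, w t ∂ℓ ∧
      ∫ t in s ∩ N, w t ∂(α : Measure ℝ) = ∫ t in s, (d t).toReal * w t ∂(lebT T) := by
    intro s hs w hw
    have hw' := hw
    rw [hdec] at hw'
    have hwd := (withDensity_absolutelyContinuous (lebT T) d) hlN
    have r1 : ℓ.restrict (s ∩ N) = 0 := by
      rw [Measure.restrict_eq_zero]
      exact measure_mono_null inter_subset_right hℓN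
    have r2 : ((lebT T).withDensity d).restrict (s ∩ Nᶜ) = 0 := by
      rw [Measure.restrict_eq_zero]
      exact measure_mono_null inter_subset_right hwd
    have r3 : ℓ.restrict (s ∩ Nᶜ) = ℓ.restrict s := by
      refine Measure.restrict_congr_set ?_
      have : ∀ᵐ t ∂ℓ, t ∈ Nᶜ := by rw [ae_iff]; simpa using hℓN
      filter_upwards [this] with t ht
      simp only [eq_iff_iff]
      exact ⟨fun h => h.1, fun h => ⟨h, ht⟩⟩
    have r4 : ((lebT T).withDensity d).restrict (s ∩ N) = ((lebT T).withDensity d).restrict s := by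
      refine Measure.restrict_congr_set ?_
      have : ∀ᵐ t ∂((lebT T).withDensity d), t ∈ N := by rw [ae_iff]; exact hwd
      filter_upwards [this] with t ht
      simp only [eq_iff_iff]
      exact ⟨fun h => h.1, fun h => ⟨h, ht⟩⟩
    constructor
    · rw [hdec, Measure.restrict_add, r2, add_zero, r3]
    · rw [hdec, Measure.restrict_add, r1, zero_add, r4, restrict_withDensity hs,
        integral_withDensity_eq_integral_toReal_smul hdm (ae_restrict_of_ae hdt)]
      rfl
  have hGd : ∀ {w : ℝ → ℝ}, Integrable w (α : Measure ℝ) →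
      Integrable (fun t => (d t).toReal * w t) (lebT T) := by
    intro w hw
    rw [hdec] at hw
    exact (integrable_withDensity_iff_integrable_smul' hdm hdt).1 hw.right_of_add_measure
  have hGℓ : ∀ k, Integrable (G k) ℓ := by
    intro k
    have := hGi k
    rw [hdec] at this
    exact this.left_of_add_measure
  have hleb : ∀ k, ∀ᵐ t ∂(lebT T), (d t).toReal * G k t = R k t := by
    intro k
    refine Integrable.ae_eq_of_forall_setIntegral_eq _ _ (hGd (hGi k)) (hRi k) fun s hs _ => ?_
    rw [← (hαN s hs _ (hGi k)).2, hset k _ (hs.inter hN)]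
    have : (lebT T).restrict (s ∩ N) = (lebT T).restrict s := by
      refine Measure.restrict_congr_set ?_
      have : ∀ᵐ t ∂(lebT T), t ∈ N := by rw [ae_iff]; exact hlN
      filter_upwards [this] with t ht
      simp only [eq_iff_iff]
      exact ⟨fun h => h.1, fun h => ⟨h, ht⟩⟩
    rw [this]
  -- On the carrier of ℓ the right side of the moment identity is zero. This is why the singular
  -- part has vanishing traces.
  have hsing : ∀ k, ∀ᵐ t ∂ℓ, G k t = 0 := by
    intro k
    refine Integrable.ae_eq_zero_of_forall_setIntegral_eq_zero (hGℓ k) fun s hs _ => ?_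
    rw [← (hαN s hs _ (hGi k)).1, hset k _ (hs.inter hN.compl)]
    have : (lebT T).restrict (s ∩ Nᶜ) = 0 := by
      rw [Measure.restrict_eq_zero]
      exact measure_mono_null inter_subset_right hlN
    rw [this, integral_zero_measure]
  have hu0 : ∀ᵐ t ∂(lebT T), HasWeakDeriv (-K) K (fun s => p (t, s) * (d t).toReal)
      (fun s => q (t, s) * (d t).toReal) ∧
      HasTraces (-K) K (fun s => p (t, s) * (d t).toReal) (2 * (m - f t)) (2 * f t) := by
    -- There are countably many moments, so one null set of times serves all k.
    filter_upwards [ae_all_iff.2 hleb, (hi1 hpi).prod_right_ae, (hi1 hqi).prod_right_ae]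
      with t ht ip iq
    refine hasWeakDeriv_and_hasTraces_of_moments hK ip iq fun k => ?_
    have := ht k
    simp only [hG, hR] at this
    rw [← this, ← integral_const_mul]
    congr 1
    ext s
    ring
  have hm0 : ∀ᵐ t ∂ℓ, HasWeakDeriv (-K) K (fun s => p (t, s)) (fun s => q (t, s)) ∧
      HasTraces (-K) K (fun s => p (t, s)) 0 0 := by
    filter_upwards [ae_all_iff.2 hsing, (hi2 hpi).prod_right_ae, (hi2 hqi).prod_right_ae]
      with t ht ip iq
    refine hasWeakDeriv_and_hasTraces_of_moments hK ip iq fun k => ?_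
    have := ht k
    simp only [hG] at this
    rw [this]
    simp
  have hℓ0 : ℓ (Icc 0 T)ᶜ = 0 := le_antisymm ((hℓα _).trans hα.le) bot_le
  refine ⟨σ, hσ, ⟨ℓ, inferInstance⟩, fun t s => p (t, s) * (d t).toReal,
    fun t s => q (t, s) * (d t).toReal, fun t s => p (t, s), fun t s => q (t, s),
    hi1 hpi, hi1 hqi, hu0.mono fun t ht => ht.1, hℓ0, ?_, ?_, ?_, hm0.mono fun t ht => ht.1,
    fun φ hφ => ?_, fun φ hφ => ?_, hu0.mono fun t ht => ht.2, hm0.mono fun t ht => ht.2⟩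
  -- Singularity is required with respect to Lebesgue measure on all of ℝ, while the decomposition
  -- was taken relative to (0, T). The complement of [0, T] is null for ℓ, and the two endpoints,
  -- which ℓ may charge, are Lebesgue null.
  · refine ⟨N ∪ (Icc 0 T)ᶜ, hN.union measurableSet_Icc.compl, ?_, ?_⟩
    · exact measure_union_null hℓN hℓ0
    · have h1 : (N ∪ (Icc 0 T)ᶜ)ᶜ ⊆ (Nᶜ ∩ Ioo 0 T) ∪ {0, T} := by
        intro t ht
        simp only [compl_union, compl_compl, mem_inter_iff, mem_compl_iff, mem_Icc] at ht
        rcases eq_or_lt_of_le ht.2.1 with h0 | h0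
        · right; simp [← h0]
        rcases eq_or_lt_of_le ht.2.2 with h1 | h1
        · right; simp [h1]
        · left; exact ⟨ht.1, h0, h1⟩
      refine measure_mono_null h1 (measure_union_null ?_ ?_)
      · rwa [Measure.restrict_apply hN.compl] at hlN
      · exact (Set.toFinite _).measure_zero _
  · have : ∀ᵐ z ∂(ℓ.prod (leb K)), |p z| ≤ 2 * m + 4 * K :=
      hνℓ.absolutelyContinuous.ae_le hpb
    exact memLp_top_of_bound hpm.aestronglyMeasurable _ this
  · exact hq2.mono_measure hνℓ
  · have := hp φ hφ
    rw [hsplit (hmul hpi φ hφ)] at this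
    simp_rw [mul_assoc] at this
    exact this
  · have := hq φ hφ
    rw [hsplit (hmul hqi φ hφ)] at this
    simp_rw [mul_assoc] at this
    exact this

end CurveSeq

/-! ### The Laplace principle. -/

/-- Laplace principle: the contribution of a region where `f` stays below its maximum is
negligible. -/
theorem tendsto_integral_exp_div {f : ℝ → ℝ} (hf : Continuous f) {a b c d M x₀ : ℝ} (hab : a < b)
    (hcd : c ≤ d) (hM : ∀ x ∈ Icc c d, f x ≤ M) (hx₀ : x₀ ∈ Icc a b) (hfx₀ : M < f x₀) :
    Tendsto (fun ε => (∫ x in c..d, Real.exp (f x / ε)) / ∫ x in a..b, Real.exp (f x / ε))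
      (𝓝[>] 0) (𝓝 0) := by
  -- A level strictly between M and f(x₀): f stays above it on a whole subinterval of [a, b], so the
  -- quotient is at most a constant times exp(-(M' - M)/ε).
  set M' := (M + f x₀) / 2
  have hMM' : M < M' := by simp only [M']; linarith
  obtain ⟨a', b', ha', hab', hb', hM'⟩ : ∃ a' b', a ≤ a' ∧ a' < b' ∧ b' ≤ b ∧
      ∀ x ∈ Icc a' b', M' ≤ f x := by
    have h1 : ∀ᶠ x in 𝓝 x₀, M' < f x := hf.continuousAt.eventually (lt_mem_nhds (by
      simp only [M']; linarith))
    obtain ⟨e, he, hball⟩ := Metric.eventually_nhds_iff.1 h1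
    refine ⟨max a (x₀ - e / 2), min b (x₀ + e / 2), le_max_left _ _, ?_, min_le_left _ _, ?_⟩
    · rw [max_lt_iff, lt_min_iff, lt_min_iff]
      exact ⟨⟨hab, by linarith [hx₀.1]⟩, by linarith [hx₀.2], by linarith⟩
    · intro x hx
      refine (hball ?_).le
      have h2 := (le_max_right _ _).trans hx.1
      have h3 := hx.2.trans (min_le_right _ _)
      rw [Real.dist_eq, abs_lt]
      constructor <;> linarith
  have hexp_int : ∀ (ε p q : ℝ), IntervalIntegrable (fun x => Real.exp (f x / ε)) volume p q :=
    fun ε p q => Continuous.intervalIntegrable (by fun_prop) _ _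
  have hlim : Tendsto (fun ε : ℝ => (d - c) / (b' - a') * Real.exp (-((M' - M) / ε))) (𝓝[>] 0)
      (𝓝 0) := by
    have h1 : Tendsto (fun ε : ℝ => (M' - M) / ε) (𝓝[>] 0) atTop := by
      simp_rw [div_eq_mul_inv]
      exact tendsto_inv_nhdsGT_zero.const_mul_atTop (by linarith)
    simpa using (Real.tendsto_exp_neg_atTop_nhds_zero.comp h1).const_mul ((d - c) / (b' - a'))
  refine squeeze_zero' ?_ ?_ hlim
  · refine Eventually.of_forall fun ε => div_nonneg ?_ ?_ <;>
      exact intervalIntegral.integral_nonneg (by linarith) fun x _ => (Real.exp_pos _).le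
  · filter_upwards [self_mem_nhdsWithin] with ε hε
    have hε : 0 < ε := hε
    have h1 : ∫ x in c..d, Real.exp (f x / ε) ≤ (d - c) * Real.exp (M / ε) := by
      have := intervalIntegral.integral_mono_on hcd (hexp_int ε c d)
        (intervalIntegrable_const (c := Real.exp (M / ε))) fun x hx => by
          have := hM x hx
          gcongr
      simpa using this
    have h2 : (b' - a') * Real.exp (M' / ε) ≤ ∫ x in a..b, Real.exp (f x / ε) := by
      have h3 := intervalIntegral.integral_mono_on hab'.le
        (intervalIntegrable_const (c := Real.exp (M' / ε))) (hexp_int ε a' b') fun x hx => by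
          have := hM' x hx
          gcongr
      have h4 := intervalIntegral.integral_mono_interval ha' hab'.le hb'
        (Eventually.of_forall fun x => (Real.exp_pos (f x / ε)).le) (hexp_int ε a b)
      simp only [intervalIntegral.integral_const, smul_eq_mul] at h3
      exact h3.trans h4
    have hba : 0 < b' - a' := by linarith
    have hdc : 0 ≤ d - c := by linarith
    calc _ ≤ ((d - c) * Real.exp (M / ε)) / ((b' - a') * Real.exp (M' / ε)) := by
          gcongr
      _ = (d - c) / (b' - a') * Real.exp (-((M' - M) / ε)) := by
          rw [mul_div_mul_comm, ← Real.exp_sub]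
          congr 2
          ring

/-! ### The change of variables for a double well. -/

namespace IsDoubleWell

variable {H : ℝ → ℝ}

theorem continuous (hH : IsDoubleWell H) : Continuous H := hH.smooth.continuous

theorem kappa_pos (hH : IsDoubleWell H) : 0 < kappa H := by
  have h1 := hH.deriv2_zero
  have h2 := hH.deriv2_one
  have h3 : 0 < |deriv (deriv H) 0| := abs_pos.2 h1.ne
  unfold kappa rate
  positivity

theorem partitionZ_pos (hH : IsDoubleWell H) (ε : ℝ) : 0 < partitionZ H ε := by
  have := hH.continuous
  exact intervalIntegral.intervalIntegral_pos_of_pos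
    (Continuous.intervalIntegrable (by fun_prop) _ _) (fun x => Real.exp_pos _) (by norm_num)

theorem gDens_pos (hH : IsDoubleWell H) (ε x : ℝ) : 0 < gDens H ε x :=
  mul_pos (inv_pos.2 (hH.partitionZ_pos ε)) (Real.exp_pos _)

theorem gDens_contDiff (hH : IsDoubleWell H) (ε : ℝ) : ContDiff ℝ ∞ (gDens H ε) :=
  contDiff_const.mul ((hH.smooth.neg.div_const ε).exp)

theorem gDens_continuous (hH : IsDoubleWell H) (ε : ℝ) : Continuous (gDens H ε) :=
  (hH.gDens_contDiff ε).continuous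

theorem one_div_gDens (ε x : ℝ) : 1 / gDens H ε x = partitionZ H ε * Real.exp (H x / ε) := by
  unfold gDens
  rw [neg_div, Real.exp_neg, ← mul_inv, one_div, inv_inv]

theorem tau_eq (ε : ℝ) : tau H ε =
    1 / (2 * kappa H) * (partitionZ H ε * ∫ x in (-1 : ℝ)..1, Real.exp (H x / ε)) := by
  unfold tau
  simp_rw [one_div_gDens]
  rw [intervalIntegral.integral_const_mul]

theorem integral_exp_pos (hH : IsDoubleWell H) (ε : ℝ) :
    0 < ∫ x in (-1 : ℝ)..1, Real.exp (H x / ε) := by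
  have := hH.continuous
  exact intervalIntegral.intervalIntegral_pos_of_pos
    (Continuous.intervalIntegrable (by fun_prop) _ _) (fun x => Real.exp_pos _) (by norm_num)

theorem tau_pos (hH : IsDoubleWell H) (ε : ℝ) : 0 < tau H ε := by
  rw [tau_eq]
  have := hH.kappa_pos
  have := hH.partitionZ_pos ε
  have := hH.integral_exp_pos ε
  positivity

theorem weight_pos (hH : IsDoubleWell H) (ε x : ℝ) : 0 < 1 / (tau H ε * gDens H ε x) :=
  one_div_pos.2 (mul_pos (hH.tau_pos ε) (hH.gDens_pos ε x))

theorem weight_contDiff (hH : IsDoubleWell H) (ε : ℝ) :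
    ContDiff ℝ ∞ fun x => 1 / (tau H ε * gDens H ε x) :=
  contDiff_const.div (contDiff_const.mul (hH.gDens_contDiff ε))
    fun x => (mul_pos (hH.tau_pos ε) (hH.gDens_pos ε x)).ne'

theorem weight_continuous (hH : IsDoubleWell H) (ε : ℝ) :
    Continuous fun x => 1 / (tau H ε * gDens H ε x) := (hH.weight_contDiff ε).continuous

theorem hasDerivAt_sHat (hH : IsDoubleWell H) (ε x : ℝ) :
    HasDerivAt (sHat H ε) (1 / (tau H ε * gDens H ε x)) x :=
  (hH.weight_continuous ε).integral_hasStrictDerivAt 0 x |>.hasDerivAt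

theorem sHat_contDiff (hH : IsDoubleWell H) (ε : ℝ) : ContDiff ℝ ∞ (sHat H ε) := by
  rw [contDiff_infty_iff_deriv]
  refine ⟨fun x => (hH.hasDerivAt_sHat ε x).differentiableAt, ?_⟩
  have : deriv (sHat H ε) = fun x => 1 / (tau H ε * gDens H ε x) :=
    funext fun x => (hH.hasDerivAt_sHat ε x).deriv
  rw [this]
  exact hH.weight_contDiff ε

theorem sHat_continuous (hH : IsDoubleWell H) (ε : ℝ) : Continuous (sHat H ε) :=
  (hH.sHat_contDiff ε).continuous

theorem sHat_strictMono (hH : IsDoubleWell H) (ε : ℝ) : StrictMono (sHat H ε) :=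
  strictMono_of_deriv_pos fun x => by
    rw [(hH.hasDerivAt_sHat ε x).deriv]; exact hH.weight_pos ε x

theorem gDens_neg (hH : IsDoubleWell H) (ε x : ℝ) : gDens H ε (-x) = gDens H ε x := by
  unfold gDens; rw [hH.even]

theorem sHat_neg (hH : IsDoubleWell H) (ε x : ℝ) : sHat H ε (-x) = -sHat H ε x := by
  unfold sHat
  have h1 := intervalIntegral.integral_comp_neg (a := 0) (b := x)
    (fun η => 1 / (tau H ε * gDens H ε η))
  simp only [hH.gDens_neg, neg_zero] at h1
  rw [h1, intervalIntegral.integral_symm]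

theorem sHat_sub (hH : IsDoubleWell H) (ε a b : ℝ) :
    sHat H ε b - sHat H ε a = ∫ x in a..b, 1 / (tau H ε * gDens H ε x) := by
  unfold sHat
  rw [intervalIntegral.integral_interval_sub_left] <;>
    exact (hH.weight_continuous ε).intervalIntegrable _ _

/-- The normalization of g_ε cancels against that of τ_ε. An increment of ŝ_ε is 2κ times a fraction
of the integral of exp(H/ε), to which the Laplace principle applies directly. -/
theorem sHat_sub' (hH : IsDoubleWell H) (ε a b : ℝ) :
    sHat H ε b - sHat H ε a = 2 * kappa H *
      ((∫ x in a..b, Real.exp (H x / ε)) / ∫ x in (-1 : ℝ)..1, Real.exp (H x / ε)) := by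
  rw [hH.sHat_sub]
  have h1 : ∀ x, 1 / (tau H ε * gDens H ε x) =
      partitionZ H ε / tau H ε * Real.exp (H x / ε) := by
    intro x
    rw [← one_div_mul_one_div, one_div_gDens]
    ring
  simp_rw [h1]
  rw [intervalIntegral.integral_const_mul, tau_eq]
  have := hH.kappa_pos
  have := hH.partitionZ_pos ε
  have := hH.integral_exp_pos ε
  field_simp

theorem sHat_one (hH : IsDoubleWell H) (ε : ℝ) : sHat H ε 1 = kappa H := by
  have h1 := hH.sHat_sub' ε (-1) 1
  rw [div_self (hH.integral_exp_pos ε).ne', hH.sHat_neg] at h1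
  linarith

theorem sHat_neg_one (hH : IsDoubleWell H) (ε : ℝ) : sHat H ε (-1) = -kappa H := by
  rw [hH.sHat_neg, hH.sHat_one]

theorem sHat_mem (hH : IsDoubleWell H) (ε : ℝ) {x : ℝ} (hx : x ∈ Icc (-1 : ℝ) 1) :
    sHat H ε x ∈ Icc (-kappa H) (kappa H) := by
  rw [← hH.sHat_one ε, ← hH.sHat_neg]
  exact ⟨(hH.sHat_strictMono ε).monotone hx.1, (hH.sHat_strictMono ε).monotone hx.2⟩

theorem sHat_image (hH : IsDoubleWell H) (ε : ℝ) :
    sHat H ε '' Icc (-1) 1 = Icc (-kappa H) (kappa H) := by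
  refine Subset.antisymm (image_subset_iff.2 fun x hx => hH.sHat_mem ε hx) ?_
  have := intermediate_value_Icc (by norm_num : (-1 : ℝ) ≤ 1)
    (hH.sHat_continuous ε).continuousOn
  rwa [hH.sHat_one, hH.sHat_neg_one] at this

theorem xiHat_mem (hH : IsDoubleWell H) (ε : ℝ) {s : ℝ} (hs : s ∈ Icc (-kappa H) (kappa H)) :
    xiHat H ε s ∈ Icc (-1 : ℝ) 1 := by
  rw [← hH.sHat_image ε] at hs
  exact Function.invFunOn_mem hs

theorem sHat_xiHat (hH : IsDoubleWell H) (ε : ℝ) {s : ℝ} (hs : s ∈ Icc (-kappa H) (kappa H)) :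
    sHat H ε (xiHat H ε s) = s := by
  rw [← hH.sHat_image ε] at hs
  exact Function.invFunOn_eq hs

theorem xiHat_sHat (hH : IsDoubleWell H) (ε : ℝ) {x : ℝ} (hx : x ∈ Icc (-1 : ℝ) 1) :
    xiHat H ε (sHat H ε x) = x :=
  (hH.sHat_strictMono ε).injective (hH.sHat_xiHat ε (hH.sHat_mem ε hx))

theorem neg_kappa_le (hH : IsDoubleWell H) : -kappa H ≤ kappa H := by linarith [hH.kappa_pos]

/-- The inverse of the change of variables, extended by constants. -/
theorem continuous_xiHat_projIcc (hH : IsDoubleWell H) (ε : ℝ) :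
    Continuous fun s => xiHat H ε (projIcc (-kappa H) (kappa H) hH.neg_kappa_le s) := by
  set e : Icc (-kappa H) (kappa H) → Icc (-1 : ℝ) 1 := fun s => ⟨xiHat H ε s, hH.xiHat_mem ε s.2⟩
  have hmono : Monotone e := by
    intro a b hab
    change xiHat H ε a ≤ xiHat H ε b
    rw [← (hH.sHat_strictMono ε).le_iff_le, hH.sHat_xiHat ε a.2, hH.sHat_xiHat ε b.2]
    exact hab
  have hsurj : Function.Surjective e := fun x =>
    ⟨⟨sHat H ε x, hH.sHat_mem ε x.2⟩, Subtype.ext (hH.xiHat_sHat ε x.2)⟩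
  exact continuous_subtype_val.comp ((hmono.continuous_of_surjective hsurj).comp continuous_projIcc)

theorem xiHat_projIcc (hH : IsDoubleWell H) (ε : ℝ) {s : ℝ}
    (hs : s ∈ Icc (-kappa H) (kappa H)) :
    xiHat H ε (projIcc (-kappa H) (kappa H) hH.neg_kappa_le s) = xiHat H ε s := by
  rw [projIcc_of_mem _ hs]

/-- Outside [-κ, κ] the map `Function.invFunOn` takes a single default value, so `xiHat` is
piecewise continuous. -/
theorem measurable_xiHat (hH : IsDoubleWell H) (ε : ℝ) : Measurable (xiHat H ε) := by
  have h1 : ∃ c, ∀ s ∉ Icc (-kappa H) (kappa H), xiHat H ε s = c := by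
    have h2 : kappa H + 1 ∉ Icc (-kappa H) (kappa H) := fun h => by linarith [h.2]
    refine ⟨xiHat H ε (kappa H + 1), fun s hs => ?_⟩
    rw [← hH.sHat_image ε] at hs h2
    exact (Function.invFunOn_neg hs).trans (Function.invFunOn_neg h2).symm
  obtain ⟨c, hc⟩ := h1
  have h2 : xiHat H ε = (Icc (-kappa H) (kappa H)).piecewise
      (fun s => xiHat H ε (projIcc (-kappa H) (kappa H) hH.neg_kappa_le s)) (fun _ => c) := by
    ext s
    by_cases hs : s ∈ Icc (-kappa H) (kappa H)
    · rw [piecewise_eq_of_mem _ _ _ hs, hH.xiHat_projIcc ε hs]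
    · rw [piecewise_eq_of_notMem _ _ _ hs, hc s hs]
  rw [h2]
  exact (hH.continuous_xiHat_projIcc ε).measurable.piecewise measurableSet_Icc measurable_const

end IsDoubleWell

/-! ### Transport of measures and concentration at the wells. -/

namespace IsDoubleWell

variable {H : ℝ → ℝ}

theorem lintegral_leb_kappa (hH : IsDoubleWell H) (ε : ℝ) (F : ℝ → ℝ≥0∞) :
    ∫⁻ s, F s ∂(leb (kappa H)) =
      ∫⁻ x, ENNReal.ofReal (1 / (tau H ε * gDens H ε x)) * F (sHat H ε x) ∂(leb 1) := by
  have h1 := lintegral_image_eq_lintegral_abs_deriv_mul (s := Icc (-1 : ℝ) 1) measurableSet_Icc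
    (fun x _ => (hH.hasDerivAt_sHat ε x).hasDerivWithinAt)
    (hH.sHat_strictMono ε).injective.injOn F
  rw [hH.sHat_image] at h1
  rw [h1]
  simp_rw [abs_of_pos (hH.weight_pos ε _)]

theorem integral_leb_kappa (hH : IsDoubleWell H) (ε : ℝ) (F : ℝ → ℝ) :
    ∫ s, F s ∂(leb (kappa H)) =
      ∫ x, 1 / (tau H ε * gDens H ε x) * F (sHat H ε x) ∂(leb 1) := by
  have h1 := integral_image_eq_integral_abs_deriv_smul (s := Icc (-1 : ℝ) 1) measurableSet_Icc
    (fun x _ => (hH.hasDerivAt_sHat ε x).hasDerivWithinAt)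
    (hH.sHat_strictMono ε).injective.injOn F
  rw [hH.sHat_image] at h1
  rw [h1]
  simp_rw [abs_of_pos (hH.weight_pos ε _), smul_eq_mul]

/-- The Jacobian 1/(τ_ε g_ε) is strictly positive, so preimages of null sets are null; the same
holds for the inverse below. Almost everywhere identities can thus be moved between ξ and s in both
directions. -/
theorem quasiMeasurePreserving_sHat (hH : IsDoubleWell H) (ε : ℝ) :
    Measure.QuasiMeasurePreserving (sHat H ε) (leb 1) (leb (kappa H)) := by
  have hm := (hH.sHat_continuous ε).measurable
  refine ⟨hm, Measure.AbsolutelyContinuous.mk fun A hA h0 => ?_⟩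
  rw [Measure.map_apply hm hA]
  rw [← lintegral_indicator_one hA, hH.lintegral_leb_kappa ε] at h0
  have hmeas : Measurable fun x => ENNReal.ofReal (1 / (tau H ε * gDens H ε x)) *
      A.indicator 1 (sHat H ε x) :=
    (hH.weight_continuous ε).measurable.ennreal_ofReal.mul ((measurable_one.indicator hA).comp hm)
  rw [lintegral_eq_zero_iff hmeas] at h0
  have h1 : ∀ᵐ x ∂(leb 1), x ∉ sHat H ε ⁻¹' A := by
    filter_upwards [h0] with x hx hxA
    simp only [Pi.zero_apply, mul_eq_zero, ENNReal.ofReal_eq_zero, not_le.2 (hH.weight_pos ε x),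
      false_or] at hx
    rw [indicator_of_mem (mem_preimage.1 hxA)] at hx
    simp at hx
  exact measure_eq_zero_iff_ae_notMem.2 h1

theorem quasiMeasurePreserving_xiHat (hH : IsDoubleWell H) (ε : ℝ) :
    Measure.QuasiMeasurePreserving (xiHat H ε) (leb (kappa H)) (leb 1) := by
  have hm := hH.measurable_xiHat ε
  refine ⟨hm, Measure.AbsolutelyContinuous.mk fun A hA h0 => ?_⟩
  rw [Measure.map_apply hm hA, ← lintegral_indicator_one (hm hA), hH.lintegral_leb_kappa ε]
  refine (lintegral_congr_ae ?_).trans lintegral_zero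
  filter_upwards [measure_eq_zero_iff_ae_notMem.1 h0, ae_restrict_mem measurableSet_Icc]
    with x hx hxm
  rw [indicator_of_notMem, mul_zero]
  rwa [mem_preimage, hH.xiHat_sHat ε hxm]

theorem lintegral_gibbs (hH : IsDoubleWell H) (ε : ℝ) (F : ℝ → ℝ≥0∞) :
    ∫⁻ x, F x ∂(gibbs H ε) = ∫⁻ x, ENNReal.ofReal (gDens H ε x) * F x ∂(leb 1) := by
  unfold gibbs
  rw [lintegral_withDensity_eq_lintegral_mul_non_measurable _
    (hH.gDens_continuous ε).measurable.ennreal_ofReal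
    (Eventually.of_forall fun x => ENNReal.ofReal_lt_top)]
  rfl

theorem integral_gibbs (hH : IsDoubleWell H) (ε : ℝ) (F : ℝ → ℝ) :
    ∫ x, F x ∂(gibbs H ε) = ∫ x, gDens H ε x * F x ∂(leb 1) := by
  unfold gibbs
  rw [integral_withDensity_eq_integral_toReal_smul
    (hH.gDens_continuous ε).measurable.ennreal_ofReal
    (Eventually.of_forall fun x => ENNReal.ofReal_lt_top)]
  simp_rw [ENNReal.toReal_ofReal (hH.gDens_pos ε _).le, smul_eq_mul]

theorem gibbs_absolutelyContinuous (H : ℝ → ℝ) (ε : ℝ) : gibbs H ε ≪ leb 1 :=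
  withDensity_absolutelyContinuous _ _

theorem absolutelyContinuous_gibbs (hH : IsDoubleWell H) (ε : ℝ) : leb 1 ≪ gibbs H ε :=
  withDensity_absolutelyContinuous' (hH.gDens_continuous ε).measurable.ennreal_ofReal.aemeasurable
    (Eventually.of_forall fun x => by
      simp only [ne_eq, ENNReal.ofReal_eq_zero, not_le]; exact hH.gDens_pos ε x)

theorem ae_gibbs_mem (H : ℝ → ℝ) (ε : ℝ) : ∀ᵐ x ∂(gibbs H ε), x ∈ Icc (-1 : ℝ) 1 :=
  (gibbs_absolutelyContinuous H ε).ae_le (ae_restrict_mem measurableSet_Icc)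

theorem integral_gDens (hH : IsDoubleWell H) (ε : ℝ) : ∫ x in (-1 : ℝ)..1, gDens H ε x = 1 := by
  unfold gDens
  rw [intervalIntegral.integral_const_mul]
  exact inv_mul_cancel₀ (hH.partitionZ_pos ε).ne'

theorem integral_leb_one (F : ℝ → ℝ) : ∫ x, F x ∂(leb 1) = ∫ x in (-1 : ℝ)..1, F x := by
  rw [intervalIntegral.integral_of_le (by norm_num), integral_Icc_eq_integral_Ioc]

theorem isProbabilityMeasure_gibbs (hH : IsDoubleWell H) (ε : ℝ) :
    IsProbabilityMeasure (gibbs H ε) := by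
  constructor
  have h1 := hH.lintegral_gibbs ε 1
  simp only [Pi.one_apply, mul_one, lintegral_one] at h1
  rw [h1, ← ofReal_integral_eq_lintegral_ofReal, integral_leb_one, hH.integral_gDens,
    ENNReal.ofReal_one]
  · exact (hH.gDens_continuous ε).continuousOn.integrableOn_Icc
  · exact Eventually.of_forall fun x => (hH.gDens_pos ε x).le

/-- The transformed invariant measure. -/
def gibbsHat (H : ℝ → ℝ) (ε : ℝ) : Measure ℝ := (gibbs H ε).map (sHat H ε)

theorem integral_gibbsHat (hH : IsDoubleWell H) (ε : ℝ) {F : ℝ → ℝ} (hF : Measurable F) :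
    ∫ s, F s ∂(gibbsHat H ε) = ∫ x, F (sHat H ε x) ∂(gibbs H ε) :=
  integral_map (hH.sHat_continuous ε).measurable.aemeasurable hF.aestronglyMeasurable

theorem ae_gibbsHat_mem (hH : IsDoubleWell H) (ε : ℝ) :
    ∀ᵐ s ∂(gibbsHat H ε), s ∈ Icc (-kappa H) (kappa H) := by
  refine (ae_map_iff (p := fun s => s ∈ Icc (-kappa H) (kappa H))
    (hH.sHat_continuous ε).measurable.aemeasurable measurableSet_Icc).2 ?_
  exact (ae_gibbs_mem H ε).mono fun x hx => hH.sHat_mem ε hx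

theorem integral_id_gibbsHat (hH : IsDoubleWell H) (ε : ℝ) : ∫ s, s ∂(gibbsHat H ε) = 0 := by
  rw [hH.integral_gibbsHat ε measurable_id', hH.integral_gibbs, integral_leb_one]
  have h1 := intervalIntegral.integral_comp_neg (a := -1) (b := 1)
    (fun x => gDens H ε x * sHat H ε x)
  simp only [hH.gDens_neg, hH.sHat_neg, neg_neg, mul_neg, intervalIntegral.integral_neg] at h1
  linarith

/-- Laplace principle for -H, whose maximum on [-1, 1] sits at ±1: any compact part of (-1, 1) loses
its mass. -/
theorem tendsto_integral_gDens (hH : IsDoubleWell H) {a : ℝ} (ha : a ∈ Ioo (0 : ℝ) 1) :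
    Tendsto (fun ε => ∫ x in -a..a, gDens H ε x) (𝓝[>] 0) (𝓝 0) := by
  have hsub : Icc (-a) a ⊆ Ioo (-1 : ℝ) 1 := fun x hx =>
    ⟨by linarith [hx.1, ha.2], by linarith [hx.2, ha.2]⟩
  obtain ⟨x₁, hx₁, hmin⟩ := (isCompact_Icc (a := -a) (b := a)).exists_isMinOn
    ⟨0, by constructor <;> linarith [ha.1]⟩ hH.continuous.continuousOn
  have h1 := tendsto_integral_exp_div (f := fun x => -H x) hH.continuous.neg (a := -1) (b := 1)
    (c := -a) (d := a) (M := -H x₁) (x₀ := 1) (by norm_num) (by linarith [ha.1])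
    (fun x hx => neg_le_neg (hmin hx)) (by norm_num) (by
      rw [hH.at_one]; linarith [hH.pos x₁ (hsub hx₁)])
  refine h1.congr fun ε => ?_
  unfold gDens
  rw [intervalIntegral.integral_const_mul, div_eq_inv_mul]
  rfl

/-- Laplace principle for H, whose strict maximum is at 0: asymptotically the whole length in s is
produced by the barrier, so every fixed δ > 0 is sent close to κ. -/
theorem tendsto_sHat (hH : IsDoubleWell H) {δ : ℝ} (hδ : 0 < δ) (hδ1 : δ ≤ 1) :
    Tendsto (fun ε => sHat H ε δ) (𝓝[>] 0) (𝓝 (kappa H)) := by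
  obtain ⟨x₁, hx₁, hmax⟩ := (isCompact_Icc (a := δ) (b := 1)).exists_isMaxOn
    ⟨1, by constructor <;> linarith⟩ hH.continuous.continuousOn
  have h1 := tendsto_integral_exp_div (f := H) hH.continuous (a := -1) (b := 1)
    (c := δ) (d := 1) (M := H x₁) (x₀ := 0) (by norm_num) hδ1
    (fun x hx => hmax hx) (by norm_num) (by
      rw [hH.at_zero]
      exact hH.lt_one x₁ ⟨by linarith [hx₁.1], hx₁.2⟩ (by linarith [hx₁.1]))
  have h2 := (h1.const_mul (2 * kappa H)).const_sub (kappa H)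
  rw [mul_zero, sub_zero] at h2
  refine h2.congr fun ε => ?_
  rw [← hH.sHat_sub', hH.sHat_one]
  ring

/-- The invariant measures concentrate at the wells. -/
theorem tendsto_integral_gibbs_zero (hH : IsDoubleWell H) {φ : ℝ → ℝ → ℝ} {M : ℝ}
    (hc : ∀ ε, Continuous (φ ε)) (h0 : ∀ ε, ∀ x ∈ Icc (-1 : ℝ) 1, 0 ≤ φ ε x)
    (hM : ∀ ε, ∀ x ∈ Icc (-1 : ℝ) 1, φ ε x ≤ M)
    (hlim : ∀ e > 0, ∃ a ∈ Ioo (0 : ℝ) 1, ∀ᶠ ε in 𝓝[>] 0, ∀ x ∈ Icc (-1 : ℝ) 1,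
      a ≤ |x| → φ ε x ≤ e) :
    Tendsto (fun ε => ∫ x, φ ε x ∂(gibbs H ε)) (𝓝[>] 0) (𝓝 0) := by
  have hM0 : 0 ≤ M := (h0 0 0 (by norm_num)).trans (hM 0 0 (by norm_num))
  rw [Metric.tendsto_nhds]
  intro e he
  obtain ⟨a, ha, hev⟩ := hlim (e / 3) (by linarith)
  have h1 := ((hH.tendsto_integral_gDens ha).const_mul M)
  rw [mul_zero] at h1
  filter_upwards [hev, h1.eventually (gt_mem_nhds (show 0 < e / 3 by linarith))] with ε h2 h3
  have := hH.isProbabilityMeasure_gibbs ε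
  have hn : 0 ≤ ∫ x, φ ε x ∂(gibbs H ε) :=
    integral_nonneg_of_ae ((ae_gibbs_mem H ε).mono fun x hx => h0 ε x hx)
  rw [Real.dist_eq, sub_zero, abs_of_nonneg hn]
  have hi : ∀ F : ℝ → ℝ, Continuous F → Integrable F (gibbs H ε) := by
    intro F hF
    obtain ⟨B, hB⟩ := (isCompact_Icc (a := (-1 : ℝ)) (b := 1)).exists_bound_of_continuousOn
      hF.continuousOn
    exact Integrable.of_bound hF.aestronglyMeasurable B ((ae_gibbs_mem H ε).mono hB)
  have hind : Integrable ((Icc (-a) a).indicator fun _ => M) (gibbs H ε) :=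
    (integrable_const M).indicator measurableSet_Icc
  have hle : ∫ x, φ ε x ∂(gibbs H ε) ≤
      ∫ x, (e / 3 + (Icc (-a) a).indicator (fun _ => M) x) ∂(gibbs H ε) := by
    refine integral_mono_ae (hi _ (hc ε)) ((integrable_const _).add hind) ?_
    filter_upwards [ae_gibbs_mem H ε] with x hx
    by_cases hxa : x ∈ Icc (-a) a
    · rw [indicator_of_mem hxa]
      linarith [hM ε x hx]
    · rw [indicator_of_notMem hxa, add_zero]
      refine h2 x hx ?_
      by_contra hlt
      rw [not_le, abs_lt] at hlt
      exact hxa ⟨hlt.1.le, hlt.2.le⟩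
  rw [integral_add (integrable_const _) hind, integral_const, probReal_univ, one_smul,
    hH.integral_gibbs ε (indicator _ _)] at hle
  have e1 : ∫ x, gDens H ε x * (Icc (-a) a).indicator (fun _ => M) x ∂(leb 1) =
      M * ∫ x in -a..a, gDens H ε x := by
    have e2 : (fun x => gDens H ε x * (Icc (-a) a).indicator (fun _ => M) x) =
        (Icc (-a) a).indicator fun x => M * gDens H ε x := by
      ext x
      by_cases hxa : x ∈ Icc (-a) a
      · rw [indicator_of_mem hxa, indicator_of_mem hxa, mul_comm]
      · rw [indicator_of_notMem hxa, indicator_of_notMem hxa, mul_zero]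
    rw [e2, integral_indicator measurableSet_Icc, Measure.restrict_restrict measurableSet_Icc,
      inter_eq_left.2 (Icc_subset_Icc (by linarith [ha.2]) ha.2.le), integral_const_mul,
      intervalIntegral.integral_of_le (by linarith [ha.1]), integral_Icc_eq_integral_Ioc]
  rw [e1] at hle
  linarith

/-- Where |x| ≥ ½ the image ŝ_ε(x) is uniformly close to ±κ by monotonicity; the region |x| < ½
carries vanishing mass. -/
theorem tendsto_conc (hH : IsDoubleWell H) :
    Tendsto (fun ε => ∫ s, (kappa H ^ 2 - s ^ 2) ∂(gibbsHat H ε)) (𝓝[>] 0) (𝓝 0) := by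
  have hκ := hH.kappa_pos
  have h1 : Tendsto (fun ε => ∫ x, (kappa H ^ 2 - sHat H ε x ^ 2) ∂(gibbs H ε)) (𝓝[>] 0)
      (𝓝 0) := by
    refine hH.tendsto_integral_gibbs_zero (φ := fun ε x => kappa H ^ 2 - sHat H ε x ^ 2)
      (M := kappa H ^ 2) (fun ε => ?_) (fun ε x hx => ?_) (fun ε x hx => ?_) fun e he => ?_
    · have := hH.sHat_continuous ε
      fun_prop
    · have := hH.sHat_mem ε hx
      nlinarith [this.1, this.2]
    · nlinarith [sq_nonneg (sHat H ε x)]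
    · have h2 := hH.tendsto_sHat (δ := 1 / 2) (by norm_num) (by norm_num)
      have h3 : Tendsto (fun ε => 2 * kappa H * (kappa H - sHat H ε (1 / 2))) (𝓝[>] 0) (𝓝 0) := by
        simpa using (h2.const_sub (kappa H)).const_mul (2 * kappa H)
      refine ⟨1 / 2, by norm_num, ?_⟩
      filter_upwards [h3.eventually (gt_mem_nhds he)] with ε hε x hx hax
      have hmono := (hH.sHat_strictMono ε).monotone
      have h4 := hmono hax
      have h5 := hH.sHat_mem ε hx
      have h6 : sHat H ε |x| ^ 2 = sHat H ε x ^ 2 := by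
        rcases abs_cases x with ⟨h, -⟩ | ⟨h, -⟩ <;> rw [h]
        rw [hH.sHat_neg]; ring
      have h7 := hH.sHat_mem ε (x := |x|) ⟨by linarith, abs_le.2 hx⟩
      have h8 := hH.sHat_mem ε (x := 1 / 2) (by norm_num)
      rw [← h6]
      nlinarith [h7.1, h7.2, h8.1, h8.2]
  refine h1.congr fun ε => ?_
  rw [hH.integral_gibbsHat ε (by fun_prop)]

end IsDoubleWell

/-! ### From the given curves to curves in the transformed variable. -/

/-- A curve `ρ = u γ_ε` of mass `m` with velocity `v` and dissipation at most `C`. -/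
structure Admissible (H : ℝ → ℝ) (T : ℝ) (m : ℝ≥0) (C ε : ℝ) (ρ : ℝ → FiniteMeasure ℝ)
    (u : ℝ → ℝ → ℝ≥0) (v : ℝ → ℝ → ℝ) : Prop where
  well : IsDoubleWell H
  T_pos : 0 < T
  u_meas : Measurable (Function.uncurry u)
  eq_withDensity : ∀ t ∈ Icc 0 T,
    (ρ t : Measure ℝ) = (gibbs H ε).withDensity (fun x => (u t x : ℝ≥0∞))
  ce : ContinuityEquation T ρ (fun t => (ρ t : Measure ℝ)) v
  mass_eq : ∀ t ∈ Icc 0 T, (ρ t).mass = m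
  dissipation_le : dissipation H ε T ρ v ≤ ENNReal.ofReal C

theorem integrable_sq_of_lintegral_le {T K C : ℝ} (hC : 0 ≤ C) {F : ℝ → ℝ → ℝ}
    (hF : Measurable (Function.uncurry F))
    (h : ∫⁻ t, ∫⁻ s, ENNReal.ofReal (F t s ^ 2) ∂(leb K) ∂(lebT T) ≤ ENNReal.ofReal C) :
    Integrable (fun z : ℝ × ℝ => F z.1 z.2 ^ 2) (lebProd T K) ∧
      ∫ z, F z.1 z.2 ^ 2 ∂(lebProd T K) ≤ C := by
  have hm : Measurable fun z : ℝ × ℝ => F z.1 z.2 ^ 2 := hF.pow_const 2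
  have h1 : ∫⁻ z, ENNReal.ofReal (F z.1 z.2 ^ 2) ∂(lebProd T K) ≤ ENNReal.ofReal C := by
    rw [lintegral_prod _ hm.ennreal_ofReal.aemeasurable]
    exact h
  have hi : Integrable (fun z : ℝ × ℝ => F z.1 z.2 ^ 2) (lebProd T K) := by
    refine ⟨hm.aestronglyMeasurable, ?_⟩
    rw [hasFiniteIntegral_iff_ofReal (Eventually.of_forall fun z => sq_nonneg _)]
    exact h1.trans_lt ENNReal.ofReal_lt_top
  refine ⟨hi, ?_⟩
  rw [← ofReal_integral_eq_lintegral_ofReal hi (Eventually.of_forall fun z => sq_nonneg _)] at h1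
  exact (ENNReal.ofReal_le_ofReal_iff hC).1 h1

theorem exists_measurableSet_of_ae {α : Type*} [MeasurableSpace α] {μ : Measure α} {p : α → Prop}
    (h : ∀ᵐ x ∂μ, p x) : ∃ S, MeasurableSet S ∧ (∀ᵐ x ∂μ, x ∈ S) ∧ ∀ x ∈ S, p x := by
  obtain ⟨N, hN, hNm, hN0⟩ := exists_measurable_superset_of_null (ae_iff.1 h)
  refine ⟨Nᶜ, hNm.compl, ?_, fun x hx => ?_⟩
  · rw [ae_iff]; simpa using hN0
  · by_contra hp
    exact hx (hN hp)

namespace Admissible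

variable {H : ℝ → ℝ} {T : ℝ} {m : ℝ≥0} {C ε : ℝ} {ρ : ℝ → FiniteMeasure ℝ}
  {u : ℝ → ℝ → ℝ≥0} {v : ℝ → ℝ → ℝ}

theorem u_slice (h : Admissible H T m C ε ρ u v) (t : ℝ) : Measurable (u t) :=
  h.u_meas.comp measurable_prodMk_left

theorem v_meas (h : Admissible H T m C ε ρ u v) : Measurable (Function.uncurry v) := h.ce.2.1

theorem lintegral_rho (h : Admissible H T m C ε ρ u v) {t : ℝ} (ht : t ∈ Icc 0 T)
    (F : ℝ → ℝ≥0∞) : ∫⁻ x, F x ∂(ρ t : Measure ℝ) =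
      ∫⁻ x, ENNReal.ofReal (gDens H ε x) * (u t x * F x) ∂(leb 1) := by
  rw [h.eq_withDensity t ht, lintegral_withDensity_eq_lintegral_mul_non_measurable _
    (h.u_slice t).coe_nnreal_ennreal (Eventually.of_forall fun x => ENNReal.coe_lt_top),
    h.well.lintegral_gibbs]
  rfl

theorem integral_rho_gibbs (h : Admissible H T m C ε ρ u v) {t : ℝ} (ht : t ∈ Icc 0 T)
    (F : ℝ → ℝ) : ∫ x, F x ∂(ρ t : Measure ℝ) = ∫ x, u t x * F x ∂(gibbs H ε) := by
  rw [h.eq_withDensity t ht, integral_withDensity_eq_integral_smul (h.u_slice t)]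
  rfl

theorem integral_rho (h : Admissible H T m C ε ρ u v) {t : ℝ} (ht : t ∈ Icc 0 T)
    (F : ℝ → ℝ) : ∫ x, F x ∂(ρ t : Measure ℝ) = ∫ x, gDens H ε x * (u t x * F x) ∂(leb 1) := by
  rw [h.integral_rho_gibbs ht, h.well.integral_gibbs]

theorem ae_rho_mem (h : Admissible H T m C ε ρ u v) {t : ℝ} (ht : t ∈ Icc 0 T) :
    ∀ᵐ x ∂(ρ t : Measure ℝ), x ∈ Icc (-1 : ℝ) 1 := by
  rw [h.eq_withDensity t ht]
  exact (withDensity_absolutelyContinuous _ _).ae_le (IsDoubleWell.ae_gibbs_mem H ε)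

/-- The Radon-Nikodym derivative is fixed only up to γ_ε-null sets; since g_ε is positive these are
the Lebesgue null sets of [-1, 1]. -/
theorem dens_eq (h : Admissible H T m C ε ρ u v) {t : ℝ} (ht : t ∈ Icc 0 T) :
    ∀ᵐ x ∂(leb 1), dens H ε (ρ t) x = u t x := by
  have := h.well.isProbabilityMeasure_gibbs ε
  have h1 : (ρ t : Measure ℝ).rnDeriv (gibbs H ε) =ᵐ[gibbs H ε] fun x => (u t x : ℝ≥0∞) := by
    rw [h.eq_withDensity t ht]
    exact Measure.rnDeriv_withDensity _ (h.u_slice t).coe_nnreal_ennreal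
  filter_upwards [(h.well.absolutelyContinuous_gibbs ε).ae_le h1] with x hx
  unfold dens
  rw [hx]
  rfl

theorem kinetic_le (h : Admissible H T m C ε ρ u v) :
    kineticPart H ε T ρ v ≤ ENNReal.ofReal C := le_self_add.trans h.dissipation_le

/-- Spatial regularity of the square root of the density at almost every time. -/
theorem exists_sqrt_deriv (h : Admissible H T m C ε ρ u v) :
    ∃ (q : ℝ → ℝ → ℝ) (S : Set ℝ), Measurable (Function.uncurry q) ∧ MeasurableSet S ∧
      (∀ᵐ t ∂(lebT T), t ∈ S) ∧ S ⊆ Ioo 0 T ∧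
      (∀ t ∈ S, (∫⁻ x, ENNReal.ofReal (2 * tau H ε * q t x ^ 2) ∂(gibbs H ε)) < ⊤ ∧
        IntegrableOn (q t) (Ioo (-1) 1) ∧
        ∃ c, ∀ᵐ x ∂(leb 1), √(u t x : ℝ) = c + ∫ y in (-1 : ℝ)..x, q t y) ∧
      ∫⁻ t, ∫⁻ x, ENNReal.ofReal (2 * tau H ε * q t x ^ 2) ∂(gibbs H ε) ∂(lebT T) ≤
        ENNReal.ofReal (|C| + 1) := by
  -- The Fisher part is an infimum over candidate derivatives. A strict upper bound is needed to
  -- select one, hence the added 1; the absolute value makes the bound positive without a sign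
  -- condition on C.
  have hlt : fisherPart H ε T ρ < ENNReal.ofReal (|C| + 1) := by
    refine (le_add_self.trans h.dissipation_le).trans_lt ?_
    rw [ENNReal.ofReal_lt_ofReal_iff (by positivity)]
    linarith [le_abs_self C]
  unfold fisherPart at hlt
  simp only [iInf_lt_iff] at hlt
  obtain ⟨q, hqm, hqw, hql⟩ := hlt
  have := h.well.isProbabilityMeasure_gibbs ε
  have hmeas : Measurable fun t => ∫⁻ x, ENNReal.ofReal (2 * tau H ε * q t x ^ 2) ∂(gibbs H ε) :=
    Measurable.lintegral_prod_right' (f := fun z : ℝ × ℝ =>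
      ENNReal.ofReal (2 * tau H ε * q z.1 z.2 ^ 2))
      (((hqm.pow_const 2).const_mul _).ennreal_ofReal)
  have hfin : ∀ᵐ t ∂(lebT T), (∫⁻ x, ENNReal.ofReal (2 * tau H ε * q t x ^ 2) ∂(gibbs H ε)) < ⊤ :=
    ae_lt_top hmeas (hql.trans ENNReal.ofReal_lt_top).ne
  obtain ⟨S, hSm, hSae, hS⟩ := exists_measurableSet_of_ae
    (hfin.and (hqw.and (ae_restrict_mem measurableSet_Ioo)))
  refine ⟨q, S, hqm, hSm, hSae, fun t ht => (hS t ht).2.2, fun t ht => ?_, hql.le⟩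
  obtain ⟨h1, h2, h3⟩ := hS t ht
  refine ⟨h1, h2.2.1, ?_⟩
  obtain ⟨c, hc⟩ := h2.ae_eq_primitive (by norm_num : (-1 : ℝ) < 1)
  refine ⟨c, ?_⟩
  rw [restrict_Ioo_eq_restrict_Icc] at hc
  filter_upwards [hc, h.dens_eq (Ioo_subset_Icc_self h3)] with x hx hd
  rw [← hx, hd]

end Admissible

/-- The primitive `∫_{-K}^s Q(t, x) dx`, in a form that is measurable in `(t, s)`. -/
def cutPrimitive (K : ℝ) (Q : ℝ → ℝ → ℝ) (t s : ℝ) : ℝ :=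
  ∫ x, (Iic s).indicator (Q t) x ∂(leb K)

theorem cutPrimitive_eq {K : ℝ} (Q : ℝ → ℝ → ℝ) (t : ℝ) {s : ℝ} (hs : s ∈ Icc (-K) K) :
    cutPrimitive K Q t s = ∫ x in (-K)..s, Q t x := by
  unfold cutPrimitive
  rw [integral_indicator measurableSet_Iic, Measure.restrict_restrict measurableSet_Iic,
    intervalIntegral.integral_of_le hs.1, ← integral_Icc_eq_integral_Ioc]
  congr 2
  ext x
  simp only [mem_inter_iff, mem_Iic, mem_Icc]
  exact ⟨fun h => ⟨h.2.1, h.1⟩, fun h => ⟨h.2, h.1, h.2.trans hs.2⟩⟩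

theorem measurable_cutPrimitive (K : ℝ) {Q : ℝ → ℝ → ℝ} (hQ : Measurable (Function.uncurry Q)) :
    Measurable (Function.uncurry (cutPrimitive K Q)) := by
  have h1 : Measurable fun p : (ℝ × ℝ) × ℝ => (Iic p.1.2).indicator (Q p.1.1) p.2 := by
    have hset : MeasurableSet {p : (ℝ × ℝ) × ℝ | p.2 ≤ p.1.2} :=
      measurableSet_le measurable_snd (measurable_snd.comp measurable_fst)
    have h2 : Measurable fun p : (ℝ × ℝ) × ℝ => Q p.1.1 p.2 :=
      hQ.comp ((measurable_fst.comp measurable_fst).prodMk measurable_snd)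
    exact h2.indicator hset
  exact (h1.stronglyMeasurable.integral_prod_right' (ν := leb K)).measurable

/-- Substitution y = ŝ_ε(η): the factor τ_ε g_ε is the inverse Jacobian, so primitives in ξ become
primitives in s. -/
theorem IsDoubleWell.integral_comp_xiHat {H : ℝ → ℝ} (hH : IsDoubleWell H) (ε : ℝ) (q : ℝ → ℝ)
    {x : ℝ} (hx : x ∈ Icc (-1 : ℝ) 1) :
    ∫ y in (-kappa H)..(sHat H ε x), q (xiHat H ε y) * (tau H ε * gDens H ε (xiHat H ε y)) =
      ∫ y in (-1 : ℝ)..x, q y := by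
  have h1 := cutPrimitive_eq (fun _ y => q (xiHat H ε y) * (tau H ε * gDens H ε (xiHat H ε y)))
    0 (hH.sHat_mem ε hx)
  have h2 := cutPrimitive_eq (fun _ y => q y) 0 hx
  rw [← h1, ← h2]
  unfold cutPrimitive
  rw [hH.integral_leb_kappa ε]
  refine setIntegral_congr_fun measurableSet_Icc fun y hy => ?_
  have hpos := mul_pos (hH.tau_pos ε) (hH.gDens_pos ε y)
  by_cases hyx : y ≤ x
  · rw [indicator_of_mem (mem_Iic.2 hyx),
      indicator_of_mem (mem_Iic.2 ((hH.sHat_strictMono ε).monotone hyx))]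
    simp only [hH.xiHat_sHat ε hy]
    rw [mul_comm (q y), ← mul_assoc, one_div_mul_cancel hpos.ne', one_mul]
  · rw [indicator_of_notMem (fun h => hyx (mem_Iic.1 h)), indicator_of_notMem, mul_zero]
    rw [mem_Iic, (hH.sHat_strictMono ε).le_iff_le]
    exact hyx

namespace Admissible

variable {H : ℝ → ℝ} {T : ℝ} {m : ℝ≥0} {C ε : ℝ} {ρ : ℝ → FiniteMeasure ℝ}
  {u : ℝ → ℝ → ℝ≥0} {v : ℝ → ℝ → ℝ}

/-- Weak continuity is tested with bounded functions; φ is extended by constants outside [-1, 1],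
which carries every ρ(t). -/
theorem continuousOn_integral_rho (h : Admissible H T m C ε ρ u v) {φ : ℝ → ℝ}
    (hφ : Continuous φ) :
    ContinuousOn (fun t => ∫ x, φ x ∂(ρ t : Measure ℝ)) (Icc 0 T) := by
  have h11 : (-1 : ℝ) ≤ 1 := by norm_num
  obtain ⟨M, hM⟩ := (isCompact_Icc (a := (-1 : ℝ)) (b := 1)).exists_bound_of_continuousOn
    hφ.continuousOn
  have hc : Continuous fun x => φ (projIcc (-1) 1 h11 x) :=
    hφ.comp (continuous_subtype_val.comp continuous_projIcc)
  have h1 : ContinuousOn (fun t => ∫ x, φ (projIcc (-1) 1 h11 x) ∂(ρ t : Measure ℝ)) (Icc 0 T) := by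
    intro t ht
    have := h.ce.1 t ht
    rw [ContinuousWithinAt, FiniteMeasure.tendsto_iff_forall_integral_tendsto] at this
    exact this (BoundedContinuousFunction.ofNormedAddCommGroup _ hc M fun x => hM _ (projIcc (-1) 1 h11 x).2)
  refine h1.congr fun t ht => ?_
  refine integral_congr_ae ((h.ae_rho_mem ht).mono fun x hx => ?_)
  simp only [projIcc_of_mem h11 hx]

/-- The continuity equation in the transformed variable. -/
theorem ce_sHat (h : Admissible H T m C ε ρ u v) {ζ ψ : ℝ → ℝ} (hζ : ContDiff ℝ ∞ ζ)
    (hζc : HasCompactSupport ζ) (hζT : tsupport ζ ⊆ Ioo 0 T) (hψ : ContDiff ℝ ∞ ψ) :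
    ∫ t in Ioo 0 T, (deriv ζ t * ∫ x, ψ (sHat H ε x) ∂(ρ t : Measure ℝ) +
      ζ t * ∫ x, v t x * (deriv ψ (sHat H ε x) * (1 / (tau H ε * gDens H ε x)))
        ∂(ρ t : Measure ℝ)) = 0 := by
  -- ψ ∘ ŝ_ε need not have compact support, as the continuity equation demands. The bump equals 1
  -- near [-1, 1], where all measures live, so neither values nor derivatives change there.
  let χ : ContDiffBump (0 : ℝ) := ⟨2, 3, by norm_num, by norm_num⟩
  have hs := h.well.sHat_contDiff ε
  set Ψ : ℝ → ℝ := fun x => ψ (sHat H ε x) * χ x with hΨ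
  have hΨs : ContDiff ℝ ∞ Ψ := (hψ.comp hs).mul χ.contDiff
  have hχ1 : ∀ x ∈ Icc (-1 : ℝ) 1, χ =ᶠ[𝓝 x] 1 := fun x hx =>
    χ.eventuallyEq_one_of_mem_ball (by
      rw [Metric.mem_ball, Real.dist_eq, sub_zero]
      exact (abs_le.2 hx).trans_lt (by norm_num : (1 : ℝ) < 2))
  have hΨ1 : ∀ x ∈ Icc (-1 : ℝ) 1, Ψ x = ψ (sHat H ε x) := fun x hx => by
    have := (hχ1 x hx).eq_of_nhds
    simp only [hΨ, this, Pi.one_apply, mul_one]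
  have hΨd : ∀ x ∈ Icc (-1 : ℝ) 1,
      deriv Ψ x = deriv ψ (sHat H ε x) * (1 / (tau H ε * gDens H ε x)) := by
    intro x hx
    have e1 : Ψ =ᶠ[𝓝 x] fun x => ψ (sHat H ε x) := by
      filter_upwards [hχ1 x hx] with y hy
      simp only [hΨ, hy, Pi.one_apply, mul_one]
    rw [e1.deriv_eq]
    have h2 := (hψ.differentiable (by norm_num) (sHat H ε x)).hasDerivAt.comp x
      (h.well.hasDerivAt_sHat ε x)
    exact h2.deriv
  have hΨc : HasCompactSupport Ψ := χ.hasCompactSupport.mul_left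
  have hsm : ContDiff ℝ ∞ (Function.uncurry fun t x => ζ t * Ψ x) :=
    (hζ.comp contDiff_fst).mul (hΨs.comp contDiff_snd)
  have hts : tsupport (Function.uncurry fun t x => ζ t * Ψ x) ⊆ tsupport ζ ×ˢ tsupport Ψ := by
    refine closure_minimal ?_ ((isClosed_tsupport ζ).prod (isClosed_tsupport Ψ))
    intro z hz
    rw [Function.mem_support] at hz
    have h1 : ζ z.1 ≠ 0 := fun h0 => hz (by simp [Function.uncurry, h0])
    have h2 : Ψ z.2 ≠ 0 := fun h0 => hz (by simp [Function.uncurry, h0])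
    exact ⟨subset_tsupport _ h1, subset_tsupport _ h2⟩
  have hcs : HasCompactSupport (Function.uncurry fun t x => ζ t * Ψ x) :=
    (hζc.isCompact.prod hΨc.isCompact).of_isClosed_subset (isClosed_tsupport _) hts
  have key := h.ce.2.2.2 _ hsm hcs fun z hz => ⟨hζT (hts hz).1, mem_univ _⟩
  refine Eq.trans ?_ key
  refine setIntegral_congr_fun measurableSet_Ioo fun t ht => ?_
  have htI := Ioo_subset_Icc_self ht
  have d1 : ∀ x, deriv (fun r => ζ r * Ψ x) t = deriv ζ t * Ψ x := fun x => by
    rw [deriv_mul_const (hζ.differentiable (by norm_num) t)]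
  have d2 : ∀ x, deriv (fun x => ζ t * Ψ x) x = ζ t * deriv Ψ x := fun x => by
    rw [deriv_const_mul _ (hΨs.differentiable (by norm_num) x)]
  simp only [d1, d2]
  rw [integral_const_mul, ← integral_const_mul (ζ t)]
  congr 1
  · congr 1
    exact integral_congr_ae ((h.ae_rho_mem htI).mono fun x hx => (hΨ1 x hx).symm)
  · refine integral_congr_ae ((h.ae_rho_mem htI).mono fun x hx => ?_)
    simp only [hΨd x hx]
    ring

end Admissible

namespace Admissible

variable {H : ℝ → ℝ} {T : ℝ} {m : ℝ≥0} {C ε : ℝ} {ρ : ℝ → FiniteMeasure ℝ}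
  {u : ℝ → ℝ → ℝ≥0} {v : ℝ → ℝ → ℝ}

theorem measurable_comp_xiHat (hH : IsDoubleWell H) (ε : ℝ) {β : Type*} [MeasurableSpace β]
    {F : ℝ → ℝ → β} (hF : Measurable (Function.uncurry F)) :
    Measurable fun z : ℝ × ℝ => F z.1 (xiHat H ε z.2) :=
  hF.comp (measurable_fst.prodMk ((hH.measurable_xiHat ε).comp measurable_snd))

theorem measurable_gDens_xiHat (hH : IsDoubleWell H) (ε : ℝ) :
    Measurable fun s => gDens H ε (xiHat H ε s) :=
  (hH.gDens_continuous ε).measurable.comp (hH.measurable_xiHat ε)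

theorem measurable_uHat (h : Admissible H T m C ε ρ u v) :
    Measurable (Function.uncurry (uHat H ε u)) :=
  (measurable_comp_xiHat h.well ε h.u_meas).coe_nnreal_real

theorem measurable_vHat (h : Admissible H T m C ε ρ u v) :
    Measurable (Function.uncurry (vHat H ε v)) :=
  (measurable_comp_xiHat h.well ε h.v_meas).div
    (((measurable_gDens_xiHat h.well ε).comp measurable_snd).const_mul _)

theorem measurable_gHat (hH : IsDoubleWell H) (ε : ℝ) : Measurable (gHat H ε) :=
  ((measurable_gDens_xiHat hH ε).pow_const 2).const_mul _

theorem measurable_wHat (h : Admissible H T m C ε ρ u v) :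
    Measurable (Function.uncurry (wHat H ε u v)) :=
  (h.measurable_uHat.mul h.measurable_vHat).mul
    ((measurable_gHat h.well ε).comp measurable_snd)

/-- The kinetic energy in the transformed variable. -/
theorem lintegral_flux_sq (h : Admissible H T m C ε ρ u v) {t : ℝ} (ht : t ∈ Icc 0 T) :
    ∫⁻ s, ENNReal.ofReal ((√(uHat H ε u t s) * vHat H ε v t s * gHat H ε s) ^ 2)
      ∂(leb (kappa H)) =
    2 * ∫⁻ x, ENNReal.ofReal (v t x ^ 2 / (2 * tau H ε)) ∂(ρ t : Measure ℝ) := by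
  rw [h.well.lintegral_leb_kappa ε, h.lintegral_rho ht, ← lintegral_const_mul' _ _ (by norm_num)]
  refine setLIntegral_congr_fun measurableSet_Icc fun x hx => ?_
  have hτ := h.well.tau_pos ε
  have hg := h.well.gDens_pos ε x
  have e1 : (u t x : ℝ≥0∞) = ENNReal.ofReal (u t x) := (ENNReal.ofReal_coe_nnreal).symm
  have e2 : (2 : ℝ≥0∞) = ENNReal.ofReal 2 := by simp
  simp only [uHat, vHat, gHat, h.well.xiHat_sHat ε hx]
  rw [e1, e2, ← ENNReal.ofReal_mul (by positivity), ← ENNReal.ofReal_mul (by positivity),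
    ← ENNReal.ofReal_mul (by positivity), ← ENNReal.ofReal_mul (by positivity)]
  congr 1
  rw [mul_pow, mul_pow, Real.sq_sqrt (NNReal.coe_nonneg _)]
  field_simp

/-- The Fisher information in the transformed variable. -/
theorem lintegral_deriv_sq (hH : IsDoubleWell H) (ε : ℝ) (q : ℝ → ℝ) :
    2 * ∫⁻ s, ENNReal.ofReal ((q (xiHat H ε s) * (tau H ε * gDens H ε (xiHat H ε s))) ^ 2)
      ∂(leb (kappa H)) =
    ∫⁻ x, ENNReal.ofReal (2 * tau H ε * q x ^ 2) ∂(gibbs H ε) := by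
  rw [hH.lintegral_leb_kappa ε, hH.lintegral_gibbs, ← lintegral_const_mul' _ _ (by norm_num)]
  refine setLIntegral_congr_fun measurableSet_Icc fun x hx => ?_
  have hτ := hH.tau_pos ε
  have hg := hH.gDens_pos ε x
  have e2 : (2 : ℝ≥0∞) = ENNReal.ofReal 2 := by simp
  simp only [hH.xiHat_sHat ε hx]
  rw [e2, ← ENNReal.ofReal_mul (by positivity), ← ENNReal.ofReal_mul (by positivity),
    ← ENNReal.ofReal_mul (by positivity)]
  congr 1
  field_simp

/-- The flux in the transformed variable. -/
theorem integral_flux (h : Admissible H T m C ε ρ u v) {t : ℝ} (ht : t ∈ Icc 0 T) (F : ℝ → ℝ) :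
    ∫ s, F s * wHat H ε u v t s ∂(leb (kappa H)) =
      ∫ x, v t x * (F (sHat H ε x) * (1 / (tau H ε * gDens H ε x))) ∂(ρ t : Measure ℝ) := by
  rw [h.well.integral_leb_kappa ε, h.integral_rho ht]
  refine setIntegral_congr_fun measurableSet_Icc fun x hx => ?_
  have hτ := h.well.tau_pos ε
  have hg := h.well.gDens_pos ε x
  simp only [wHat, uHat, vHat, gHat, h.well.xiHat_sHat ε hx]
  field_simp

/-- The continuous representative of the square root of the density, in the transformed
variable. -/
theorem exists_representative (h : Admissible H T m C ε ρ u v) {t : ℝ} {q : ℝ → ℝ} {c : ℝ}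
    (hq : ∫⁻ x, ENNReal.ofReal (2 * tau H ε * q x ^ 2) ∂(gibbs H ε) < ⊤) (hqm : Measurable q)
    (hc : ∀ᵐ x ∂(leb 1), √(u t x : ℝ) = c + ∫ y in (-1 : ℝ)..x, q y)
    {Q : ℝ → ℝ} (hQ : Q = fun s => q (xiHat H ε s) * (tau H ε * gDens H ε (xiHat H ε s))) :
    MemLp Q 2 (leb (kappa H)) ∧
      (∀ᵐ s ∂(leb (kappa H)), √(uHat H ε u t s) = c + ∫ x in (-kappa H)..s, Q x) ∧
      (∀ s ∈ Icc (-kappa H) (kappa H), 0 ≤ c + ∫ x in (-kappa H)..s, Q x) ∧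
      2 * kappa H * c = (∫ s, √(uHat H ε u t s) ∂(leb (kappa H))) -
        ∫ s, (∫ x in (-kappa H)..s, Q x) ∂(leb (kappa H)) := by
  have hH := h.well
  have hκ := hH.kappa_pos
  have hκκ := hH.neg_kappa_le
  have hQm : Measurable Q := by
    rw [hQ]
    exact (hqm.comp (hH.measurable_xiHat ε)).mul ((measurable_gDens_xiHat hH ε).const_mul _)
  have hL2 : MemLp Q 2 (leb (kappa H)) := by
    rw [memLp_two_iff_integrable_sq hQm.aestronglyMeasurable]
    refine ⟨(hQm.pow_const 2).aestronglyMeasurable, ?_⟩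
    rw [hasFiniteIntegral_iff_ofReal (Eventually.of_forall fun z => sq_nonneg _)]
    rw [← lintegral_deriv_sq hH] at hq
    rw [hQ]
    exact (ENNReal.mul_lt_top_iff.1 hq).elim (fun h => h.2) fun h => by
      rcases h with h | h
      · norm_num at h
      · rw [h]; exact ENNReal.zero_lt_top
  have hQi : Integrable Q (leb (kappa H)) := hL2.integrable one_le_two
  have hQii : IntervalIntegrable Q volume (-kappa H) (kappa H) := by
    rw [intervalIntegrable_iff_integrableOn_Icc_of_le hκκ]; exact hQi
  have hcont : ContinuousOn (fun s => ∫ x in (-kappa H)..s, Q x) (Icc (-kappa H) (kappa H)) := by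
    have := intervalIntegral.continuousOn_primitive_interval' hQii left_mem_uIcc
    rwa [uIcc_of_le hκκ] at this
  have hrep : ∀ᵐ s ∂(leb (kappa H)), √(uHat H ε u t s) = c + ∫ x in (-kappa H)..s, Q x := by
    filter_upwards [(hH.quasiMeasurePreserving_xiHat ε).ae hc, ae_restrict_mem measurableSet_Icc]
      with s hs hsm
    rw [uHat, hs, ← hH.integral_comp_xiHat ε q (hH.xiHat_mem ε hsm), hH.sHat_xiHat ε hsm, hQ]
  refine ⟨hL2, hrep, ?_, ?_⟩
  -- Almost everywhere the representative is a square root, so it equals its positive part; both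
  -- being continuous, they agree at every point.
  · have h1 : (fun s => c + ∫ x in (-kappa H)..s, Q x) =ᵐ[volume.restrict
        (Icc (-kappa H) (kappa H))] fun s => max (c + ∫ x in (-kappa H)..s, Q x) 0 := by
      filter_upwards [hrep] with s hs
      rw [← hs, max_eq_left (Real.sqrt_nonneg _)]
    have h2 := Measure.eqOn_Icc_of_ae_eq volume (by linarith : -kappa H ≠ kappa H) h1
      (continuousOn_const.add hcont) ((continuousOn_const.add hcont).sup continuousOn_const)
    intro s hs
    have := h2 hs
    simp only at this
    rw [this]
    exact le_max_right _ _
  -- Integrating the representation over [-κ, κ] expresses c by integrals, which makes it measurable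
  -- in the time parameter when t varies.
  · have h1 := integral_congr_ae hrep
    have h2 : Integrable (fun s => ∫ x in (-kappa H)..s, Q x) (leb (kappa H)) :=
      hcont.integrableOn_Icc
    rw [integral_add (integrable_const c) h2, setIntegral_const, Real.volume_real_Icc_of_le hκκ,
      smul_eq_mul] at h1
    rw [h1]
    ring

end Admissible

namespace Admissible

variable {H : ℝ → ℝ} {T : ℝ} {m : ℝ≥0} {C ε : ℝ} {ρ : ℝ → FiniteMeasure ℝ}
  {u : ℝ → ℝ → ℝ≥0} {v : ℝ → ℝ → ℝ}

theorem integral_u (h : Admissible H T m C ε ρ u v) {t : ℝ} (ht : t ∈ Icc 0 T) :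
    ∫ x, (u t x : ℝ) ∂(gibbs H ε) = m := by
  have h1 := h.integral_rho_gibbs ht fun _ => 1
  simp only [mul_one, integral_const, smul_eq_mul] at h1
  rw [← h1, ← h.mass_eq t ht]
  rfl

theorem integral_map_rho (h : Admissible H T m C ε ρ u v) (t : ℝ) {φ : ℝ → ℝ}
    (hφ : Continuous φ) :
    ∫ s, φ s ∂((ρ t).map (sHat H ε) : Measure ℝ) = ∫ x, φ (sHat H ε x) ∂(ρ t : Measure ℝ) := by
  rw [FiniteMeasure.toMeasure_map]
  exact integral_map (h.well.sHat_continuous ε).measurable.aemeasurable hφ.aestronglyMeasurable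

/-- An admissible curve is a `Curve` in the transformed variable. -/
theorem exists_curve (h : Admissible H T m C ε ρ u v) :
    ∃ r Q B : ℝ → ℝ → ℝ,
      Curve (kappa H) T m (2 * (|C| + 1)) (IsDoubleWell.gibbsHat H ε)
        (fun t => (ρ t).map (sHat H ε)) r Q B ∧
      ∀ᵐ t ∂(lebT T), ∀ᵐ s ∂(leb (kappa H)),
        uHat H ε u t s = r t s ^ 2 ∧ wHat H ε u v t s = r t s * B t s := by
  have hH := h.well
  have hκ := hH.kappa_pos
  have hκκ := hH.neg_kappa_le
  have hT := h.T_pos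
  have hprob := hH.isProbabilityMeasure_gibbs ε
  have hsm := (hH.sHat_continuous ε).measurable
  obtain ⟨q, S, hqm, hSm, hSae, hST, hS, hql⟩ := h.exists_sqrt_deriv
  set K := kappa H with hK
  -- All data are set to zero at the exceptional times, so that the pointwise requirements of
  -- `Curve` hold for every t. There the mass is 0 instead of m, hence only an inequality for the
  -- mass of r².
  set Q : ℝ → ℝ → ℝ := fun t s => S.indicator
    (fun t => q t (xiHat H ε s) * (tau H ε * gDens H ε (xiHat H ε s))) t with hQ
  set a : ℝ → ℝ → ℝ := fun t s => S.indicator (fun t => √(uHat H ε u t s)) t with ha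
  -- The integration constant is given by an explicit formula instead of a choice for each t, for
  -- joint measurability. The positive part in r does nothing on [-κ, κ] at good times and ensures
  -- nonnegativity elsewhere.
  set c : ℝ → ℝ := fun t => (1 / (2 * K)) * ((∫ s, a t s ∂(leb K)) -
    ∫ s, cutPrimitive K Q t s ∂(leb K)) with hc
  set r : ℝ → ℝ → ℝ := fun t s => max (c t + cutPrimitive K Q t s) 0 with hr
  set B : ℝ → ℝ → ℝ := fun t s => a t s * vHat H ε v t s * gHat H ε s with hB
  have hQ1 : ∀ t ∈ S, Q t = fun s =>
      q t (xiHat H ε s) * (tau H ε * gDens H ε (xiHat H ε s)) := fun t ht => by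
    ext s; simp only [hQ, indicator_of_mem ht]
  have hQ0 : ∀ t ∉ S, Q t = fun _ => 0 := fun t ht => by
    ext s; simp only [hQ, indicator_of_notMem ht]
  have ha1 : ∀ t ∈ S, a t = fun s => √(uHat H ε u t s) := fun t ht => by
    ext s; simp only [ha, indicator_of_mem ht]
  have ha0 : ∀ t ∉ S, a t = fun _ => 0 := fun t ht => by
    ext s; simp only [ha, indicator_of_notMem ht]
  have hSfst : MeasurableSet {z : ℝ × ℝ | z.1 ∈ S} := measurable_fst hSm
  have hQmeas : Measurable (Function.uncurry Q) := by
    have h1 : Measurable fun z : ℝ × ℝ =>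
        q z.1 (xiHat H ε z.2) * (tau H ε * gDens H ε (xiHat H ε z.2)) :=
      (measurable_comp_xiHat hH ε hqm).mul
        (((measurable_gDens_xiHat hH ε).comp measurable_snd).const_mul _)
    exact h1.indicator hSfst
  have hameas : Measurable (Function.uncurry a) :=
    (h.measurable_uHat.sqrt).indicator hSfst
  have hcut := measurable_cutPrimitive K hQmeas
  have hcmeas : Measurable c := by
    refine Measurable.const_mul (Measurable.sub ?_ ?_) _
    · exact (hameas.stronglyMeasurable.integral_prod_right' (ν := leb K)).measurable
    · exact (hcut.stronglyMeasurable.integral_prod_right' (ν := leb K)).measurable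
  have hrmeas : Measurable (Function.uncurry r) :=
    ((hcmeas.comp measurable_fst).add hcut).max measurable_const
  have hBmeas : Measurable (Function.uncurry B) :=
    (hameas.mul h.measurable_vHat).mul ((measurable_gHat hH ε).comp measurable_snd)
  have hc0 : ∀ t ∉ S, c t = 0 := fun t ht => by
    have e1 : cutPrimitive K Q t = fun _ => 0 := by
      ext s; simp only [cutPrimitive, hQ0 t ht]; simp
    simp only [hc, ha0 t ht, e1, integral_zero, sub_zero, mul_zero]
  -- the representative at a good time
  have hgood : ∀ t ∈ S, MemLp (Q t) 2 (leb K) ∧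
      (∀ᵐ s ∂(leb K), √(uHat H ε u t s) = c t + ∫ x in (-K)..s, Q t x) ∧
      ∀ s ∈ Icc (-K) K, 0 ≤ c t + ∫ x in (-K)..s, Q t x := by
    intro t ht
    obtain ⟨h1, -, c', hc'⟩ := hS t ht
    have hqt : Measurable (q t) := hqm.comp measurable_prodMk_left
    obtain ⟨r1, r2, r3, r4⟩ := h.exists_representative h1 hqt hc' (hQ1 t ht)
    have hcc : c t = c' := by
      have e1 : ∫ s, cutPrimitive K Q t s ∂(leb K) = ∫ s, (∫ x in (-K)..s, Q t x) ∂(leb K) :=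
        setIntegral_congr_fun measurableSet_Icc fun s hs => cutPrimitive_eq Q t hs
      simp only [hc, e1, ha1 t ht]
      rw [← r4, ← hK]
      field_simp
    rw [hcc]
    exact ⟨r1, r2, r3⟩
  have hrS : ∀ t ∈ S, ∀ s ∈ Icc (-K) K, r t s = c t + ∫ x in (-K)..s, Q t x := by
    intro t ht s hs
    simp only [hr]
    rw [cutPrimitive_eq Q t hs, max_eq_left ((hgood t ht).2.2 s hs)]
  have hr0 : ∀ t ∉ S, ∀ s, r t s = 0 := by
    intro t ht s
    simp only [hr, hc0 t ht, cutPrimitive, hQ0 t ht]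
    simp
  have hrae : ∀ t ∈ S, ∀ᵐ s ∂(leb K), √(uHat H ε u t s) = r t s := by
    intro t ht
    filter_upwards [(hgood t ht).2.1, ae_restrict_mem measurableSet_Icc] with s hs hsm
    rw [hs, hrS t ht s hsm]
  have hrg : ∀ t ∈ S, ∀ᵐ x ∂(gibbs H ε), (u t x : ℝ) = r t (sHat H ε x) ^ 2 := by
    intro t ht
    have h1 := (IsDoubleWell.gibbs_absolutelyContinuous H ε).ae_le
      ((hH.quasiMeasurePreserving_sHat ε).ae (hrae t ht))
    filter_upwards [h1, IsDoubleWell.ae_gibbs_mem H ε] with x hx hxm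
    rw [← hx, uHat, hH.xiHat_sHat ε hxm, Real.sq_sqrt (NNReal.coe_nonneg _)]
  have hrsl : ∀ t, Measurable (r t) := fun t => hrmeas.comp measurable_prodMk_left
  have hQsq : ∀ t, ∫⁻ s, ENNReal.ofReal (Q t s ^ 2) ∂(leb K) ≤
      ∫⁻ x, ENNReal.ofReal (2 * tau H ε * q t x ^ 2) ∂(gibbs H ε) := by
    intro t
    by_cases ht : t ∈ S
    · rw [hQ1 t ht, ← lintegral_deriv_sq hH ε (q t), two_mul]
      exact le_self_add
    · rw [hQ0 t ht]; simp
  have hQC : ∫⁻ t, ∫⁻ s, ENNReal.ofReal (Q t s ^ 2) ∂(leb K) ∂(lebT T) ≤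
      ENNReal.ofReal (2 * (|C| + 1)) :=
    (lintegral_mono hQsq).trans (hql.trans (ENNReal.ofReal_le_ofReal (by linarith [abs_nonneg C])))
  have hBC : ∫⁻ t, ∫⁻ s, ENNReal.ofReal (B t s ^ 2) ∂(leb K) ∂(lebT T) ≤
      ENNReal.ofReal (2 * (|C| + 1)) := by
    have h1 : ∫⁻ t, ∫⁻ s, ENNReal.ofReal (B t s ^ 2) ∂(leb K) ∂(lebT T) ≤
        2 * kineticPart H ε T ρ v := by
      unfold kineticPart
      rw [← lintegral_const_mul' _ _ (by norm_num)]
      refine lintegral_mono_ae (hSae.mono fun t ht => ?_)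
      rw [← h.lintegral_flux_sq (Ioo_subset_Icc_self (hST ht))]
      simp only [hB, ha1 t ht]
      exact le_rfl
    refine h1.trans ?_
    calc 2 * kineticPart H ε T ρ v ≤ ENNReal.ofReal 2 * ENNReal.ofReal (|C| + 1) := by
          have e2 : (2 : ℝ≥0∞) = ENNReal.ofReal 2 := by simp
          rw [e2]
          gcongr
          exact h.kinetic_le.trans (ENNReal.ofReal_le_ofReal (by linarith [le_abs_self C]))
      _ = _ := by rw [← ENNReal.ofReal_mul (by norm_num)]
  -- A common constant: the Fisher part is 2 ∫∫ Q², and ∫∫ B² is twice the kinetic part, so both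
  -- squares are bounded by 2(|C| + 1).
  have hCn : (0 : ℝ) ≤ 2 * (|C| + 1) := by positivity
  obtain ⟨hQi, hQle⟩ := integrable_sq_of_lintegral_le hCn hQmeas hQC
  obtain ⟨hBi, hBle⟩ := integrable_sq_of_lintegral_le hCn hBmeas hBC
  have hw : ∀ t ∈ S, ∀ᵐ s ∂(leb K), uHat H ε u t s = r t s ^ 2 ∧
      wHat H ε u v t s = r t s * B t s := by
    intro t ht
    filter_upwards [hrae t ht] with s hs
    have h1 : uHat H ε u t s = r t s ^ 2 := by
      rw [← hs, Real.sq_sqrt (by unfold uHat; positivity)]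
    refine ⟨h1, ?_⟩
    simp only [wHat, hB, ha1 t ht, hs]
    rw [h1]
    ring
  refine ⟨r, Q, B, ?_, hSae.mono hw⟩
  exact
    { K_pos := hκ
      T_pos := hT
      m_nonneg := m.2
      C_nonneg := hCn
      prob := Measure.isProbabilityMeasure_map hsm.aemeasurable
      γ_supp := hH.ae_gibbsHat_mem ε
      r_meas := hrmeas
      Q_meas := hQmeas
      B_meas := hBmeas
      r_nonneg := fun t s => le_max_right _ _
      Q_memLp := fun t => by
        by_cases ht : t ∈ S
        · exact (hgood t ht).1
        · rw [hQ0 t ht]; exact MemLp.zero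
      ftc := fun t s hs => by
        by_cases ht : t ∈ S
        · rw [hrS t ht s hs, hrS t ht (-K) (left_mem_Icc.2 hκκ), intervalIntegral.integral_same,
            add_zero]
        · rw [hr0 t ht, hr0 t ht, hQ0 t ht]; simp
      mass_le := fun t => by
        by_cases ht : t ∈ S
        · rw [hH.integral_gibbsHat ε ((hrsl t).pow_const 2),
            ← integral_congr_ae (hrg t ht), h.integral_u (Ioo_subset_Icc_self (hST ht))]
        · simp [hr0 t ht]
      P_supp := fun t ht => by
        rw [FiniteMeasure.toMeasure_map]
        refine (ae_map_iff (p := fun s => s ∈ Icc (-K) K) hsm.aemeasurable measurableSet_Icc).2 ?_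
        exact (h.ae_rho_mem ht).mono fun x hx => hH.sHat_mem ε hx
      P_mass := fun t ht => by
        have : ((ρ t).map (sHat H ε)).mass = (ρ t).mass := by
          rw [FiniteMeasure.mass, FiniteMeasure.map_apply _ hsm MeasurableSet.univ, preimage_univ]
          rfl
        rw [this, h.mass_eq t ht]
      P_cont := fun φ hφ => by
        simp_rw [h.integral_map_rho _ hφ]
        exact h.continuousOn_integral_rho (hφ.comp (hH.sHat_continuous ε))
      P_eq := by
        filter_upwards [hSae] with t ht φ hφ
        rw [h.integral_map_rho t hφ, h.integral_rho_gibbs (Ioo_subset_Icc_self (hST ht)),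
          hH.integral_gibbsHat ε (F := fun s => φ s * r t s ^ 2)
            (hφ.measurable.mul ((hrsl t).pow_const 2))]
        refine integral_congr_ae ((hrg t ht).mono fun x hx => ?_)
        simp only
        rw [hx, mul_comm]
      Q_int := hQi
      B_int := hBi
      Q_le := hQle
      B_le := hBle
      ce := fun ζ ψ hζ hζc hζT hψ => by
        refine Eq.trans (integral_congr_ae ?_) (h.ce_sHat hζ hζc hζT hψ)
        filter_upwards [hSae] with t ht
        rw [h.integral_map_rho t hψ.continuous,
          ← h.integral_flux (Ioo_subset_Icc_self (hST ht))]
        congr 2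
        refine integral_congr_ae ((hw t ht).mono fun s hs => ?_)
        simp only [hs.2] }

end Admissible

namespace Admissible

variable {H : ℝ → ℝ} {T : ℝ} {m : ℝ≥0} {C C' ε : ℝ} {ρ : ℝ → FiniteMeasure ℝ}
  {u : ℝ → ℝ → ℝ≥0} {v : ℝ → ℝ → ℝ} {γ : Measure ℝ} {P : ℝ → FiniteMeasure ℝ}
  {r Q B : ℝ → ℝ → ℝ}

theorem ae_prod_eq {F G : ℝ → ℝ → ℝ} {K : ℝ} (hF : Measurable (Function.uncurry F))
    (hG : Measurable (Function.uncurry G)) (h : ∀ᵐ t ∂(lebT T), ∀ᵐ s ∂(leb K), F t s = G t s) :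
    Function.uncurry F =ᵐ[lebProd T K] Function.uncurry G :=
  (Measure.ae_prod_iff_ae_ae (measurableSet_eq_fun hF hG)).2 h

theorem memL1W11_uHat (h : Admissible H T m C ε ρ u v)
    (hc : Curve (kappa H) T m C' γ P r Q B)
    (hu : ∀ᵐ t ∂(lebT T), ∀ᵐ s ∂(leb (kappa H)), uHat H ε u t s = r t s ^ 2) :
    MemL1W11 H T (uHat H ε u) (fun t s => 2 * (r t s * Q t s)) := by
  refine ⟨?_, hc.rQ_integrable.const_mul 2, ?_⟩
  · exact hc.r_sq_integrable.congr
      (ae_prod_eq h.measurable_uHat (G := fun t s => r t s ^ 2) (hc.r_meas.pow_const 2) hu).symm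
  · filter_upwards [hu] with t ht
    refine hasWeakDeriv_of_ae_eq_primitive (c := r t (-kappa H) ^ 2) (by linarith [hc.K_pos])
      (IntegrableOn.mono_set ((hc.rQ_slice_integrable t).const_mul 2) Ioo_subset_Icc_self) ?_
    have := ae_restrict_of_ae_restrict_of_subset Ioo_subset_Icc_self ht
    filter_upwards [this, ae_restrict_mem measurableSet_Ioo] with s hs hsm
    rw [hs, hc.r_sq_ftc t (Ioo_subset_Icc_self hsm)]

theorem wHat_integrable (h : Admissible H T m C ε ρ u v)
    (hc : Curve (kappa H) T m C' γ P r Q B)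
    (hw : ∀ᵐ t ∂(lebT T), ∀ᵐ s ∂(leb (kappa H)), wHat H ε u v t s = r t s * B t s) :
    Integrable (Function.uncurry (wHat H ε u v)) (lebTS H T) :=
  hc.rB_integrable.congr
    (ae_prod_eq h.measurable_wHat (G := fun t s => r t s * B t s) (hc.r_meas.mul hc.B_meas) hw).symm

theorem ae_eq_comp_sHat (h : Admissible H T m C ε ρ u v)
    (hu : ∀ᵐ t ∂(lebT T), ∀ᵐ s ∂(leb (kappa H)), uHat H ε u t s = r t s ^ 2) :
    ∀ᵐ t ∂(lebT T), ∀ᵐ x ∂(leb 1), (u t x : ℝ) = r t (sHat H ε x) ^ 2 := by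
  filter_upwards [hu] with t ht
  filter_upwards [(h.well.quasiMeasurePreserving_sHat ε).ae ht, ae_restrict_mem measurableSet_Icc]
    with x hx hxm
  rw [← hx, uHat, h.well.xiHat_sHat ε hxm]

/-- r(t, ŝ_ε(·))² is the continuous representative of u(t, ·), and ŝ_ε(±1) = ±κ. -/
theorem hasTraces (h : Admissible H T m C ε ρ u v)
    (hc : Curve (kappa H) T m C' γ P r Q B)
    (hu : ∀ᵐ t ∂(lebT T), ∀ᵐ s ∂(leb (kappa H)), uHat H ε u t s = r t s ^ 2) :
    ∀ᵐ t ∂(lebT T), HasTraces (-1) 1 (fun x => (u t x : ℝ)) (r t (-kappa H) ^ 2)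
      (r t (kappa H) ^ 2) := by
  filter_upwards [h.ae_eq_comp_sHat hu] with t ht
  refine ⟨fun x => r t (sHat H ε x) ^ 2, ?_, ht, ?_, ?_⟩
  · exact (((hc.r_continuousOn t).comp (h.well.sHat_continuous ε).continuousOn
      fun x hx => h.well.sHat_mem ε hx).pow 2)
  · simp only [h.well.sHat_neg_one]
  · simp only [h.well.sHat_one]

/-- Uniform convergence away from the origin is controlled by the convergence of the traces. -/
theorem lintegral_eLpNorm_le (h : Admissible H T m C ε ρ u v)
    (hc : Curve (kappa H) T m C' γ P r Q B)
    (hu : ∀ᵐ t ∂(lebT T), ∀ᵐ s ∂(leb (kappa H)), uHat H ε u t s = r t s ^ 2)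
    {y : ℝ → ℝ} (hy : Integrable y (lebT T)) {D : Set ℝ} (hD : MeasurableSet D)
    (hD1 : D ⊆ Icc (-1) 1) {k d : ℝ}
    (hk : k ∈ Icc (-kappa H) (kappa H)) (hd : ∀ x ∈ D, |sHat H ε x - k| ≤ d) :
    ∫⁻ t in Ioo 0 T, eLpNorm (fun x => (u t x : ℝ) - y t) ⊤ (volume.restrict D) ≤
      ENNReal.ofReal ((∫ t, |r t k ^ 2 - y t| ∂(lebT T)) +
        2 * √(2 * m + 4 * kappa H) * √d * (T + C')) := by
  set c := 2 * √(2 * (m : ℝ) + 4 * kappa H) * √d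
  have hc0 : 0 ≤ c := by positivity
  have i1 : Integrable (fun t => |r t k ^ 2 - y t|) (lebT T) := ((hc.trace_integrable hk).sub hy).abs
  have i2 : Integrable (fun t => c * (1 + energy (kappa H) Q t)) (lebT T) :=
    ((integrable_const 1).add hc.energy_integrable).const_mul c
  have hle : ∀ᵐ t ∂(lebT T), eLpNorm (fun x => (u t x : ℝ) - y t) ⊤ (volume.restrict D) ≤
      ENNReal.ofReal (|r t k ^ 2 - y t| + c * (1 + energy (kappa H) Q t)) := by
    filter_upwards [h.ae_eq_comp_sHat hu] with t ht
    rw [eLpNorm_exponent_top]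
    have hA := energy_nonneg (kappa H) Q t
    have h2 := ae_restrict_of_ae_restrict_of_subset hD1 ht
    refine eLpNormEssSup_le_of_ae_bound (C := |r t k ^ 2 - y t| + c * (1 + energy (kappa H) Q t)) ?_
    filter_upwards [h2, ae_restrict_mem hD] with x hx hxD
    rw [hx, Real.norm_eq_abs]
    -- On D the Hölder bound compares r² with its endpoint value at the price √d (1 + E), which is
    -- integrable in time.
    have h3 := hc.abs_sq_sub_sq_le t (h.well.sHat_mem ε (hD1 hxD)) hk
    have h4 : √|sHat H ε x - k| ≤ √d := Real.sqrt_le_sqrt (hd x hxD)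
    have h5 : 2 * √(2 * (m : ℝ) + 4 * kappa H) * √|sHat H ε x - k| * (1 + energy (kappa H) Q t) ≤
        c * (1 + energy (kappa H) Q t) := by
      refine mul_le_mul_of_nonneg_right ?_ (by linarith)
      exact mul_le_mul_of_nonneg_left h4 (by positivity)
    have h6 := abs_sub_le (r t (sHat H ε x) ^ 2) (r t k ^ 2) (y t)
    linarith
  refine (lintegral_mono_ae hle).trans ?_
  have i3 : Integrable (fun t => |r t k ^ 2 - y t| + c * (1 + energy (kappa H) Q t)) (lebT T) :=
    i1.add i2
  rw [← ofReal_integral_eq_lintegral_ofReal i3 (Eventually.of_forall fun t => by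
    have := energy_nonneg (kappa H) Q t
    exact add_nonneg (abs_nonneg _) (mul_nonneg hc0 (by linarith)))]
  refine ENNReal.ofReal_le_ofReal ?_
  rw [integral_add i1 i2, integral_const_mul]
  have := hc.integral_one_add_energy_le
  gcongr

end Admissible

/-! ### Two-point measures and the limit in the original variable. -/

/-- The integral of a function with respect to a measure on two points. -/
theorem integral_twoPoint (x : ℝ) (a b : ℝ≥0) {φ : ℝ → ℝ} :
    ∫ y, φ y ∂(twoPoint x a b : Measure ℝ) = a / 2 * φ (-x) + b / 2 * φ x := by
  have e : (twoPoint x a b : Measure ℝ) =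
      (a / 2 : ℝ≥0) • Measure.dirac (-x) + (b / 2 : ℝ≥0) • Measure.dirac x := by
    simp only [twoPoint, FiniteMeasure.toMeasure_add, FiniteMeasure.toMeasure_smul]
    rfl
  have i : ∀ (c : ℝ≥0) (z : ℝ), Integrable φ (c • Measure.dirac z) := fun c z =>
    (integrable_dirac (by simp)).smul_measure_nnreal
  rw [e, integral_add_measure (i _ _) (i _ _), integral_smul_nnreal_measure,
    integral_smul_nnreal_measure, integral_dirac, integral_dirac]
  simp [NNReal.smul_def]

open Curve

theorem tendsto_twoPoint {ι : Type*} {l : Filter ι} {ρ : ι → FiniteMeasure ℝ} {x : ℝ} {a b : ℝ≥0}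
    (h : ∀ φ : ℝ → ℝ, Continuous φ → Tendsto (fun i => ∫ y, φ y ∂(ρ i : Measure ℝ)) l
      (𝓝 (a / 2 * φ (-x) + b / 2 * φ x))) : Tendsto ρ l (𝓝 (twoPoint x a b)) := by
  rw [FiniteMeasure.tendsto_iff_forall_integral_tendsto]
  intro φ
  rw [integral_twoPoint]
  exact h φ φ.continuous

theorem continuousOn_twoPoint (x : ℝ) {T : ℝ} {a b : ℝ → ℝ≥0}
    (ha : ContinuousOn (fun t => (a t : ℝ)) (Icc 0 T))
    (hb : ContinuousOn (fun t => (b t : ℝ)) (Icc 0 T)) :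
    ContinuousOn (fun t => twoPoint x (a t) (b t)) (Icc 0 T) := by
  intro t ht
  refine tendsto_twoPoint fun φ _ => ?_
  simp_rw [integral_twoPoint]
  exact (((ha t ht).div_const 2).mul_const _).add (((hb t ht).div_const 2).mul_const _)

theorem absolutelyContinuousOnInterval_congr {f g : ℝ → ℝ} {a b : ℝ}
    (hf : AbsolutelyContinuousOnInterval f a b) (h : ∀ x ∈ uIcc a b, g x = f x) :
    AbsolutelyContinuousOnInterval g a b := by
  rw [absolutelyContinuousOnInterval_iff] at hf ⊢
  intro e he
  obtain ⟨δ, hδ, H⟩ := hf e he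
  refine ⟨δ, hδ, fun E hE hlt => ?_⟩
  refine lt_of_eq_of_lt (Finset.sum_congr rfl fun i hi => ?_) (H E hE hlt)
  have := hE.1 i hi
  rw [h _ this.1, h _ this.2]

/-- The limit continuity equation. -/
theorem continuityEquation_twoPoint {K T m : ℝ} (hK : 0 < K) (hT : 0 < T) {f : ℝ → ℝ}
    (hf : AbsolutelyContinuousOnInterval f 0 T) {uM uP : ℝ → ℝ≥0}
    (hP : ∀ t ∈ Icc 0 T, (uP t : ℝ) = 2 * f t) (hM : ∀ t ∈ Icc 0 T, (uM t : ℝ) = 2 * (m - f t)) :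
    ContinuityEquation T (fun t => twoPoint K (uM t) (uP t)) (fun _ => leb K)
      (fun t _ => deriv f t) := by
  have hfc : ContinuousOn f (Icc 0 T) := by
    have := hf.continuousOn
    rwa [uIcc_of_le hT.le] at this
  have hKK : -K ≤ K := by linarith
  have hdi : Integrable (deriv f) (lebT T) := by
    have := hf.intervalIntegrable_deriv
    rwa [intervalIntegrable_iff_integrableOn_Ioo_of_le hT.le] at this
  refine ⟨continuousOn_twoPoint K ?_ ?_, (measurable_deriv f).comp measurable_fst, ?_, ?_⟩
  · exact ((continuousOn_const.sub hfc).const_mul 2).congr hM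
  · exact (hfc.const_mul 2).congr hP
  · simp only [lintegral_const]
    rw [lintegral_mul_const' _ _ (measure_ne_top _ _)]
    exact ENNReal.mul_lt_top hdi.2 (measure_lt_top _ _)
  · intro φ hφ hφc hφT
    have hslice : ∀ x, ContDiff ℝ ∞ fun t => φ t x := fun x =>
      hφ.comp (contDiff_id.prodMk contDiff_const)
    have hslice' : ∀ t, ContDiff ℝ ∞ (φ t) := fun t =>
      hφ.comp (contDiff_const.prodMk contDiff_id)
    have hzero : ∀ t ∉ Ioo 0 T, ∀ x, φ t x = 0 := by
      intro t ht x
      by_contra hne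
      exact ht (hφT (subset_tsupport (Function.uncurry φ) (show (t, x) ∈ _ from hne))).1
    -- As the flux is constant in s, only the difference of the boundary values of φ matters. The
    -- weak equation becomes ∫ (f Φ)' dt + m ∫ ∂ₜφ(t, -K) dt = 0, and both integrals vanish because
    -- φ vanishes at t = 0 and t = T.
    set Φ : ℝ → ℝ := fun t => φ t K - φ t (-K) with hΦ
    have hΦs : ContDiff ℝ ∞ Φ := (hslice K).sub (hslice (-K))
    have hΦd : ∀ t, deriv Φ t = deriv (fun r => φ r K) t - deriv (fun r => φ r (-K)) t := fun t =>
      deriv_fun_sub ((hslice K).differentiable (by norm_num) t)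
        ((hslice (-K)).differentiable (by norm_num) t)
    have hΦac : AbsolutelyContinuousOnInterval Φ 0 T :=
      (hΦs.of_le (by exact_mod_cast le_top) : ContDiff ℝ 1 Φ).contDiffOn.absolutelyContinuousOnInterval
    have h0 : (0 : ℝ) ∉ Ioo 0 T := fun h => lt_irrefl _ h.1
    have hT' : T ∉ Ioo 0 T := fun h => lt_irrefl _ h.2
    have i1 := hf.integral_deriv_mul_eq_sub hΦac
    have i2 : ∫ t in (0 : ℝ)..T, deriv (fun r => φ r (-K)) t = 0 := by
      rw [intervalIntegral.integral_deriv_eq_sub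
        (fun t _ => (hslice (-K)).differentiable (by norm_num) t)
        (((hslice (-K)).continuous_deriv (by norm_num)).intervalIntegrable _ _)]
      simp only [hzero _ h0, hzero _ hT', sub_zero]
    simp only [hΦ, hzero _ h0, hzero _ hT', sub_zero, mul_zero] at i1
    have hdc : Continuous (deriv Φ) := hΦs.continuous_deriv (by norm_num)
    have j1 : IntervalIntegrable (fun t => deriv f t * Φ t + f t * deriv Φ t) volume 0 T := by
      refine IntervalIntegrable.add ?_ ?_
      · exact hf.intervalIntegrable_deriv.mul_continuousOn hΦs.continuous.continuousOn
      · refine ContinuousOn.intervalIntegrable ?_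
        exact hf.continuousOn.mul hdc.continuousOn
    have j2 : IntervalIntegrable (fun t => m * deriv (fun r => φ r (-K)) t) volume 0 T :=
      (((hslice (-K)).continuous_deriv (by norm_num)).const_mul m |>.intervalIntegrable _ _)
    have key : ∫ t in (0 : ℝ)..T, ((deriv f t * Φ t + f t * deriv Φ t) +
        m * deriv (fun r => φ r (-K)) t) = 0 := by
      rw [intervalIntegral.integral_add j1 j2, intervalIntegral.integral_const_mul, i2, mul_zero,
        add_zero]
      exact i1
    rw [intervalIntegral.integral_of_le hT.le, integral_Ioc_eq_integral_Ioo] at key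
    refine Eq.trans ?_ key
    refine setIntegral_congr_fun measurableSet_Ioo fun t ht => ?_
    have htI := Ioo_subset_Icc_self ht
    have e1 : ∫ x, deriv f t * deriv (φ t) x ∂(leb K) = deriv f t * Φ t := by
      rw [integral_const_mul]
      congr 1
      rw [integral_Icc_eq_integral_Ioc, ← intervalIntegral.integral_of_le hKK,
        intervalIntegral.integral_deriv_eq_sub
          (fun x _ => (hslice' t).differentiable (by norm_num) x)
          (((hslice' t).continuous_deriv (by norm_num)).intervalIntegrable _ _)]
    simp only
    rw [integral_twoPoint, e1, hP t htI, hM t htI, hΦd]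
    ring

/-- Convergence of the curves in the original variable. -/
theorem tendsto_integral_rho {H : ℝ → ℝ} {T : ℝ} {m : ℝ≥0} {C C' : ℝ} {ε : ℕ → ℝ}
    {ρ : ℕ → ℝ → FiniteMeasure ℝ} {u : ℕ → ℝ → ℝ → ℝ≥0} {v r Q B : ℕ → ℝ → ℝ → ℝ}
    (hA : ∀ n, Admissible H T m C (ε n) (ρ n) (u n) (v n))
    (hS : CurveSeq (kappa H) T m C' (fun n => IsDoubleWell.gibbsHat H (ε n))
      (fun n t => (ρ n t).map (sHat H (ε n))) r Q B)
    (hε : Tendsto ε atTop (𝓝[>] 0)) {f : ℝ → ℝ}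
    (hf : ∀ t ∈ Icc 0 T, Tendsto
      (fun n => CurveSeq.massP (kappa H) (fun t => (ρ n t).map (sHat H (ε n))) t) atTop (𝓝 (f t)))
    {φ : ℝ → ℝ} (hφ : Continuous φ) {t : ℝ} (ht : t ∈ Icc 0 T) :
    Tendsto (fun n => ∫ x, φ x ∂(ρ n t : Measure ℝ)) atTop
      (𝓝 (φ 1 * f t + φ (-1) * (m - f t))) := by
  have hH := (hA 0).well
  have hκ := hH.kappa_pos
  have hwc := Curve.weight_continuous (kappa H)
  obtain ⟨M, hM⟩ := (isCompact_Icc (a := (-1 : ℝ)) (b := 1)).exists_bound_of_continuousOn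
    hφ.continuousOn
  simp only [Real.norm_eq_abs] at hM
  have hM1 := hM 1 (by norm_num)
  have hM2 := hM (-1) (by norm_num)
  have hM0 : 0 ≤ M := (abs_nonneg _).trans hM1
  rw [abs_le] at hM1 hM2
  -- I interpolates between φ(-1) and φ(1) with the transported weight, so its ρ-integral is an
  -- exact expression in the mass at κ. The difference to φ has vanishing γ_ε-mean, and the entropy
  -- estimate transfers this to ρ_ε(t).
  set I : ℝ → ℝ → ℝ := fun ε x => φ 1 * weight (kappa H) (sHat H ε x) +
    φ (-1) * (1 - weight (kappa H) (sHat H ε x)) with hI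
  set D : ℝ → ℝ → ℝ := fun ε x => |φ x - I ε x| with hD
  have hIc : ∀ ε, Continuous (I ε) := fun ε => by
    have := hH.sHat_continuous ε
    simp only [hI]
    fun_prop
  have hDc : ∀ ε, Continuous (D ε) := fun ε => (hφ.sub (hIc ε)).abs
  have hw01 : ∀ ε, ∀ x ∈ Icc (-1 : ℝ) 1, weight (kappa H) (sHat H ε x) ∈ Icc (0 : ℝ) 1 :=
    fun ε x hx => (hS.curve 0).weight_mem (hH.sHat_mem ε hx)
  have hD2 : ∀ ε, ∀ x ∈ Icc (-1 : ℝ) 1, D ε x ≤ 2 * M := by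
    intro ε x hx
    have h1 := hM x hx
    have h2 := hw01 ε x hx
    rw [abs_le] at h1
    simp only [hD, hI]
    rw [abs_le]
    constructor <;> nlinarith [h2.1, h2.2]
  have hlimD : Tendsto (fun ε => ∫ x, D ε x ∂(gibbs H ε)) (𝓝[>] 0) (𝓝 0) := by
    refine hH.tendsto_integral_gibbs_zero hDc (fun ε x _ => abs_nonneg _) hD2 fun e he => ?_
    obtain ⟨d₁, hd₁, H1⟩ := Metric.continuousAt_iff.1 (hφ.continuousAt (x := 1)) (e / 2) (by linarith)
    obtain ⟨d₂, hd₂, H2⟩ := Metric.continuousAt_iff.1 (hφ.continuousAt (x := -1)) (e / 2)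
      (by linarith)
    set d := min (1 / 2) (min (d₁ / 2) (d₂ / 2)) with hd
    have hd0 : 0 < d := by positivity
    have hdl : d ≤ 1 / 2 := min_le_left _ _
    have hdd₁ : d < d₁ := ((min_le_right _ _).trans (min_le_left _ _)).trans_lt (by linarith)
    have hdd₂ : d < d₂ := ((min_le_right _ _).trans (min_le_right _ _)).trans_lt (by linarith)
    have h3 : Tendsto (fun ε => 2 * M * ((kappa H - sHat H ε (1 - d)) / (2 * kappa H))) (𝓝[>] 0)
        (𝓝 0) := by
      have := hH.tendsto_sHat (δ := 1 - d) (by linarith) (by linarith)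
      simpa using ((this.const_sub (kappa H)).div_const (2 * kappa H)).const_mul (2 * M)
    refine ⟨1 - d, ⟨by linarith, by linarith⟩, ?_⟩
    filter_upwards [h3.eventually (gt_mem_nhds (half_pos he))] with ε hε x hx hax
    have hmono := (hH.sHat_strictMono ε).monotone
    have hw := hw01 ε x hx
    rcases le_abs.1 hax with hx1 | hx1
    · have g1 := H1 (x := x) (by rw [Real.dist_eq, abs_lt]; constructor <;> linarith [hx.2])
      rw [Real.dist_eq, abs_lt] at g1
      have g2 : 1 - weight (kappa H) (sHat H ε x) ≤
          (kappa H - sHat H ε (1 - d)) / (2 * kappa H) := by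
        have := hmono hx1
        rw [weight, le_div_iff₀ (by positivity), sub_mul, div_mul_cancel₀ _ (by positivity)]
        linarith
      have g3 : 2 * M * (1 - weight (kappa H) (sHat H ε x)) < e / 2 :=
        (mul_le_mul_of_nonneg_left g2 (by positivity)).trans_lt hε
      simp only [hD, hI]
      rw [abs_le]
      constructor <;> nlinarith [hw.1, hw.2, g1.1, g1.2]
    · have g1 := H2 (x := x) (by rw [Real.dist_eq, abs_lt]; constructor <;> linarith [hx.1])
      rw [Real.dist_eq, abs_lt] at g1
      have g2 : weight (kappa H) (sHat H ε x) ≤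
          (kappa H - sHat H ε (1 - d)) / (2 * kappa H) := by
        have := hmono hx1
        rw [hH.sHat_neg] at this
        rw [weight]
        gcongr
        linarith
      have g3 : 2 * M * weight (kappa H) (sHat H ε x) < e / 2 :=
        (mul_le_mul_of_nonneg_left g2 (by positivity)).trans_lt hε
      simp only [hD, hI]
      rw [abs_le]
      constructor <;> nlinarith [hw.1, hw.2, g1.1, g1.2]
  -- transfer to the transformed variable
  set ξ : ℕ → ℝ → ℝ := fun n s =>
    xiHat H (ε n) (projIcc (-kappa H) (kappa H) hH.neg_kappa_le s) with hξ
  have hξc : ∀ n, Continuous (ξ n) := fun n => hH.continuous_xiHat_projIcc (ε n)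
  have hξs : ∀ n, ∀ x ∈ Icc (-1 : ℝ) 1, ξ n (sHat H (ε n) x) = x := fun n x hx => by
    simp only [hξ]
    rw [hH.xiHat_projIcc _ (hH.sHat_mem _ hx), hH.xiHat_sHat _ hx]
  -- Division by 2M + 1 brings the difference into [0, 1], as the entropy estimate requires.
  set ψ : ℕ → ℝ → ℝ := fun n s => D (ε n) (ξ n s) / (2 * M + 1) with hψ
  have hψc : ∀ n, Continuous (ψ n) := fun n => ((hDc _).comp (hξc n)).div_const _
  have hψ01 : ∀ n, ∀ s ∈ Icc (-kappa H) (kappa H), ψ n s ∈ Icc (0 : ℝ) 1 := by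
    intro n s hs
    have hm : ξ n s ∈ Icc (-1 : ℝ) 1 := by
      simp only [hξ]; rw [hH.xiHat_projIcc _ hs]; exact hH.xiHat_mem _ hs
    refine ⟨div_nonneg (abs_nonneg _) (by linarith), ?_⟩
    rw [hψ, div_le_one (by linarith)]
    linarith [hD2 (ε n) _ hm]
  have hψlim : Tendsto (fun n => ∫ s, ψ n s ∂(IsDoubleWell.gibbsHat H (ε n))) atTop (𝓝 0) := by
    have h1 := (hlimD.comp hε).div_const (2 * M + 1)
    rw [zero_div] at h1
    refine h1.congr fun n => ?_
    rw [hH.integral_gibbsHat _ (hψc n).measurable, Function.comp_apply, ← integral_div]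
    refine integral_congr_ae ((IsDoubleWell.ae_gibbs_mem H (ε n)).mono fun x hx => ?_)
    simp only [hψ, hξs n x hx]
  have hρi : ∀ n, ∀ F : ℝ → ℝ, Continuous F → Integrable F (ρ n t : Measure ℝ) := by
    intro n F hF
    obtain ⟨L, hL⟩ := (isCompact_Icc (a := (-1 : ℝ)) (b := 1)).exists_bound_of_continuousOn
      hF.continuousOn
    exact Integrable.of_bound hF.aestronglyMeasurable L (((hA n).ae_rho_mem ht).mono hL)
  have herr : Tendsto (fun n => ∫ x, (φ x - I (ε n) x) ∂(ρ n t : Measure ℝ)) atTop (𝓝 0) := by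
    rw [Metric.tendsto_nhds]
    intro e he
    filter_upwards [hS.eventually_integral_P_le hψc hψ01 hψlim
      (e := e / (2 * (2 * M + 1))) (by positivity)] with n hn
    have h1 := hn t ht
    rw [(hA n).integral_map_rho t (hψc n)] at h1
    have h2 : ∫ x, ψ n (sHat H (ε n) x) ∂(ρ n t : Measure ℝ) =
        (∫ x, D (ε n) x ∂(ρ n t : Measure ℝ)) / (2 * M + 1) := by
      rw [← integral_div]
      refine integral_congr_ae (((hA n).ae_rho_mem ht).mono fun x hx => ?_)
      simp only [hψ, hξs n x hx]
    rw [h2, div_le_iff₀ (by linarith)] at h1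
    have h3 : e / (2 * (2 * M + 1)) * (2 * M + 1) = e / 2 := by
      have : (2 * M + 1) ≠ 0 := by linarith
      field_simp
    rw [Real.dist_eq, sub_zero]
    have h4 : |∫ x, (φ x - I (ε n) x) ∂(ρ n t : Measure ℝ)| ≤ ∫ x, D (ε n) x ∂(ρ n t : Measure ℝ) :=
      abs_integral_le_integral_abs
    linarith
  have hmain : ∀ n, ∫ x, I (ε n) x ∂(ρ n t : Measure ℝ) =
      φ 1 * CurveSeq.massP (kappa H) (fun t => (ρ n t).map (sHat H (ε n))) t +
      φ (-1) * (m - CurveSeq.massP (kappa H) (fun t => (ρ n t).map (sHat H (ε n))) t) := by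
    intro n
    have hc : Continuous fun x => weight (kappa H) (sHat H (ε n) x) :=
      hwc.comp (hH.sHat_continuous _)
    have h1 : (ρ n t : Measure ℝ).real univ = m := by
      rw [← (hA n).mass_eq t ht]; rfl
    have i1 : Integrable (fun x => 1 - weight (kappa H) (sHat H (ε n) x)) (ρ n t : Measure ℝ) :=
      (integrable_const _).sub (hρi n _ hc)
    simp only [hI, CurveSeq.massP]
    rw [(hA n).integral_map_rho t hwc, integral_add ((hρi n _ hc).const_mul _)
      (i1.const_mul _), integral_const_mul,
      integral_const_mul, integral_sub (integrable_const _) (hρi n _ hc), integral_const, h1,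
      smul_eq_mul, mul_one]
  have h5 := ((hf t ht).const_mul (φ 1)).add
    (((hf t ht).const_sub (m : ℝ)).const_mul (φ (-1)))
  have h6 := herr.add h5
  rw [zero_add] at h6
  refine h6.congr fun n => ?_
  rw [← hmain n, integral_sub (hρi n _ hφ) (hρi n _ (hIc _)), sub_add_cancel]

end Kramers

end

/-! ### Assembly of the compactness theorem. -/

theorem mainTheorem1 (H : ℝ → ℝ) (hH : Kramers.IsDoubleWell H)
    (T : ℝ) (hT : 0 < T) (m : ℝ≥0) (hm : 0 < m) (C : ℝ)
    (ε : ℕ → ℝ) (hε : ∀ n, 0 < ε n) (hε0 : Tendsto ε atTop (𝓝 0))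
    (ρ : ℕ → ℝ → FiniteMeasure ℝ) (u : ℕ → ℝ → ℝ → ℝ≥0) (v : ℕ → ℝ → ℝ → ℝ)
    -- `ρ_ε = u_ε γ_ε`
    (hu : ∀ n, Measurable (Function.uncurry (u n)))
    (hρu : ∀ n, ∀ t ∈ Icc 0 T, (ρ n t : Measure ℝ) =
      (Kramers.gibbs H (ε n)).withDensity (fun x => (u n t x : ℝ≥0∞)))
    -- `ρ_ε ∈ C([0,T]; M(Ξ))` and `(ρ_ε, ρ_ε v_ε) ∈ CE(0,T;Ξ)`
    (hCE : ∀ n, Kramers.ContinuityEquation T (ρ n) (fun t => (ρ n t : Measure ℝ)) (v n))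
    -- the three bounds
    (hmass : ∀ n, ∀ t ∈ Icc 0 T, (ρ n t).mass = m)
    (hE : ∀ n, Kramers.freeEnergy H (ε n) (ρ n 0) ≤ (C : EReal))
    (hJ : ∀ n, Kramers.dissipation H (ε n) T (ρ n) (v n) ≤ ENNReal.ofReal C) :
    ∃ (σ : ℕ → ℕ) (uM uP : ℝ → ℝ≥0), StrictMono σ ∧
      -- `ρ₀ = ½ u₀⁻ δ_{-1} + ½ u₀⁺ δ_1 ∈ C([0,T]; M(Ξ))`
      ContinuousOn (fun t => Kramers.twoPoint 1 (uM t) (uP t)) (Icc 0 T) ∧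
      -- (1) pointwise weak-* convergence
      (∀ t ∈ Icc 0 T,
        Tendsto (fun n => ρ (σ n) t) atTop (𝓝 (Kramers.twoPoint 1 (uM t) (uP t)))) ∧
      -- (2) the spatial traces are well-defined and converge strongly in `L¹(0,T)`
      (∃ trM trP : ℕ → ℝ → ℝ,
        (∀ n, (∀ᵐ t ∂(volume.restrict (Ioo 0 T)),
            Kramers.HasTraces (-1) 1 (fun x => (u n t x : ℝ)) (trM n t) (trP n t)) ∧
          IntegrableOn (trM n) (Ioo 0 T) ∧ IntegrableOn (trP n) (Ioo 0 T)) ∧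
        Tendsto (fun n => ∫ t in Ioo 0 T, |trM (σ n) t - uM t|) atTop (𝓝 0) ∧
        Tendsto (fun n => ∫ t in Ioo 0 T, |trP (σ n) t - uP t|) atTop (𝓝 0)) ∧
      -- (3) convergence in `L¹(0,T; L^∞(-1,-δ))` and `L¹(0,T; L^∞(δ,1))`
      (∀ δ : ℝ, 0 < δ → δ < 1 →
        Tendsto (fun n => ∫⁻ t in Ioo 0 T,
          eLpNorm (fun x => (u (σ n) t x : ℝ) - uM t) ∞ (volume.restrict (Ioo (-1) (-δ))))
          atTop (𝓝 0) ∧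
        Tendsto (fun n => ∫⁻ t in Ioo 0 T,
          eLpNorm (fun x => (u (σ n) t x : ℝ) - uP t) ∞ (volume.restrict (Ioo δ 1)))
          atTop (𝓝 0)) ∧
      ∃ (duHat : ℕ → ℝ → ℝ → ℝ) (u₀ du₀ w₀ : ℝ → ℝ → ℝ)
        (lam : FiniteMeasure ℝ) (m₀ dm₀ : ℝ → ℝ → ℝ),
        -- `û_ε ∈ L¹(0,T; W^{1,1}(S))` with derivative `∂_s û_ε`, and `ŵ_ε ∈ L¹((0,T) × S)`
        (∀ n, Kramers.MemL1W11 H T (Kramers.uHat H (ε n) (u n)) (duHat n)) ∧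
        (∀ n, Integrable (Function.uncurry (Kramers.wHat H (ε n) (u n) (v n)))
          (Kramers.lebTS H T)) ∧
        -- regularity of the limits
        Kramers.MemL1W11 H T u₀ du₀ ∧
        Integrable (Function.uncurry w₀) (Kramers.lebTS H T) ∧
        (lam : Measure ℝ) (Icc 0 T)ᶜ = 0 ∧
        (lam : Measure ℝ) ⟂ₘ volume ∧
        MemLp (Function.uncurry m₀) ∞ ((lam : Measure ℝ).prod (Kramers.lebS H)) ∧
        MemLp (Function.uncurry dm₀) 2 ((lam : Measure ℝ).prod (Kramers.lebS H)) ∧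
        (∀ᵐ t ∂(lam : Measure ℝ),
          Kramers.HasWeakDeriv (-Kramers.kappa H) (Kramers.kappa H) (m₀ t) (dm₀ t)) ∧
        -- (4) weak-* convergence in duality with `C([0,T] × S)`
        Kramers.WeakStarTendsto H T
          (fun n => Kramers.uHat H (ε (σ n)) (u (σ n))) u₀ lam m₀ ∧
        Kramers.WeakStarTendsto H T (fun n => duHat (σ n)) du₀ lam dm₀ ∧
        Kramers.WeakStarTendsto H T
          (fun n => Kramers.wHat H (ε (σ n)) (u (σ n)) (v (σ n))) w₀ 0 0 ∧
        -- (5) identification of the traces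
        (∀ᵐ t ∂(volume.restrict (Ioo 0 T)),
          Kramers.HasTraces (-Kramers.kappa H) (Kramers.kappa H) (u₀ t) (uM t) (uP t)) ∧
        (∀ᵐ t ∂(lam : Measure ℝ),
          Kramers.HasTraces (-Kramers.kappa H) (Kramers.kappa H) (m₀ t) 0 0) ∧
        -- (6) pointwise weak-* convergence of the transformed curves
        (∀ t ∈ Icc 0 T,
          Tendsto (fun n => (ρ (σ n) t).map (Kramers.sHat H (ε (σ n)))) atTop
            (𝓝 (Kramers.twoPoint (Kramers.kappa H) (uM t) (uP t)))) ∧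
        -- (7) structure of `ŵ₀` and the limit continuity equation
        AbsolutelyContinuousOnInterval (fun t => (uP t : ℝ)) 0 T ∧
        (∀ᵐ t ∂(volume.restrict (Ioo 0 T)), ∃ w : ℝ,
          HasDerivAt (fun r => (uP r : ℝ) / 2) w t ∧ ∀ᵐ s ∂(Kramers.lebS H), w₀ t s = w) ∧
        Kramers.ContinuityEquation T
          (fun t => Kramers.twoPoint (Kramers.kappa H) (uM t) (uP t))
          (fun _ => Kramers.lebS H) w₀ := by
  have hA : ∀ n, Kramers.Admissible H T m C (ε n) (ρ n) (u n) (v n) := fun n =>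
    ⟨hH, hT, hu n, hρu n, hCE n, hmass n, hJ n⟩
  have hεp : Tendsto ε atTop (𝓝[>] 0) :=
    tendsto_nhdsWithin_iff.2 ⟨hε0, Eventually.of_forall hε⟩
  have hκ := hH.kappa_pos
  have hκκ := hH.neg_kappa_le
  choose r Q B hc hae using fun n => (hA n).exists_curve
  have hu' : ∀ n, ∀ᵐ t ∂(Kramers.lebT T), ∀ᵐ s ∂(Kramers.leb (Kramers.kappa H)),
      Kramers.uHat H (ε n) (u n) t s = r n t s ^ 2 := fun n =>
    (hae n).mono fun t ht => ht.mono fun s hs => hs.1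
  have hw' : ∀ n, ∀ᵐ t ∂(Kramers.lebT T), ∀ᵐ s ∂(Kramers.leb (Kramers.kappa H)),
      Kramers.wHat H (ε n) (u n) (v n) t s = r n t s * B n t s := fun n =>
    (hae n).mono fun t ht => ht.mono fun s hs => hs.2
  have hS : Kramers.CurveSeq (Kramers.kappa H) T m (2 * (|C| + 1))
      (fun n => Kramers.IsDoubleWell.gibbsHat H (ε n))
      (fun n t => (ρ n t).map (Kramers.sHat H (ε n))) r Q B :=
    ⟨hc, fun n => hH.integral_id_gibbsHat (ε n), hH.tendsto_conc.comp hεp⟩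
  -- First the endpoint masses, then along a further subsequence the weak-* limits of û and its
  -- derivative. The fluxes need no extraction because their limit is determined by f.
  obtain ⟨σ₁, hσ₁, f, hf₁⟩ := hS.exists_subseq_massP
  obtain ⟨σ₂, hσ₂, lam, u₀, du₀, m₀, dm₀, hu₀, hdu₀, hwd, hlam, hsing, hm₀, hdm₀, hmwd, hlu, hldu,
    htr₀, htrm⟩ := (hS.comp hσ₁).exists_limit hf₁
  have hσ := hσ₁.comp hσ₂
  set σ : ℕ → ℕ := σ₁ ∘ σ₂
  have hSσ := hS.comp hσ
  have hf : ∀ t ∈ Icc 0 T, Tendsto (fun n => Kramers.CurveSeq.massP (Kramers.kappa H)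
      (fun t => (ρ (σ n) t).map (Kramers.sHat H (ε (σ n)))) t) atTop (𝓝 (f t)) :=
    fun t ht => (hf₁ t ht).comp hσ₂.tendsto_atTop
  have hεσ : Tendsto (fun n => ε (σ n)) atTop (𝓝[>] 0) := hεp.comp hσ.tendsto_atTop
  have hfm : ∀ t ∈ Icc 0 T, f t ∈ Icc 0 (m : ℝ) := fun t ht => hSσ.limit_mem hf ht
  have hfc := hSσ.limit_continuousOn hf
  have hfi := hSσ.limit_integrable hf
  have hac := hSσ.absolutelyContinuous_of_tendsto hf
  -- The truncation at 0 is inactive on [0, T], where 0 ≤ f ≤ m.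
  set uP : ℝ → ℝ≥0 := fun t => (2 * f t).toNNReal with huP
  set uM : ℝ → ℝ≥0 := fun t => (2 * (m - f t)).toNNReal with huM
  have hP : ∀ t ∈ Icc 0 T, (uP t : ℝ) = 2 * f t := fun t ht =>
    Real.coe_toNNReal _ (by linarith [(hfm t ht).1])
  have hM : ∀ t ∈ Icc 0 T, (uM t : ℝ) = 2 * (m - f t) := fun t ht =>
    Real.coe_toNNReal _ (by linarith [(hfm t ht).2])
  have hPc : ContinuousOn (fun t => (uP t : ℝ)) (Icc 0 T) := (hfc.const_mul 2).congr hP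
  have hMc : ContinuousOn (fun t => (uM t : ℝ)) (Icc 0 T) :=
    ((continuousOn_const.sub hfc).const_mul 2).congr hM
  have hPi : Integrable (fun t => (uP t : ℝ)) (Kramers.lebT T) :=
    (hPc.integrableOn_compact isCompact_Icc).mono_set Ioo_subset_Icc_self
  have hMi : Integrable (fun t => (uM t : ℝ)) (Kramers.lebT T) :=
    (hMc.integrableOn_compact isCompact_Icc).mono_set Ioo_subset_Icc_self
  have hdi : Integrable (deriv f) (Kramers.lebT T) := by
    have := hac.intervalIntegrable_deriv
    rwa [intervalIntegrable_iff_integrableOn_Ioo_of_le hT.le] at this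
  obtain ⟨htrP, htrM⟩ := hSσ.tendsto_trace hf
  have htrP' : Tendsto (fun n => ∫ t, |r (σ n) t (Kramers.kappa H) ^ 2 - uP t| ∂(Kramers.lebT T))
      atTop (𝓝 0) := htrP.congr fun n => setIntegral_congr_fun measurableSet_Ioo fun t ht => by
    simp only [hP t (Ioo_subset_Icc_self ht)]
  have htrM' : Tendsto (fun n => ∫ t, |r (σ n) t (-Kramers.kappa H) ^ 2 - uM t| ∂(Kramers.lebT T))
      atTop (𝓝 0) := htrM.congr fun n => setIntegral_congr_fun measurableSet_Ioo fun t ht => by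
    simp only [hM t (Ioo_subset_Icc_self ht)]
  refine ⟨σ, uM, uP, hσ, Kramers.continuousOn_twoPoint 1 hMc hPc, fun t ht => ?_, ?_, ?_, ?_⟩
  · refine Kramers.tendsto_twoPoint fun φ hφ => ?_
    have h1 := Kramers.tendsto_integral_rho (fun n => hA (σ n)) hSσ hεσ hf hφ ht
    have e : (uM t : ℝ) / 2 * φ (-1) + uP t / 2 * φ 1 = φ 1 * f t + φ (-1) * (m - f t) := by
      rw [hP t ht, hM t ht]; ring
    rw [e]
    exact h1
  · refine ⟨fun n t => r n t (-Kramers.kappa H) ^ 2, fun n t => r n t (Kramers.kappa H) ^ 2,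
      fun n => ⟨(hA n).hasTraces (hc n) (hu' n), (hc n).trace_integrable (left_mem_Icc.2 hκκ),
        (hc n).trace_integrable (right_mem_Icc.2 hκκ)⟩, htrM', htrP'⟩
  · intro δ hδ hδ1
    -- For ξ in (δ, 1) the distance of ŝ_ε(ξ) from κ is at most κ - ŝ_ε(δ), which tends to 0, and
    -- symmetrically at -κ. The Hölder bound thus compares u_ε with its trace uniformly there.
    have hs : Tendsto (fun n => √(Kramers.kappa H - Kramers.sHat H (ε (σ n)) δ)) atTop (𝓝 0) := by
      have := ((hH.tendsto_sHat hδ hδ1.le).comp hεσ).const_sub (Kramers.kappa H)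
      simpa using this.sqrt
    have hs' : Tendsto (fun n => 2 * √(2 * (m : ℝ) + 4 * Kramers.kappa H) *
        √(Kramers.kappa H - Kramers.sHat H (ε (σ n)) δ) * (T + 2 * (|C| + 1))) atTop (𝓝 0) := by
      simpa using (hs.const_mul (2 * √(2 * (m : ℝ) + 4 * Kramers.kappa H))).mul_const
        (T + 2 * (|C| + 1))
    constructor
    · have hlim := ENNReal.tendsto_ofReal (htrM'.add hs')
      rw [add_zero, ENNReal.ofReal_zero] at hlim
      refine tendsto_of_tendsto_of_tendsto_of_le_of_le tendsto_const_nhds hlim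
        (fun _ => bot_le) fun n => ?_
      refine (hA (σ n)).lintegral_eLpNorm_le (hc (σ n)) (hu' (σ n)) hMi measurableSet_Ioo
        (fun x hx => ⟨hx.1.le, by linarith [hx.2]⟩) (left_mem_Icc.2 hκκ) fun x hx => ?_
      have h1 := hH.sHat_mem (ε (σ n)) (x := x) ⟨hx.1.le, by linarith [hx.2]⟩
      have h2 := (hH.sHat_strictMono (ε (σ n))).monotone hx.2.le
      rw [hH.sHat_neg] at h2
      rw [abs_of_nonneg (by linarith [h1.1])]
      linarith
    · have hlim := ENNReal.tendsto_ofReal (htrP'.add hs')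
      rw [add_zero, ENNReal.ofReal_zero] at hlim
      refine tendsto_of_tendsto_of_tendsto_of_le_of_le tendsto_const_nhds hlim
        (fun _ => bot_le) fun n => ?_
      refine (hA (σ n)).lintegral_eLpNorm_le (hc (σ n)) (hu' (σ n)) hPi measurableSet_Ioo
        (fun x hx => ⟨by linarith [hx.1], hx.2.le⟩) (right_mem_Icc.2 hκκ) fun x hx => ?_
      have h1 := hH.sHat_mem (ε (σ n)) (x := x) ⟨by linarith [hx.1], hx.2.le⟩
      have h2 := (hH.sHat_strictMono (ε (σ n))).monotone hx.1.le
      rw [abs_of_nonpos (by linarith [h1.2])]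
      linarith
  · have hw₀ : Integrable (fun z : ℝ × ℝ => deriv f z.1)
        (Kramers.lebProd T (Kramers.kappa H)) := hdi.comp_fst _
    refine ⟨fun n t s => 2 * (r n t s * Q n t s), u₀, du₀, fun t _ => deriv f t, lam, m₀, dm₀,
      fun n => (hA n).memL1W11_uHat (hc n) (hu' n), fun n => (hA n).wHat_integrable (hc n) (hw' n),
      ⟨hu₀, hdu₀, hwd⟩, hw₀, hlam, hsing, hm₀, hdm₀, hmwd, ?_, ?_, ?_, ?_, htrm, ?_, ?_,
      ?_, Kramers.continuityEquation_twoPoint hκ hT hac hP hM⟩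
    · intro φ hφ
      refine (hlu φ hφ).congr fun n => ?_
      refine integral_congr_ae ((Kramers.Admissible.ae_prod_eq (hA (σ n)).measurable_uHat
        (G := fun t s => r (σ n) t s ^ 2) ((hc (σ n)).r_meas.pow_const 2) (hu' (σ n))).mono
        fun z hz => ?_)
      exact congrArg (φ z * ·) hz.symm
    · intro φ hφ
      exact hldu φ hφ
    · intro φ hφ
      have h1 := hSσ.tendsto_flux hf hφ
      simp only [Pi.zero_apply, mul_zero, integral_zero, add_zero]
      refine h1.congr fun n => ?_
      refine integral_congr_ae ((Kramers.Admissible.ae_prod_eq (hA (σ n)).measurable_wHat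
        (G := fun t s => r (σ n) t s * B (σ n) t s)
        ((hc (σ n)).r_meas.mul (hc (σ n)).B_meas) (hw' (σ n))).mono fun z hz => ?_)
      exact congrArg (φ z * ·) hz.symm
    · filter_upwards [htr₀, ae_restrict_mem measurableSet_Ioo] with t ht htm
      rw [hP t (Ioo_subset_Icc_self htm), hM t (Ioo_subset_Icc_self htm)]
      exact ht
    · intro t ht
      refine Kramers.tendsto_twoPoint fun φ hφ => ?_
      have h1 := hSσ.tendsto_integral_P hf hφ ht
      have e : (uM t : ℝ) / 2 * φ (-Kramers.kappa H) + uP t / 2 * φ (Kramers.kappa H) =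
          φ (Kramers.kappa H) * f t + φ (-Kramers.kappa H) * (m - f t) := by
        rw [hP t ht, hM t ht]; ring
      rw [e]
      exact h1
    · refine Kramers.absolutelyContinuousOnInterval_congr (hac.const_mul 2) fun t ht => ?_
      rw [uIcc_of_le hT.le] at ht
      exact hP t ht
    · have hd := hac.ae_differentiableAt
      rw [uIcc_of_le hT.le] at hd
      filter_upwards [ae_restrict_of_ae hd, ae_restrict_mem measurableSet_Ioo] with t ht htm
      refine ⟨deriv f t, ?_, Eventually.of_forall fun _ => rfl⟩
      refine (ht (Ioo_subset_Icc_self htm)).hasDerivAt.congr_of_eventuallyEq ?_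
      -- u₀⁺/2 coincides with f only on [0, T], which is a neighbourhood of the interior point t.
      filter_upwards [isOpen_Ioo.mem_nhds htm] with x hx
      rw [hP x (Ioo_subset_Icc_self hx)]
      ring
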